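/- **Setting.** Let $N\in\{2,3\}$, $k\ge 2$, and let $\Omega\subset\mathbb R^N$ be a bounded domain of class $C^{k+1,1}$ with boundary $\Gamma$. Fix a finite system of local coordinates $\{(U_r,\boldsymbol y_r,\varphi_r)\}_{r=1}^M$: the open sets $U_r$ cover $\Gamma$, $\boldsymbol y_r=(\boldsymbol y_r',y_{r,N})$ is a Cartesian coordinate system obtained by a rigid motion, the projection $\boldsymbol b_r(\boldsymbol x)=\boldsymbol y_r'$ maps $U_r$ into an open cube $\Delta_r\subset\mathbb R^{N-1}$, $\Gamma\cap U_r$ is the graph of $\varphi_r\in C^{k+1,1}(\Delta_r)$, and $\Omega\cap U_r$ is the part of $U_r$ above this graph. Put $\Gamma(\delta)=\{\boldsymbol x\in\mathbb R^N:\operatorname{dist}(\boldsymbol x,\Gamma)\le\delta\}$. Fix a closed reference simplex $\hat T\subset\mathbb R^N$, the nodes $\hat{\boldsymbol a}_i$ $(1\le i\le N_k)$ of the $\mathbb P_k$ Lagrange element on $\hat T$ (the points with barycentric coordinates in $\{0,1/k,\dots,1\}$), and the nodal basis $\hat\phi_i\in\mathbb P_k$, $\hat\phi_i(\hat{\boldsymbol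 a}_j)=\delta_{ij}$. Fix constants $c$ and $c_\delta>0$. A mesh consists of a finite set $\tilde{\mathcal T}_h$ of closed simplices $\tilde T=\tilde{\boldsymbol F}_T(\hat T)$, with affine isomorphisms $\tilde{\boldsymbol F}_T(\hat{\boldsymbol x})=B_T\hat{\boldsymbol x}+\boldsymbol b_T$, and of the set $\mathcal T_h$ of the corresponding curved elements $T=\boldsymbol F_T(\hat T)$, $\boldsymbol F_T=\sum_i\boldsymbol a_i^T\hat\phi_i$. Let $h_T$ be the diameter of $\tilde T$, $\rho_T$ the diameter of the largest ball contained in $\tilde T$, $h=\max_T h_T$, $\delta=c_\delta h^{k+1}$, let $\Omega_h$ be the interior of $\bigcup_{T\in\mathcal T_h}T$, and $\Gamma_h=\partial\Omega_h$. The mesh is assumed to satisfy: 1. two different simplices of $\tilde{\mathcal T}_h$ are disjoint or meet in a common face of dimension $\le N-1$; the same holds for the curved elements $T\in\mathcal T_h$ (faces being the images of the faces of $\hat T$), and the nodes of both elements on the common face coincide; 2. $h_T\le c\,\rho_T$ and $h\le c\,h_T$ for all $T$; 3. $|\boldsymbol a_i^T-\tilde{\boldsymbol F}_T(\hat{\boldsymbol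 a}_i)|\le c\,h_T^2$ for all $i$ and $T$; 4. $\|\nabla^j\boldsymbol F_T\|_{L^\infty(\hat T)}\le c\,\|B_T\|^j$ for all $T$ and $1\le j\le k+1$; 5. $\Gamma_h$ is covered by the $U_r$, and $\Gamma_h\cap U_r$ is the graph over $\Delta_r$ of a function $\varphi_{rh}\in C(\overline{\Delta_r})$; 6. each boundary element $S$ (the image $\boldsymbol F_T(\hat S)\subset\Gamma_h$ of a closed $(N-1)$-face $\hat S$ of $\hat T$) is contained in some $U_r$ such that $\varphi_{rh}$ is a polynomial of degree $\le k$ on $\boldsymbol b_r(S)$, $|\varphi_r-\varphi_{rh}|\le\delta$ on $\boldsymbol b_r(S)$, and $|\nabla'^j(\varphi_r-\varphi_{rh})|\le c\,h^{k+1-j}$ on $\boldsymbol b_r(S)$ for $1\le j\le k+1$; 7. $\Omega\cup\Gamma(\delta)=\Omega_h\cup\Gamma(\delta)=:\tilde\Omega$. For a node $\boldsymbol a$ (a point $\boldsymbol F_T(\hat{\boldsymbol a}_i)$), let $\phi_{\boldsymbol a}$ be the global basis function: on each $T\in\mathcal T_h$, $\phi_{\boldsymbol a}=\hat\phi_i\circ\boldsymbol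 F_T^{-1}$ if $\boldsymbol a=\boldsymbol F_T(\hat{\boldsymbol a}_i)$, and $\phi_{\boldsymbol a}=0$ if $\boldsymbol a\notin T$. Define $\mathring I_hv=\sum_{\boldsymbol a}v(\boldsymbol a)\phi_{\boldsymbol a}$, where the sum is over the nodes $\boldsymbol a\in\Omega_h$ only (the nodes on $\Gamma_h$ are left out). **Proposition 3.3.** Let $l,m$ be integers with $0\le l\le m\le k+1$ and $m\ge2$, and let $p\in[1,\infty]$ be such that the embedding $W^{m,p}\hookrightarrow C^0$ holds (on $\hat T$). Then there are constants $C>0$ and $h_0>0$, depending only on the fixed data ($N$, $k$, $\Omega$ and its local coordinates, $\hat T$, $c$, $c_\delta$, $l$, $m$, $p$), such that for every mesh as above with $h\le h_0$ and every $v\in W^{m,p}(\tilde\Omega)$ (identified with its continuous representative) with $v=0$ on $\Gamma$, $$\Big(\sum_{T\in\mathcal T_h}\|\nabla^l(v-\mathring I_hv)\|_{L^p(T)}^p\Big)^{1/p}\le C h^{m-l}\|v\|_{W^{m,p}(\Omega_h)}+C h^{k+1-l}\|\nabla^2v\|_{L^p(\Gamma(\delta))},$$ where for $p=\infty$ the left-hand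 side is $\max_{T\in\mathcal T_h}\|\nabla^l(v-\mathring I_hv)\|_{L^\infty(T)}$. -/

import Mathlib

open MeasureTheory Set
open scoped ENNReal ContDiff

noncomputable section

namespace IsoFEM

/-- `ℝⁿ` with its Euclidean norm. -/
abbrev Space (n : ℕ) := EuclideanSpace ℝ (Fin n)

/-! ### Sobolev seminorms through weak derivatives -/

/-- `G` is the tensor of all weak partial derivatives of order `l` of `v` on the open set `U`:
its component with index `J = (j₁, …, j_l)` is the weak derivative `∂_{j₁} ⋯ ∂_{j_l} v`. -/
def IsWeakGrad {n : ℕ} (l : ℕ) (U : Set (Space n)) (v : Space n → ℝ)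
    (G : Space n → EuclideanSpace ℝ (Fin l → Fin n)) : Prop :=
  LocallyIntegrableOn v U volume ∧ LocallyIntegrableOn G U volume ∧
    ∀ (J : Fin l → Fin n) (φ : Space n → ℝ), ContDiff ℝ ∞ φ → HasCompactSupport φ →
      tsupport φ ⊆ U →
      ∫ x, v x * iteratedFDeriv ℝ l φ x (fun i => EuclideanSpace.single (J i) (1 : ℝ)) =
        (-1 : ℝ) ^ l * ∫ x, G x J * φ x

/-- The seminorm `‖∇^l v‖_{L^p(U)}` on an open set `U`. Weak derivatives are unique up to null
sets, so the infimum is over one value only; it is `∞` if there is no weak derivative of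
order `l` on `U`. -/
def gradNorm {n : ℕ} (l : ℕ) (p : ℝ≥0∞) (U : Set (Space n)) (v : Space n → ℝ) : ℝ≥0∞ :=
  ⨅ (G : Space n → EuclideanSpace ℝ (Fin l → Fin n)) (_ : IsWeakGrad l U v G),
    eLpNorm G p (volume.restrict U)

/-- The `ℓ^p` norm of a finite family of extended nonnegative reals (a maximum if `p = ∞`). -/
def lpSum {ι : Type} [Fintype ι] (p : ℝ≥0∞) (f : ι → ℝ≥0∞) : ℝ≥0∞ :=
  if p = ⊤ then ⨆ i, f i else (∑ i, f i ^ p.toReal) ^ (1 / p.toReal)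

/-- The norm `‖v‖_{W^{m,p}(U)}` (`∞` if `v` is not in `W^{m,p}(U)`). -/
def sobolevNorm {n : ℕ} (m : ℕ) (p : ℝ≥0∞) (U : Set (Space n)) (v : Space n → ℝ) : ℝ≥0∞ :=
  lpSum p (fun j : Fin (m + 1) => gradNorm (j : ℕ) p U v)

/-- Membership in `W^{m,p}(U)`. -/
def MemSobolev {n : ℕ} (m : ℕ) (p : ℝ≥0∞) (U : Set (Space n)) (v : Space n → ℝ) : Prop :=
  sobolevNorm m p U v < ⊤

/-- The continuous embedding of `W^{m,p}(U)` into `C⁰(closure U)`. -/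
def EmbedsC0 {n : ℕ} (m : ℕ) (p : ℝ≥0∞) (U : Set (Space n)) : Prop :=
  ∃ C : NNReal, ∀ w : Space n → ℝ, MemSobolev m p U w →
    ∃ w' : Space n → ℝ, ContinuousOn w' (closure U) ∧ w' =ᵐ[volume.restrict U] w ∧
      ∀ x ∈ closure U, ‖w' x‖ₑ ≤ (C : ℝ≥0∞) * sobolevNorm m p U w

/-! ### The smooth domain -/

/-- The first `d` coordinates `y'` of `y = (y', y_N)`, where `N = d + 1`. -/
def base {d : ℕ} (y : Space (d + 1)) : Space d := WithLp.toLp 2 (fun i => y (Fin.castSucc i))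

/-- The last coordinate `y_N` of `y = (y', y_N)`, where `N = d + 1`. -/
def height {d : ℕ} (y : Space (d + 1)) : ℝ := y (Fin.last d)

/-- The open cube with the given center and half side length. -/
def cube {d : ℕ} (z : Space d) (a : ℝ) : Set (Space d) := {y | ∀ i, |y i - z i| < a}

/-- A finite system of local coordinates `(U_r, y_r, φ_r)` which shows that the boundary of the
open set `Ω ⊆ ℝ^{d+1}` is of class `C^{k+1,1}`. -/
structure BoundaryAtlas (d k : ℕ) (Ω : Set (Space (d + 1))) where
  M : ℕ
  U : Fin M → Set (Space (d + 1))
  coord : Fin M → (Space (d + 1) ≃ᵃⁱ[ℝ] Space (d + 1))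
  center : Fin M → Space d
  half : Fin M → ℝ
  φ : Fin M → Space d → ℝ
  isOpen_U : ∀ r, IsOpen (U r)
  half_pos : ∀ r, 0 < half r
  cover : frontier Ω ⊆ ⋃ r, U r
  base_mem : ∀ r, ∀ x ∈ U r, base (coord r x) ∈ cube (center r) (half r)
  graph : ∀ r, frontier Ω ∩ U r =
    {x | base (coord r x) ∈ cube (center r) (half r) ∧
      height (coord r x) = φ r (base (coord r x))}
  side : ∀ r, Ω ∩ U r = {x ∈ U r | φ r (base (coord r x)) < height (coord r x)}
  contDiffOn : ∀ r, ContDiffOn ℝ ((k + 1 : ℕ) : ℕ∞) (φ r) (cube (center r) (half r))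
  bounded : ∃ K : NNReal, ∀ r,
    (∀ j ≤ k + 1, ∀ y ∈ cube (center r) (half r), ‖iteratedFDeriv ℝ j (φ r) y‖ ≤ K) ∧
    LipschitzOnWith K (iteratedFDeriv ℝ (k + 1) (φ r)) (cube (center r) (half r))

/-- The projection `b_r` to the base set, `x ↦ y_r'`. -/
def BoundaryAtlas.proj {d k : ℕ} {Ω : Set (Space (d + 1))} (A : BoundaryAtlas d k Ω)
    (r : Fin A.M) (x : Space (d + 1)) : Space d := base (A.coord r x)

/-- The tubular neighborhood `Γ(δ) = {x | dist (x, Γ) ≤ δ}` of `Γ = ∂Ω`. -/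
def tube {n : ℕ} (Ω : Set (Space n)) (δ : ℝ) : Set (Space n) :=
  Metric.cthickening δ (frontier Ω)

/-! ### The reference Lagrange element -/

/-- The closed face spanned by the vertices with index in `s`, of the simplex whose vertices are
the points of the affine basis `t`. -/
def face {n : ℕ} (t : AffineBasis (Fin (n + 1)) ℝ (Space n)) (s : Set (Fin (n + 1))) :
    Set (Space n) := convexHull ℝ (t '' s)

/-- The closed simplex with the points of `t` as its vertices. -/
def simplex {n : ℕ} (t : AffineBasis (Fin (n + 1)) ℝ (Space n)) : Set (Space n) := face t univ

/-- Indices of the nodes of the Lagrange `P_k`-element: `(α_0, …, α_n)` with sum `k`. -/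
abbrev NodeIdx (n k : ℕ) := {α : Fin (n + 1) → Fin (k + 1) // ∑ i, (α i : ℕ) = k}

/-- The node with barycentric coordinates `α_i / k`. -/
def refNode {n k : ℕ} (t : AffineBasis (Fin (n + 1)) ℝ (Space n)) (α : NodeIdx n k) : Space n :=
  ∑ i, (((α.1 i : ℕ) : ℝ) / (k : ℝ)) • t i

/-- The nodal basis function of the node with index `α`, a polynomial of degree `k`, written in
the barycentric coordinates `λ_i`: `∏_i ∏_{j < α_i} (k λ_i - j) / (j + 1)`. -/
def refBasis {n k : ℕ} (t : AffineBasis (Fin (n + 1)) ℝ (Space n)) (α : NodeIdx n k)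
    (x : Space n) : ℝ :=
  ∏ i, ∏ j ∈ Finset.range (α.1 i : ℕ), (((k : ℝ) * t.coord i x - (j : ℝ)) / ((j : ℝ) + 1))

lemma coord_refNode {n k : ℕ} (hk : k ≠ 0) (t : AffineBasis (Fin (n + 1)) ℝ (Space n))
    (β : NodeIdx n k) (i : Fin (n + 1)) :
    t.coord i (refNode t β) = ((β.1 i : ℕ) : ℝ) / (k : ℝ) := by
  have hs : ∑ i, (((β.1 i : ℕ) : ℝ) / (k : ℝ)) = 1 := by
    rw [← Finset.sum_div, ← Nat.cast_sum, β.2]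
    exact div_self (Nat.cast_ne_zero.mpr hk)
  have h := t.coord_apply_combination_of_mem (Finset.mem_univ i) hs
  rwa [Finset.affineCombination_eq_linear_combination _ _ _ hs] at h

/-- The nodal basis functions satisfy `φ_α (a_β) = δ_{αβ}`. -/
theorem refBasis_refNode {n k : ℕ} (hk : k ≠ 0) (t : AffineBasis (Fin (n + 1)) ℝ (Space n))
    (α β : NodeIdx n k) : refBasis t α (refNode t β) = if α = β then 1 else 0 := by
  have hk' : (k : ℝ) ≠ 0 := Nat.cast_ne_zero.mpr hk
  have e : ∀ i, (k : ℝ) * t.coord i (refNode t β) = ((β.1 i : ℕ) : ℝ) := fun i => by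
    rw [coord_refNode hk]; field_simp
  unfold refBasis
  simp only [e]
  split_ifs with h
  · subst h
    refine Finset.prod_eq_one fun i _ => ?_
    generalize (α.1 i : ℕ) = a
    rw [Finset.prod_div_distrib, div_eq_one_iff_eq
      (Finset.prod_ne_zero_iff.mpr fun j _ => by positivity), ← Finset.prod_range_reflect]
    refine Finset.prod_congr rfl fun j hj => ?_
    have hj' := Finset.mem_range.mp hj
    rw [Nat.cast_sub (by omega), Nat.cast_sub (by omega)]
    push_cast; ring
  · obtain ⟨i, hi⟩ : ∃ i, (β.1 i : ℕ) < (α.1 i : ℕ) := by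
      by_contra hc
      push Not at hc
      apply h
      have hsum : ∑ i, (α.1 i : ℕ) = ∑ i, (β.1 i : ℕ) := by rw [α.2, β.2]
      have := (Finset.sum_eq_sum_iff_of_le (fun i _ => hc i)).mp hsum
      exact Subtype.ext (funext fun i => Fin.ext (this i (Finset.mem_univ i)))
    refine Finset.prod_eq_zero (Finset.mem_univ i) ?_
    exact Finset.prod_eq_zero (Finset.mem_range.mpr hi) (by simp)

/-! ### Isoparametric meshes -/

/-- The data of a mesh: finitely many elements; the element with index `i` has the affine
isomorphism `F̃_i` of the reference simplex onto the straight simplex `T̃_i`, and the nodes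
`a_{i,α}` which define the parametric map `F_i`. -/
structure Mesh (N k : ℕ) where
  card : ℕ
  aff : Fin card → (Space N ≃ᵃ[ℝ] Space N)
  node : Fin card → NodeIdx N k → Space N

namespace Mesh

variable {N k : ℕ} (t : AffineBasis (Fin (N + 1)) ℝ (Space N)) (𝒯 : Mesh N k)

/-- The straight simplex `T̃_i`. -/
def straight (i : Fin 𝒯.card) : Set (Space N) := 𝒯.aff i '' simplex t

/-- The parametric map `F_i = ∑_α a_{i,α} φ̂_α`. -/
def param (i : Fin 𝒯.card) (x : Space N) : Space N := ∑ α, refBasis t α x • 𝒯.node i α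

/-- The curved element `T_i`, the image of the reference simplex under `F_i`. -/
def elem (i : Fin 𝒯.card) : Set (Space N) := 𝒯.param t i '' simplex t

/-- The diameter `h_T` of the straight simplex `T̃_i`. -/
def diam (i : Fin 𝒯.card) : ℝ := Metric.diam (𝒯.straight t i)

/-- The diameter `ρ_T` of the largest ball contained in the straight simplex `T̃_i`. -/
def inDiam (i : Fin 𝒯.card) : ℝ :=
  sSup {s | ∃ (z : Space N) (r : ℝ), 0 ≤ r ∧ s = 2 * r ∧ Metric.closedBall z r ⊆ 𝒯.straight t i}

/-- The mesh size `h = max h_T`. -/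
def size : ℝ := ⨆ i, 𝒯.diam t i

/-- The norm `‖B_T‖` of the linear part of the affine isomorphism. -/
def linNorm (i : Fin 𝒯.card) : ℝ :=
  ‖LinearMap.toContinuousLinearMap ((𝒯.aff i).linear : Space N →ₗ[ℝ] Space N)‖

/-- The approximate domain `Ω_h`, the interior of the union of the elements. Its boundary `Γ_h`
is written `frontier (𝒯.domain t)`. -/
def domain : Set (Space N) := interior (⋃ i, 𝒯.elem t i)

/-- The side of the element `T_i` opposite to its vertex with index `j`. -/
def side (i : Fin 𝒯.card) (j : Fin (N + 1)) : Set (Space N) := 𝒯.param t i '' face t {j}ᶜ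

/-- The boundary mesh `𝒮_h`. -/
def boundaryMesh : Set (Set (Space N)) :=
  {S | (∃ i j, S = 𝒯.side t i j) ∧ S ⊆ frontier (𝒯.domain t)}

open Classical in
/-- The interior nodes, i.e. the nodes which lie in the open set `Ω_h`. -/
def interiorNodes : Finset (Space N) :=
  (Finset.univ.image fun q : Fin 𝒯.card × NodeIdx N k => 𝒯.param t q.1 (refNode t q.2)).filter
    (· ∈ 𝒯.domain t)

open Classical in
/-- The restriction to `T_i` of the global basis function of the node `a`: this is
`φ̂_α ∘ F_i⁻¹` if `a = F_i (â_α)`, and `0` if `a` is not a node of `T_i`. -/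
def localBasis (i : Fin 𝒯.card) (a x : Space N) : ℝ :=
  if h : ∃ α : NodeIdx N k, 𝒯.param t i (refNode t α) = a then
    refBasis t h.choose (Function.invFunOn (𝒯.param t i) (simplex t) x) else 0

open Classical in
/-- The global nodal basis function `φ_a`, extended by `0` outside the union of the elements.
In a common face of two elements, both give the same value. -/
def basis (a x : Space N) : ℝ :=
  if h : ∃ i, x ∈ 𝒯.elem t i then 𝒯.localBasis t h.choose a x else 0

/-- The interpolation `∑ v(a) φ_a` over the interior nodes `a`. -/
def interp (v : Space N → ℝ) (x : Space N) : ℝ :=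
  ∑ a ∈ 𝒯.interiorNodes t, v a * 𝒯.basis t a x

end Mesh

/-- The assumptions on a mesh, with all the constants in them bounded by `c`, except for the
constant `cδ` in `δ = cδ * h ^ (k + 1)`. Here `t` is the reference simplex. -/
structure Mesh.Admissible {d k : ℕ} {Ω : Set (Space (d + 1))} (A : BoundaryAtlas d k Ω)
    (t : AffineBasis (Fin (d + 2)) ℝ (Space (d + 1))) (c cδ : ℝ) (𝒯 : Mesh (d + 1) k) :
    Prop where
  /-- Two straight simplices meet in a common face of dimension `≤ N - 1` or not at all
  (a face without vertices is empty). -/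
  straight_inter : ∀ i j, i ≠ j → ∃ s s' : Set (Fin (d + 2)), s ≠ univ ∧ s' ≠ univ ∧
    𝒯.straight t i ∩ 𝒯.straight t j = 𝒯.aff i '' face t s ∧
    𝒯.straight t i ∩ 𝒯.straight t j = 𝒯.aff j '' face t s'
  /-- Shape-regularity. -/
  shape_regular : ∀ i, 𝒯.diam t i ≤ c * 𝒯.inDiam t i
  /-- Quasi-uniformity. -/
  quasi_uniform : ∀ i, 𝒯.size t ≤ c * 𝒯.diam t i
  /-- The curved elements are perturbations of the straight ones. -/
  perturb : ∀ i α, ‖𝒯.node i α - 𝒯.aff i (refNode t α)‖ ≤ c * 𝒯.diam t i ^ 2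
  /-- Two curved elements meet in a common face of dimension `≤ N - 1`, on which their nodes
  coincide, or not at all. -/
  elem_inter : ∀ i j, i ≠ j → ∃ s s' : Set (Fin (d + 2)), s ≠ univ ∧ s' ≠ univ ∧
    𝒯.elem t i ∩ 𝒯.elem t j = 𝒯.param t i '' face t s ∧
    𝒯.elem t i ∩ 𝒯.elem t j = 𝒯.param t j '' face t s' ∧
    𝒯.param t i '' (range (refNode (k := k) t) ∩ face t s) =
      𝒯.param t j '' (range (refNode (k := k) t) ∩ face t s')
  /-- Regularity of order `k`. -/
  regular : ∀ i, ∀ j, 1 ≤ j → j ≤ k + 1 → ∀ x ∈ simplex t,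
    ‖iteratedFDeriv ℝ j (𝒯.param t i) x‖ ≤ c * 𝒯.linNorm i ^ j
  /-- `Γ_h` is covered by the local coordinate system of `Γ`. -/
  cover : frontier (𝒯.domain t) ⊆ ⋃ r, A.U r
  /-- `Γ_h` is a graph in each of the local coordinates, and on each boundary element it is a
  polynomial graph that approximates `Γ` with the accuracy of the `P_k`-interpolation. -/
  approx : ∃ φh : Fin A.M → Space d → ℝ,
    (∀ r, ContinuousOn (φh r) (closure (cube (A.center r) (A.half r)))) ∧
    (∀ r, frontier (𝒯.domain t) ∩ A.U r =
      {x | A.proj r x ∈ cube (A.center r) (A.half r) ∧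
        height (A.coord r x) = φh r (A.proj r x)}) ∧
    ∀ S ∈ 𝒯.boundaryMesh t, ∃ r, S ⊆ A.U r ∧ ∃ q : MvPolynomial (Fin d) ℝ,
      q.totalDegree ≤ k ∧ ∀ y ∈ A.proj r '' S,
        φh r y = MvPolynomial.eval (fun i => y i) q ∧
        |A.φ r y - φh r y| ≤ cδ * 𝒯.size t ^ (k + 1) ∧
        ∀ j, 1 ≤ j → j ≤ k + 1 →
          ‖iteratedFDeriv ℝ j
            (fun z : Space d => A.φ r z - MvPolynomial.eval (fun i => z i) q) y‖ ≤
              c * 𝒯.size t ^ (k + 1 - j)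
  /-- `Ω_h` approximates `Ω` up to the layer `Γ(δ)`, i.e. `Ω ∪ Γ(δ) = Ω_h ∪ Γ(δ)`. -/
  compat : Ω ∪ tube Ω (cδ * 𝒯.size t ^ (k + 1)) =
    𝒯.domain t ∪ tube Ω (cδ * 𝒯.size t ^ (k + 1))

end IsoFEM

end

namespace IsoFEM

section

/-! ### Iterated derivatives: symmetry and components -/

section IteratedDeriv

variable {E F : Type*} [NormedAddCommGroup E] [NormedSpace ℝ E] [NormedAddCommGroup F]
  [NormedSpace ℝ F]

/-! Everything is reduced to one element. Let `w = v ∘ F` be the pull-back of `v` to the reference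
simplex. Nodal interpolation reproduces polynomials of degree at most `k`. The Bramble–Hilbert lemma
and the embedding into continuous functions therefore bound the error of the interpolation with some
nodes left out by the derivatives of order `m` of `w` plus the values of `|w|` at the omitted nodes
(`exists_interp_bound`). Scaling back to the element turns the first contribution into `h^(m-l)`
times a local Sobolev norm of `v`. The heart of the matter is the size of the omitted values
(`exists_node_bound`).

An omitted node lies in `Γ(δ)` (`mem_tube_of_notMem`), hence at distance at most `δ ~ h^(k+1)` from
a point `a` of `Γ`, where `v` vanishes. Near `a` the boundary is flattened by a chart which maps
vertical lines to parallel straight lines (`exists_isGraphChart`). Consider in this chart a slab of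
size `ρ ~ h` that starts at a height `s₀ ~ δ`, so that it is mapped into `Ω_h`, and approximate `v`
there by a polynomial `P`. For `y` in the slab let `y₀` be its vertical projection to the flat
boundary. Since `v` vanishes at `y₀`, one has `P(y₀) = -(v - P)(y₀)`. Taylor's formula on the
vertical segment from `y` down to `y₀` bounds this by `v - P` and its gradient at `y`, plus an
integral of the second vertical derivative of `v - P` weighted by the height. This weight is
decisive. Above `s₀` it is at most `ρ`, and the approximation property yields `h^m`. Below `s₀` it
is at most `s₀`, which produces the factor `h^(k+1)` in front of `∇²v`; the points concerned lie in
`Ω`, hence in `Ω_h` or in `Γ(δ)` (`enorm_le_of_vertical_segment`, `exists_polyLT_slab`).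

Averaging over `y` and the equivalence of norms for polynomials (`exists_polyLT_bound`) bound
`P(0)`. The chart coordinate of the node has norm at most `s₀`, so `P` at the node differs from
`P(0)` by at most a multiple of `s₀ max |∇P|`. Finally `v - P` at the node is estimated on the
reference element by derivatives of order `m` and an `L¹` norm on an interior ball
(`exists_enorm_le_of_embedsC0`).

The analytic basis is mollification (`exists_smoothing`). It gives the chain rule for weak
derivatives (`IsWeakGrad.comp`) and the Poincaré inequality (`eLpNorm_sub_average_le`), from which
polynomial approximation follows (`exists_polyLT_approx`). Changes of variables are inequalities
based on a Lipschitz inverse (`AntiLipOn`), without Jacobians. Uniform bounds for the parametric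
maps and their inverses come from `exists_isElemMap_of_admissible`. The bound on one element
(`exists_local_interp_bound`) involves `v` on a ball of radius `R h`. These balls overlap boundedly
often (`exists_card_le_of_admissible`), so the `ℓ^p` sum over the elements closes the proof
(`lpSum_eLpNorm_le`). -/

lemma contDiff_iteratedFDeriv_infty {φ : E → F} (hφ : ContDiff ℝ ∞ φ) (l : ℕ) :
    ContDiff ℝ ∞ (iteratedFDeriv ℝ l φ) := by
  rw [contDiff_infty] at *
  exact fun n => (hφ (n + l)).iteratedFDeriv_right (by norm_cast)

lemma contDiff_iteratedFDeriv_apply {φ : E → F} (hφ : ContDiff ℝ ∞ φ) {l : ℕ} (w : Fin l → E) :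
    ContDiff ℝ ∞ (fun y => iteratedFDeriv ℝ l φ y w) :=
  (ContinuousMultilinearMap.apply ℝ (fun _ : Fin l => E) F w).contDiff.comp
    (contDiff_iteratedFDeriv_infty hφ l)

lemma contDiff_fderiv_apply_const {φ : E → F} (hφ : ContDiff ℝ ∞ φ) (u : E) :
    ContDiff ℝ ∞ (fun y => fderiv ℝ φ y u) :=
  (ContinuousLinearMap.apply ℝ F u).contDiff.comp (hφ.fderiv_right (m := ∞) (by simp))

/-- Freezing the inner direction is composition with an evaluation map, so both sides are values of
the second derivative, which is symmetric. -/
lemma fderiv_fderiv_comm {φ : E → F} (hφ : ContDiff ℝ ∞ φ) (u w x : E) :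
    fderiv ℝ (fun y => fderiv ℝ φ y u) x w = fderiv ℝ (fun y => fderiv ℝ φ y w) x u := by
  have hd : DifferentiableAt ℝ (fderiv ℝ φ) x :=
    ((hφ.fderiv_right (m := ∞) (by simp)).differentiable (by simp)).differentiableAt
  have h := (hφ.contDiffAt (x := x)).isSymmSndFDerivAt
    (by simpa using WithTop.coe_le_coe.mpr (le_top (a := (2 : ℕ∞))))
  have e : ∀ v, fderiv ℝ (fun y => fderiv ℝ φ y v) x = (fderiv ℝ (fderiv ℝ φ) x).flip v := by
    intro v
    have := (ContinuousLinearMap.apply ℝ F v).hasFDerivAt.comp x hd.hasFDerivAt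
    have h2 := this.fderiv
    rw [Function.comp_def] at h2
    change fderiv ℝ (fun y => fderiv ℝ φ y v) x = _ at h2
    rw [h2]; ext; rfl
  rw [e u, e w]
  exact h.eq w u

lemma iteratedFDeriv_succ_apply_cons {φ : E → F} (hφ : ContDiff ℝ ∞ φ) {l : ℕ}
    (m : Fin (l + 1) → E) (x : E) :
    iteratedFDeriv ℝ (l + 1) φ x m =
      fderiv ℝ (fun y => iteratedFDeriv ℝ l φ y (Fin.tail m)) x (m 0) :=
  ((contDiff_iteratedFDeriv_infty hφ l).differentiable
    (by simp)).differentiableAt.iteratedFDeriv_succ_apply_left'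

/-- Directional derivatives commute, so one taken first may as well be taken last. Integration by
parts needs this when a directional derivative of a test function serves as the new test function.
-/
lemma iteratedFDeriv_fderiv_apply {φ : E → F} (hφ : ContDiff ℝ ∞ φ) (u : E) :
    ∀ {l : ℕ} (w : Fin l → E) (x : E), iteratedFDeriv ℝ l (fun y => fderiv ℝ φ y u) x w =
      fderiv ℝ (fun y => iteratedFDeriv ℝ l φ y w) x u := by
  intro l
  induction l with
  | zero => intro w x; simp
  | succ l ih =>
    intro w x
    rw [iteratedFDeriv_succ_apply_cons (contDiff_fderiv_apply_const hφ u)]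
    simp_rw [ih]
    rw [fderiv_fderiv_comm (contDiff_iteratedFDeriv_apply hφ _)]
    congr 2
    ext y
    rw [iteratedFDeriv_succ_apply_cons hφ]

/-- As a fold over the list of directions, invariance under permutations follows from the
commutation of two steps. The fold runs over a subtype so that smoothness is carried along. -/
lemma iteratedFDeriv_eq_foldr {φ : E → F} (hφ : ContDiff ℝ ∞ φ) {l : ℕ} (w : Fin l → E) :
    (fun y => iteratedFDeriv ℝ l φ y w) = ((List.ofFn w).foldr
      (fun u (ψ : {ψ : E → F // ContDiff ℝ ∞ ψ}) =>
        ⟨fun y => fderiv ℝ ψ.1 y u, contDiff_fderiv_apply_const ψ.2 u⟩) ⟨φ, hφ⟩).1 := by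
  induction l with
  | zero => ext y; simp
  | succ l ih =>
    ext y
    rw [List.ofFn_succ, List.foldr_cons, iteratedFDeriv_succ_apply_cons hφ, ih]
    rfl

/-- The iterated derivatives of a smooth function are symmetric. -/
lemma iteratedFDeriv_comp_perm_of_contDiff {φ : E → F} (hφ : ContDiff ℝ ∞ φ) {l : ℕ}
    (w : Fin l → E) (σ : Equiv.Perm (Fin l)) (x : E) :
    iteratedFDeriv ℝ l φ x (w ∘ σ) = iteratedFDeriv ℝ l φ x w := by
  have h := iteratedFDeriv_eq_foldr hφ (w ∘ σ)
  rw [(σ.ofFn_comp_perm w).foldr_eq' (fun u _ v _ ψ => Subtype.ext (funext fun y =>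
    fderiv_fderiv_comm ψ.2 _ _ _)), ← iteratedFDeriv_eq_foldr hφ w] at h
  exact congrFun h x

end IteratedDeriv

variable {n : ℕ}

/-- The family of standard basis vectors with indices `J`. -/
noncomputable abbrev stdVec {l : ℕ} (J : Fin l → Fin n) : Fin l → Space n :=
  fun i => EuclideanSpace.single (J i) (1 : ℝ)

lemma norm_multilinear_stdVec_le {l : ℕ} (M : Space n [×l]→L[ℝ] ℝ) (J : Fin l → Fin n) :
    ‖M (stdVec J)‖ ≤ ‖M‖ := by
  refine (M.le_opNorm _).trans_eq ?_
  simp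

lemma norm_euclidean_le_sum {ι : Type*} [Fintype ι] (T : EuclideanSpace ℝ ι) :
    ‖T‖ ≤ ∑ J, ‖T J‖ := by
  classical
  have : T = ∑ J, EuclideanSpace.single J (T J) := by
    ext K
    simp [Finset.sum_apply, Pi.single_apply]
  conv_lhs => rw [this]
  refine (norm_sum_le _ _).trans (le_of_eq ?_)
  simp

/-- The components of a multilinear form. -/
noncomputable def components (n l : ℕ) :
    (Space n [×l]→L[ℝ] ℝ) →L[ℝ] EuclideanSpace ℝ (Fin l → Fin n) :=
  LinearMap.mkContinuous
    { toFun := fun M => WithLp.toLp 2 fun J => M (stdVec J)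
      map_add' := fun M M' => by ext J; simp
      map_smul' := fun a M => by ext J; simp } ((n : ℝ) ^ l) (by
    intro M
    refine (norm_euclidean_le_sum _).trans ?_
    refine (Finset.sum_le_sum fun J _ => norm_multilinear_stdVec_le M J).trans ?_
    simp)

lemma components_apply {l : ℕ} (M : Space n [×l]→L[ℝ] ℝ) (J : Fin l → Fin n) :
    components n l M J = M (stdVec J) := rfl

lemma norm_components_le {l : ℕ} (M : Space n [×l]→L[ℝ] ℝ) :
    ‖components n l M‖ ≤ (n : ℝ) ^ l * ‖M‖ :=
  (norm_euclidean_le_sum _).trans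
    ((Finset.sum_le_sum fun J _ => norm_multilinear_stdVec_le M J).trans_eq (by simp))

/-- The multilinear form with the given components. -/
noncomputable def ofComponents (n l : ℕ) :
    EuclideanSpace ℝ (Fin l → Fin n) →L[ℝ] (Space n [×l]→L[ℝ] ℝ) :=
  ∑ J : Fin l → Fin n, (EuclideanSpace.proj J : EuclideanSpace ℝ (Fin l → Fin n) →L[ℝ] ℝ).smulRight
    ((ContinuousMultilinearMap.mkPiAlgebra ℝ (Fin l) ℝ).compContinuousLinearMap
      (fun i => (EuclideanSpace.proj (J i) : Space n →L[ℝ] ℝ)))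

lemma ofComponents_apply {l : ℕ} (T : EuclideanSpace ℝ (Fin l → Fin n)) (v : Fin l → Space n) :
    ofComponents n l T v = ∑ J : Fin l → Fin n, T J * ∏ i, v i (J i) := by
  simp [ofComponents]

lemma components_ofComponents {l : ℕ} (T : EuclideanSpace ℝ (Fin l → Fin n)) :
    components n l (ofComponents n l T) = T := by
  ext J
  rw [components_apply, ofComponents_apply, Finset.sum_eq_single J]
  · simp
  · intro K _ hK
    obtain ⟨i, hi⟩ := Function.ne_iff.mp hK
    rw [Finset.prod_eq_zero (Finset.mem_univ i), mul_zero]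
    simp [hi]
  · simp

lemma components_injective {l : ℕ} : Function.Injective (components n l) := by
  intro M M' h
  apply ContinuousMultilinearMap.toMultilinearMap_injective
  refine Module.Basis.ext_multilinear (fun _ => (EuclideanSpace.basisFun (Fin n) ℝ).toBasis) ?_
  intro J
  have := congrArg (fun T : EuclideanSpace ℝ (Fin l → Fin n) => T J) h
  simpa [components_apply] using this

lemma ofComponents_components {l : ℕ} (M : Space n [×l]→L[ℝ] ℝ) :
    ofComponents n l (components n l M) = M :=
  components_injective (components_ofComponents _)

lemma abs_tensor_apply_le {ι : Type*} [Fintype ι] (T : EuclideanSpace ℝ ι) (J : ι) :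
    ‖T J‖ ≤ ‖T‖ := PiLp.norm_apply_le T J

lemma norm_ofComponents_le {l : ℕ} (T : EuclideanSpace ℝ (Fin l → Fin n)) :
    ‖ofComponents n l T‖ ≤ (n : ℝ) ^ l * ‖T‖ := by
  refine ContinuousMultilinearMap.opNorm_le_bound (by positivity) fun v => ?_
  rw [ofComponents_apply]
  refine (norm_sum_le _ _).trans ?_
  have : ∀ J ∈ (Finset.univ : Finset (Fin l → Fin n)),
      ‖T J * ∏ i, v i (J i)‖ ≤ ‖T‖ * ∏ i, ‖v i‖ := by
    intro J _
    rw [norm_mul, norm_prod]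
    gcongr
    · exact abs_tensor_apply_le T J
    · exact abs_tensor_apply_le _ _
  refine (Finset.sum_le_sum this).trans (le_of_eq ?_)
  simp [mul_assoc]

lemma norm_multilinear_le_components {l : ℕ} (M : Space n [×l]→L[ℝ] ℝ) :
    ‖M‖ ≤ (n : ℝ) ^ l * ‖components n l M‖ := by
  simpa [ofComponents_components] using norm_ofComponents_le (components n l M)

/-- The tensor of the classical partial derivatives of order `l`. -/
noncomputable def tensorDeriv (l : ℕ) (g : Space n → ℝ) (x : Space n) :
    EuclideanSpace ℝ (Fin l → Fin n) :=
  components n l (iteratedFDeriv ℝ l g x)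

lemma tensorDeriv_apply (l : ℕ) (g : Space n → ℝ) (x : Space n) (J : Fin l → Fin n) :
    tensorDeriv l g x J = iteratedFDeriv ℝ l g x (stdVec J) := rfl

lemma norm_tensorDeriv_le (l : ℕ) (g : Space n → ℝ) (x : Space n) :
    ‖tensorDeriv l g x‖ ≤ (n : ℝ) ^ l * ‖iteratedFDeriv ℝ l g x‖ := norm_components_le _

lemma norm_iteratedFDeriv_le_tensorDeriv (l : ℕ) (g : Space n → ℝ) (x : Space n) :
    ‖iteratedFDeriv ℝ l g x‖ ≤ (n : ℝ) ^ l * ‖tensorDeriv l g x‖ :=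
  norm_multilinear_le_components _

/-! ### Weak gradients -/

lemma tsupport_iteratedFDeriv_apply_subset {l : ℕ} (φ : Space n → ℝ) (w : Fin l → Space n) :
    tsupport (fun y => iteratedFDeriv ℝ l φ y w) ⊆ tsupport φ := by
  refine subset_trans ?_ (tsupport_iteratedFDeriv_subset (𝕜 := ℝ) (f := φ) l)
  refine closure_mono fun y hy => ?_
  rw [Function.mem_support] at *
  contrapose! hy
  simp [hy]

lemma hasCompactSupport_iteratedFDeriv_apply {l : ℕ} {φ : Space n → ℝ} (hφ : HasCompactSupport φ)
    (w : Fin l → Space n) : HasCompactSupport (fun y => iteratedFDeriv ℝ l φ y w) :=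
  hφ.of_isClosed_subset isClosed_closure (tsupport_iteratedFDeriv_apply_subset φ w)

lemma continuous_mul_of_tsupport_subset {U : Set (Space n)} (hU : IsOpen U) {g φ : Space n → ℝ}
    (hg : ContinuousOn g U) (hφ : Continuous φ) (hs : tsupport φ ⊆ U) :
    Continuous (fun x => g x * φ x) := by
  rw [continuous_iff_continuousAt]
  intro x
  by_cases hx : x ∈ tsupport φ
  · exact (hg.continuousAt (hU.mem_nhds (hs hx))).mul hφ.continuousAt
  · have : (fun x => g x * φ x) =ᶠ[nhds x] fun _ => 0 := by
      filter_upwards [(isClosed_tsupport φ).isOpen_compl.mem_nhds hx] with y hy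
      rw [image_eq_zero_of_notMem_tsupport hy, mul_zero]
    exact this.continuousAt

lemma integrable_mul_of_tsupport_subset {U : Set (Space n)} (hU : IsOpen U) {g φ : Space n → ℝ}
    (hg : ContinuousOn g U) (hφ : Continuous φ) (hc : HasCompactSupport φ) (hs : tsupport φ ⊆ U) :
    Integrable (fun x => g x * φ x) :=
  (continuous_mul_of_tsupport_subset hU hg hφ hs).integrable_of_hasCompactSupport hc.mul_left

/-- Integration by parts, for a function which is of class `C^l` on an open set. -/
lemma integral_mul_iteratedFDeriv {U : Set (Space n)} (hU : IsOpen U) {g : Space n → ℝ} :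
    ∀ {l : ℕ} (_ : ContDiffOn ℝ l g U) (w : Fin l → Space n) {φ : Space n → ℝ}
      (_ : ContDiff ℝ ∞ φ) (_ : HasCompactSupport φ) (_ : tsupport φ ⊆ U),
      ∫ x, g x * iteratedFDeriv ℝ l φ x w =
        (-1 : ℝ) ^ l * ∫ x, iteratedFDeriv ℝ l g x w * φ x := by
  intro l
  induction l with
  | zero => intro hg w φ hφ hc hs; simp
  | succ l ih =>
    intro hg w φ hφ hc hs
    -- The derivative in the direction `w 0` is absorbed into the test function. The induction
    -- hypothesis moves the other `l` derivatives, and one classical integration by parts moves this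
    -- last one.
    set ψ : Space n → ℝ := fun y => fderiv ℝ φ y (w 0) with hψ
    have hψs : tsupport ψ ⊆ tsupport φ := by
      refine subset_trans (closure_mono fun y hy => ?_) (tsupport_fderiv_subset ℝ (f := φ))
      rw [Function.mem_support] at *
      contrapose! hy
      simp [hψ, hy]
    have hψ1 : ContDiff ℝ ∞ ψ := contDiff_fderiv_apply_const hφ _
    have hψc : HasCompactSupport ψ := hc.of_isClosed_subset isClosed_closure hψs
    have e1 : ∀ x, iteratedFDeriv ℝ (l + 1) φ x w = iteratedFDeriv ℝ l ψ x (Fin.tail w) := by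
      intro x
      rw [iteratedFDeriv_fderiv_apply hφ, iteratedFDeriv_succ_apply_cons hφ]
    have hgl : ContDiffOn ℝ l g U := hg.of_le (by norm_cast; omega)
    have hdiff : ∀ x ∈ U, ContDiffAt ℝ 1 (iteratedFDeriv ℝ l g) x := fun x hx =>
      (hg.contDiffAt (hU.mem_nhds hx)).iteratedFDeriv_right (by norm_cast; omega)
    set G : Space n → ℝ := fun y => iteratedFDeriv ℝ l g y (Fin.tail w) with hG
    have hG1 : ContDiffOn ℝ 1 G U := fun x hx =>
      ((ContinuousMultilinearMap.apply ℝ (fun _ : Fin l => Space n) ℝ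
        (Fin.tail w)).contDiff.contDiffAt.comp x (hdiff x hx)).contDiffWithinAt
    have e2 : ∀ x ∈ U, iteratedFDeriv ℝ (l + 1) g x w = fderiv ℝ G x (w 0) := fun x hx =>
      ((hdiff x hx).differentiableAt (by simp)).iteratedFDeriv_succ_apply_left'
    have e3 : ∀ x, iteratedFDeriv ℝ (l + 1) g x w * φ x = fderiv ℝ G x (w 0) * φ x := by
      intro x
      by_cases hx : x ∈ tsupport φ
      · rw [e2 x (hs hx)]
      · rw [image_eq_zero_of_notMem_tsupport hx, mul_zero, mul_zero]
    have hG' : ContinuousOn (fun x => fderiv ℝ G x (w 0)) U :=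
      (hG1.continuousOn_fderiv_of_isOpen hU le_rfl).clm_apply continuousOn_const
    simp_rw [e1, e3]
    rw [ih hgl (Fin.tail w) hψ1 hψc (hψs.trans hs)]
    have key := integral_mul_fderiv_eq_neg_fderiv_mul_of_integrable (μ := volume) (f := G)
      (g := φ) (v := w 0)
      (integrable_mul_of_tsupport_subset hU hG' hφ.continuous hc hs)
      (integrable_mul_of_tsupport_subset hU hG1.continuousOn hψ1.continuous hψc (hψs.trans hs))
      (integrable_mul_of_tsupport_subset hU hG1.continuousOn hφ.continuous hc hs)
      (fun x hx => (hG1.contDiffAt (hU.mem_nhds (hs hx))).differentiableAt (by simp))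
      (fun x _ => (hφ.differentiable (by simp)).differentiableAt)
    change _ * ∫ x, G x * fderiv ℝ φ x (w 0) = _
    rw [key, pow_succ]
    ring

lemma continuousOn_tensorDeriv {U : Set (Space n)} (hU : IsOpen U) {g : Space n → ℝ} {l : ℕ}
    (hg : ContDiffOn ℝ l g U) : ContinuousOn (tensorDeriv l g) U := by
  refine (components n l).continuous.comp_continuousOn fun x hx => ?_
  exact (((hg.contDiffAt (hU.mem_nhds hx)).iteratedFDeriv_right (m := 0) (i := l)
    (by simp)).continuousAt).continuousWithinAt

/-- The classical derivatives are weak derivatives. -/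
lemma isWeakGrad_tensorDeriv {U : Set (Space n)} (hU : IsOpen U) {g : Space n → ℝ} {l : ℕ}
    (hg : ContDiffOn ℝ l g U) : IsWeakGrad l U g (tensorDeriv l g) := by
  refine ⟨hg.continuousOn.locallyIntegrableOn hU.measurableSet,
    (continuousOn_tensorDeriv hU hg).locallyIntegrableOn hU.measurableSet, ?_⟩
  intro J φ hφ hc hs
  exact integral_mul_iteratedFDeriv hU hg _ hφ hc hs

lemma IsWeakGrad.mono {l : ℕ} {U V : Set (Space n)} {v : Space n → ℝ}
    {G : Space n → EuclideanSpace ℝ (Fin l → Fin n)} (h : IsWeakGrad l V v G) (hUV : U ⊆ V) :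
    IsWeakGrad l U v G :=
  ⟨h.1.mono_set hUV, h.2.1.mono_set hUV, fun J φ hφ hc hs => h.2.2 J φ hφ hc (hs.trans hUV)⟩

lemma integrable_locallyIntegrableOn_mul {U : Set (Space n)} {g φ : Space n → ℝ}
    (hg : LocallyIntegrableOn g U) (hφ : Continuous φ) (hc : HasCompactSupport φ)
    (hs : tsupport φ ⊆ U) : Integrable (fun x => g x * φ x) := by
  have h1 : IntegrableOn g (tsupport φ) := hg.integrableOn_compact_subset hs hc
  have h2 : IntegrableOn (fun x => g x * φ x) (tsupport φ) :=
    h1.mul_continuousOn hφ.continuousOn hc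
  refine (integrableOn_iff_integrable_of_support_subset ?_).mp h2
  intro x hx
  refine subset_tsupport _ fun h => hx ?_
  simp [h]

lemma locallyIntegrableOn_tensor_apply {ι : Type*} [Fintype ι] {U : Set (Space n)}
    {G : Space n → EuclideanSpace ℝ ι}
    (hG : LocallyIntegrableOn G U) (J : ι) : LocallyIntegrableOn (fun x => G x J) U := fun x hx => by
  obtain ⟨s, hs, h⟩ := hG x hx
  exact ⟨s, hs, ((EuclideanSpace.proj J : EuclideanSpace ℝ ι →L[ℝ] ℝ)).integrable_comp h⟩

lemma IsWeakGrad.sub {l : ℕ} {U : Set (Space n)} {v v' : Space n → ℝ}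
    {G G' : Space n → EuclideanSpace ℝ (Fin l → Fin n)} (h : IsWeakGrad l U v G)
    (h' : IsWeakGrad l U v' G') :
    IsWeakGrad l U (fun x => v x - v' x) (fun x => G x - G' x) := by
  refine ⟨h.1.sub h'.1, h.2.1.sub h'.2.1, fun J φ hφ hc hs => ?_⟩
  have c1 : Continuous fun x => iteratedFDeriv ℝ l φ x (stdVec J) :=
    (contDiff_iteratedFDeriv_apply hφ _).continuous
  have c2 := hasCompactSupport_iteratedFDeriv_apply (l := l) hc (stdVec J)
  have c3 := (tsupport_iteratedFDeriv_apply_subset φ (stdVec (l := l) J)).trans hs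
  have e1 := integral_sub (integrable_locallyIntegrableOn_mul h.1 c1 c2 c3)
    (integrable_locallyIntegrableOn_mul h'.1 c1 c2 c3)
  have e2 := integral_sub
    (integrable_locallyIntegrableOn_mul (locallyIntegrableOn_tensor_apply h.2.1 J)
      hφ.continuous hc hs)
    (integrable_locallyIntegrableOn_mul (locallyIntegrableOn_tensor_apply h'.2.1 J)
      hφ.continuous hc hs)
  simp only [sub_mul, PiLp.sub_apply]
  rw [e1, e2, h.2.2 J φ hφ hc hs, h'.2.2 J φ hφ hc hs]
  ring

lemma IsWeakGrad.congr {l : ℕ} {U : Set (Space n)} (hU : MeasurableSet U) {v v' : Space n → ℝ}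
    {G : Space n → EuclideanSpace ℝ (Fin l → Fin n)} (h : IsWeakGrad l U v G)
    (hv : v =ᵐ[volume.restrict U] v') : IsWeakGrad l U v' G := by
  refine ⟨?_, h.2.1, fun J φ hφ hc hs => ?_⟩
  · intro x hx
    obtain ⟨s, hs, hi⟩ := h.1 x hx
    refine ⟨s ∩ U, Filter.inter_mem hs self_mem_nhdsWithin, ?_⟩
    refine (hi.mono_set inter_subset_left).congr_fun_ae ?_
    exact ae_mono (Measure.restrict_mono inter_subset_right le_rfl) hv
  · rw [← h.2.2 J φ hφ hc hs]
    refine integral_congr_ae ?_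
    rw [Filter.EventuallyEq, ae_restrict_iff' hU] at hv
    filter_upwards [hv] with x hx
    by_cases hxs : x ∈ tsupport φ
    · rw [hx (hs hxs)]
    · have : iteratedFDeriv ℝ l φ x = 0 := by
        refine image_eq_zero_of_notMem_tsupport fun h' => hxs ?_
        exact tsupport_iteratedFDeriv_subset l h'
      simp [this]

/-- Weak derivatives are unique. -/
lemma IsWeakGrad.ae_eq {l : ℕ} {U : Set (Space n)} (hU : IsOpen U) {v : Space n → ℝ}
    {G G' : Space n → EuclideanSpace ℝ (Fin l → Fin n)} (h : IsWeakGrad l U v G)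
    (h' : IsWeakGrad l U v G') : G =ᵐ[volume.restrict U] G' := by
  have hJ : ∀ J, ∀ᵐ x, x ∈ U → G x J - G' x J = 0 := by
    intro J
    refine hU.ae_eq_zero_of_integral_contDiff_smul_eq_zero
      ((locallyIntegrableOn_tensor_apply h.2.1 J).sub (locallyIntegrableOn_tensor_apply h'.2.1 J))
      fun φ hφ hc hs => ?_
    have e2 := integral_sub
      (integrable_locallyIntegrableOn_mul (locallyIntegrableOn_tensor_apply h.2.1 J)
        hφ.continuous hc hs)
      (integrable_locallyIntegrableOn_mul (locallyIntegrableOn_tensor_apply h'.2.1 J)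
        hφ.continuous hc hs)
    have e3 := (h.2.2 J φ hφ hc hs).symm.trans (h'.2.2 J φ hφ hc hs)
    have e4 := mul_left_cancel₀ (pow_ne_zero l (by norm_num : (-1 : ℝ) ≠ 0)) e3
    calc ∫ x, φ x • (G x J - G' x J) = ∫ x, (G x J * φ x - G' x J * φ x) := by
          refine integral_congr_ae (.of_forall fun x => ?_)
          simp only [smul_eq_mul]; ring
      _ = 0 := by rw [e2, e4, sub_self]
  rw [Filter.EventuallyEq, ae_restrict_iff' hU.measurableSet]
  filter_upwards [ae_all_iff.mpr hJ] with x hx hxU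
  ext J
  exact sub_eq_zero.mp (hx J hxU)

lemma gradNorm_le {l : ℕ} {p : ℝ≥0∞} {U : Set (Space n)} {v : Space n → ℝ}
    {G : Space n → EuclideanSpace ℝ (Fin l → Fin n)} (h : IsWeakGrad l U v G) :
    gradNorm l p U v ≤ eLpNorm G p (volume.restrict U) := iInf₂_le G h

lemma gradNorm_eq {l : ℕ} {p : ℝ≥0∞} {U : Set (Space n)} (hU : IsOpen U) {v : Space n → ℝ}
    {G : Space n → EuclideanSpace ℝ (Fin l → Fin n)} (h : IsWeakGrad l U v G) :
    gradNorm l p U v = eLpNorm G p (volume.restrict U) := by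
  refine le_antisymm (gradNorm_le h) (le_iInf₂ fun G' h' => ?_)
  rw [eLpNorm_congr_ae (h.ae_eq hU h')]

lemma exists_isWeakGrad_of_gradNorm_lt_top {l : ℕ} {p : ℝ≥0∞} {U : Set (Space n)}
    {v : Space n → ℝ} (h : gradNorm l p U v < ⊤) :
    ∃ G, IsWeakGrad l U v G ∧ eLpNorm G p (volume.restrict U) < ⊤ := by
  simp only [gradNorm, iInf_lt_iff] at h
  obtain ⟨G, hG, h⟩ := h
  exact ⟨G, hG, h⟩

end

section

variable {n : ℕ}

/-! ### Mollification -/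

open scoped Convolution in
lemma contDiff_convolution_smooth {ψ f : Space n → ℝ} (hψ : ContDiff ℝ ∞ ψ)
    (hc : HasCompactSupport ψ) (hf : LocallyIntegrable f) :
    ContDiff ℝ ∞ (ψ ⋆[ContinuousLinearMap.lsmul ℝ ℝ] f) :=
  hc.contDiff_convolution_left (n := (⊤ : ℕ∞)) _ hψ hf

open scoped Convolution in
-- All derivatives fall on the mollifier, so local integrability of `f` suffices.
lemma iteratedFDeriv_convolution {f : Space n → ℝ} (hf : LocallyIntegrable f) {l : ℕ}
    {ψ : Space n → ℝ} (hψ : ContDiff ℝ ∞ ψ) (hc : HasCompactSupport ψ) (w : Fin l → Space n)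
    (x : Space n) :
    iteratedFDeriv ℝ l (ψ ⋆[ContinuousLinearMap.lsmul ℝ ℝ] f) x w =
      ((fun y => iteratedFDeriv ℝ l ψ y w) ⋆[ContinuousLinearMap.lsmul ℝ ℝ] f) x := by
  induction l generalizing x with
  | zero => simp
  | succ l ih =>
    rw [iteratedFDeriv_succ_apply_cons (contDiff_convolution_smooth hψ hc hf)]
    have e : (fun y => iteratedFDeriv ℝ l (ψ ⋆[ContinuousLinearMap.lsmul ℝ ℝ] f) y (Fin.tail w)) =
        ((fun y => iteratedFDeriv ℝ l ψ y (Fin.tail w)) ⋆[ContinuousLinearMap.lsmul ℝ ℝ] f) := by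
      ext y
      exact ih _ y
    set ρ : Space n → ℝ := fun y => iteratedFDeriv ℝ l ψ y (Fin.tail w) with hρ
    have hρ1 : ContDiff ℝ ∞ ρ := contDiff_iteratedFDeriv_apply hψ _
    have hρc : HasCompactSupport ρ := hasCompactSupport_iteratedFDeriv_apply hc _
    have hd := hρc.hasFDerivAt_convolution_left (ContinuousLinearMap.lsmul ℝ ℝ (E := ℝ))
      (hρ1.of_le (by exact_mod_cast le_top)) hf x (μ := volume)
    rw [e, hd.fderiv, convolution_eq_swap, convolution_eq_swap]
    have hi : Integrable fun t => ((ContinuousLinearMap.lsmul ℝ ℝ).precompL (Space n)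
        (fderiv ℝ ρ (x - t))) (f t) :=
      ((hρc.fderiv ℝ).convolutionExists_left _
        (hρ1.continuous_fderiv (by simp)) hf x).integrable_swap
    rw [ContinuousLinearMap.integral_apply hi]
    refine integral_congr_ae (.of_forall fun t => ?_)
    simp only [iteratedFDeriv_succ_apply_cons hψ, ContinuousLinearMap.precompL_apply]
    rfl

lemma iteratedFDeriv_comp_const_sub {ψ : Space n → ℝ} (hψ : ContDiff ℝ ∞ ψ) (x : Space n) {l : ℕ}
    (w : Fin l → Space n) (y : Space n) :
    iteratedFDeriv ℝ l (fun z => ψ (x - z)) y w = (-1 : ℝ) ^ l * iteratedFDeriv ℝ l ψ (x - y) w := by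
  induction l generalizing y with
  | zero => simp
  | succ l ih =>
    have h1 : ContDiff ℝ ∞ (fun z => ψ (x - z)) := hψ.comp (contDiff_const.sub contDiff_id)
    rw [iteratedFDeriv_succ_apply_cons h1, iteratedFDeriv_succ_apply_cons hψ]
    simp_rw [ih]
    have hd := ((contDiff_iteratedFDeriv_apply hψ (Fin.tail w)).differentiable (by simp)
      (x - y)).hasFDerivAt
    have h2 := (hd.comp y ((hasFDerivAt_id y).const_sub x)).const_mul ((-1 : ℝ) ^ l)
    rw [Function.comp_def] at h2
    simp only at h2
    rw [h2.fderiv]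
    simp [pow_succ]

open scoped Convolution in
/-- Mollification commutes with weak derivatives. -/
lemma tensorDeriv_mollify {U : Set (Space n)} {v : Space n → ℝ} {l : ℕ}
    {G : Space n → EuclideanSpace ℝ (Fin l → Fin n)} (hG : IsWeakGrad l U v G)
    {K : Set (Space n)} (hK : IsCompact K) (hKU : K ⊆ U) {ψ : Space n → ℝ} (hψ : ContDiff ℝ ∞ ψ)
    {r : ℝ} (hs : tsupport ψ ⊆ Metric.closedBall 0 r) {x : Space n}
    (hx : Metric.closedBall x r ⊆ K) (J : Fin l → Fin n) :
    tensorDeriv l (ψ ⋆[ContinuousLinearMap.lsmul ℝ ℝ] (K.indicator v)) x J =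
      (ψ ⋆[ContinuousLinearMap.lsmul ℝ ℝ] (K.indicator fun y => G y J)) x := by
  have hc : HasCompactSupport ψ :=
    (isCompact_closedBall (0 : Space n) r).of_isClosed_subset isClosed_closure hs
  have hv : LocallyIntegrable (K.indicator v) :=
    ((integrable_indicator_iff hK.measurableSet).mpr
      (hG.1.integrableOn_compact_subset hKU hK)).locallyIntegrable
  rw [tensorDeriv_apply, iteratedFDeriv_convolution hv hψ hc, convolution_eq_swap,
    convolution_eq_swap]
  have h1 : ContDiff ℝ ∞ (fun z => ψ (x - z)) := hψ.comp (contDiff_const.sub contDiff_id)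
  have hsub : tsupport (fun z => ψ (x - z)) ⊆ Metric.closedBall x r := by
    refine closure_minimal ?_ Metric.isClosed_closedBall
    intro z hz
    have := hs (subset_tsupport _ (Function.mem_support.mpr hz))
    rw [Metric.mem_closedBall, dist_comm, dist_eq_norm]
    simpa [Metric.mem_closedBall, dist_eq_norm] using this
  have h1c : HasCompactSupport (fun z => ψ (x - z)) :=
    (isCompact_closedBall x r).of_isClosed_subset isClosed_closure hsub
  -- The weak derivative is tested with `z ↦ ψ (x - z)`, whose support lies in the ball around `x`
  -- and hence in `K`. The sign from the reflection cancels the sign from integration by parts.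
  have key := hG.2.2 J _ h1 h1c (hsub.trans (hx.trans hKU))
  simp_rw [iteratedFDeriv_comp_const_sub hψ] at key
  have hz : ∀ t ∉ K, ∀ (k : ℕ) (w : Fin k → Space n), iteratedFDeriv ℝ k ψ (x - t) w = 0 := by
    intro t ht k w
    have : x - t ∉ tsupport ψ := fun h => ht (hx (by
      have := hs h
      rw [Metric.mem_closedBall, dist_comm, dist_eq_norm]
      simpa [Metric.mem_closedBall, dist_eq_norm] using this))
    rw [image_eq_zero_of_notMem_tsupport (fun h => this (tsupport_iteratedFDeriv_subset k h))]
    rfl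
  have e1 : ∫ t, (ContinuousLinearMap.lsmul ℝ ℝ (iteratedFDeriv ℝ l ψ (x - t) (stdVec J)))
      (K.indicator v t) = (-1 : ℝ) ^ l * ∫ t, v t * ((-1 : ℝ) ^ l *
        iteratedFDeriv ℝ l ψ (x - t) (stdVec J)) := by
    rw [← integral_const_mul]
    refine integral_congr_ae (.of_forall fun t => ?_)
    have hsq : ((-1 : ℝ) ^ l) * (-1 : ℝ) ^ l = 1 := by rw [← mul_pow]; simp
    by_cases ht : t ∈ K
    · simp only [indicator_of_mem ht, ContinuousLinearMap.lsmul_apply, smul_eq_mul]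
      linear_combination (-(iteratedFDeriv ℝ l ψ (x - t) (stdVec J) * v t)) * hsq
    · simp [hz t ht]
  have e2 : ∫ t, (ContinuousLinearMap.lsmul ℝ ℝ (ψ (x - t))) (K.indicator (fun y => G y J) t) =
      ∫ t, G t J * ψ (x - t) := by
    refine integral_congr_ae (.of_forall fun t => ?_)
    by_cases ht : t ∈ K
    · simp only [indicator_of_mem ht, ContinuousLinearMap.lsmul_apply, smul_eq_mul]
      ring
    · have := hz t ht 0 (fun _ => 0)
      simp only [iteratedFDeriv_zero_apply] at this
      simp [this]
  rw [e1, key, e2, ← mul_assoc, ← mul_pow]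
  simp

/-- Translations are continuous in `L¹`. -/
lemma exists_lintegral_translate_le {f : Space n → ℝ} (hf : Integrable f) {ε : ℝ≥0∞}
    (hε : 0 < ε) : ∃ r > 0, ∀ t : Space n, ‖t‖ < r →
      ∫⁻ x, ‖f (t + x) - f x‖ₑ ≤ ε := by
  have hm : MemLp f 1 := memLp_one_iff_integrable.mpr hf
  have : Fact ((1 : ℝ≥0∞) ≠ ⊤) := ⟨by simp⟩
  have hcont : Continuous fun t : Space n => DomAddAct.mk t +ᵥ hm.toLp f := by
    have h1 : Continuous fun t : Space n => (DomAddAct.mk t, hm.toLp f) :=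
      (DomAddAct.continuous_mk).prodMk continuous_const
    exact continuous_vadd.comp h1
  have h0 := Metric.continuous_iff'.mp hcont 0
  -- The value `ε = ∞` is allowed, hence the minimum with `1`.
  have hε' : 0 < (min ε 1).toReal := ENNReal.toReal_pos (by simp [hε.ne']) (by simp)
  obtain ⟨r, hr, h⟩ := Metric.eventually_nhds_iff.mp (h0 _ hε')
  refine ⟨r, hr, fun t ht => ?_⟩
  have h1 := h (y := t) (by simpa using ht)
  have e0 : (DomAddAct.mk (0 : Space n)) +ᵥ hm.toLp f = hm.toLp f := by simp
  rw [e0, DomAddAct.mk_vadd_toLp, dist_eq_norm, ← MemLp.toLp_sub, Lp.norm_toLp,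
    ENNReal.toReal_lt_toReal ?_ (by simp)] at h1
  · rw [eLpNorm_one_eq_lintegral_enorm] at h1
    exact (h1.trans_le (min_le_left _ _)).le
  · exact ((hm.comp_measurePreserving (measurePreserving_vadd t volume)).sub hm).2.ne

open scoped Convolution in
/-- Mollifications converge in `L¹`. -/
lemma lintegral_mollify_sub_le {f : Space n → ℝ} (hf : Integrable f) {r : ℝ} {ε : ℝ≥0∞}
    (h : ∀ t : Space n, ‖t‖ < r → ∫⁻ x, ‖f (t + x) - f x‖ₑ ≤ ε) (φ : ContDiffBump (0 : Space n))
    (hφ : φ.rOut ≤ r) :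
    ∫⁻ x, ‖(φ.normed volume ⋆[ContinuousLinearMap.lsmul ℝ ℝ] f) x - f x‖ₑ ≤ ε := by
  set ρ := φ.normed volume with hρ
  have hρc : Continuous ρ := φ.continuous_normed
  have hρs : HasCompactSupport ρ := φ.hasCompactSupport_normed
  have hρi : Integrable ρ := φ.integrable_normed
  -- The mollifier is nonnegative with integral one, so the difference is an average of `f (x - t) -
  -- f x`. Exchanging the integrals leaves only translations by vectors shorter than `rOut`.
  have hpt : ∀ x, ‖(ρ ⋆[ContinuousLinearMap.lsmul ℝ ℝ] f) x - f x‖ₑ ≤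
      ∫⁻ t, ‖ρ t‖ₑ * ‖f (x - t) - f x‖ₑ := by
    intro x
    have hi : Integrable fun t => ρ t • f (x - t) :=
      hρs.convolutionExists_left (ContinuousLinearMap.lsmul ℝ ℝ (E := ℝ)) hρc
        hf.locallyIntegrable x
    have e : (ρ ⋆[ContinuousLinearMap.lsmul ℝ ℝ] f) x - f x = ∫ t, ρ t • (f (x - t) - f x) := by
      have h1 : f x = ∫ t, ρ t • f x := by
        rw [integral_smul_const, φ.integral_normed, one_smul]
      rw [convolution_lsmul]
      conv_lhs => rw [h1]
      rw [← integral_sub hi (hρi.smul_const _)]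
      simp [mul_sub]
    rw [e]
    refine (enorm_integral_le_lintegral_enorm _).trans (le_of_eq ?_)
    simp [enorm_mul]
  refine (lintegral_mono hpt).trans ?_
  have hmeas : AEMeasurable (Function.uncurry fun (x t : Space n) =>
      ‖ρ t‖ₑ * ‖f (x - t) - f x‖ₑ) (volume.prod volume) := by
    refine AEMeasurable.mul (hρc.comp continuous_snd).enorm.measurable.aemeasurable ?_
    refine AEStronglyMeasurable.enorm ?_
    exact (hf.1.comp_quasiMeasurePreserving (quasiMeasurePreserving_sub volume volume)).sub
      hf.1.comp_fst
  rw [lintegral_lintegral_swap hmeas]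
  have h2 : ∀ t, ∫⁻ x, ‖ρ t‖ₑ * ‖f (x - t) - f x‖ₑ ≤ ‖ρ t‖ₑ * ε := by
    intro t
    by_cases ht : ρ t = 0
    · simp [ht]
    · rw [lintegral_const_mul' _ _ (by simp)]
      gcongr
      have : t ∈ Metric.ball (0 : Space n) φ.rOut := by
        rw [← φ.support_normed_eq (μ := volume)]
        exact ht
      have := h (-t) (by
        rw [norm_neg]
        exact (by simpa using this : ‖t‖ < φ.rOut).trans_le hφ)
      simpa [sub_eq_neg_add] using this
  refine (lintegral_mono h2).trans ?_
  rw [lintegral_mul_const'' _ hρc.enorm.aemeasurable]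
  have : ∫⁻ t, ‖ρ t‖ₑ = 1 := by
    have e1 := ofReal_integral_norm_eq_lintegral_enorm hρi
    rw [← e1]
    have : ∀ t, ‖ρ t‖ = ρ t := fun t => Real.norm_of_nonneg (φ.nonneg_normed t)
    simp_rw [this]
    rw [hρ, φ.integral_normed]
    simp
  rw [this, one_mul]

lemma enorm_euclidean_le_sum {ι : Type*} [Fintype ι] (T : EuclideanSpace ℝ ι) :
    ‖T‖ₑ ≤ ∑ J, ‖T J‖ₑ := by
  have h := norm_euclidean_le_sum T
  rw [← ofReal_norm]
  refine (ENNReal.ofReal_le_ofReal h).trans (le_of_eq ?_)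
  rw [ENNReal.ofReal_sum_of_nonneg (fun _ _ => norm_nonneg _)]
  simp only [ofReal_norm]

open scoped Convolution in
/-- Approximation by smooth functions: on a compact subset of an open set, the weak derivatives
are limits in `L¹` of the derivatives of smooth functions. -/
theorem exists_smoothing {U : Set (Space n)} (hU : IsOpen U) {m : ℕ} {v : Space n → ℝ}
    {G : (j : ℕ) → Space n → EuclideanSpace ℝ (Fin j → Fin n)}
    (hv : LocallyIntegrableOn v U)
    (hG : ∀ j ≤ m, IsWeakGrad j U v (G j)) {K : Set (Space n)} (hK : IsCompact K) (hKU : K ⊆ U)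
    {ε : ℝ} (hε : 0 < ε) :
    ∃ g : Space n → ℝ, ContDiff ℝ ∞ g ∧
      (∀ j ≤ m, ∫⁻ x in K, ‖tensorDeriv j g x - G j x‖ₑ ≤ ENNReal.ofReal ε) ∧
      (∫⁻ x in K, ‖g x - v x‖ₑ ≤ ENNReal.ofReal ε) ∧
      (ContinuousOn v U → ∀ x ∈ K, |g x - v x| ≤ ε) := by
  -- All functions are cut off to a compact neighbourhood `K'` of `K` inside `U`. They become
  -- globally integrable, and at points of `K` the convolution sees only values in `K'`.
  obtain ⟨δ, hδ, hδU⟩ := hK.exists_cthickening_subset_open hU hKU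
  set K' := Metric.cthickening δ K with hK'
  have hK'c : IsCompact K' := hK.cthickening
  have hball : ∀ x ∈ K, Metric.closedBall x δ ⊆ K' := fun x hx =>
    Metric.closedBall_subset_cthickening hx δ
  have hvi : Integrable (K'.indicator v) :=
    (integrable_indicator_iff hK'c.measurableSet).mpr (hv.integrableOn_compact_subset hδU hK'c)
  have hGi : ∀ j ≤ m, ∀ J, Integrable (K'.indicator fun y => G j y J) := fun j hj J =>
    (integrable_indicator_iff hK'c.measurableSet).mpr
      ((locallyIntegrableOn_tensor_apply (hG j hj).2.1 J).integrableOn_compact_subset hδU hK'c)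
  -- a common radius
  have hr1 : ∃ r > 0, ∀ t : Space n, ‖t‖ < r →
      ∫⁻ x, ‖K'.indicator v (t + x) - K'.indicator v x‖ₑ ≤ ENNReal.ofReal ε :=
    exists_lintegral_translate_le hvi (by simpa using hε)
  -- Each of the `n ^ j` components gets an equal share of `ε`; the summand `1` keeps the
  -- denominator positive when `n = 0`.
  have hr2 : ∀ j ≤ m, ∀ J : Fin j → Fin n, ∃ r > 0, ∀ t : Space n, ‖t‖ < r →
      ∫⁻ x, ‖K'.indicator (fun y => G j y J) (t + x) - K'.indicator (fun y => G j y J) x‖ₑ ≤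
        ENNReal.ofReal (ε / ((n : ℝ) ^ j + 1)) := fun j hj J =>
    exists_lintegral_translate_le (hGi j hj J) (by simp only [ENNReal.ofReal_pos]; positivity)
  have hr3 : ∃ r > 0, ContinuousOn v U → ∀ x ∈ K, ∀ y, dist y x < r → y ∈ K' →
      dist (v y) (v x) ≤ ε := by
    by_cases hc : ContinuousOn v U
    · have huc := hK'c.uniformContinuousOn_of_continuous (hc.mono hδU)
      obtain ⟨r, hr, h⟩ := Metric.uniformContinuousOn_iff.mp huc ε hε
      exact ⟨r, hr, fun _ x hx y hyx hy =>
        (h y hy x (Metric.self_subset_cthickening K hx) hyx).le⟩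
    · exact ⟨1, one_pos, fun h => absurd h hc⟩
  obtain ⟨r1, hr1, h1⟩ := hr1
  obtain ⟨r3, hr3, h3⟩ := hr3
  have hr2' : ∃ r > 0, ∀ j ≤ m, ∀ J : Fin j → Fin n, ∀ t : Space n, ‖t‖ < r →
      ∫⁻ x, ‖K'.indicator (fun y => G j y J) (t + x) - K'.indicator (fun y => G j y J) x‖ₑ ≤
        ENNReal.ofReal (ε / ((n : ℝ) ^ j + 1)) := by
    have hJ : ∀ j ≤ m, ∀ᶠ r in nhdsWithin (0 : ℝ) (Ioi 0), ∀ J : Fin j → Fin n, ∀ t : Space n,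
        ‖t‖ < r → ∫⁻ x, ‖K'.indicator (fun y => G j y J) (t + x) -
          K'.indicator (fun y => G j y J) x‖ₑ ≤ ENNReal.ofReal (ε / ((n : ℝ) ^ j + 1)) := by
      intro j hj
      rw [Filter.eventually_all]
      intro J
      obtain ⟨r, hr, h⟩ := hr2 j hj J
      filter_upwards [Ioo_mem_nhdsGT hr] with s hs t ht
      exact h t (ht.trans hs.2)
    have hall : ∀ᶠ r in nhdsWithin (0 : ℝ) (Ioi 0), ∀ j ∈ Finset.range (m + 1),
        ∀ J : Fin j → Fin n, ∀ t : Space n,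
        ‖t‖ < r → ∫⁻ x, ‖K'.indicator (fun y => G j y J) (t + x) -
          K'.indicator (fun y => G j y J) x‖ₑ ≤ ENNReal.ofReal (ε / ((n : ℝ) ^ j + 1)) := by
      rw [Filter.eventually_all_finset]
      exact fun j hj => hJ j (by simpa [Nat.lt_succ_iff] using hj)
    obtain ⟨r, hr, hpos⟩ := (hall.and self_mem_nhdsWithin).exists
    exact ⟨r, hpos, fun j hj => hr j (by simpa [Nat.lt_succ_iff] using hj)⟩
  obtain ⟨r2, hr2, h2⟩ := hr2'
  set R := min δ (min r1 (min r2 r3)) with hR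
  have hRpos : 0 < R := by positivity
  let φ : ContDiffBump (0 : Space n) := ⟨R / 2, R, by positivity, by linarith⟩
  have hφR : φ.rOut = R := rfl
  have hts : tsupport (φ.normed volume) ⊆ Metric.closedBall 0 R := by
    rw [φ.tsupport_normed_eq]
  have hsm : ContDiff ℝ ∞ (φ.normed volume) := φ.contDiff_normed
  refine ⟨φ.normed volume ⋆[ContinuousLinearMap.lsmul ℝ ℝ] (K'.indicator v),
    contDiff_convolution_smooth hsm φ.hasCompactSupport_normed hvi.locallyIntegrable, ?_, ?_, ?_⟩
  · intro j hj
    have hb : ∀ x ∈ K, ‖tensorDeriv j (φ.normed volume ⋆[ContinuousLinearMap.lsmul ℝ ℝ]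
        (K'.indicator v)) x - G j x‖ₑ ≤ ∑ J, ‖(φ.normed volume ⋆[ContinuousLinearMap.lsmul ℝ ℝ]
          (K'.indicator fun y => G j y J)) x - K'.indicator (fun y => G j y J) x‖ₑ := by
      intro x hx
      refine (enorm_euclidean_le_sum _).trans (le_of_eq (Finset.sum_congr rfl fun J _ => ?_))
      rw [PiLp.sub_apply, tensorDeriv_mollify (hG j hj) hK'c hδU hsm hts
        ((Metric.closedBall_subset_closedBall (min_le_left _ _)).trans (hball x hx)),
        indicator_of_mem (Metric.self_subset_cthickening K hx)]
    calc _ ≤ ∫⁻ x in K, ∑ J, ‖(φ.normed volume ⋆[ContinuousLinearMap.lsmul ℝ ℝ]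
          (K'.indicator fun y => G j y J)) x - K'.indicator (fun y => G j y J) x‖ₑ :=
          setLIntegral_mono' hK.measurableSet hb
      _ ≤ ∫⁻ x, ∑ J, ‖(φ.normed volume ⋆[ContinuousLinearMap.lsmul ℝ ℝ]
          (K'.indicator fun y => G j y J)) x - K'.indicator (fun y => G j y J) x‖ₑ :=
          setLIntegral_le_lintegral _ _
      _ = ∑ J, ∫⁻ x, ‖(φ.normed volume ⋆[ContinuousLinearMap.lsmul ℝ ℝ]
          (K'.indicator fun y => G j y J)) x - K'.indicator (fun y => G j y J) x‖ₑ := by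
          refine lintegral_finsetSum' _ fun J _ => AEStronglyMeasurable.enorm ?_
          exact (contDiff_convolution_smooth hsm φ.hasCompactSupport_normed
            (hGi j hj J).locallyIntegrable).continuous.aestronglyMeasurable.sub (hGi j hj J).1
      _ ≤ ∑ _J : Fin j → Fin n, ENNReal.ofReal (ε / ((n : ℝ) ^ j + 1)) := by
          refine Finset.sum_le_sum fun J _ => ?_
          refine lintegral_mollify_sub_le (hGi j hj J) (h2 j hj J) φ ?_
          rw [hφR]
          exact (min_le_right _ _).trans ((min_le_right _ _).trans (min_le_left _ _))
      _ ≤ ENNReal.ofReal ε := by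
          rw [Finset.sum_const, nsmul_eq_mul]
          have : ((Finset.univ : Finset (Fin j → Fin n)).card : ℝ≥0∞) =
              ENNReal.ofReal ((n : ℝ) ^ j) := by
            rw [ENNReal.ofReal_pow (by positivity)]
            simp
          rw [this, ← ENNReal.ofReal_mul (by positivity)]
          refine ENNReal.ofReal_le_ofReal ?_
          rw [mul_div_assoc', div_le_iff₀ (by positivity)]
          nlinarith [pow_nonneg (Nat.cast_nonneg (α := ℝ) n) j]
  · calc _ = ∫⁻ x in K, ‖(φ.normed volume ⋆[ContinuousLinearMap.lsmul ℝ ℝ]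
          (K'.indicator v)) x - K'.indicator v x‖ₑ := by
          refine setLIntegral_congr_fun hK.measurableSet fun x hx => ?_
          have hxK : x ∈ K' := Metric.self_subset_cthickening K hx
          beta_reduce
          rw [indicator_of_mem hxK]
      _ ≤ _ := setLIntegral_le_lintegral _ _
      _ ≤ _ := by
          refine lintegral_mollify_sub_le hvi h1 φ ?_
          rw [hφR]
          exact (min_le_right _ _).trans (min_le_left _ _)
  · intro hc x hx
    have := φ.dist_normed_convolution_le (μ := volume) (g := K'.indicator v) (x₀ := x) (ε := ε)
      hvi.1 (fun y hy => by
        rw [hφR] at hy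
        have hyK' : y ∈ K' := hball x hx (Metric.ball_subset_closedBall
          (Metric.ball_subset_ball (min_le_left _ _) hy))
        rw [indicator_of_mem hyK', indicator_of_mem (Metric.self_subset_cthickening K hx)]
        refine h3 hc x hx y ?_ hyK'
        exact (Metric.mem_ball.mp hy).trans_le
          ((min_le_right _ _).trans ((min_le_right _ _).trans (min_le_right _ _))))
    rwa [indicator_of_mem (Metric.self_subset_cthickening K hx), Real.dist_eq] at this

end

section

variable {n : ℕ}

/-! ### Change of variables for maps with a Lipschitz inverse -/

open Measure in
-- Lebesgue measure is a multiple of the `n`-dimensional Hausdorff measure, which scales with the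
-- Lipschitz constant for arbitrary sets.
lemma volume_image_le {S : Set (Space n)} {f : Space n → Space n} {K : NNReal}
    (h : LipschitzOnWith K f S) : volume (f '' S) ≤ (K : ℝ≥0∞) ^ n * volume S := by
  have : IsAddHaarMeasure (μH[(n : ℝ)] : Measure (Space n)) := by
    simpa using isAddHaarMeasure_hausdorffMeasure (E := Space n)
  have h1 := isAddLeftInvariant_eq_smul (volume : Measure (Space n)) μH[(n : ℝ)]
  rw [h1]
  have h2 := h.hausdorffMeasure_image_le (d := n) (Nat.cast_nonneg n)
  rw [ENNReal.rpow_natCast] at h2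
  simp only [Measure.smul_apply, ENNReal.smul_def, smul_eq_mul]
  calc _ ≤ _ * ((K : ℝ≥0∞) ^ n * μH[(n : ℝ)] S) := by gcongr
    _ = _ := by ring

/-- The map `Φ` does not shrink distances on `S` by more than the factor `c`. -/
def AntiLipOn (c : ℝ) (Φ : Space n → Space n) (S : Set (Space n)) : Prop :=
  ∀ x ∈ S, ∀ y ∈ S, dist x y ≤ c * dist (Φ x) (Φ y)

lemma AntiLipOn.mono {c : ℝ} {Φ : Space n → Space n} {S S' : Set (Space n)}
    (h : AntiLipOn c Φ S) (hs : S' ⊆ S) : AntiLipOn c Φ S' :=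
  fun x hx y hy => h x (hs hx) y (hs hy)

lemma AntiLipOn.injOn {c : ℝ} {Φ : Space n → Space n} {S : Set (Space n)}
    (h : AntiLipOn c Φ S) : InjOn Φ S := fun x hx y hy e => by
  have := h x hx y hy
  rw [e, dist_self, mul_zero] at this
  exact dist_le_zero.mp this

/-- The inverse of `Φ` on its image is Lipschitz with constant `c`, and the preimage is the image of
a set under it. This replaces the transformation formula. -/
lemma AntiLipOn.volume_preimage_le {c : ℝ} {Φ : Space n → Space n} {S E : Set (Space n)}
    (h : AntiLipOn c Φ S) (hc : 0 ≤ c) :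
    volume (S ∩ Φ ⁻¹' E) ≤ ENNReal.ofReal c ^ n * volume (E ∩ Φ '' S) := by
  set g := Function.invFunOn Φ S with hg
  have hgS : ∀ x ∈ S, g (Φ x) = x := fun x hx => h.injOn.leftInvOn_invFunOn hx
  have hL : LipschitzOnWith c.toNNReal g (E ∩ Φ '' S) := by
    refine LipschitzOnWith.of_dist_le_mul ?_
    rintro _ ⟨_, x, hx, rfl⟩ _ ⟨_, y, hy, rfl⟩
    rw [hgS x hx, hgS y hy, Real.coe_toNNReal c hc]
    exact h x hx y hy
  refine (measure_mono ?_).trans (volume_image_le hL)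
  rintro x ⟨hx, hxE⟩
  exact ⟨Φ x, ⟨hxE, x, hx, rfl⟩, hgS x hx⟩

/-- Stated for measures, the estimate yields absolute continuity, hence measurability of
compositions, and at once the bounds for integrals and for `L^p` norms. -/
lemma AntiLipOn.map_le {c : ℝ} {Φ : Space n → Space n} {S T : Set (Space n)}
    (h : AntiLipOn c Φ S) (hc : 0 ≤ c) (hS : MeasurableSet S) (hΦ : ContinuousOn Φ S)
    (hT : MapsTo Φ S T) :
    (volume.restrict S).map Φ ≤ ENNReal.ofReal c ^ n • volume.restrict T := by
  refine Measure.le_iff.mpr fun E hE => ?_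
  rw [Measure.map_apply_of_aemeasurable (hΦ.aemeasurable hS) hE, Measure.restrict_apply' hS,
    inter_comm, Measure.smul_apply, Measure.restrict_apply hE, smul_eq_mul]
  refine (h.volume_preimage_le hc).trans ?_
  gcongr
  exact hT.image_subset

lemma AntiLipOn.map_absolutelyContinuous {c : ℝ} {Φ : Space n → Space n} {S T : Set (Space n)}
    (h : AntiLipOn c Φ S) (hc : 0 ≤ c) (hS : MeasurableSet S) (hΦ : ContinuousOn Φ S)
    (hT : MapsTo Φ S T) :
    (volume.restrict S).map Φ ≪ volume.restrict T :=
  (Measure.absolutelyContinuous_of_le (h.map_le hc hS hΦ hT)).trans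
    Measure.smul_absolutelyContinuous

lemma AntiLipOn.lintegral_comp_le {c : ℝ} {Φ : Space n → Space n} {S T : Set (Space n)}
    (h : AntiLipOn c Φ S) (hc : 0 ≤ c) (hS : MeasurableSet S) (hΦ : ContinuousOn Φ S)
    (hT : MapsTo Φ S T) {f : Space n → ℝ≥0∞} (hf : AEMeasurable f (volume.restrict T)) :
    ∫⁻ x in S, f (Φ x) ≤ ENNReal.ofReal c ^ n * ∫⁻ y in T, f y := by
  rw [← lintegral_map' (hf.mono_ac (h.map_absolutelyContinuous hc hS hΦ hT)) (hΦ.aemeasurable hS)]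
  refine (lintegral_mono' (h.map_le hc hS hΦ hT) le_rfl).trans_eq ?_
  rw [lintegral_smul_measure, smul_eq_mul]

lemma AntiLipOn.aestronglyMeasurable_comp {c : ℝ} {Φ : Space n → Space n} {S T : Set (Space n)}
    (h : AntiLipOn c Φ S) (hc : 0 ≤ c) (hS : MeasurableSet S) (hΦ : ContinuousOn Φ S)
    (hT : MapsTo Φ S T) {E : Type*} [NormedAddCommGroup E] {f : Space n → E}
    (hf : AEStronglyMeasurable f (volume.restrict T)) :
    AEStronglyMeasurable (fun x => f (Φ x)) (volume.restrict S) :=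
  (hf.mono_ac (h.map_absolutelyContinuous hc hS hΦ hT)).comp_aemeasurable (hΦ.aemeasurable hS)

lemma AntiLipOn.eLpNorm_comp_le {c : ℝ} {Φ : Space n → Space n} {S T : Set (Space n)}
    (h : AntiLipOn c Φ S) (hc : 0 ≤ c) (hS : MeasurableSet S) (hΦ : ContinuousOn Φ S)
    (hT : MapsTo Φ S T) {E : Type*} [NormedAddCommGroup E] {f : Space n → E} (p : ℝ≥0∞)
    (hf : AEStronglyMeasurable f (volume.restrict T)) :
    eLpNorm (fun x => f (Φ x)) p (volume.restrict S) ≤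
      (ENNReal.ofReal c ^ n) ^ (1 / p).toReal * eLpNorm f p (volume.restrict T) := by
  have := eLpNorm_map_measure (p := p) (hf.mono_ac (h.map_absolutelyContinuous hc hS hΦ hT))
    (hΦ.aemeasurable hS)
  rw [Function.comp_def] at this
  rw [← this]
  exact (eLpNorm_mono_measure _ (h.map_le hc hS hΦ hT)).trans (eLpNorm_smul_measure_le _ _ _ _)

/-! ### The chain rule for weak derivatives -/

/-- The Faà di Bruno formula: the derivative of order `l` of `v ∘ Φ`, if `G j` is the tensor of the
derivatives of `v` of order `j`. -/
noncomputable def chainTensor (l : ℕ) (Φ : Space n → Space n)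
    (G : (j : ℕ) → Space n → EuclideanSpace ℝ (Fin j → Fin n)) (x : Space n) :
    EuclideanSpace ℝ (Fin l → Fin n) :=
  components n l (∑ c : OrderedFinpartition l, c.compAlongOrderedFinpartition
    (ofComponents n c.length (G c.length (Φ x))) fun i => iteratedFDeriv ℝ (c.partSize i) Φ x)

lemma chainTensor_tensorDeriv {l : ℕ} {Φ : Space n → Space n} {g : Space n → ℝ} {x : Space n}
    (hΦ : ContDiffAt ℝ l Φ x) (hg : ContDiffAt ℝ l g (Φ x)) :
    chainTensor l Φ (fun j => tensorDeriv j g) x = tensorDeriv l (fun y => g (Φ y)) x := by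
  have h : iteratedFDeriv ℝ l (fun y => g (Φ y)) x = _ := iteratedFDeriv_comp hg hΦ le_rfl
  rw [tensorDeriv, h, chainTensor]
  simp_rw [tensorDeriv, ofComponents_components]
  rfl

lemma chainTensor_sub (l : ℕ) (Φ : Space n → Space n)
    (G G' : (j : ℕ) → Space n → EuclideanSpace ℝ (Fin j → Fin n)) (x : Space n) :
    chainTensor l Φ G x - chainTensor l Φ G' x = chainTensor l Φ (fun j y => G j y - G' j y) x := by
  rw [chainTensor, chainTensor, chainTensor, ← map_sub, ← Finset.sum_sub_distrib]
  congr 1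
  refine Finset.sum_congr rfl fun c _ => ?_
  rw [map_sub]
  rfl

/-- The constant in the bound for the derivatives of a composition. -/
noncomputable def chainConst (n l : ℕ) : ℝ :=
  (n : ℝ) ^ l * ((Fintype.card (OrderedFinpartition l) : ℝ) * ((n : ℝ) + 1) ^ l) + 1

lemma chainConst_pos (n l : ℕ) : 0 < chainConst n l := by unfold chainConst; positivity

/-- In every term of the Faà di Bruno formula the sizes of the parts add up to `l`. If the
derivative of order `i` of `Φ` is bounded by `D ^ i`, each term therefore carries exactly the factor
`D ^ l`. This makes the powers of `h` come out right for `D = b * h` and `D = b / h`. -/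
lemma norm_chainTensor_le {l : ℕ} {Φ : Space n → Space n}
    (G : (j : ℕ) → Space n → EuclideanSpace ℝ (Fin j → Fin n)) {x : Space n} {D : ℝ}
    (hD : ∀ i, 1 ≤ i → i ≤ l → ‖iteratedFDeriv ℝ i Φ x‖ ≤ D ^ i) :
    ‖chainTensor l Φ G x‖ ≤ chainConst n l * D ^ l * ∑ j ∈ Finset.range (l + 1), ‖G j (Φ x)‖ := by
  set A := ∑ j ∈ Finset.range (l + 1), ‖G j (Φ x)‖ with hA
  have hA0 : 0 ≤ A := Finset.sum_nonneg fun _ _ => norm_nonneg _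
  have hDl : 0 ≤ D ^ l := by
    rcases Nat.eq_zero_or_pos l with rfl | hl
    · simp
    · exact (norm_nonneg _).trans (hD l hl le_rfl)
  have h1 : ∀ c : OrderedFinpartition l, ‖c.compAlongOrderedFinpartition
      (ofComponents n c.length (G c.length (Φ x))) fun i => iteratedFDeriv ℝ (c.partSize i) Φ x‖ ≤
        ((n : ℝ) + 1) ^ l * A * D ^ l := by
    intro c
    refine (c.norm_compAlongOrderedFinpartition_le _ _).trans ?_
    have h2 : ‖ofComponents n c.length (G c.length (Φ x))‖ ≤ ((n : ℝ) + 1) ^ l * A := by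
      refine (norm_ofComponents_le _).trans ?_
      gcongr
      · calc (n : ℝ) ^ c.length ≤ ((n : ℝ) + 1) ^ c.length := by gcongr; linarith
          _ ≤ _ := pow_le_pow_right₀ (by linarith [Nat.cast_nonneg (α := ℝ) n]) c.length_le
      · exact Finset.single_le_sum (f := fun j => ‖G j (Φ x)‖) (fun _ _ => norm_nonneg _)
          (Finset.mem_range.mpr (Nat.lt_succ_of_le c.length_le))
    have h3 : ∏ i, ‖iteratedFDeriv ℝ (c.partSize i) Φ x‖ ≤ D ^ l := by
      refine (Finset.prod_le_prod (fun _ _ => norm_nonneg _) fun i _ =>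
        hD (c.partSize i) (c.partSize_pos i) (c.partSize_le i)).trans (le_of_eq ?_)
      simpa using c.prod_sigma_eq_prod (fun _ => D)
    gcongr
  calc ‖chainTensor l Φ G x‖ ≤ (n : ℝ) ^ l * ∑ c : OrderedFinpartition l,
        ‖c.compAlongOrderedFinpartition (ofComponents n c.length (G c.length (Φ x)))
          fun i => iteratedFDeriv ℝ (c.partSize i) Φ x‖ := by
        refine (norm_components_le _).trans ?_
        gcongr
        exact norm_sum_le _ _
    _ ≤ (n : ℝ) ^ l * ∑ _c : OrderedFinpartition l, ((n : ℝ) + 1) ^ l * A * D ^ l := by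
        gcongr with c
        exact h1 c
    _ ≤ chainConst n l * D ^ l * A := by
        rw [Finset.sum_const, Finset.card_univ, nsmul_eq_mul, chainConst]
        nlinarith [mul_nonneg hDl hA0]

lemma aestronglyMeasurable_chainTensor {l : ℕ} {Φ : Space n → Space n} {U : Set (Space n)}
    (hU : IsOpen U) (hΦ : ContDiffOn ℝ l Φ U)
    {G : (j : ℕ) → Space n → EuclideanSpace ℝ (Fin j → Fin n)}
    (hG : ∀ j ≤ l, AEStronglyMeasurable (fun x => G j (Φ x)) (volume.restrict U)) :
    AEStronglyMeasurable (chainTensor l Φ G) (volume.restrict U) := by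
  refine (components n l).continuous.comp_aestronglyMeasurable ?_
  refine Finset.aestronglyMeasurable_fun_sum _ fun c _ => ?_
  set B := c.compAlongOrderedFinpartitionL ℝ (Space n) (Space n) ℝ
  have h1 : AEStronglyMeasurable (fun x => (ofComponents n c.length (G c.length (Φ x)),
      fun i => iteratedFDeriv ℝ (c.partSize i) Φ x)) (volume.restrict U) := by
    refine AEStronglyMeasurable.prodMk
      ((ofComponents n _).continuous.comp_aestronglyMeasurable (hG _ c.length_le)) ?_
    have := secondCountableTopologyEither_of_left (Space n)
      ((i : Fin c.length) → Space n [×c.partSize i]→L[ℝ] Space n)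
    refine ContinuousOn.aestronglyMeasurable ?_ hU.measurableSet
    refine continuousOn_pi.mpr fun i x hx => ?_
    exact ((((hΦ.contDiffAt (hU.mem_nhds hx)).of_le (by exact_mod_cast c.partSize_le i)
      : ContDiffAt ℝ (c.partSize i) Φ x).iteratedFDeriv_right (m := 0) (i := c.partSize i)
      (by simp)).continuousAt).continuousWithinAt
  exact B.continuous_uncurry_of_multilinear.comp_aestronglyMeasurable h1

lemma exists_iteratedFDeriv_bound {l : ℕ} {F E : Type*} [NormedAddCommGroup F] [NormedSpace ℝ F]
    [NormedAddCommGroup E] [NormedSpace ℝ E] {Φ : F → E} {U K : Set F}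
    (hU : IsOpen U) (hΦ : ContDiffOn ℝ l Φ U) (hK : IsCompact K) (hKU : K ⊆ U) :
    ∃ D : ℝ, 1 ≤ D ∧ ∀ x ∈ K, ∀ i ≤ l, ‖iteratedFDeriv ℝ i Φ x‖ ≤ D := by
  have h : ∀ i : Fin (l + 1), ∃ D : ℝ, ∀ x ∈ K, ‖iteratedFDeriv ℝ (i : ℕ) Φ x‖ ≤ D := by
    intro i
    refine hK.exists_bound_of_continuousOn fun x hx => ?_
    exact ((((hΦ.contDiffAt (hU.mem_nhds (hKU hx))).of_le (by exact_mod_cast i.is_le)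
      : ContDiffAt ℝ (i : ℕ) Φ x).iteratedFDeriv_right (m := 0) (i := i)
      (by simp)).continuousAt).continuousWithinAt
  choose D hD using h
  refine ⟨1 + ∑ i, |D i|, ?_, fun x hx i hi => ?_⟩
  · linarith [Finset.sum_nonneg (s := Finset.univ) fun (i : Fin (l + 1)) _ => abs_nonneg (D i)]
  · have h1 := hD ⟨i, Nat.lt_succ_of_le hi⟩ x hx
    have h2 := Finset.single_le_sum (f := fun i => |D i|) (fun i _ => abs_nonneg (D i))
      (Finset.mem_univ (⟨i, Nat.lt_succ_of_le hi⟩ : Fin (l + 1)))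
    have h3 := le_abs_self (D ⟨i, Nat.lt_succ_of_le hi⟩)
    simp only at h1 h2
    linarith

lemma enorm_integral_mul_le {f φ : Space n → ℝ} {M : ℝ} (hM : ∀ x, |φ x| ≤ M) :
    ‖∫ x, f x * φ x‖ₑ ≤ ENNReal.ofReal M * ∫⁻ x in tsupport φ, ‖f x‖ₑ := by
  refine (enorm_integral_le_lintegral_enorm _).trans ?_
  rw [← lintegral_const_mul' _ _ (by simp), ← lintegral_indicator (isClosed_tsupport φ).measurableSet]
  refine lintegral_mono fun x => ?_
  by_cases hx : x ∈ tsupport φ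
  · rw [indicator_of_mem hx, enorm_mul, mul_comm]
    gcongr
    rw [← ofReal_norm]
    exact ENNReal.ofReal_le_ofReal (hM x)
  · rw [image_eq_zero_of_notMem_tsupport hx]
    simp

/-- The chain rule for weak derivatives. -/
theorem IsWeakGrad.comp {m l : ℕ} (hl : l ≤ m) {U V : Set (Space n)} (hU : IsOpen U)
    (hV : IsOpen V) {Φ : Space n → Space n} (hΦ : ContDiffOn ℝ m Φ U) (hΦV : MapsTo Φ U V)
    {c : ℝ} (hc : 0 ≤ c) (hanti : AntiLipOn c Φ U) {v : Space n → ℝ}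
    {G : (j : ℕ) → Space n → EuclideanSpace ℝ (Fin j → Fin n)}
    (hG : ∀ j ≤ m, IsWeakGrad j V v (G j)) :
    IsWeakGrad l U (fun x => v (Φ x)) (chainTensor l Φ G) := by
  have hΦl : ContDiffOn ℝ l Φ U := hΦ.of_le (by exact_mod_cast hl)
  have hΦc : ContinuousOn Φ U := hΦ.continuousOn
  have hv : LocallyIntegrableOn v V := (hG 0 (Nat.zero_le _)).1
  -- integrability on compact sets
  have hint : ∀ {E : Type} [NormedAddCommGroup E] {f : Space n → E}, LocallyIntegrableOn f V →
      ∀ K ⊆ U, IsCompact K → IntegrableOn (fun x => f (Φ x)) K := by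
    intro E _ f hf K hKU hK
    have hKΦ : IsCompact (Φ '' K) := hK.image_of_continuousOn (hΦc.mono hKU)
    have hfi : IntegrableOn f (Φ '' K) :=
      hf.integrableOn_compact_subset ((image_mono hKU).trans hΦV.image_subset) hKΦ
    refine ⟨(hanti.mono hKU).aestronglyMeasurable_comp hc hK.measurableSet (hΦc.mono hKU)
      (mapsTo_image Φ K) hfi.1, ?_⟩
    refine ((hanti.mono hKU).lintegral_comp_le hc hK.measurableSet (hΦc.mono hKU)
      (mapsTo_image Φ K) hfi.1.enorm).trans_lt ?_
    exact ENNReal.mul_lt_top (by finiteness) hfi.2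
  have hvΦ : LocallyIntegrableOn (fun x => v (Φ x)) U :=
    (locallyIntegrableOn_iff hU.isLocallyClosed).mpr (hint hv)
  have hGm : ∀ j ≤ l, AEStronglyMeasurable (fun x => G j (Φ x)) (volume.restrict U) := by
    intro j hj
    exact hanti.aestronglyMeasurable_comp hc hU.measurableSet hΦc hΦV
      ((hG j (hj.trans hl)).2.1.aestronglyMeasurable)
  have hHm := aestronglyMeasurable_chainTensor hU hΦl hGm
  have hbd : ∀ K ⊆ U, IsCompact K → ∃ D : ℝ, 1 ≤ D ∧ ∀ x ∈ K, ∀ i, 1 ≤ i → i ≤ l →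
      ‖iteratedFDeriv ℝ i Φ x‖ ≤ D ^ i := by
    intro K hKU hK
    obtain ⟨D, hD1, hD⟩ := exists_iteratedFDeriv_bound hU hΦl hK hKU
    exact ⟨D, hD1, fun x hx i hi hil => (hD x hx i hil).trans
      (le_self_pow₀ hD1 (by omega))⟩
  have hH : LocallyIntegrableOn (chainTensor l Φ G) U := by
    refine (locallyIntegrableOn_iff hU.isLocallyClosed).mpr fun K hKU hK => ?_
    obtain ⟨D, hD1, hD⟩ := hbd K hKU hK
    have hs : IntegrableOn (fun x => chainConst n l * D ^ l *
        ∑ j ∈ Finset.range (l + 1), ‖G j (Φ x)‖) K := by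
      refine Integrable.const_mul (integrable_finsetSum _ fun j hj => ?_) _
      exact (hint (hG j (by have := Finset.mem_range.mp hj; omega)).2.1 K hKU hK).norm
    refine Integrable.mono' hs (hHm.mono_measure (Measure.restrict_mono hKU le_rfl)) ?_
    filter_upwards [ae_restrict_mem hK.measurableSet] with x hx
    exact norm_chainTensor_le G (hD x hx)
  refine ⟨hvΦ, hH, fun J φ hφ hφc hs => ?_⟩
  -- approximate by smooth functions
  set K := tsupport φ with hK
  have hKc : IsCompact K := hφc
  have hKΦ : IsCompact (Φ '' K) := hKc.image_of_continuousOn (hΦc.mono hs)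
  have hKV : Φ '' K ⊆ V := (image_mono hs).trans hΦV.image_subset
  obtain ⟨D, hD1, hD⟩ := hbd K hs hKc
  set χ : Space n → ℝ := fun x => iteratedFDeriv ℝ l φ x (stdVec J) with hχ
  have hχ1 : ContDiff ℝ ∞ χ := contDiff_iteratedFDeriv_apply hφ _
  have hχc : HasCompactSupport χ := hasCompactSupport_iteratedFDeriv_apply hφc _
  have hχs : tsupport χ ⊆ K := tsupport_iteratedFDeriv_apply_subset φ _
  obtain ⟨M, hM⟩ := hχ1.continuous.bounded_above_of_compact_support hχc
  obtain ⟨M', hM'⟩ := hφ.continuous.bounded_above_of_compact_support hφc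
  have hM0 : 0 ≤ M := (norm_nonneg _).trans (hM 0)
  have hM0' : 0 ≤ M' := (norm_nonneg _).trans (hM' 0)
  set C : ℝ := M * c ^ n + M' * (chainConst n l * D ^ l * ((l + 1 : ℕ) * c ^ n)) with hC
  have hC0 : 0 ≤ C := by have := chainConst_pos n l; positivity
  have key : ∀ ε > 0, ‖(∫ x, v (Φ x) * χ x) -
      (-1 : ℝ) ^ l * ∫ x, chainTensor l Φ G x J * φ x‖ₑ ≤ ENNReal.ofReal (C * ε) := by
    intro ε hε
    obtain ⟨g, hg, hg1, hg2, -⟩ := exists_smoothing hV (m := m) hv hG hKΦ hKV hε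
    have hgΦ : ContDiffOn ℝ l (fun x => g (Φ x)) U :=
      (hg.of_le (by exact_mod_cast le_top)).comp_contDiffOn hΦl
    have hcl : IsWeakGrad l U (fun x => g (Φ x)) (chainTensor l Φ fun j => tensorDeriv j g) := by
      have h := isWeakGrad_tensorDeriv hU hgΦ
      have heq : ∀ x ∈ U, chainTensor l Φ (fun j => tensorDeriv j g) x =
          tensorDeriv l (fun y => g (Φ y)) x := fun x hx =>
        chainTensor_tensorDeriv (hΦl.contDiffAt (hU.mem_nhds hx))
          ((hg.of_le (by exact_mod_cast le_top)).contDiffAt)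
      refine ⟨h.1, ?_, fun J φ hφ hc hs => ?_⟩
      · exact ContinuousOn.locallyIntegrableOn
          ((continuousOn_tensorDeriv hU hgΦ).congr heq) hU.measurableSet
      · rw [h.2.2 J φ hφ hc hs]
        congr 1
        refine integral_congr_ae (.of_forall fun x => ?_)
        by_cases hx : x ∈ tsupport φ
        · simp only [heq x (hs hx)]
        · simp only [image_eq_zero_of_notMem_tsupport hx, mul_zero]
    -- The identity holds exactly for the smooth function `g` by the classical chain rule. Since the
    -- Faà di Bruno expression is linear in the tensors, subtraction leaves only the differences `v
    -- - g` and `G - ∇g`, which are small in `L¹` on the image of the support.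
    have e1 : (∫ x, v (Φ x) * χ x) - (-1 : ℝ) ^ l * ∫ x, chainTensor l Φ G x J * φ x =
        (∫ x, (v (Φ x) - g (Φ x)) * χ x) - (-1 : ℝ) ^ l *
          ∫ x, (chainTensor l Φ (fun j y => G j y - tensorDeriv j g y) x J) * φ x := by
      have h1 := integral_sub
        (integrable_locallyIntegrableOn_mul hvΦ hχ1.continuous hχc (hχs.trans hs))
        (integrable_locallyIntegrableOn_mul hcl.1 hχ1.continuous hχc (hχs.trans hs))
      have h2 := integral_sub
        (integrable_locallyIntegrableOn_mul (locallyIntegrableOn_tensor_apply hH J)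
          hφ.continuous hφc hs)
        (integrable_locallyIntegrableOn_mul (locallyIntegrableOn_tensor_apply hcl.2.1 J)
          hφ.continuous hφc hs)
      have h3 := hcl.2.2 J φ hφ hφc hs
      simp_rw [← chainTensor_sub, PiLp.sub_apply, sub_mul]
      rw [h1, h2]
      linear_combination h3
    have b1 : ‖∫ x, (v (Φ x) - g (Φ x)) * χ x‖ₑ ≤ ENNReal.ofReal (M * c ^ n * ε) := by
      refine (enorm_integral_mul_le hM).trans ?_
      have : ∫⁻ x in tsupport χ, ‖v (Φ x) - g (Φ x)‖ₑ ≤ ENNReal.ofReal c ^ n * ENNReal.ofReal ε := by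
        refine (lintegral_mono_set hχs).trans ?_
        refine ((hanti.mono hs).lintegral_comp_le hc hKc.measurableSet (hΦc.mono hs)
          (mapsTo_image Φ K) (f := fun y => ‖v y - g y‖ₑ) ?_).trans ?_
        · exact ((hv.integrableOn_compact_subset hKV hKΦ).1.sub
            hg.continuous.aestronglyMeasurable).enorm
        · gcongr
          simpa only [enorm_sub_rev] using hg2
      calc _ ≤ ENNReal.ofReal M * (ENNReal.ofReal c ^ n * ENNReal.ofReal ε) := by gcongr
        _ = _ := by
          rw [← ENNReal.ofReal_pow hc, ← ENNReal.ofReal_mul (by positivity),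
            ← ENNReal.ofReal_mul hM0, mul_assoc]
    have b2 : ‖∫ x, (chainTensor l Φ (fun j y => G j y - tensorDeriv j g y) x J) * φ x‖ₑ ≤
        ENNReal.ofReal (M' * (chainConst n l * D ^ l * ((l + 1 : ℕ) * c ^ n)) * ε) := by
      refine (enorm_integral_mul_le hM').trans ?_
      have hX : 0 ≤ chainConst n l * D ^ l := by have := chainConst_pos n l; positivity
      have : ∫⁻ x in K, ‖chainTensor l Φ (fun j y => G j y - tensorDeriv j g y) x J‖ₑ ≤
          ENNReal.ofReal (chainConst n l * D ^ l) * ((l + 1 : ℕ) * (ENNReal.ofReal c ^ n *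
            ENNReal.ofReal ε)) := by
        calc _ ≤ ∫⁻ x in K, ENNReal.ofReal (chainConst n l * D ^ l) *
              ∑ j ∈ Finset.range (l + 1), ‖G j (Φ x) - tensorDeriv j g (Φ x)‖ₑ := by
              refine setLIntegral_mono' hKc.measurableSet fun x hx => ?_
              rw [← ofReal_norm]
              simp_rw [← ofReal_norm]
              rw [← ENNReal.ofReal_sum_of_nonneg (fun _ _ => norm_nonneg _),
                ← ENNReal.ofReal_mul hX]
              refine ENNReal.ofReal_le_ofReal ((abs_tensor_apply_le _ _).trans ?_)
              exact norm_chainTensor_le _ (hD x hx)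
          _ = ENNReal.ofReal (chainConst n l * D ^ l) * ∑ j ∈ Finset.range (l + 1),
              ∫⁻ x in K, ‖G j (Φ x) - tensorDeriv j g (Φ x)‖ₑ := by
              rw [lintegral_const_mul' _ _ (by simp), lintegral_finsetSum']
              intro j hj
              refine AEStronglyMeasurable.enorm (AEStronglyMeasurable.sub ?_ ?_)
              · exact (hint (hG j (by have := Finset.mem_range.mp hj; omega)).2.1 K hs hKc).1
              · refine (ContinuousOn.aestronglyMeasurable ?_ hKc.measurableSet)
                exact ((continuousOn_tensorDeriv isOpen_univ
                  (hg.of_le (by exact_mod_cast le_top)).contDiffOn).comp (hΦc.mono hs)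
                  (mapsTo_univ _ _))
          _ ≤ ENNReal.ofReal (chainConst n l * D ^ l) * ∑ _j ∈ Finset.range (l + 1),
              (ENNReal.ofReal c ^ n * ENNReal.ofReal ε) := by
              gcongr with j hj
              have hjm : j ≤ m := by have := Finset.mem_range.mp hj; omega
              refine ((hanti.mono hs).lintegral_comp_le hc hKc.measurableSet (hΦc.mono hs)
                (mapsTo_image Φ K) (f := fun y => ‖G j y - tensorDeriv j g y‖ₑ) ?_).trans ?_
              · refine AEStronglyMeasurable.enorm (AEStronglyMeasurable.sub
                  ((hG j hjm).2.1.integrableOn_compact_subset hKV hKΦ).1 ?_)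
                refine (ContinuousOn.aestronglyMeasurable ?_ hKΦ.measurableSet)
                exact (continuousOn_tensorDeriv isOpen_univ
                  (hg.of_le (by exact_mod_cast le_top)).contDiffOn).mono (subset_univ _)
              · gcongr
                simpa only [enorm_sub_rev] using hg1 j hjm
          _ = _ := by
              rw [Finset.sum_const, Finset.card_range, nsmul_eq_mul]
      calc _ ≤ ENNReal.ofReal M' * (ENNReal.ofReal (chainConst n l * D ^ l) * ((l + 1 : ℕ) *
            (ENNReal.ofReal c ^ n * ENNReal.ofReal ε))) := by gcongr
        _ = _ := by
          rw [← ENNReal.ofReal_natCast, ← ENNReal.ofReal_pow hc,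
            ← ENNReal.ofReal_mul (by positivity), ← ENNReal.ofReal_mul (by positivity),
            ← ENNReal.ofReal_mul hX, ← ENNReal.ofReal_mul hM0']
          congr 1
          ring
    rw [e1]
    refine (enorm_sub_le).trans ?_
    have hsgn : ‖(-1 : ℝ) ^ l‖ₑ = 1 := by rw [enorm_pow]; simp
    rw [enorm_mul, hsgn, one_mul]
    refine (add_le_add b1 b2).trans ?_
    rw [← ENNReal.ofReal_add (by positivity) (by have := chainConst_pos n l; positivity)]
    refine ENNReal.ofReal_le_ofReal (le_of_eq ?_)
    rw [hC]; ring
  have hzero : ‖(∫ x, v (Φ x) * χ x) -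
      (-1 : ℝ) ^ l * ∫ x, chainTensor l Φ G x J * φ x‖ ≤ 0 := by
    refine le_of_forall_pos_le_add fun ε hε => ?_
    have := key (ε / (C + 1)) (by positivity)
    rw [← ofReal_norm, ENNReal.ofReal_le_ofReal_iff (by positivity)] at this
    refine this.trans ?_
    rw [zero_add, mul_div_assoc', div_le_iff₀ (by positivity)]
    nlinarith
  exact sub_eq_zero.mp (norm_le_zero_iff.mp hzero)

end

section

variable {n : ℕ}

/-! ### Polynomials -/

/-- The affine function `x ↦ a + L x`. -/
noncomputable def affFunMap (n : ℕ) : (ℝ × (Space n →L[ℝ] ℝ)) →ₗ[ℝ] (Space n → ℝ) where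
  toFun q x := q.1 + q.2 x
  map_add' q q' := by ext x; simp; ring
  map_smul' a q := by ext x; simp; ring

/-- The affine functions on `ℝⁿ`. -/
noncomputable def affFun (n : ℕ) : Submodule ℝ (Space n → ℝ) := LinearMap.range (affFunMap n)

lemma mem_affFun {f : Space n → ℝ} :
    f ∈ affFun n ↔ ∃ (a : ℝ) (L : Space n →L[ℝ] ℝ), f = fun x => a + L x := by
  constructor
  · rintro ⟨⟨a, L⟩, rfl⟩
    exact ⟨a, L, rfl⟩
  · rintro ⟨a, L, rfl⟩
    exact ⟨(a, L), rfl⟩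

lemma const_mem_affFun (a : ℝ) : (fun _ : Space n => a) ∈ affFun n :=
  mem_affFun.mpr ⟨a, 0, by simp⟩

lemma fg_affFun (n : ℕ) : (affFun n).FG := by
  rw [affFun, LinearMap.range_eq_map]
  exact Module.Finite.fg_top.map _

/-- The polynomials of degree less than `m`. -/
noncomputable def polyLT (n : ℕ) : ℕ → Submodule ℝ (Space n → ℝ)
  | 0 => ⊥
  | m + 1 => affFun n ^ m

lemma fg_polyLT (n m : ℕ) : (polyLT n m).FG := by
  cases m with
  | zero => exact Submodule.fg_bot
  | succ m => exact (fg_affFun n).pow m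

lemma mul_mem_polyLT {m : ℕ} {f Q : Space n → ℝ} (hf : f ∈ affFun n) (hQ : Q ∈ polyLT n m) :
    f * Q ∈ polyLT n (m + 1) := by
  cases m with
  | zero =>
    rw [(Submodule.mem_bot ℝ).mp hQ, mul_zero]
    exact Submodule.zero_mem _
  | succ m =>
    change f * Q ∈ affFun n ^ (m + 1)
    rw [pow_succ']
    exact Submodule.mul_mem_mul hf hQ

lemma polyLT_le_succ (n m : ℕ) : polyLT n m ≤ polyLT n (m + 1) := by
  intro Q hQ
  simpa using mul_mem_polyLT (const_mem_affFun 1) hQ |> fun h => by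
    rwa [show (fun _ : Space n => (1 : ℝ)) = 1 from rfl, one_mul] at h

lemma polyLT_mono (n : ℕ) : Monotone (polyLT n) := monotone_nat_of_le_succ (polyLT_le_succ n)

/-- A power of the space of affine functions is generated from constants by sums and by
multiplication with an affine function, which raises the degree by one. -/
lemma polyLT_induction {C : ℕ → (Space n → ℝ) → Prop} (h0 : C 0 0)
    (hc : ∀ a : ℝ, C 1 fun _ => a)
    (hadd : ∀ m Q Q', Q ∈ polyLT n (m + 1) → Q' ∈ polyLT n (m + 1) →
      C (m + 1) Q → C (m + 1) Q' → C (m + 1) (Q + Q'))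
    (hmul : ∀ m f Q, f ∈ affFun n → Q ∈ polyLT n (m + 1) → C (m + 1) Q → C (m + 2) (f * Q))
    {m : ℕ} {Q : Space n → ℝ} (hQ : Q ∈ polyLT n m) : C m Q := by
  cases m with
  | zero => rw [(Submodule.mem_bot ℝ).mp hQ]; exact h0
  | succ m =>
    exact Submodule.pow_induction_on_left' (affFun n) (C := fun i Q _ => C (i + 1) Q)
      (fun r => hc r) (fun x y i hx hy h1 h2 => hadd i x y hx hy h1 h2)
      (fun f hf i Q hQ h => hmul i f Q hf hQ h) hQ

lemma contDiff_of_mem_affFun {f : Space n → ℝ} (hf : f ∈ affFun n) (k : WithTop ℕ∞) :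
    ContDiff ℝ k f := by
  obtain ⟨a, L, rfl⟩ := mem_affFun.mp hf
  exact contDiff_const.add L.contDiff

lemma contDiff_of_mem_polyLT {m : ℕ} {Q : Space n → ℝ} (hQ : Q ∈ polyLT n m) (k : WithTop ℕ∞) :
    ContDiff ℝ k Q :=
  polyLT_induction (C := fun _ Q => ContDiff ℝ k Q) contDiff_const (fun _ => contDiff_const)
    (fun _ _ _ _ _ h h' => h.add h')
    (fun _ _ _ hf _ h => (contDiff_of_mem_affFun hf k).mul h) hQ

/-- By the product rule, since the derivative of an affine factor is a constant. -/
lemma fderiv_mem_polyLT {m : ℕ} {Q : Space n → ℝ} (hQ : Q ∈ polyLT n (m + 1)) (u : Space n) :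
    (fun y => fderiv ℝ Q y u) ∈ polyLT n m := by
  have hd : ∀ {k : ℕ} {P : Space n → ℝ}, P ∈ polyLT n k → Differentiable ℝ P := fun h =>
    (contDiff_of_mem_polyLT h 1).differentiable (by simp)
  -- The index is generalized to `m = k + 1` because the induction also passes through the index
  -- `0`, where there is nothing to prove.
  refine polyLT_induction (n := n) (C := fun m Q => ∀ k, m = k + 1 →
    (fun y => fderiv ℝ Q y u) ∈ polyLT n k) (by simp) ?_ ?_ ?_ hQ m rfl
  · intro a k hk
    simp only [fderiv_fun_const]
    exact Submodule.zero_mem _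
  · intro m Q Q' hQ hQ' h h' k hk
    have : (fun y => fderiv ℝ (Q + Q') y u) = (fun y => fderiv ℝ Q y u) + fun y => fderiv ℝ Q' y u := by
      ext y
      rw [fderiv_add (hd hQ y) (hd hQ' y)]
      rfl
    rw [this]
    exact Submodule.add_mem _ (h k hk) (h' k hk)
  · intro m f Q hf hQ h k hk
    obtain rfl : k = m + 1 := by omega
    obtain ⟨a, L, rfl⟩ := mem_affFun.mp hf
    have h1 : Differentiable ℝ fun x => a + L x := (L.differentiable).const_add a
    have : (fun y => fderiv ℝ ((fun x => a + L x) * Q) y u) =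
        (fun x => a + L x) * (fun y => fderiv ℝ Q y u) + L u • Q := by
      ext y
      rw [fderiv_mul (h1 y) (hd hQ y)]
      have : fderiv ℝ (fun x => a + L x) y = L := by
        rw [fderiv_const_add]; exact L.fderiv
      simp [this]
      ring
    rw [this]
    exact Submodule.add_mem _ (mul_mem_polyLT hf (h m rfl)) (Submodule.smul_mem _ _ hQ)

lemma iteratedFDeriv_eq_zero_of_mem_polyLT {m : ℕ} : ∀ {Q : Space n → ℝ}, Q ∈ polyLT n m →
    ∀ j ≥ m, ∀ x, iteratedFDeriv ℝ j Q x = 0 := by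
  induction m with
  | zero =>
    intro Q hQ j _ x
    rw [(Submodule.mem_bot ℝ).mp hQ]
    simp
  | succ m ih =>
    intro Q hQ j hj x
    obtain ⟨j, rfl⟩ : ∃ i, j = i + 1 := ⟨j - 1, by omega⟩
    ext w
    have hs := contDiff_of_mem_polyLT hQ ∞
    rw [iteratedFDeriv_succ_apply_cons hs, ← iteratedFDeriv_fderiv_apply hs,
      ih (fderiv_mem_polyLT hQ _) j (by omega)]
    rfl

lemma tensorDeriv_eq_zero_of_mem_polyLT {m : ℕ} {Q : Space n → ℝ} (hQ : Q ∈ polyLT n m) {j : ℕ}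
    (hj : m ≤ j) (x : Space n) : tensorDeriv j Q x = 0 := by
  rw [tensorDeriv, iteratedFDeriv_eq_zero_of_mem_polyLT hQ j hj, map_zero]

lemma comp_mem_polyLT {g : Space n → Space n} (hg : ∀ f ∈ affFun n, (fun x => f (g x)) ∈ affFun n)
    {m : ℕ} {Q : Space n → ℝ} (hQ : Q ∈ polyLT n m) : (fun x => Q (g x)) ∈ polyLT n m :=
  polyLT_induction (C := fun m Q => (fun x => Q (g x)) ∈ polyLT n m) (Submodule.zero_mem _)
    (fun a => by
      change _ ∈ affFun n ^ 0
      rw [pow_zero]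
      exact Submodule.mem_one.mpr ⟨a, rfl⟩)
    (fun _ _ _ _ _ h h' => Submodule.add_mem _ h h')
    (fun m f Q hf _ h => mul_mem_polyLT (hg f hf) h) hQ

lemma comp_affine_mem_affFun (z : Space n) (L : Space n →L[ℝ] Space n) :
    ∀ f ∈ affFun n, (fun x => f (z + L x)) ∈ affFun n := by
  intro f hf
  obtain ⟨a, M, rfl⟩ := mem_affFun.mp hf
  exact mem_affFun.mpr ⟨a + M z, M.comp L, by ext x; simp; ring⟩

lemma diagonal_mem_polyLT {m : ℕ} (T : EuclideanSpace ℝ (Fin m → Fin n)) :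
    (fun x => ofComponents n m T (fun _ => x)) ∈ polyLT n (m + 1) := by
  have h1 : ∀ (k : ℕ) (J : Fin k → Fin n), (fun x : Space n => ∏ i, x (J i)) ∈ polyLT n (k + 1) := by
    intro k
    induction k with
    | zero =>
      intro J
      change _ ∈ affFun n ^ 0
      rw [pow_zero]
      exact Submodule.mem_one.mpr ⟨1, by ext x; simp⟩
    | succ k ih =>
      intro J
      have : (fun x : Space n => ∏ i, x (J i)) =
          (fun x : Space n => x (J 0)) * fun x : Space n => ∏ i, x (Fin.tail J i) := by
        ext x
        simp [Fin.prod_univ_succ, Fin.tail]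
      rw [this]
      exact mul_mem_polyLT (mem_affFun.mpr ⟨0, EuclideanSpace.proj (J 0), by ext x; simp⟩) (ih _)
  have : (fun x => ofComponents n m T (fun _ => x)) =
      ∑ J : Fin m → Fin n, T J • fun x : Space n => ∏ i, x (J i) := by
    ext x
    simp [ofComponents_apply]
  rw [this]
  exact Submodule.sum_mem _ fun J _ => Submodule.smul_mem _ _ (h1 m J)

/-- The derivative of order `m` of the homogeneous polynomial of a symmetric tensor. -/
lemma tensorDeriv_diagonal {m : ℕ} {T : EuclideanSpace ℝ (Fin m → Fin n)}
    (hT : ∀ (σ : Equiv.Perm (Fin m)) J, T (J ∘ σ) = T J) (x : Space n) :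
    tensorDeriv m (fun x => ofComponents n m T (fun _ => x)) x = (m.factorial : ℝ) • T := by
  ext J
  -- The derivative of order `m` of the diagonal is the sum over all permutations of the arguments;
  -- symmetry makes the `m!` terms equal.
  rw [tensorDeriv_apply, ContinuousMultilinearMap.iteratedFDeriv_comp_diagonal]
  have : ∀ σ : Equiv.Perm (Fin m), ofComponents n m T (fun i => stdVec J (σ i)) = T J := by
    intro σ
    rw [← hT σ J]
    conv_rhs => rw [← components_ofComponents T]
    rfl
  simp [this, Fintype.card_perm]

lemma contDiff_tensorDeriv {g : Space n → ℝ} (hg : ContDiff ℝ ∞ g) (l : ℕ) :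
    ContDiff ℝ ∞ (tensorDeriv l g) :=
  (components n l).contDiff.comp (contDiff_iteratedFDeriv_infty hg l)

lemma tensorDeriv_add {l : ℕ} {f g : Space n → ℝ} {x : Space n} (hf : ContDiffAt ℝ l f x)
    (hg : ContDiffAt ℝ l g x) :
    tensorDeriv l (fun y => f y + g y) x = tensorDeriv l f x + tensorDeriv l g x := by
  rw [tensorDeriv, tensorDeriv, tensorDeriv, ← map_add]
  congr 1
  exact iteratedFDeriv_add_apply hf hg

lemma tensorDeriv_const_smul {l : ℕ} {f : Space n → ℝ} {x : Space n} (hf : ContDiffAt ℝ l f x)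
    (a : ℝ) : tensorDeriv l (fun y => a * f y) x = a • tensorDeriv l f x := by
  rw [tensorDeriv, tensorDeriv, ← map_smul]
  congr 1
  exact iteratedFDeriv_const_smul_apply (a := a) hf

lemma analyticOnNhd_tensorDeriv {m : ℕ} {Q : Space n → ℝ} (hQ : Q ∈ polyLT n m) (j : ℕ) :
    AnalyticOnNhd ℝ (tensorDeriv j Q) univ := by
  have h1 : AnalyticOnNhd ℝ Q univ := fun x _ => (contDiff_of_mem_polyLT hQ ω).contDiffAt.analyticAt
  exact (components n j).comp_analyticOnNhd (h1.iteratedFDeriv j)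

/-- In a finite-dimensional space of analytic functions, the `L¹` norm on an open set controls the
maximum norm on compact sets. -/
lemma exists_analytic_bound {E : Type*} [NormedAddCommGroup E] [NormedSpace ℝ E] [CompleteSpace E]
    (W : Submodule ℝ (Space n → E)) [FiniteDimensional ℝ W]
    (hW : ∀ g ∈ W, AnalyticOnNhd ℝ g univ) {B K : Set (Space n)} (hB : IsOpen B)
    (hBne : B.Nonempty) (hBb : Bornology.IsBounded B) (hK : IsCompact K) :
    ∃ C : ℝ, 0 < C ∧ ∀ g ∈ W, ∀ x ∈ K, ‖g x‖ₑ ≤ ENNReal.ofReal C * ∫⁻ y in B, ‖g y‖ₑ := by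
  have hc : ∀ g ∈ W, Continuous g := fun g hg =>
    continuousOn_univ.mp (hW g hg).continuousOn
  have hi : ∀ g ∈ W, Integrable g (volume.restrict B) := fun g hg =>
    ((hc g hg).continuousOn.integrableOn_compact hBb.isCompact_closure).mono_set subset_closure
  let b := Module.finBasis ℝ W
  let r := Module.finrank ℝ W
  have hsum : ∀ c : Fin r → ℝ, (∑ i, c i • (b i : Space n → E)) ∈ W := fun c =>
    Submodule.sum_mem _ fun i _ => Submodule.smul_mem _ _ (b i).2
  -- `T` sends coefficients to the class of the function in `L¹(B)`. It is injective: a function in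
  -- `W` that vanishes almost everywhere on `B` vanishes on `B` by continuity and then everywhere by
  -- the identity theorem. An injective linear map on a finite-dimensional space has a Lipschitz
  -- inverse, so the `L¹` norm controls the coefficients.
  let T : (Fin r → ℝ) →ₗ[ℝ] (Space n →₁[volume.restrict B] E) :=
    { toFun := fun c => (hi _ (hsum c)).toL1 _
      map_add' := fun c c' => by
        rw [← Integrable.toL1_add]
        exact (Integrable.toL1_eq_toL1_iff _ _ _ _).mpr
          (.of_eq (by simp [add_smul, Finset.sum_add_distrib]))
      map_smul' := fun a c => by
        rw [RingHom.id_apply, ← Integrable.toL1_smul]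
        exact (Integrable.toL1_eq_toL1_iff _ _ _ _).mpr
          (.of_eq (by ext y; simp [Finset.smul_sum, smul_smul, Finset.sum_apply])) }
  have hT : LinearMap.ker T = ⊥ := by
    rw [LinearMap.ker_eq_bot']
    intro c hTc
    have h0 : (∑ i, c i • (b i : Space n → E)) =ᵐ[volume.restrict B] 0 :=
      by
      have h1 := (hi _ (hsum c)).coeFn_toL1
      have h2 : (hi _ (hsum c)).toL1 _ = 0 := hTc
      rw [h2] at h1
      exact h1.symm.trans (Lp.coeFn_zero _ _ _)
    have h1 : EqOn (∑ i, c i • (b i : Space n → E)) 0 B :=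
      Measure.eqOn_open_of_ae_eq h0 hB (hc _ (hsum c)).continuousOn continuousOn_const
    obtain ⟨z, hz⟩ := hBne
    have h2 := (hW _ (hsum c)).eqOn_zero_of_preconnected_of_eventuallyEq_zero
      isPreconnected_univ (mem_univ z) (by
        filter_upwards [hB.mem_nhds hz] with y hy using h1 hy)
    have h3 : ∑ i, c i • b i = 0 := by
      apply Subtype.ext
      rw [Submodule.coe_sum]
      ext x
      simpa using h2 (mem_univ x)
    ext i
    exact Fintype.linearIndependent_iff.mp b.linearIndependent c h3 i
  obtain ⟨κ, -, hκ⟩ := T.exists_antilipschitzWith hT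
  have hM : ∀ i, ∃ M : ℝ, ∀ x ∈ K, ‖(b i : Space n → E) x‖ ≤ M := fun i =>
    hK.exists_bound_of_continuousOn (hc _ (b i).2).continuousOn
  choose M hM using hM
  refine ⟨(∑ i, |M i|) * κ + 1, by positivity, fun g hg x hx => ?_⟩
  set c := b.repr ⟨g, hg⟩ with hcdef
  have hgc : g = ∑ i, c i • (b i : Space n → E) := by
    have := b.sum_repr ⟨g, hg⟩
    have h2 := congrArg (Subtype.val) this
    rw [Submodule.coe_sum] at h2
    exact h2.symm
  have h1 : ‖(c : Fin r → ℝ)‖ ≤ κ * ‖T c‖ := by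
    have := hκ.le_mul_dist (c : Fin r → ℝ) 0
    simpa using this
  have h2 : ‖g x‖ ≤ (∑ i, |M i|) * ‖(c : Fin r → ℝ)‖ := by
    conv_lhs => rw [hgc]
    rw [Finset.sum_apply, Finset.sum_mul]
    refine (norm_sum_le _ _).trans (Finset.sum_le_sum fun i _ => ?_)
    rw [Pi.smul_apply, norm_smul, mul_comm]
    exact mul_le_mul ((hM i x hx).trans (le_abs_self _)) (norm_le_pi_norm (c : Fin r → ℝ) i)
      (norm_nonneg _) (abs_nonneg _)
  have h3 : ENNReal.ofReal ‖T c‖ = ∫⁻ y in B, ‖g y‖ₑ := by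
    have : T c = (hi g hg).toL1 g := (Integrable.toL1_eq_toL1_iff _ _ (hi _ (hsum c)) (hi g hg)).mpr (.of_eq hgc.symm)
    rw [this, Integrable.norm_toL1]
    exact ENNReal.ofReal_toReal (hi g hg).2.ne |> fun h => by
      simpa using h
  rw [← h3, ← ofReal_norm, ← ENNReal.ofReal_mul (by positivity)]
  refine ENNReal.ofReal_le_ofReal (h2.trans ?_)
  have := mul_le_mul_of_nonneg_left h1 (Finset.sum_nonneg (s := Finset.univ) fun i _ => abs_nonneg (M i))
  nlinarith [norm_nonneg (T c)]

lemma iteratedFDeriv_comp_dilation {g : Space n → ℝ} (hg : ContDiff ℝ ∞ g) (z : Space n) (h : ℝ)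
    {l : ℕ} (w : Fin l → Space n) (y : Space n) :
    iteratedFDeriv ℝ l (fun x => g (z + h • x)) y w = h ^ l * iteratedFDeriv ℝ l g (z + h • y) w := by
  induction l generalizing y with
  | zero => simp
  | succ l ih =>
    have h1 : ContDiff ℝ ∞ (fun x => g (z + h • x)) :=
      hg.comp (contDiff_const.add (contDiff_id.const_smul h))
    rw [iteratedFDeriv_succ_apply_cons h1, iteratedFDeriv_succ_apply_cons hg]
    simp_rw [ih]
    have hd := ((contDiff_iteratedFDeriv_apply hg (Fin.tail w)).differentiable (by simp)
      (z + h • y)).hasFDerivAt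
    have h2 := (hd.comp y (((hasFDerivAt_id y).const_smul h).const_add z)).const_mul (h ^ l)
    have h3 : HasFDerivAt (fun y => h ^ l * iteratedFDeriv ℝ l g (z + h • y) (Fin.tail w)) _ y := h2
    rw [HasFDerivAt.fderiv h3]
    simp [pow_succ]
    ring

/-- For polynomials, the `L¹` norm of the derivatives on an open set controls their maximum on
compact sets; the constant is invariant under dilations. -/
theorem exists_polyLT_bound (n m j : ℕ) {B K : Set (Space n)} (hB : IsOpen B)
    (hBne : B.Nonempty) (hBb : Bornology.IsBounded B) (hK : IsCompact K) :
    ∃ C : ℝ, 0 < C ∧ ∀ Q ∈ polyLT n m, ∀ (z : Space n) (h : ℝ), 0 < h → ∀ x ∈ K,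
      ‖tensorDeriv j Q (z + h • x)‖ₑ ≤
        ENNReal.ofReal (C / h ^ n) * ∫⁻ y in (fun x => z + h • x) '' B, ‖tensorDeriv j Q y‖ₑ := by
  let S : polyLT n m →ₗ[ℝ] (Space n → EuclideanSpace ℝ (Fin j → Fin n)) :=
    { toFun := fun Q => tensorDeriv j (Q : Space n → ℝ)
      map_add' := fun Q Q' => by
        ext1 x
        exact tensorDeriv_add (contDiff_of_mem_polyLT Q.2 _).contDiffAt
          (contDiff_of_mem_polyLT Q'.2 _).contDiffAt
      map_smul' := fun a Q => by
        ext1 x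
        exact tensorDeriv_const_smul (contDiff_of_mem_polyLT Q.2 _).contDiffAt a }
  have : FiniteDimensional ℝ (polyLT n m) := Module.Finite.iff_fg.mpr (fg_polyLT n m)
  obtain ⟨C, hC, h⟩ := exists_analytic_bound (LinearMap.range S) (by
    rintro _ ⟨Q, rfl⟩
    exact analyticOnNhd_tensorDeriv Q.2 j) hB hBne hBb hK
  refine ⟨C, hC, fun Q hQ z r hr x hx => ?_⟩
  have hQs := contDiff_of_mem_polyLT hQ ∞
  -- Dilations preserve the space of polynomials. The factor `r ^ j` of the derivatives appears on
  -- both sides and cancels, so only the volume factor `1 / r ^ n` remains.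
  have hdil : (fun x => Q (z + r • x)) ∈ polyLT n m := comp_mem_polyLT
    (g := fun x => z + r • x) (comp_affine_mem_affFun z (r • ContinuousLinearMap.id ℝ _)) hQ
  have hten : ∀ y, tensorDeriv j (fun x => Q (z + r • x)) y = r ^ j • tensorDeriv j Q (z + r • y) := by
    intro y
    ext J
    simp only [tensorDeriv_apply, iteratedFDeriv_comp_dilation hQs, PiLp.smul_apply, smul_eq_mul]
  have h1 := h _ ⟨⟨_, hdil⟩, rfl⟩ x hx
  change ‖tensorDeriv j (fun x => Q (z + r • x)) x‖ₑ ≤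
    _ * ∫⁻ y in B, ‖tensorDeriv j (fun x => Q (z + r • x)) y‖ₑ at h1
  simp_rw [hten, enorm_smul] at h1
  rw [lintegral_const_mul' _ _ (by simp), mul_left_comm] at h1
  have hr0 : ‖r ^ j‖ₑ ≠ 0 := by simp [hr.ne']
  have h2 := (ENNReal.mul_le_mul_iff_right hr0 (by simp)).mp h1
  refine h2.trans ?_
  have hanti : AntiLipOn (1 / r) (fun x : Space n => z + r • x) B := by
    intro x _ y _
    rw [dist_add_left, dist_smul₀, Real.norm_of_nonneg hr.le]
    field_simp
    exact le_rfl
  have h3 := hanti.lintegral_comp_le (by positivity) hB.measurableSet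
    (by fun_prop) (mapsTo_image _ B) (f := fun y => ‖tensorDeriv j Q y‖ₑ)
    ((contDiff_tensorDeriv hQs j).continuous.enorm.aemeasurable)
  calc _ ≤ ENNReal.ofReal C * (ENNReal.ofReal (1 / r) ^ n *
        ∫⁻ y in (fun x => z + r • x) '' B, ‖tensorDeriv j Q y‖ₑ) := by gcongr
    _ = _ := by
      rw [← mul_assoc, ← ENNReal.ofReal_pow (by positivity), ← ENNReal.ofReal_mul hC.le]
      congr 2
      rw [one_div, inv_pow, div_eq_mul_inv]

end

section

variable {n : ℕ}

/-! ### Averages along segments -/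

/-- The point `y + s (x - y)` of the segment from `y` to `x`. -/
def segMap (q : Space n × Space n × ℝ) : Space n := q.2.1 + q.2.2 • (q.1 - q.2.1)

lemma measurable_segMap : Measurable (segMap (n := n)) := by
  unfold segMap; fun_prop

/-- The normalized Lebesgue measure on `B`. -/
noncomputable def avgMeasure (B : Set (Space n)) : Measure (Space n) :=
  (volume B)⁻¹ • volume.restrict B

/-- The uniform probability on `B × [0, 1]`. -/
noncomputable def segMeasure (B : Set (Space n)) : Measure (Space n × ℝ) :=
  (avgMeasure B).prod (volume.restrict (Icc 0 1))

lemma isProbabilityMeasure_avgMeasure {B : Set (Space n)} (h0 : volume B ≠ 0)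
    (h1 : volume B ≠ ⊤) : IsProbabilityMeasure (avgMeasure B) :=
  ⟨by simp [avgMeasure, ENNReal.inv_mul_cancel h0 h1]⟩

lemma isProbabilityMeasure_segMeasure {B : Set (Space n)} (h0 : volume B ≠ 0)
    (h1 : volume B ≠ ⊤) : IsProbabilityMeasure (segMeasure B) := by
  have := isProbabilityMeasure_avgMeasure h0 h1
  have : IsProbabilityMeasure ((volume : Measure ℝ).restrict (Icc 0 1)) := ⟨by simp⟩
  unfold segMeasure
  infer_instance

/-- The point is `s x + (1 - s) y`, and one of the weights is at least `1/2`. Substituting in the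
corresponding variable costs at most `2 ^ n`, whereas a substitution in `x` alone would degenerate
as `s` tends to `0`. Convexity keeps the point in `K`. -/
lemma lintegral_segMap_le {K B : Set (Space n)} (hKc : Convex ℝ K) (hK : MeasurableSet K)
    (hB : MeasurableSet B) (hBK : B ⊆ K)
    {f : Space n → ℝ≥0∞} (hf : Measurable f) :
    ∫⁻ s in Icc (0 : ℝ) 1, ∫⁻ y in B, ∫⁻ x in K, f (segMap (x, y, s)) ≤
      2 ^ n * (volume B + volume K) * ∫⁻ x in K, f x := by
  have key : ∀ s ∈ Icc (0 : ℝ) 1, ∫⁻ y in B, ∫⁻ x in K, f (segMap (x, y, s)) ≤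
      2 ^ n * (volume B + volume K) * ∫⁻ x in K, f x := by
    intro s hs
    have h2 : ENNReal.ofReal 2 ^ n = 2 ^ n := by simp
    have hmem : ∀ x ∈ K, ∀ y ∈ K, segMap (x, y, s) ∈ K := by
      intro x hx y hy
      have := hKc hx hy hs.1 (sub_nonneg.mpr hs.2) (by ring)
      convert this using 1
      simp only [segMap]
      module
    rcases le_total (1 / 2) s with h | h
    · have h1 : ∀ y ∈ B, ∫⁻ x in K, f (segMap (x, y, s)) ≤ 2 ^ n * ∫⁻ x in K, f x := by
        intro y hy
        have ha : AntiLipOn 2 (fun x => segMap (x, y, s)) K := by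
          intro x _ x' _
          simp only [segMap]
          rw [dist_add_left, dist_smul₀, dist_sub_right, Real.norm_of_nonneg hs.1]
          nlinarith [dist_nonneg (x := x) (y := x')]
        rw [← h2]
        exact ha.lintegral_comp_le (by norm_num) hK (by unfold segMap; fun_prop)
          (fun x hx => hmem x hx y (hBK hy)) hf.aemeasurable
      calc _ ≤ ∫⁻ y in B, 2 ^ n * ∫⁻ x in K, f x := setLIntegral_mono' hB h1
        _ = 2 ^ n * volume B * ∫⁻ x in K, f x := by
          rw [setLIntegral_const]; ring
        _ ≤ _ := by gcongr; exact le_self_add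
    · have h1 : ∀ x ∈ K, ∫⁻ y in B, f (segMap (x, y, s)) ≤ 2 ^ n * ∫⁻ x in K, f x := by
        intro x hx
        have ha : AntiLipOn 2 (fun y => segMap (x, y, s)) B := by
          intro y _ y' _
          simp only [segMap]
          have : ∀ y : Space n, y + s • (x - y) = s • x + (1 - s) • y := fun y => by module
          rw [this, this, dist_add_left, dist_smul₀, Real.norm_of_nonneg (by linarith)]
          nlinarith [dist_nonneg (x := y) (y := y')]
        rw [← h2]
        exact ha.lintegral_comp_le (by norm_num) hB (by unfold segMap; fun_prop)
          (fun y hy => hmem x hx y (hBK hy)) hf.aemeasurable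
      rw [lintegral_lintegral_swap]
      · calc _ ≤ ∫⁻ x in K, 2 ^ n * ∫⁻ x in K, f x := setLIntegral_mono' hK h1
          _ = 2 ^ n * volume K * ∫⁻ x in K, f x := by
            rw [setLIntegral_const]; ring
          _ ≤ _ := by gcongr; exact le_add_self
      · refine (hf.comp ?_).aemeasurable
        unfold segMap; fun_prop
  refine (setLIntegral_mono' measurableSet_Icc key).trans ?_
  rw [setLIntegral_const]
  simp

/-- The distribution of a random point of a random segment. -/
lemma map_segMap_le {K B : Set (Space n)} (hKc : Convex ℝ K) (hK : MeasurableSet K)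
    (hB : MeasurableSet B) (hBK : B ⊆ K) (h0 : volume B ≠ 0) (h1 : volume B ≠ ⊤) :
    Measure.map segMap ((volume.restrict K).prod (segMeasure B)) ≤
      (2 ^ n * (1 + volume K / volume B)) • volume.restrict K := by
  have := isProbabilityMeasure_avgMeasure h0 h1
  have := isProbabilityMeasure_segMeasure h0 h1
  refine Measure.le_iff.mpr fun S hS => ?_
  have hf : Measurable (S.indicator (1 : Space n → ℝ≥0∞)) := measurable_const.indicator hS
  rw [← lintegral_indicator_one hS, lintegral_map hf measurable_segMap,
    lintegral_prod_symm (fun z => S.indicator (1 : Space n → ℝ≥0∞) (segMap z))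
      (hf.comp measurable_segMap).aemeasurable, segMeasure, lintegral_prod_symm]
  · simp only [avgMeasure, lintegral_smul_measure, smul_eq_mul]
    rw [lintegral_const_mul']
    · calc _ ≤ (volume B)⁻¹ * (2 ^ n * (volume B + volume K) *
            ∫⁻ x in K, S.indicator (1 : Space n → ℝ≥0∞) x) := by
            gcongr
            exact lintegral_segMap_le hKc hK hB hBK hf
        _ = (2 ^ n * (1 + volume K / volume B)) *
            ∫⁻ x in K, S.indicator (1 : Space n → ℝ≥0∞) x := by
            rw [← mul_assoc]
            congr 1
            rw [mul_left_comm, mul_add, ENNReal.inv_mul_cancel h0 h1, ENNReal.div_eq_inv_mul]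
        _ = _ := by
            rw [Measure.smul_apply, ← lintegral_indicator_one hS]; rfl
    · exact ENNReal.inv_ne_top.mpr h0
  · refine Measurable.aemeasurable ?_
    exact Measurable.lintegral_prod_left' (hf.comp measurable_segMap)

/-- Jensen's inequality, read off from the monotonicity of `L^r` norms on a probability space. -/
lemma lintegral_rpow_le_of_isProbabilityMeasure {α : Type*} {m : MeasurableSpace α} {π : Measure α}
    [IsProbabilityMeasure π] {f : α → ℝ≥0∞} (hf : AEMeasurable f π) {r : ℝ} (hr : 1 ≤ r) :
    (∫⁻ q, f q ∂π) ^ r ≤ ∫⁻ q, f q ^ r ∂π := by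
  have h := eLpNorm_le_eLpNorm_of_exponent_le (p := 1) (q := ENNReal.ofReal r) (μ := π) (f := f)
    (by simpa using hr) hf.aestronglyMeasurable
  have hr0 : 0 < r := by linarith
  rw [eLpNorm_one_eq_lintegral_enorm, eLpNorm_eq_lintegral_rpow_enorm_toReal (by simpa using hr0)
    (by simp), ENNReal.toReal_ofReal hr0.le] at h
  simp only [enorm_eq_self] at h
  calc _ ≤ ((∫⁻ q, f q ^ r ∂π) ^ (1 / r)) ^ r := ENNReal.rpow_le_rpow h hr0.le
    _ = _ := by rw [← ENNReal.rpow_mul, one_div_mul_cancel hr0.ne', ENNReal.rpow_one]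

/-- A function which is bounded by averages of `f` is bounded in `L^p` by `f`. -/
lemma eLpNorm_le_of_ae_le_average {X Q E F : Type*} [MeasurableSpace X] [MeasurableSpace Q]
    [NormedAddCommGroup E] [NormedAddCommGroup F] {μ : Measure X} [SFinite μ] {π : Measure Q}
    [IsProbabilityMeasure π] {Ψ : X × Q → X} (hΨ : Measurable Ψ) {C a : ℝ≥0∞} (hC : 1 ≤ C)
    (hmap : Measure.map Ψ (μ.prod π) ≤ C • μ) {p : ℝ≥0∞} (hp : 1 ≤ p) {f : X → E} {g : X → F}
    (hf : AEStronglyMeasurable f μ) (ha : a ≠ ⊤)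
    (h : ∀ᵐ x ∂μ, ‖g x‖ₑ ≤ a * ∫⁻ q, ‖f (Ψ (x, q))‖ₑ ∂π) :
    eLpNorm g p μ ≤ a * C * eLpNorm f p μ := by
  have hac : Measure.map Ψ (μ.prod π) ≪ μ :=
    (Measure.absolutelyContinuous_of_le hmap).trans (Measure.smul_absolutelyContinuous)
  have hfm : AEStronglyMeasurable f (Measure.map Ψ (μ.prod π)) := hf.mono_ac hac
  have hfΨ : AEStronglyMeasurable (fun z => f (Ψ z)) (μ.prod π) := hfm.comp_measurable hΨ
  have h2 : eLpNorm (fun z => f (Ψ z)) p (μ.prod π) ≤ C * eLpNorm f p μ := by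
    have := eLpNorm_map_measure (p := p) hfm hΨ.aemeasurable
    rw [Function.comp_def] at this
    rw [← this]
    refine (eLpNorm_mono_measure _ hmap).trans ((eLpNorm_smul_measure_le _ _ _ _).trans ?_)
    rw [smul_eq_mul]
    gcongr
    -- Since `1 ≤ C`, the factor `C^(1/p)` may be replaced by `C`, which treats all `p` alike,
    -- including `p = ∞`.
    refine (ENNReal.rpow_le_rpow_of_exponent_le hC (z := 1) ?_).trans_eq (ENNReal.rpow_one C)
    rw [one_div, ENNReal.toReal_inv]
    rcases eq_or_ne p ⊤ with rfl | hpt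
    · simp
    · exact inv_le_one_of_one_le₀ (by simpa using ENNReal.toReal_mono hpt hp)
  suffices h3 : eLpNorm g p μ ≤ a * eLpNorm (fun z => f (Ψ z)) p (μ.prod π) by
    calc _ ≤ _ := h3
      _ ≤ a * (C * eLpNorm f p μ) := by gcongr
      _ = _ := by ring
  rcases eq_or_ne p ⊤ with rfl | hpt
  · rw [eLpNorm_exponent_top, eLpNorm_exponent_top]
    refine eLpNormEssSup_le_of_ae_enorm_bound ?_
    have h4 := Measure.ae_ae_of_ae_prod (ae_le_eLpNormEssSup (f := fun z => f (Ψ z)) (μ := μ.prod π))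
    filter_upwards [h, h4] with x hx hx4
    refine hx.trans ?_
    gcongr
    exact (lintegral_mono_ae hx4).trans (by simp)
  · have hp0 : p ≠ 0 := (zero_lt_one.trans_le hp).ne'
    have hr : 1 ≤ p.toReal := by simpa using ENNReal.toReal_mono hpt hp
    have hr0 : 0 < p.toReal := by linarith
    rw [eLpNorm_eq_lintegral_rpow_enorm_toReal hp0 hpt, eLpNorm_eq_lintegral_rpow_enorm_toReal hp0 hpt]
    have h5 : ∫⁻ x, ‖g x‖ₑ ^ p.toReal ∂μ ≤
        a ^ p.toReal * ∫⁻ z, ‖f (Ψ z)‖ₑ ^ p.toReal ∂(μ.prod π) := by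
      rw [lintegral_prod _ (hfΨ.enorm.pow_const _),
        ← lintegral_const_mul' _ _ (ENNReal.rpow_ne_top_of_nonneg hr0.le ha)]
      refine lintegral_mono_ae ?_
      filter_upwards [h, hfΨ.prodMk_left] with x hx hxm
      calc _ ≤ (a * ∫⁻ q, ‖f (Ψ (x, q))‖ₑ ∂π) ^ p.toReal := ENNReal.rpow_le_rpow hx hr0.le
        _ = a ^ p.toReal * (∫⁻ q, ‖f (Ψ (x, q))‖ₑ ∂π) ^ p.toReal :=
            ENNReal.mul_rpow_of_nonneg _ _ hr0.le
        _ ≤ _ := by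
          gcongr
          exact lintegral_rpow_le_of_isProbabilityMeasure hxm.enorm hr
    calc _ ≤ (a ^ p.toReal * ∫⁻ z, ‖f (Ψ z)‖ₑ ^ p.toReal ∂(μ.prod π)) ^ (1 / p.toReal) :=
          ENNReal.rpow_le_rpow h5 (by positivity)
      _ = _ := by
        rw [ENNReal.mul_rpow_of_nonneg _ _ (by positivity), ← ENNReal.rpow_mul,
          mul_one_div_cancel hr0.ne', ENNReal.rpow_one]

/-! ### The Poincaré inequality -/

/-- The fundamental theorem of calculus along the segment. The factor is `n ^ m * n ^ (m + 1)`, the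
cost of passing between operator norms and Euclidean norms of the components for the orders `m` and
`m + 1`. -/
lemma enorm_sub_le_lintegral_segMap {g : Space n → ℝ} (hg : ContDiff ℝ ∞ g) (m : ℕ) (x y : Space n) :
    ‖tensorDeriv m g x - tensorDeriv m g y‖ₑ ≤ ENNReal.ofReal (n ^ (2 * m + 1) * dist x y) *
      ∫⁻ s in Icc (0 : ℝ) 1, ‖tensorDeriv (m + 1) g (segMap (x, y, s))‖ₑ := by
  have hF := contDiff_tensorDeriv hg m
  have hd : ∀ s : ℝ, HasDerivAt (fun s : ℝ => tensorDeriv m g (segMap (x, y, s)))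
      (fderiv ℝ (tensorDeriv m g) (segMap (x, y, s)) (x - y)) s := by
    intro s
    have h1 : HasDerivAt (fun s : ℝ => segMap (x, y, s)) (x - y) s := by
      simpa [segMap] using ((hasDerivAt_id s).smul_const (x - y)).const_add y
    exact ((hF.differentiable (by simp)) _).hasFDerivAt.comp_hasDerivAt s h1
  have hc : Continuous fun s : ℝ => fderiv ℝ (tensorDeriv m g) (segMap (x, y, s)) (x - y) := by
    have h1 : Continuous (fderiv ℝ (tensorDeriv m g)) := hF.continuous_fderiv (by simp)
    have h2 : Continuous fun s : ℝ => segMap (x, y, s) := by unfold segMap; fun_prop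
    fun_prop
  have hint := intervalIntegral.integral_eq_sub_of_hasDerivAt (a := 0) (b := 1) (fun s _ => hd s)
    (hc.intervalIntegrable _ _)
  have e1 : segMap (x, y, (1 : ℝ)) = x := by simp [segMap]
  have e0 : segMap (x, y, (0 : ℝ)) = y := by simp [segMap]
  rw [e1, e0] at hint
  rw [← hint, intervalIntegral.integral_of_le zero_le_one, ← integral_Icc_eq_integral_Ioc]
  refine (enorm_integral_le_lintegral_enorm _).trans ?_
  rw [← lintegral_const_mul' _ _ ENNReal.ofReal_ne_top]
  refine lintegral_mono fun s => ?_
  simp only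
  rw [← ofReal_norm, ← ofReal_norm, ← ENNReal.ofReal_mul (by positivity)]
  refine ENNReal.ofReal_le_ofReal ?_
  set z := segMap (x, y, s)
  have h3 : ‖fderiv ℝ (tensorDeriv m g) z‖ ≤ n ^ (2 * m + 1) * ‖tensorDeriv (m + 1) g z‖ := by
    have h4 : fderiv ℝ (tensorDeriv m g) z =
        (components n m).comp (fderiv ℝ (iteratedFDeriv ℝ m g) z) := by
      have := ((contDiff_iteratedFDeriv_infty hg m).differentiable (by simp) z).hasFDerivAt
      exact ((components n m).hasFDerivAt.comp z this).fderiv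
    have h5 : ‖(components n m).comp (fderiv ℝ (iteratedFDeriv ℝ m g) z)‖ ≤
        n ^ m * ‖fderiv ℝ (iteratedFDeriv ℝ m g) z‖ := by
      refine ContinuousLinearMap.opNorm_le_bound _ (by positivity) fun u => ?_
      rw [ContinuousLinearMap.comp_apply, mul_assoc]
      exact (norm_components_le _).trans (by gcongr; exact ContinuousLinearMap.le_opNorm _ _)
    rw [h4]
    refine h5.trans ?_
    rw [norm_fderiv_iteratedFDeriv]
    calc _ ≤ (n : ℝ) ^ m * (n ^ (m + 1) * ‖tensorDeriv (m + 1) g z‖) := by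
          gcongr; exact norm_iteratedFDeriv_le_tensorDeriv _ _ _
      _ = _ := by ring
  calc _ ≤ ‖fderiv ℝ (tensorDeriv m g) z‖ * ‖x - y‖ := ContinuousLinearMap.le_opNorm _ _
    _ ≤ n ^ (2 * m + 1) * ‖tensorDeriv (m + 1) g z‖ * ‖x - y‖ := by gcongr
    _ = _ := by rw [dist_eq_norm]; ring

lemma enorm_sub_average_le {g : Space n → ℝ} (hg : ContDiff ℝ ∞ g) (m : ℕ) {B : Set (Space n)}
    (hB : IsCompact B) (h0 : volume B ≠ 0) {d : ℝ} {x : Space n} (hd : ∀ y ∈ B, dist x y ≤ d) :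
    ‖tensorDeriv m g x - ∫ y, tensorDeriv m g y ∂(avgMeasure B)‖ₑ ≤
      ENNReal.ofReal (n ^ (2 * m + 1) * d) *
        ∫⁻ q, ‖tensorDeriv (m + 1) g (segMap (x, q))‖ₑ ∂(segMeasure B) := by
  have := isProbabilityMeasure_avgMeasure h0 hB.measure_lt_top.ne
  have hint : Integrable (tensorDeriv m g) (avgMeasure B) :=
    Integrable.smul_measure ((contDiff_tensorDeriv hg m).continuous.continuousOn.integrableOn_compact
      hB) (ENNReal.inv_ne_top.mpr h0)
  have h1 : tensorDeriv m g x - ∫ y, tensorDeriv m g y ∂(avgMeasure B) =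
      ∫ y, (tensorDeriv m g x - tensorDeriv m g y) ∂(avgMeasure B) := by
    rw [integral_sub (integrable_const _) hint]; simp
  rw [h1, segMeasure, lintegral_prod]
  · refine (enorm_integral_le_lintegral_enorm _).trans ?_
    rw [← lintegral_const_mul' _ _ ENNReal.ofReal_ne_top]
    refine lintegral_mono_ae ?_
    have : ∀ᵐ y ∂(avgMeasure B), y ∈ B :=
      Measure.smul_absolutelyContinuous.ae_le (ae_restrict_mem hB.measurableSet)
    filter_upwards [this] with y hy
    refine (enorm_sub_le_lintegral_segMap hg m x y).trans ?_
    gcongr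
    exact hd y hy
  · refine Measurable.aemeasurable ?_
    have h2 : Continuous fun q : Space n × ℝ => segMap (x, q) := by unfold segMap; fun_prop
    exact ((contDiff_tensorDeriv hg (m + 1)).continuous.comp h2).enorm.measurable

/-- The points whose ball of radius `δ / 2` stays inside a bounded convex set form a compact convex
set. Such sets are needed because smoothing is available only on compact subsets. -/
lemma exists_isCompact_convex {K B : Set (Space n)} (hK : IsOpen K) (hKc : Convex ℝ K)
    (hKb : Bornology.IsBounded K) (hB : IsCompact B) (hBK : B ⊆ K) {x : Space n} (hx : x ∈ K) :
    ∃ K', IsCompact K' ∧ Convex ℝ K' ∧ K' ⊆ K ∧ B ⊆ K' ∧ K' ∈ nhds x := by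
  obtain ⟨δ, hδ, h⟩ := (hB.insert x).exists_thickening_subset_open hK (insert_subset hx hBK)
  have h1 : ∀ z ∈ insert x B, ∀ y ∈ Metric.ball z (δ / 2), Metric.ball y (δ / 2) ⊆ K := by
    intro z hz y hy u hu
    refine h (Metric.mem_thickening_iff.mpr ⟨z, hz, ?_⟩)
    have := dist_triangle u y z
    rw [Metric.mem_ball] at hy hu
    linarith
  have hsub : {y | Metric.ball y (δ / 2) ⊆ K} ⊆ K := fun y hy => hy (Metric.mem_ball_self (by linarith))
  refine ⟨{y | Metric.ball y (δ / 2) ⊆ K}, ?_, ?_, hsub, fun z hz => ?_, ?_⟩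
  · refine Metric.isCompact_of_isClosed_isBounded ?_ (hKb.subset hsub)
    refine isClosed_of_closure_subset fun y hy u hu => ?_
    rw [Metric.mem_closure_iff] at hy
    obtain ⟨b, hb, hyb⟩ := hy (δ / 2 - dist u y) (sub_pos.mpr hu)
    refine hb ?_
    rw [Metric.mem_ball]
    linarith [dist_triangle u y b]
  · intro y hy z hz a b ha hb hab u hu
    have h2 : u - (a • y + b • z) ∈ Metric.ball (0 : Space n) (δ / 2) := by
      rw [mem_ball_zero_iff, ← dist_eq_norm]; exact hu
    have h3 : ∀ w : Space n, w + (u - (a • y + b • z)) ∈ Metric.ball w (δ / 2) := by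
      intro w
      rw [Metric.mem_ball, dist_self_add_left]
      exact mem_ball_zero_iff.mp h2
    have h4 := hKc (hy (h3 y)) (hz (h3 z)) ha hb hab
    convert h4 using 1
    obtain rfl : a = 1 - b := by linarith
    module
  · exact h1 z (mem_insert_of_mem _ hz) z (Metric.mem_ball_self (by linarith))
  · filter_upwards [Metric.ball_mem_nhds x (show 0 < δ / 2 by linarith)] with y hy
    exact h1 x (mem_insert _ _) y hy

/-- The truncated difference is the positive part of `f - g`; its integral is arbitrarily small,
hence zero. -/
lemma ae_le_of_lintegral_sub_le {X : Type*} [MeasurableSpace X] {μ : Measure X} {f g : X → ℝ≥0∞}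
    (hf : AEMeasurable f μ) (hg : AEMeasurable g μ) {C : ℝ≥0∞} (hC : C ≠ ⊤)
    (h : ∀ ε : ℝ, 0 < ε → ∫⁻ x, f x - g x ∂μ ≤ C * ENNReal.ofReal ε) : f ≤ᵐ[μ] g := by
  have h0 : ∫⁻ x, f x - g x ∂μ = 0 := by
    have ht : Filter.Tendsto (fun ε : ℝ => C * ENNReal.ofReal ε) (nhdsWithin 0 (Ioi 0)) (nhds 0) := by
      have : Filter.Tendsto (fun ε : ℝ => C * ENNReal.ofReal ε) (nhds 0)
          (nhds (C * ENNReal.ofReal 0)) :=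
        ENNReal.Tendsto.const_mul (ENNReal.continuous_ofReal.tendsto 0) (Or.inr hC)
      simp only [ENNReal.ofReal_zero, mul_zero] at this
      exact this.mono_left nhdsWithin_le_nhds
    exact le_antisymm (ge_of_tendsto ht (by
      filter_upwards [self_mem_nhdsWithin] with ε hε using h ε hε)) zero_le
  replace h0 := (lintegral_eq_zero_iff' (hf.sub hg)).mp h0
  filter_upwards [h0] with x hx using tsub_eq_zero_iff_le.mp hx

lemma IsWeakGrad.integrableOn {l : ℕ} {U K : Set (Space n)} {v : Space n → ℝ}
    {G : Space n → EuclideanSpace ℝ (Fin l → Fin n)} (h : IsWeakGrad l U v G) (hK : IsCompact K)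
    (hKU : K ⊆ U) : IntegrableOn G K :=
  h.2.1.integrableOn_compact_subset hKU hK

/-- The inequality holds for smooth functions, and it passes to the limit in integrated form. The
averages over segments are bounded in `L¹(K)` by the `L¹(K)` norm of the integrand, thanks to
`map_segMap_le`. Hence the integral of the truncated difference of the two sides is at most a
constant times the smoothing error. -/
lemma ae_enorm_sub_average_le_of_isCompact {U K B : Set (Space n)} (hU : IsOpen U)
    (hK : IsCompact K) (hKc : Convex ℝ K) (hKU : K ⊆ U) (hB : IsCompact B) (hBK : B ⊆ K)
    (h0 : volume B ≠ 0) {d : ℝ} (hd : ∀ x ∈ K, ∀ y ∈ B, dist x y ≤ d) {m : ℕ} {v : Space n → ℝ}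
    {G : (j : ℕ) → Space n → EuclideanSpace ℝ (Fin j → Fin n)}
    (hG : ∀ j ≤ m + 1, IsWeakGrad j U v (G j)) :
    ∀ᵐ x ∂(volume.restrict K), ‖G m x - ∫ y, G m y ∂(avgMeasure B)‖ₑ ≤
      ENNReal.ofReal (n ^ (2 * m + 1) * d) *
        ∫⁻ q, ‖G (m + 1) (segMap (x, q))‖ₑ ∂(segMeasure B) := by
  have h1 : volume B ≠ ⊤ := hB.measure_lt_top.ne
  have := isProbabilityMeasure_avgMeasure h0 h1
  have := isProbabilityMeasure_segMeasure h0 h1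
  have hGK : ∀ j ≤ m + 1, AEStronglyMeasurable (G j) (volume.restrict K) := fun j hj =>
    ((hG j hj).integrableOn hK hKU).1
  set C : ℝ≥0∞ := 2 ^ n * (1 + volume K / volume B) with hCdef
  have hCt : C ≠ ⊤ := ENNReal.mul_ne_top (by simp) (ENNReal.add_ne_top.mpr
    ⟨by simp, ENNReal.div_ne_top hK.measure_lt_top.ne h0⟩)
  have hmap := map_segMap_le hKc hK.measurableSet hB.measurableSet hBK h0 h1
  have hac : Measure.map segMap ((volume.restrict K).prod (segMeasure B)) ≪ volume.restrict K :=
    (Measure.absolutelyContinuous_of_le hmap).trans (Measure.smul_absolutelyContinuous)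
  have hseg : ∀ {f : Space n → ℝ≥0∞}, AEMeasurable f (volume.restrict K) →
      AEMeasurable (fun z => f (segMap z)) ((volume.restrict K).prod (segMeasure B)) := fun hf =>
    (hf.mono_ac hac).comp_measurable measurable_segMap
  have hL : ∀ {f : Space n → ℝ≥0∞}, AEMeasurable f (volume.restrict K) →
      ∫⁻ x in K, ∫⁻ q, f (segMap (x, q)) ∂(segMeasure B) ≤ C * ∫⁻ x in K, f x := by
    intro f hf
    have e := lintegral_map' (hf.mono_ac hac) measurable_segMap.aemeasurable
    rw [lintegral_prod _ (hseg hf)] at e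
    rw [← e]
    refine (lintegral_mono' hmap le_rfl).trans ?_
    rw [lintegral_smul_measure, smul_eq_mul]
  refine ae_le_of_lintegral_sub_le (C := 1 + volume K / volume B +
      ENNReal.ofReal (n ^ (2 * m + 1) * d) * C) ?_ ?_ ?_ ?_
  · exact ((hGK m (by omega)).sub aestronglyMeasurable_const).enorm
  · exact ((hseg (hGK (m + 1) le_rfl).enorm).lintegral_prod_right').const_mul _
  · exact ENNReal.add_ne_top.mpr ⟨ENNReal.add_ne_top.mpr
      ⟨by simp, ENNReal.div_ne_top hK.measure_lt_top.ne h0⟩, ENNReal.mul_ne_top ENNReal.ofReal_ne_top hCt⟩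
  intro ε hε
  obtain ⟨g, hg, hgG, -, -⟩ := exists_smoothing hU (hG 0 (by omega)).1 hG hK hKU hε
  have hgm : ∀ j, Continuous (tensorDeriv j g) := fun j => (contDiff_tensorDeriv hg j).continuous
  have hint : ∀ {f : Space n → EuclideanSpace ℝ (Fin m → Fin n)}, IntegrableOn f K →
      Integrable f (avgMeasure B) := fun hf =>
    Integrable.smul_measure (hf.mono_set hBK) (ENNReal.inv_ne_top.mpr h0)
  set e₂ : ℝ≥0∞ := ∫⁻ y, ‖tensorDeriv m g y - G m y‖ₑ ∂(avgMeasure B) with he₂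
  have he₂' : e₂ ≤ (volume B)⁻¹ * ENNReal.ofReal ε := by
    rw [he₂, avgMeasure, lintegral_smul_measure, smul_eq_mul]
    gcongr
    exact (lintegral_mono_set hBK).trans (hgG m (by omega))
  have hdm : AEMeasurable (fun x => ‖tensorDeriv (m + 1) g x - G (m + 1) x‖ₑ) (volume.restrict K) :=
    ((hgm _).aestronglyMeasurable.sub (hGK _ le_rfl)).enorm
  have hpt : ∀ᵐ x ∂(volume.restrict K), ‖G m x - ∫ y, G m y ∂(avgMeasure B)‖ₑ -
      ENNReal.ofReal (n ^ (2 * m + 1) * d) *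
        ∫⁻ q, ‖G (m + 1) (segMap (x, q))‖ₑ ∂(segMeasure B) ≤
      ‖tensorDeriv m g x - G m x‖ₑ + (e₂ + ENNReal.ofReal (n ^ (2 * m + 1) * d) *
        ∫⁻ q, ‖tensorDeriv (m + 1) g (segMap (x, q)) - G (m + 1) (segMap (x, q))‖ₑ
          ∂(segMeasure B)) := by
    have hs : ∀ᵐ x ∂(volume.restrict K),
        AEMeasurable (fun q => ‖tensorDeriv (m + 1) g (segMap (x, q)) -
          G (m + 1) (segMap (x, q))‖ₑ) (segMeasure B) := by
      have h2 : AEStronglyMeasurable (fun z => tensorDeriv (m + 1) g (segMap z) - G (m + 1) (segMap z))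
          ((volume.restrict K).prod (segMeasure B)) :=
        (((hgm _).aestronglyMeasurable.sub (hGK _ le_rfl)).mono_ac hac).comp_measurable
          measurable_segMap
      filter_upwards [h2.prodMk_left] with x hx using hx.enorm
    filter_upwards [hs, ae_restrict_mem hK.measurableSet] with x hx hxK
    rw [tsub_le_iff_right]
    have t1 : G m x - ∫ y, G m y ∂(avgMeasure B) = -(tensorDeriv m g x - G m x) +
        ((∫ y, (tensorDeriv m g y - G m y) ∂(avgMeasure B)) +
        (tensorDeriv m g x - ∫ y, tensorDeriv m g y ∂(avgMeasure B))) := by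
      rw [integral_sub (hint ((hgm m).continuousOn.integrableOn_compact hK))
        (hint ((hG m (by omega)).integrableOn hK hKU))]
      abel
    have t2 := enorm_sub_average_le hg m hB h0 (hd x hxK)
    have t3 : ∫⁻ q, ‖tensorDeriv (m + 1) g (segMap (x, q))‖ₑ ∂(segMeasure B) ≤
        ∫⁻ q, ‖tensorDeriv (m + 1) g (segMap (x, q)) - G (m + 1) (segMap (x, q))‖ₑ
          ∂(segMeasure B) + ∫⁻ q, ‖G (m + 1) (segMap (x, q))‖ₑ ∂(segMeasure B) := by
      rw [← lintegral_add_left' hx]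
      refine lintegral_mono fun q => ?_
      simpa using enorm_add_le (tensorDeriv (m + 1) g (segMap (x, q)) - G (m + 1) (segMap (x, q)))
        (G (m + 1) (segMap (x, q)))
    rw [t1]
    refine (enorm_add_le _ _).trans ?_
    rw [enorm_neg, add_assoc]
    gcongr
    refine (enorm_add_le _ _).trans ?_
    rw [add_assoc]
    gcongr
    · exact enorm_integral_le_lintegral_enorm _
    · rw [← mul_add]
      exact t2.trans (by gcongr)
  refine (lintegral_mono_ae hpt).trans ?_
  have hdm' : AEMeasurable (fun x => ‖tensorDeriv m g x - G m x‖ₑ) (volume.restrict K) :=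
    ((hgm _).aestronglyMeasurable.sub (hGK _ (by omega))).enorm
  rw [lintegral_add_left' hdm',
    lintegral_add_left' aemeasurable_const, setLIntegral_const,
    lintegral_const_mul' _ _ ENNReal.ofReal_ne_top]
  calc _ ≤ ENNReal.ofReal ε + ((volume B)⁻¹ * ENNReal.ofReal ε * volume K +
        ENNReal.ofReal (n ^ (2 * m + 1) * d) * (C * ENNReal.ofReal ε)) := by
        gcongr
        · exact hgG m (by omega)
        · exact (hL hdm).trans (by gcongr; exact hgG _ le_rfl)
    _ = _ := by rw [ENNReal.div_eq_inv_mul]; ring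

/-- The Poincaré inequality on convex sets, pointwise form. -/
lemma ae_enorm_sub_average_le_of_isWeakGrad {K B : Set (Space n)} (hK : IsOpen K)
    (hKc : Convex ℝ K) (hKb : Bornology.IsBounded K) (hB : IsCompact B) (hBK : B ⊆ K)
    (h0 : volume B ≠ 0) {d : ℝ} (hd : ∀ x ∈ K, ∀ y ∈ K, dist x y ≤ d) {m : ℕ} {v : Space n → ℝ}
    {G : (j : ℕ) → Space n → EuclideanSpace ℝ (Fin j → Fin n)}
    (hG : ∀ j ≤ m + 1, IsWeakGrad j K v (G j)) :
    ∀ᵐ x ∂(volume.restrict K), ‖G m x - ∫ y, G m y ∂(avgMeasure B)‖ₑ ≤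
      ENNReal.ofReal (n ^ (2 * m + 1) * d) *
        ∫⁻ q, ‖G (m + 1) (segMap (x, q))‖ₑ ∂(segMeasure B) := by
  rw [ae_iff, Measure.restrict_apply₀']
  -- Being null is a local property, and each point of `K` has a compact convex neighbourhood in `K`
  -- which contains `B`.
  · refine measure_null_of_locally_null _ fun x hx => ?_
    obtain ⟨K', hK', hKc', hKK', hBK', hxK'⟩ := exists_isCompact_convex hK hKc hKb hB hBK hx.2
    have h := ae_enorm_sub_average_le_of_isCompact hK hK' hKc' hKK' hB hBK' h0
      (fun x hx y hy => hd x (hKK' hx) y (hBK hy)) hG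
    rw [ae_iff, Measure.restrict_apply₀' hK'.measurableSet.nullMeasurableSet] at h
    refine ⟨_ ∩ K', Filter.inter_mem self_mem_nhdsWithin (mem_nhdsWithin_of_mem_nhds hxK'), ?_⟩
    exact measure_mono_null (inter_subset_inter_left _ inter_subset_left) h
  · exact hK.measurableSet.nullMeasurableSet

/-- The Poincaré inequality on convex sets. -/
theorem eLpNorm_sub_average_le {K B : Set (Space n)} (hK : IsOpen K)
    (hKc : Convex ℝ K) (hKb : Bornology.IsBounded K) (hB : IsCompact B) (hBK : B ⊆ K)
    (h0 : volume B ≠ 0) {d : ℝ} (hd : ∀ x ∈ K, ∀ y ∈ K, dist x y ≤ d) {m : ℕ} {v : Space n → ℝ}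
    {G : (j : ℕ) → Space n → EuclideanSpace ℝ (Fin j → Fin n)}
    (hG : ∀ j ≤ m + 1, IsWeakGrad j K v (G j)) {p : ℝ≥0∞} (hp : 1 ≤ p) :
    eLpNorm (fun x => G m x - ∫ y, G m y ∂(avgMeasure B)) p (volume.restrict K) ≤
      ENNReal.ofReal (n ^ (2 * m + 1) * d) * (2 ^ n * (1 + volume K / volume B)) *
        eLpNorm (G (m + 1)) p (volume.restrict K) := by
  have h1 : volume B ≠ ⊤ := hB.measure_lt_top.ne
  have := isProbabilityMeasure_segMeasure h0 h1
  refine eLpNorm_le_of_ae_le_average measurable_segMap ?_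
    (map_segMap_le hKc hK.measurableSet hB.measurableSet hBK h0 h1) hp
    ((hG _ le_rfl).2.1.aestronglyMeasurable) ENNReal.ofReal_ne_top
    (ae_enorm_sub_average_le_of_isWeakGrad hK hKc hKb hB hBK h0 hd hG)
  calc (1 : ℝ≥0∞) ≤ 2 ^ n * 1 := by rw [mul_one]; exact one_le_pow₀ (by norm_num)
    _ ≤ _ := by gcongr; exact le_self_add

/-! ### Approximation by polynomials -/

/-- The derivatives of test functions are symmetric. Together with the uniqueness of weak
derivatives this shows that weak derivatives are symmetric almost everywhere. -/
lemma IsWeakGrad.comp_perm {l : ℕ} {U : Set (Space n)} {v : Space n → ℝ}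
    {G : Space n → EuclideanSpace ℝ (Fin l → Fin n)} (h : IsWeakGrad l U v G)
    (σ : Equiv.Perm (Fin l)) :
    IsWeakGrad l U v (fun x => WithLp.toLp 2 fun J => G x (J ∘ σ)) := by
  refine ⟨h.1, ?_, fun J φ hφ hc hs => ?_⟩
  · let L : EuclideanSpace ℝ (Fin l → Fin n) →L[ℝ] EuclideanSpace ℝ (Fin l → Fin n) :=
      LinearMap.toContinuousLinearMap
        { toFun := fun T => WithLp.toLp 2 fun J => T (J ∘ σ)
          map_add' := fun _ _ => rfl
          map_smul' := fun _ _ => rfl }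
    intro x hx
    obtain ⟨s, hs, h2⟩ := h.2.1 x hx
    exact ⟨s, hs, L.integrable_comp h2⟩
  · rw [← h.2.2 (J ∘ σ) φ hφ hc hs]
    congr 1
    ext x
    congr 1
    exact (iteratedFDeriv_comp_perm_of_contDiff hφ _ σ x).symm

/-- Symmetry of the mean is what allows it to be the constant derivative of order `l` of a
homogeneous polynomial. -/
lemma integral_avgMeasure_comp_perm {l : ℕ} {U B : Set (Space n)} (hU : IsOpen U) {v : Space n → ℝ}
    {G : Space n → EuclideanSpace ℝ (Fin l → Fin n)} (h : IsWeakGrad l U v G) (hB : IsCompact B)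
    (hBU : B ⊆ U) (h0 : volume B ≠ 0) (σ : Equiv.Perm (Fin l)) (J : Fin l → Fin n) :
    (∫ y, G y ∂(avgMeasure B)) (J ∘ σ) = (∫ y, G y ∂(avgMeasure B)) J := by
  have hi : Integrable G (avgMeasure B) :=
    Integrable.smul_measure (h.integrableOn hB hBU) (ENNReal.inv_ne_top.mpr h0)
  have hJ : ∀ J, (∫ y, G y ∂(avgMeasure B)) J = ∫ y, G y J ∂(avgMeasure B) := fun J =>
    ((EuclideanSpace.proj J : EuclideanSpace ℝ (Fin l → Fin n) →L[ℝ] ℝ).integral_comp_comm hi).symm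
  rw [hJ, hJ]
  refine integral_congr_ae ?_
  have h1 := ae_restrict_of_ae_restrict_of_subset hBU (h.ae_eq hU (h.comp_perm σ))
  have h2 := (Measure.smul_absolutelyContinuous (c := (volume B)⁻¹)).ae_le h1
  filter_upwards [h2] with y hy
  conv_rhs => rw [hy]

/-- The Bramble–Hilbert lemma. -/
theorem exists_polyLT_approx {K B : Set (Space n)} (hK : IsOpen K)
    (hKc : Convex ℝ K) (hKb : Bornology.IsBounded K) (hB : IsCompact B) (hBK : B ⊆ K)
    (h0 : volume B ≠ 0) {d P : ℝ} (hd0 : 0 ≤ d) (hP0 : 0 ≤ P)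
    (hd : ∀ x ∈ K, ∀ y ∈ K, dist x y ≤ d) {m : ℕ}
    (hP : ∀ j < m, ENNReal.ofReal (n ^ (2 * j + 1)) * (2 ^ n * (1 + volume K / volume B)) ≤
      ENNReal.ofReal P) {v : Space n → ℝ}
    {G : (j : ℕ) → Space n → EuclideanSpace ℝ (Fin j → Fin n)}
    (hG : ∀ j ≤ m, IsWeakGrad j K v (G j)) {p : ℝ≥0∞} (hp : 1 ≤ p) :
    ∃ Q ∈ polyLT n m, ∀ j ≤ m, eLpNorm (fun x => G j x - tensorDeriv j Q x) p (volume.restrict K) ≤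
      ENNReal.ofReal ((P * d) ^ (m - j)) * eLpNorm (G m) p (volume.restrict K) := by
  induction m generalizing v G with
  | zero =>
    refine ⟨0, Submodule.zero_mem _, fun j hj => ?_⟩
    obtain rfl : j = 0 := by omega
    simp [tensorDeriv_eq_zero_of_mem_polyLT (Submodule.zero_mem (polyLT n 0)) le_rfl]
  | succ m ih =>
    -- The homogeneous polynomial `q` has `M`, the mean of `∇^m v`, as its derivative of order `m`.
    -- By the Poincaré inequality `∇^m (v - q)` is controlled by `∇^(m+1) v`, and the induction
    -- hypothesis for `v - q` takes care of the lower orders.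
    set M := ∫ y, G m y ∂(avgMeasure B)
    set q : Space n → ℝ := fun x => (m.factorial : ℝ)⁻¹ * ofComponents n m M (fun _ => x) with hq
    have hqp : q ∈ polyLT n (m + 1) := Submodule.smul_mem _ (m.factorial : ℝ)⁻¹ (diagonal_mem_polyLT M)
    have hqd : ∀ x, tensorDeriv m q x = M := by
      intro x
      rw [hq, tensorDeriv_const_smul (contDiff_of_mem_polyLT (diagonal_mem_polyLT M) m).contDiffAt,
        tensorDeriv_diagonal, smul_smul, inv_mul_cancel₀ (by positivity), one_smul]
      exact fun σ J => integral_avgMeasure_comp_perm hK (hG m (by omega)) hB hBK h0 σ J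
    have hqs := contDiff_of_mem_polyLT hqp
    obtain ⟨Q, hQ, hQG⟩ := ih (v := fun x => v x - q x) (G := fun j x => G j x - tensorDeriv j q x)
      (fun j hj => hP j (by omega))
      (fun j hj => (hG j (by omega)).sub (isWeakGrad_tensorDeriv hK (hqs j).contDiffOn))
    have hQs := contDiff_of_mem_polyLT hQ
    refine ⟨q + Q, Submodule.add_mem _ hqp (polyLT_le_succ n m hQ), fun j hj => ?_⟩
    have hsum : ∀ x, tensorDeriv j (q + Q) x = tensorDeriv j q x + tensorDeriv j Q x := fun x =>
      tensorDeriv_add (hqs j).contDiffAt (hQs j).contDiffAt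
    rcases Nat.lt_or_ge m j with hjm | hjm
    · obtain rfl : j = m + 1 := by omega
      simp only [hsum, tensorDeriv_eq_zero_of_mem_polyLT hqp le_rfl,
        tensorDeriv_eq_zero_of_mem_polyLT hQ (Nat.le_succ m)]
      simp
    · have h1 := eLpNorm_sub_average_le hK hKc hKb hB hBK h0 hd hG hp
      simp only [hsum, ← sub_sub]
      refine (hQG j hjm).trans ?_
      simp only [hqd]
      calc _ ≤ ENNReal.ofReal ((P * d) ^ (m - j)) * (ENNReal.ofReal (P * d) *
            eLpNorm (G (m + 1)) p (volume.restrict K)) := by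
            gcongr
            refine h1.trans ?_
            gcongr
            rw [ENNReal.ofReal_mul (by positivity), ENNReal.ofReal_mul hP0, mul_right_comm]
            gcongr
            exact hP m (by omega)
        _ = _ := by
          rw [← mul_assoc, ← ENNReal.ofReal_mul (by positivity), ← pow_succ,
            show m - j + 1 = m + 1 - j by omega]

end

section

variable {n : ℕ}

/-! ### The reference element -/

lemma coord_mem_affFun (t : AffineBasis (Fin (n + 1)) ℝ (Space n)) (i : Fin (n + 1)) :
    (fun x => t.coord i x) ∈ affFun n := by
  refine mem_affFun.mpr ⟨t.coord i 0, LinearMap.toContinuousLinearMap (t.coord i).linear, ?_⟩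
  ext x
  have := congrFun (AffineMap.decomp (t.coord i)) x
  rw [this]
  simp [add_comm]

lemma affFun_le_span_coord (t : AffineBasis (Fin (n + 1)) ℝ (Space n)) :
    affFun n ≤ Submodule.span ℝ (range fun i => (fun x => t.coord i x)) := by
  intro f hf
  obtain ⟨a, L, rfl⟩ := mem_affFun.mp hf
  have : (fun x => a + L x) = ∑ i, (a + L (t i)) • fun x => t.coord i x := by
    ext x
    have h1 := t.sum_coord_apply_eq_one x
    have h2 := t.linear_combination_coord_eq_self x
    simp only [Finset.sum_apply, Pi.smul_apply, smul_eq_mul]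
    conv_lhs => rw [← h2, map_sum]
    simp only [map_smul, smul_eq_mul, add_mul, Finset.sum_add_distrib, ← Finset.mul_sum, h1, mul_one]
    congr 1
    exact Finset.sum_congr rfl fun i _ => mul_comm _ _
  rw [this]
  exact Submodule.sum_mem _ fun i _ => Submodule.smul_mem _ _ (Submodule.subset_span ⟨i, rfl⟩)

lemma prod_mem_affFun_pow {ι : Type*} (s : Finset ι) (f : ι → Space n → ℝ) (a : ι → ℕ)
    (h : ∀ i ∈ s, f i ∈ affFun n ^ a i) : ∏ i ∈ s, f i ∈ affFun n ^ ∑ i ∈ s, a i := by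
  classical
  induction s using Finset.induction_on with
  | empty => simp
  | insert i s hi ih =>
    rw [Finset.prod_insert hi, Finset.sum_insert hi, pow_add]
    exact Submodule.mul_mem_mul (h i (Finset.mem_insert_self _ _))
      (ih fun j hj => h j (Finset.mem_insert_of_mem hj))

lemma refBasis_mem_polyLT {k : ℕ} (t : AffineBasis (Fin (n + 1)) ℝ (Space n)) (α : NodeIdx n k) :
    refBasis t α ∈ polyLT n (k + 1) := by
  have h1 : refBasis t α = ∏ i, ∏ j ∈ Finset.range (α.1 i : ℕ),
      fun x => (((k : ℝ) * t.coord i x - (j : ℝ)) / ((j : ℝ) + 1)) := by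
    ext x
    simp [refBasis, Finset.prod_apply]
  have hk : affFun n ^ k = affFun n ^ ∑ i, (α.1 i : ℕ) := by rw [α.2]
  change _ ∈ affFun n ^ k
  rw [hk, h1]
  refine prod_mem_affFun_pow _ _ _ fun i _ => ?_
  have := prod_mem_affFun_pow (n := n) (Finset.range (α.1 i : ℕ))
    (fun j x => (((k : ℝ) * t.coord i x - (j : ℝ)) / ((j : ℝ) + 1))) (fun _ => 1) (fun j _ => ?_)
  · simpa using this
  · rw [pow_one]
    have : (fun x => (((k : ℝ) * t.coord i x - (j : ℝ)) / ((j : ℝ) + 1))) =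
        ((k : ℝ) / ((j : ℝ) + 1)) • (fun x => t.coord i x) + fun _ => -(j : ℝ) / ((j : ℝ) + 1) := by
      ext x; simp; ring
    rw [this]
    exact Submodule.add_mem _ (Submodule.smul_mem _ _ (coord_mem_affFun t i)) (const_mem_affFun _)

/-- Barycentric coordinates sum to one, so constants are combinations of them too, and polynomials
of degree at most `k` become homogeneous of degree `k` in these coordinates. -/
lemma affFun_pow_le_span (t : AffineBasis (Fin (n + 1)) ℝ (Space n)) (k : ℕ) :
    affFun n ^ k ≤ Submodule.span ℝ
      {f | ∃ β : Fin (n + 1) → ℕ, ∑ i, β i = k ∧ f = fun x => ∏ i, t.coord i x ^ β i} := by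
  induction k with
  | zero =>
    rw [pow_zero]
    intro f hf
    obtain ⟨a, rfl⟩ := Submodule.mem_one.mp hf
    have : (algebraMap ℝ (Space n → ℝ)) a = a • fun _ => (1 : ℝ) := by ext x; simp
    rw [this]
    exact Submodule.smul_mem _ _ (Submodule.subset_span ⟨0, by simp, by simp⟩)
  | succ k ih =>
    rw [pow_succ']
    refine (mul_le_mul' (affFun_le_span_coord t) ih).trans ?_
    rw [Submodule.span_mul_span]
    refine Submodule.span_mono ?_
    rintro _ ⟨_, ⟨i, rfl⟩, _, ⟨β, hβ, rfl⟩, rfl⟩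
    refine ⟨fun j => β j + if j = i then 1 else 0, by simp [Finset.sum_add_distrib, hβ], ?_⟩
    ext x
    have h1 : ∀ j, t.coord j x ^ (if j = i then 1 else 0) = if j = i then t.coord j x else 1 := by
      intro j; split_ifs <;> simp
    simp only [Pi.mul_apply, pow_add, Finset.prod_mul_distrib, h1]
    simp [mul_comm]

lemma affFun_pow_le_span_range (t : AffineBasis (Fin (n + 1)) ℝ (Space n)) (k : ℕ) :
    affFun n ^ k ≤ Submodule.span ℝ
      (range fun (α : NodeIdx n k) (x : Space n) => ∏ i, t.coord i x ^ (α.1 i : ℕ)) := by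
  refine (affFun_pow_le_span t k).trans (Submodule.span_mono ?_)
  rintro _ ⟨β, hβ, rfl⟩
  have hle : ∀ i, β i < k + 1 := fun i => by
    rw [← hβ]
    exact Nat.lt_succ_of_le (Finset.single_le_sum (fun _ _ => Nat.zero_le _) (Finset.mem_univ i))
  exact ⟨⟨fun i => ⟨β i, hle i⟩, hβ⟩, rfl⟩

/-- The nodal interpolation reproduces the polynomials of degree at most `k`. -/
theorem eq_sum_refBasis {k : ℕ} (hk : k ≠ 0) (t : AffineBasis (Fin (n + 1)) ℝ (Space n))
    {Q : Space n → ℝ} (hQ : Q ∈ polyLT n (k + 1)) :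
    Q = fun x => ∑ α : NodeIdx n k, Q (refNode t α) * refBasis t α x := by
  let W := polyLT n (k + 1)
  have : FiniteDimensional ℝ W := Module.Finite.iff_fg.mpr (fg_polyLT n (k + 1))
  let b : NodeIdx n k → W := fun α => ⟨refBasis t α, refBasis_mem_polyLT t α⟩
  have hb : LinearIndependent ℝ b := by
    rw [Fintype.linearIndependent_iff]
    intro g hg β
    have h1 := congrFun (congrArg Subtype.val hg) (refNode t β)
    rw [Submodule.coe_sum, Finset.sum_apply] at h1
    simpa [b, refBasis_refNode hk] using h1
  -- The monomials of degree `k` in the barycentric coordinates are indexed by the nodes and span a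
  -- space containing `W`, so the dimension of `W` is at most the number of nodes. The independent
  -- nodal basis functions give the other inequality.
  have hcard : Fintype.card (NodeIdx n k) = Module.finrank ℝ W := by
    refine le_antisymm hb.fintype_card_le_finrank ?_
    have : FiniteDimensional ℝ (Submodule.span ℝ
        (range fun (α : NodeIdx n k) (x : Space n) => ∏ i, t.coord i x ^ (α.1 i : ℕ))) :=
      FiniteDimensional.span_of_finite ℝ (finite_range _)
    refine (Submodule.finrank_mono (affFun_pow_le_span_range t k)).trans ?_
    exact finrank_range_le_card _
  have hspan := hb.span_eq_top_of_card_eq_finrank' hcard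
  have hmem : (⟨Q, hQ⟩ : W) ∈ Submodule.span ℝ (range b) := by rw [hspan]; trivial
  obtain ⟨c, hc⟩ := (Submodule.mem_span_range_iff_exists_fun ℝ).mp hmem
  have hQc : ∀ x, Q x = ∑ α, c α * refBasis t α x := by
    intro x
    have := congrFun (congrArg Subtype.val hc) x
    rw [Submodule.coe_sum, Finset.sum_apply] at this
    simpa [b] using this.symm
  ext x
  rw [hQc]
  refine Finset.sum_congr rfl fun α _ => ?_
  rw [hQc (refNode t α)]
  simp [refBasis_refNode hk]

lemma simplex_eq (t : AffineBasis (Fin (n + 1)) ℝ (Space n)) : simplex t = convexHull ℝ (range t) := by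
  rw [simplex, face, image_univ]

lemma convex_simplex (t : AffineBasis (Fin (n + 1)) ℝ (Space n)) : Convex ℝ (simplex t) :=
  convex_convexHull ℝ _

lemma isCompact_face (t : AffineBasis (Fin (n + 1)) ℝ (Space n)) (s : Set (Fin (n + 1))) :
    IsCompact (face t s) := ((toFinite s).image t).isCompact_convexHull ℝ

lemma isCompact_simplex (t : AffineBasis (Fin (n + 1)) ℝ (Space n)) : IsCompact (simplex t) :=
  isCompact_face t _

lemma interior_simplex (t : AffineBasis (Fin (n + 1)) ℝ (Space n)) :
    interior (simplex t) = {x | ∀ i, 0 < t.coord i x} := by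
  rw [simplex_eq, AffineBasis.interior_convexHull]

lemma interior_simplex_nonempty (t : AffineBasis (Fin (n + 1)) ℝ (Space n)) :
    (interior (simplex t)).Nonempty := by
  rw [simplex_eq, interior_convexHull_nonempty_iff_affineSpan_eq_top]
  exact t.tot

lemma closure_interior_simplex (t : AffineBasis (Fin (n + 1)) ℝ (Space n)) :
    closure (interior (simplex t)) = simplex t := by
  rw [(convex_simplex t).closure_interior_eq_closure_of_nonempty_interior
    (interior_simplex_nonempty t), (isCompact_simplex t).isClosed.closure_eq]

lemma refNode_mem_simplex {k : ℕ} (hk : k ≠ 0) (t : AffineBasis (Fin (n + 1)) ℝ (Space n))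
    (α : NodeIdx n k) : refNode t α ∈ simplex t := by
  refine (convex_simplex t).sum_mem (fun i _ => by positivity) ?_ fun i _ =>
    subset_convexHull ℝ _ ⟨i, mem_univ _, rfl⟩
  rw [← Finset.sum_div, ← Nat.cast_sum, α.2]
  exact div_self (Nat.cast_ne_zero.mpr hk)

/-- The barycentric coordinate of a missing vertex vanishes on the face but is positive in the
interior. -/
lemma face_subset_compl_interior (t : AffineBasis (Fin (n + 1)) ℝ (Space n)) {s : Set (Fin (n + 1))}
    (hs : s ≠ univ) : face t s ⊆ (interior (simplex t))ᶜ := by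
  obtain ⟨i, hi⟩ := (ne_univ_iff_exists_notMem s).mp hs
  have h0 : face t s ⊆ {x | t.coord i x = 0} := by
    refine convexHull_min ?_ ?_
    · rintro _ ⟨j, hj, rfl⟩
      have : i ≠ j := fun h => hi (h ▸ hj)
      simp [t.coord_apply, this]
    · exact (convex_singleton (0 : ℝ)).affine_preimage (t.coord i)
  intro x hx hx'
  rw [interior_simplex] at hx'
  exact (hx' i).ne' (h0 hx)

lemma lpSum_le {ι : Type} [Fintype ι] {p : ℝ≥0∞} (hp : 1 ≤ p) {f : ι → ℝ≥0∞} {M : ℝ≥0∞}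
    (h : ∀ i, f i ≤ M) : lpSum p f ≤ Fintype.card ι * M := by
  unfold lpSum
  split_ifs with hpt
  · refine iSup_le fun i => (h i).trans ?_
    have : (1 : ℝ≥0∞) ≤ Fintype.card ι := by
      exact_mod_cast Fintype.card_pos_iff.mpr ⟨i⟩
    calc M = 1 * M := (one_mul M).symm
      _ ≤ _ := by gcongr
  · have hr : 1 ≤ p.toReal := by simpa using ENNReal.toReal_mono hpt hp
    have hr0 : 0 < p.toReal := by linarith
    calc _ ≤ (∑ _i : ι, M ^ p.toReal) ^ (1 / p.toReal) := by
          gcongr with i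
          exact h i
      _ = (Fintype.card ι : ℝ≥0∞) ^ (1 / p.toReal) * M := by
          rw [Finset.sum_const, nsmul_eq_mul, ENNReal.mul_rpow_of_nonneg _ _ (by positivity),
            ← ENNReal.rpow_mul, mul_one_div_cancel hr0.ne', ENNReal.rpow_one, Finset.card_univ]
      _ ≤ _ := by
          gcongr
          rcases Nat.eq_zero_or_pos (Fintype.card ι) with h0 | h0
          · rw [h0, Nat.cast_zero, ENNReal.zero_rpow_of_pos (by positivity)]
          · refine (ENNReal.rpow_le_rpow_of_exponent_le (z := 1) (by exact_mod_cast h0) ?_).trans_eq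
              (ENNReal.rpow_one _)
            rw [one_div]
            exact inv_le_one_of_one_le₀ hr

lemma le_lpSum {ι : Type} [Fintype ι] {p : ℝ≥0∞} (hp : 1 ≤ p) (f : ι → ℝ≥0∞) (i : ι) :
    f i ≤ lpSum p f := by
  unfold lpSum
  split_ifs with hpt
  · exact le_iSup f i
  · have hr : 1 ≤ p.toReal := by simpa using ENNReal.toReal_mono hpt hp
    have hr0 : 0 < p.toReal := by linarith
    calc f i = (f i ^ p.toReal) ^ (1 / p.toReal) := by
          rw [← ENNReal.rpow_mul, mul_one_div_cancel hr0.ne', ENNReal.rpow_one]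
      _ ≤ _ := by
          gcongr
          exact Finset.single_le_sum (f := fun i => f i ^ p.toReal) (fun _ _ => zero_le) (Finset.mem_univ i)

lemma exists_ofReal_of_ne_top {a : ℝ≥0∞} (ha : a ≠ ⊤) : ∃ C : ℝ, 0 < C ∧ a ≤ ENNReal.ofReal C :=
  ⟨a.toReal + 1, by positivity, by
    rw [ENNReal.ofReal_add ENNReal.toReal_nonneg zero_le_one, ENNReal.ofReal_toReal ha]
    exact le_self_add⟩

/-- The Bramble–Hilbert lemma on a fixed convex set. -/
lemma exists_polyLT_approx_const {K : Set (Space n)} (hK : IsOpen K) (hKc : Convex ℝ K)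
    (hKb : Bornology.IsBounded K) (hKn : K.Nonempty) (m : ℕ) {p : ℝ≥0∞} (hp : 1 ≤ p) :
    ∃ C : ℝ, 0 < C ∧ ∀ (v : Space n → ℝ) (G : (j : ℕ) → Space n → EuclideanSpace ℝ (Fin j → Fin n)),
      (∀ j ≤ m, IsWeakGrad j K v (G j)) → ∃ Q ∈ polyLT n m, ∀ j ≤ m,
        eLpNorm (fun x => G j x - tensorDeriv j Q x) p (volume.restrict K) ≤
          ENNReal.ofReal C * eLpNorm (G m) p (volume.restrict K) := by
  obtain ⟨z, hz⟩ := hKn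
  obtain ⟨r, hr, hrK⟩ := Metric.nhds_basis_closedBall.mem_iff.mp (hK.mem_nhds hz)
  have h0 : volume (Metric.closedBall z r) ≠ 0 := (Metric.measure_closedBall_pos _ _ hr).ne'
  have hB : IsCompact (Metric.closedBall z r) := isCompact_closedBall z r
  set a : ℝ≥0∞ := ∑ j ∈ Finset.range m, ENNReal.ofReal (n ^ (2 * j + 1)) *
    (2 ^ n * (1 + volume K / volume (Metric.closedBall z r)))
  have ha : a ≠ ⊤ := by
    refine ENNReal.sum_ne_top.mpr fun j _ => ENNReal.mul_ne_top ENNReal.ofReal_ne_top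
      (ENNReal.mul_ne_top (by simp) (ENNReal.add_ne_top.mpr ⟨by simp, ?_⟩))
    exact ENNReal.div_ne_top hKb.measure_lt_top.ne h0
  obtain ⟨P, hP, haP⟩ := exists_ofReal_of_ne_top ha
  refine ⟨max 1 (P * Metric.diam K) ^ m, by positivity, fun v G hG => ?_⟩
  obtain ⟨Q, hQ, h⟩ := exists_polyLT_approx hK hKc hKb hB hrK h0 Metric.diam_nonneg hP.le
    (fun x hx y hy => Metric.dist_le_diam_of_mem hKb hx hy)
    (fun j hj => (Finset.single_le_sum (fun _ _ => zero_le) (Finset.mem_range.mpr hj)).trans haP) hG hp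
  refine ⟨Q, hQ, fun j hj => (h j hj).trans ?_⟩
  gcongr
  calc (P * Metric.diam K) ^ (m - j) ≤ max 1 (P * Metric.diam K) ^ (m - j) :=
        pow_le_pow_left₀ (mul_nonneg hP.le Metric.diam_nonneg) (le_max_right _ _) _
    _ ≤ _ := pow_le_pow_right₀ (le_max_left _ _) (Nat.sub_le _ _)

/-- Approximation by polynomials in the maximum norm. -/
lemma exists_polyLT_approx_sup {K : Set (Space n)} (hK : IsOpen K) (hKc : Convex ℝ K)
    (hKb : Bornology.IsBounded K) (hKn : K.Nonempty) {m : ℕ} {p : ℝ≥0∞} (hp : 1 ≤ p)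
    (hemb : EmbedsC0 m p K) :
    ∃ C : ℝ, 0 < C ∧ ∀ (w w' : Space n → ℝ)
      (G : (j : ℕ) → Space n → EuclideanSpace ℝ (Fin j → Fin n)),
      (∀ j ≤ m, IsWeakGrad j K w (G j)) → ContinuousOn w' (closure K) →
      w' =ᵐ[volume.restrict K] w → eLpNorm (G m) p (volume.restrict K) ≠ ⊤ →
      ∃ Q ∈ polyLT n m, (∀ j ≤ m,
        eLpNorm (fun x => G j x - tensorDeriv j Q x) p (volume.restrict K) ≤
          ENNReal.ofReal C * eLpNorm (G m) p (volume.restrict K)) ∧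
        ∀ x ∈ closure K, ‖w' x - Q x‖ₑ ≤ ENNReal.ofReal C * eLpNorm (G m) p (volume.restrict K) := by
  obtain ⟨C₁, hC₁, h1⟩ := exists_polyLT_approx_const hK hKc hKb hKn m hp
  obtain ⟨C₂, h2⟩ := hemb
  refine ⟨C₁ + C₂ * ((m + 1) * C₁), by positivity, fun w w' G hG hw' hww hfin => ?_⟩
  obtain ⟨Q, hQ, hQG⟩ := h1 w G hG
  have hQs := contDiff_of_mem_polyLT hQ
  set e := eLpNorm (G m) p (volume.restrict K)
  have hle : ENNReal.ofReal C₁ ≤ ENNReal.ofReal (C₁ + C₂ * ((m + 1) * C₁)) :=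
    ENNReal.ofReal_le_ofReal (le_add_of_nonneg_right (by positivity))
  refine ⟨Q, hQ, fun j hj => (hQG j hj).trans (by gcongr), fun x hx => ?_⟩
  have hwg : ∀ j ≤ m, IsWeakGrad j K (fun x => w x - Q x) (fun x => G j x - tensorDeriv j Q x) :=
    fun j hj => (hG j hj).sub (isWeakGrad_tensorDeriv hK (hQs j).contDiffOn)
  have hS : sobolevNorm m p K (fun x => w x - Q x) ≤ (m + 1 : ℕ) * (ENNReal.ofReal C₁ * e) := by
    have := lpSum_le hp (f := fun j : Fin (m + 1) => gradNorm (j : ℕ) p K (fun x => w x - Q x))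
      (M := ENNReal.ofReal C₁ * e) fun j => by
        rw [gradNorm_eq hK (hwg j (by omega))]
        exact hQG j (by omega)
    simpa [sobolevNorm] using this
  have hSt : MemSobolev m p K (fun x => w x - Q x) :=
    hS.trans_lt (ENNReal.mul_lt_top (by simp) (ENNReal.mul_lt_top (by simp) hfin.lt_top))
  obtain ⟨y, hy, hyae, hyb⟩ := h2 _ hSt
  -- The embedding provides some continuous representative `y` of `w - Q`. It equals `w' - Q` on the
  -- open set `K`, and then on the closure by continuity.
  have heq : EqOn (fun x => w' x - Q x) y (closure K) := by
    have hc : ContinuousOn (fun x => w' x - Q x) (closure K) :=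
      hw'.sub (hQs 0).continuous.continuousOn
    have h3 : EqOn (fun x => w' x - Q x) y K := by
      refine Measure.eqOn_open_of_ae_eq (μ := volume) ?_ hK (hc.mono subset_closure) (hy.mono subset_closure)
      filter_upwards [hww, hyae] with x h4 h5
      rw [h4, h5]
    exact h3.of_subset_closure hc hy subset_closure le_rfl
  have h6 : w' x - Q x = y x := heq hx
  rw [h6]
  refine (hyb x hx).trans ?_
  calc (C₂ : ℝ≥0∞) * sobolevNorm m p K (fun x => w x - Q x)
      ≤ C₂ * ((m + 1 : ℕ) * (ENNReal.ofReal C₁ * e)) := by gcongr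
    _ = ENNReal.ofReal (C₂ * ((m + 1) * C₁)) * e := by
        rw [ENNReal.ofReal_mul (by positivity), ENNReal.ofReal_mul (by positivity),
          ENNReal.ofReal_coe_nnreal, ← mul_assoc, ← mul_assoc, ← mul_assoc]
        congr 3
        rw [← ENNReal.ofReal_natCast]
        push_cast
        rfl
    _ ≤ _ := by
        gcongr
        exact le_add_of_nonneg_left hC₁.le

/-- The maximum norm is bounded by the derivatives of order `m` and the mean over a ball. -/
theorem exists_enorm_le_of_embedsC0 {K B : Set (Space n)} (hK : IsOpen K) (hKc : Convex ℝ K)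
    (hKb : Bornology.IsBounded K) (hB : IsOpen B) (hBn : B.Nonempty) (hBK : B ⊆ K)
    {m : ℕ} {p : ℝ≥0∞} (hp : 1 ≤ p) (hemb : EmbedsC0 m p K) :
    ∃ C : ℝ, 0 < C ∧ ∀ (w w' : Space n → ℝ)
      (G : (j : ℕ) → Space n → EuclideanSpace ℝ (Fin j → Fin n)),
      (∀ j ≤ m, IsWeakGrad j K w (G j)) → ContinuousOn w' (closure K) →
      w' =ᵐ[volume.restrict K] w → ∀ x ∈ closure K, ‖w' x‖ₑ ≤
        ENNReal.ofReal C * (eLpNorm (G m) p (volume.restrict K) + ∫⁻ y in B, ‖w y‖ₑ) := by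
  obtain ⟨C₁, hC₁, h1⟩ := exists_polyLT_approx_sup hK hKc hKb (hBn.mono hBK) hp hemb
  obtain ⟨C₂, hC₂, h2⟩ := exists_polyLT_bound n m 0 hB hBn (hKb.subset hBK)
    (K := closure K) (hKb.isCompact_closure)
  obtain ⟨V, hV, hVB⟩ := exists_ofReal_of_ne_top (a := volume B) (hKb.subset hBK).measure_lt_top.ne
  refine ⟨C₁ + C₂ + C₂ * (C₁ * V), by positivity, fun w w' G hG hw' hww x hx => ?_⟩
  set e := eLpNorm (G m) p (volume.restrict K)
  rcases eq_or_ne e ⊤ with he | he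
  · rw [he, top_add, ENNReal.mul_top]
    · exact le_top
    · simp only [ne_eq, ENNReal.ofReal_eq_zero, not_le]; positivity
  obtain ⟨Q, hQ, -, hQw⟩ := h1 w w' G hG hw' hww he
  have hQs := contDiff_of_mem_polyLT hQ
  have hnorm : ∀ y, ‖tensorDeriv 0 Q y‖ₑ = ‖Q y‖ₑ := by
    intro y
    have h3 : ‖tensorDeriv 0 Q y‖ = ‖Q y‖ := by
      have : tensorDeriv 0 Q y = WithLp.toLp 2 fun _ => Q y := by
        ext J; rw [tensorDeriv_apply]; simp
      rw [this, EuclideanSpace.norm_eq]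
      simp [Real.sqrt_sq_eq_abs]
    rw [← ofReal_norm, h3, ofReal_norm]
  -- The polynomial is controlled everywhere by its `L¹` norm on the small ball `B`, where it
  -- differs from `w` only by the approximation error.
  have h4 : ‖Q x‖ₑ ≤ ENNReal.ofReal C₂ * ∫⁻ y in B, ‖Q y‖ₑ := by
    have := h2 Q hQ 0 1 one_pos x hx
    simpa [hnorm] using this
  have h5 : ∫⁻ y in B, ‖Q y‖ₑ ≤ (∫⁻ y in B, ‖w y‖ₑ) + ENNReal.ofReal C₁ * e * ENNReal.ofReal V := by
    calc _ ≤ ∫⁻ y in B, (ENNReal.ofReal C₁ * e + ‖w y‖ₑ) := by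
          refine lintegral_mono_ae ?_
          filter_upwards [ae_restrict_of_ae_restrict_of_subset hBK hww,
            ae_restrict_mem hB.measurableSet] with y hy hyB
          have h6 := hQw y (subset_closure (hBK hyB))
          rw [hy] at h6
          have : Q y = -(w y - Q y) + w y := by ring
          rw [this]
          refine (enorm_add_le _ _).trans ?_
          rw [enorm_neg]
          gcongr
      _ = ENNReal.ofReal C₁ * e * volume B + ∫⁻ y in B, ‖w y‖ₑ := by
          rw [lintegral_add_left' aemeasurable_const, setLIntegral_const]
      _ ≤ _ := by rw [add_comm]; gcongr
  calc ‖w' x‖ₑ = ‖(w' x - Q x) + Q x‖ₑ := by simp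
    _ ≤ ENNReal.ofReal C₁ * e + ENNReal.ofReal C₂ *
        ((∫⁻ y in B, ‖w y‖ₑ) + ENNReal.ofReal C₁ * e * ENNReal.ofReal V) :=
      (enorm_add_le _ _).trans (add_le_add (hQw x hx) (h4.trans (by gcongr)))
    _ = (ENNReal.ofReal C₁ + ENNReal.ofReal C₂ * (ENNReal.ofReal C₁ * ENNReal.ofReal V)) * e +
        ENNReal.ofReal C₂ * ∫⁻ y in B, ‖w y‖ₑ := by ring
    _ ≤ _ := by
      rw [mul_add, ← ENNReal.ofReal_mul hC₁.le, ← ENNReal.ofReal_mul hC₂.le,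
        ← ENNReal.ofReal_add hC₁.le (by positivity)]
      gcongr ?_ * _ + ?_ * _
      · exact ENNReal.ofReal_le_ofReal (by linarith)
      · refine ENNReal.ofReal_le_ofReal ?_
        have : 0 < C₂ * (C₁ * V) := by positivity
        linarith

lemma tensorDeriv_sum {ι : Type*} (s : Finset ι) {l : ℕ} (f : ι → Space n → ℝ)
    (hf : ∀ i ∈ s, ContDiff ℝ l (f i)) (x : Space n) :
    tensorDeriv l (fun y => ∑ i ∈ s, f i y) x = ∑ i ∈ s, tensorDeriv l (f i) x := by
  classical
  induction s using Finset.induction_on with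
  | empty =>
    have h0 := tensorDeriv_const_smul (l := l) (f := fun _ : Space n => (0 : ℝ)) (x := x)
      contDiffAt_const 0
    simpa using h0
  | insert i s hi ih =>
    have hs : ∀ i ∈ s, ContDiff ℝ l (f i) := fun j hj => hf j (Finset.mem_insert_of_mem hj)
    simp only [Finset.sum_insert hi]
    rw [tensorDeriv_add (hf i (Finset.mem_insert_self _ _)).contDiffAt
      (ContDiff.sum hs).contDiffAt, ih hs]

/-- The error of the interpolation with the boundary nodes left out, on the reference element. -/
theorem exists_interp_bound {k m : ℕ} (hk : k ≠ 0) (hmk : m ≤ k + 1)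
    (t : AffineBasis (Fin (n + 1)) ℝ (Space n)) {p : ℝ≥0∞} (hp : 1 ≤ p)
    (hemb : EmbedsC0 m p (interior (simplex t))) :
    ∃ C : ℝ, 0 < C ∧ ∀ (w w' : Space n → ℝ)
      (G : (j : ℕ) → Space n → EuclideanSpace ℝ (Fin j → Fin n)) (S : Finset (NodeIdx n k)),
      (∀ j ≤ m, IsWeakGrad j (interior (simplex t)) w (G j)) → ContinuousOn w' (simplex t) →
      w' =ᵐ[volume.restrict (interior (simplex t))] w → ∀ j ≤ m,
        eLpNorm (fun x => G j x - tensorDeriv j (fun y => ∑ α ∈ S, w' (refNode t α) * refBasis t α y) x)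
          p (volume.restrict (interior (simplex t))) ≤
        ENNReal.ofReal C * (eLpNorm (G m) p (volume.restrict (interior (simplex t))) +
          ∑ α ∈ Sᶜ, ‖w' (refNode t α)‖ₑ) := by
  have hK : IsOpen (interior (simplex t)) := isOpen_interior
  have hKb : Bornology.IsBounded (interior (simplex t)) :=
    (isCompact_simplex t).isBounded.subset interior_subset
  obtain ⟨C₁, hC₁, h1⟩ := exists_polyLT_approx_sup hK (convex_simplex t).interior hKb
    (interior_simplex_nonempty t) hp hemb
  have hφ : ∀ α : NodeIdx n k, ∀ j : ℕ, ContDiff ℝ j (refBasis t α) := fun α j =>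
    contDiff_of_mem_polyLT (refBasis_mem_polyLT t α) j
  have hφm : ∀ (α : NodeIdx n k) (j : ℕ), Continuous (tensorDeriv j (refBasis t α)) := fun α j =>
    (contDiff_tensorDeriv (contDiff_of_mem_polyLT (refBasis_mem_polyLT t α) ∞) j).continuous
  set N : NodeIdx n k → ℕ → ℝ≥0∞ := fun α j =>
    eLpNorm (tensorDeriv j (refBasis t α)) p (volume.restrict (interior (simplex t)))
  have hN : ∀ α j, N α j ≠ ⊤ := by
    intro α j
    obtain ⟨M, hM⟩ := (isCompact_simplex t).exists_bound_of_continuousOn (hφm α j).continuousOn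
    have : IsFiniteMeasure (volume.restrict (interior (simplex t))) :=
      ⟨by simpa using hKb.measure_lt_top⟩
    exact (MemLp.of_bound (hφm α j).aestronglyMeasurable M (by
      filter_upwards [ae_restrict_mem hK.measurableSet] with x hx
      exact hM x (interior_subset hx))).2.ne
  obtain ⟨V, hV, hNV⟩ := exists_ofReal_of_ne_top (a := ∑ α, ∑ j ∈ Finset.range (m + 1), N α j)
    (ENNReal.sum_ne_top.mpr fun α _ => ENNReal.sum_ne_top.mpr fun j _ => hN α j)
  have hNV' : ∀ α, ∀ j ≤ m, N α j ≤ ENNReal.ofReal V := fun α j hj =>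
    ((Finset.single_le_sum (f := fun j => N α j) (fun _ _ => zero_le)
      (Finset.mem_range.mpr (Nat.lt_succ_of_le hj))).trans (Finset.single_le_sum
      (f := fun α => ∑ j ∈ Finset.range (m + 1), N α j) (fun _ _ => zero_le)
      (Finset.mem_univ α))).trans hNV
  set c : ℕ := Fintype.card (NodeIdx n k)
  refine ⟨C₁ + c * (C₁ * V) + V, by positivity, fun w w' G S hG hw' hww j hj => ?_⟩
  set e := eLpNorm (G m) p (volume.restrict (interior (simplex t)))
  rcases eq_or_ne e ⊤ with he | he
  · rw [he, top_add, ENNReal.mul_top]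
    · exact le_top
    · simp only [ne_eq, ENNReal.ofReal_eq_zero, not_le]; positivity
  obtain ⟨Q, hQ, hQG, hQw⟩ := h1 w w' G hG (by rwa [closure_interior_simplex]) hww he
  rw [closure_interior_simplex] at hQw
  have hQs := contDiff_of_mem_polyLT hQ
  have hrep : ∀ x, tensorDeriv j Q x = ∑ α : NodeIdx n k, Q (refNode t α) • tensorDeriv j (refBasis t α) x := by
    intro x
    conv_lhs => rw [eq_sum_refBasis hk t (polyLT_mono n hmk hQ)]
    rw [tensorDeriv_sum _ _ fun α _ => contDiff_const.mul (hφ α j)]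
    exact Finset.sum_congr rfl fun α _ => tensorDeriv_const_smul (hφ α j).contDiffAt _
  have hint : ∀ x, tensorDeriv j (fun y => ∑ α ∈ S, w' (refNode t α) * refBasis t α y) x =
      ∑ α ∈ S, w' (refNode t α) • tensorDeriv j (refBasis t α) x := by
    intro x
    rw [tensorDeriv_sum _ _ fun α _ => contDiff_const.mul (hφ α j)]
    exact Finset.sum_congr rfl fun α _ => tensorDeriv_const_smul (hφ α j).contDiffAt _
  -- Because `m ≤ k + 1`, the full interpolation reproduces `Q`. What remains is the error of `Q`
  -- itself, the interpolation of `Q - w'` at all nodes, and the basis functions of the omitted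
  -- nodes weighted by the values of `w'`.
  have hsplit : (fun x => G j x -
      tensorDeriv j (fun y => ∑ α ∈ S, w' (refNode t α) * refBasis t α y) x) =
      (fun x => G j x - tensorDeriv j Q x) +
      (∑ α : NodeIdx n k, (Q (refNode t α) - w' (refNode t α)) • tensorDeriv j (refBasis t α) +
       ∑ α ∈ Sᶜ, w' (refNode t α) • tensorDeriv j (refBasis t α)) := by
    ext1 x
    simp only [Pi.add_apply, Finset.sum_apply, Pi.smul_apply, hint, sub_smul, Finset.sum_sub_distrib,
      Pi.sub_apply]
    rw [← Finset.sum_add_sum_compl S fun α => w' (refNode t α) • tensorDeriv j (refBasis t α) x, hrep]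
    abel
  have hm1 : ∀ (s : Finset (NodeIdx n k)) (a : NodeIdx n k → ℝ), AEStronglyMeasurable
      (∑ α ∈ s, a α • tensorDeriv j (refBasis t α)) (volume.restrict (interior (simplex t))) :=
    fun s a => Finset.aestronglyMeasurable_sum s fun α _ =>
      ((hφm α j).const_smul (a α)).aestronglyMeasurable
  have hb1 : ∀ (s : Finset (NodeIdx n k)) (a : NodeIdx n k → ℝ), eLpNorm
      (∑ α ∈ s, a α • tensorDeriv j (refBasis t α)) p (volume.restrict (interior (simplex t))) ≤
      (∑ α ∈ s, ‖a α‖ₑ) * ENNReal.ofReal V := by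
    intro s a
    rw [Finset.sum_mul]
    refine (eLpNorm_sum_le (fun α _ => ((hφm α j).const_smul (a α)).aestronglyMeasurable) hp).trans
      (Finset.sum_le_sum fun α _ => ?_)
    rw [eLpNorm_const_smul]
    gcongr
    exact hNV' α j hj
  have hmG : AEStronglyMeasurable (fun x => G j x - tensorDeriv j Q x)
      (volume.restrict (interior (simplex t))) :=
    (hG j hj).2.1.aestronglyMeasurable.sub
      (contDiff_tensorDeriv (hQs ∞) j).continuous.aestronglyMeasurable
  rw [hsplit]
  refine (eLpNorm_add_le hmG ((hm1 _ _).add (hm1 _ _)) hp).trans ?_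
  refine (add_le_add_right (eLpNorm_add_le (hm1 _ _) (hm1 _ _) hp) _).trans ?_
  calc _ ≤ ENNReal.ofReal C₁ * e + ((∑ _α : NodeIdx n k, ENNReal.ofReal C₁ * e) * ENNReal.ofReal V +
        (∑ α ∈ Sᶜ, ‖w' (refNode t α)‖ₑ) * ENNReal.ofReal V) := by
        gcongr
        · exact hQG j hj
        · refine (hb1 _ _).trans ?_
          gcongr with α
          rw [← enorm_neg, neg_sub]
          exact hQw _ (refNode_mem_simplex hk t α)
        · exact hb1 _ _
    _ = (ENNReal.ofReal C₁ + c * (ENNReal.ofReal C₁ * ENNReal.ofReal V)) * e +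
        ENNReal.ofReal V * (∑ α ∈ Sᶜ, ‖w' (refNode t α)‖ₑ) := by
        rw [Finset.sum_const, nsmul_eq_mul, Finset.card_univ]; ring
    _ ≤ _ := by
      rw [mul_add, ← ENNReal.ofReal_mul hC₁.le, ← ENNReal.ofReal_natCast,
        ← ENNReal.ofReal_mul (by positivity), ← ENNReal.ofReal_add hC₁.le (by positivity)]
      gcongr ?_ * _ + ?_ * _
      · exact ENNReal.ofReal_le_ofReal (by linarith)
      · refine ENNReal.ofReal_le_ofReal ?_
        have : 0 ≤ c * (C₁ * V) := by positivity
        linarith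

end

section

variable {n : ℕ}

/-! ### Derivatives of inverse maps -/

lemma exists_equiv_of_antilipschitz {A : Space n →L[ℝ] Space n} {b : ℝ}
    (h : ∀ u, ‖u‖ ≤ b * ‖A u‖) : ∃ e : Space n ≃L[ℝ] Space n, (e : Space n →L[ℝ] Space n) = A := by
  have hinj : Function.Injective (A : Space n →ₗ[ℝ] Space n) := by
    rw [← LinearMap.ker_eq_bot, LinearMap.ker_eq_bot']
    intro u hu
    have h1 := h u
    rw [show A u = 0 from hu, norm_zero, mul_zero] at h1
    exact norm_le_zero_iff.mp h1
  refine ⟨(LinearEquiv.ofInjectiveEndo (A : Space n →ₗ[ℝ] Space n) hinj).toContinuousLinearEquiv, ?_⟩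
  ext1 x
  rfl

/-- Operators with these bounds form a compact subset of the open set of invertible operators, on
which inversion is smooth. -/
lemma exists_iteratedFDeriv_inverse_bound (n m : ℕ) (b : ℝ) : ∃ M : ℝ, 1 ≤ M ∧
    ∀ A : Space n →L[ℝ] Space n, ‖A‖ ≤ b → (∀ u, ‖u‖ ≤ b * ‖A u‖) → ∀ i ≤ m,
      ‖iteratedFDeriv ℝ i (ContinuousLinearMap.inverse : (Space n →L[ℝ] Space n) → _) A‖ ≤ M := by
  set K : Set (Space n →L[ℝ] Space n) := {A | ‖A‖ ≤ b ∧ ∀ u, ‖u‖ ≤ b * ‖A u‖}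
  have hK : IsCompact K := by
    have : ProperSpace (Space n →L[ℝ] Space n) := FiniteDimensional.proper ℝ _
    refine Metric.isCompact_of_isClosed_isBounded ?_ ?_
    · refine IsClosed.and (isClosed_le continuous_norm continuous_const) ?_
      simp only [ofPred_forall]
      exact isClosed_iInter fun u => isClosed_le continuous_const (by fun_prop)
    · exact (Metric.isBounded_closedBall (x := 0) (r := b)).subset fun A hA => by
        simpa using hA.1
  have hU : IsOpen (range ((↑) : (Space n ≃L[ℝ] Space n) → (Space n →L[ℝ] Space n))) :=
    ContinuousLinearEquiv.isOpen
  obtain ⟨M, hM, h⟩ := exists_iteratedFDeriv_bound (l := m) (K := K) hU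
    (Φ := (ContinuousLinearMap.inverse : (Space n →L[ℝ] Space n) → _)) (by
      rintro _ ⟨e, rfl⟩
      exact (contDiffAt_map_inverse e).contDiffWithinAt) hK fun A hA => by
        obtain ⟨e, he⟩ := exists_equiv_of_antilipschitz hA.2
        exact ⟨e, he⟩
  exact ⟨M, hM, fun A h1 h2 i hi => h A ⟨h1, h2⟩ i hi⟩

lemma norm_iteratedFDeriv_comp_le_of_isOpen {E F G : Type*} [NormedAddCommGroup E] [NormedSpace ℝ E]
    [NormedAddCommGroup F] [NormedSpace ℝ F] [NormedAddCommGroup G] [NormedSpace ℝ G]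
    {g : F → G} {f : E → F} {l : ℕ} {s : Set E} {t : Set F} (ht : IsOpen t) (hs : IsOpen s)
    (hg : ContDiffOn ℝ l g t) (hf : ContDiffOn ℝ l f s) (hst : MapsTo f s t) {x : E} (hx : x ∈ s)
    {C D : ℝ} (hC : ∀ i ≤ l, ‖iteratedFDeriv ℝ i g (f x)‖ ≤ C)
    (hD : ∀ i, 1 ≤ i → i ≤ l → ‖iteratedFDeriv ℝ i f x‖ ≤ D ^ i) :
    ‖iteratedFDeriv ℝ l (g ∘ f) x‖ ≤ l.factorial * C * D ^ l := by
  rw [← iteratedFDerivWithin_of_isOpen l hs hx]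
  refine norm_iteratedFDerivWithin_comp_le hg hf le_rfl ht.uniqueDiffOn hs.uniqueDiffOn hst hx
    (fun i hi => ?_) (fun i hi hil => ?_)
  · rw [iteratedFDerivWithin_of_isOpen i ht (hst hx)]
    exact hC i hi
  · rw [iteratedFDerivWithin_of_isOpen i hs hx]
    exact hD i hi hil

/-- Quantitative inverse function theorem for derivatives of higher order. -/
theorem exists_iteratedFDeriv_le_of_leftInverse (n m : ℕ) (b : ℝ) : ∃ C : ℝ, 1 ≤ C ∧
    ∀ (U V : Set (Space n)) (Φ Ψ : Space n → Space n), IsOpen U → IsOpen V →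
      ContDiffOn ℝ ∞ Φ U → ContDiffOn ℝ ∞ Ψ V → MapsTo Ψ V U → (∀ y ∈ V, Φ (Ψ y) = y) →
      (∀ x ∈ U, ∀ j, 1 ≤ j → j ≤ m → ‖iteratedFDeriv ℝ j Φ x‖ ≤ b) →
      (∀ x ∈ U, ∀ u, ‖u‖ ≤ b * ‖fderiv ℝ Φ x u‖) →
      ∀ y ∈ V, ∀ j, 1 ≤ j → j ≤ m → ‖iteratedFDeriv ℝ j Ψ y‖ ≤ C ^ j := by
  obtain ⟨M, hM1, hM⟩ := exists_iteratedFDeriv_inverse_bound n m b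
  set M' : ℝ := m.factorial * M * (max 1 b) ^ m with hM'
  have hM'0 : 0 ≤ M' := by positivity
  suffices H : ∀ l ≤ m, ∃ C : ℝ, 1 ≤ C ∧
    ∀ (U V : Set (Space n)) (Φ Ψ : Space n → Space n), IsOpen U → IsOpen V →
      ContDiffOn ℝ ∞ Φ U → ContDiffOn ℝ ∞ Ψ V → MapsTo Ψ V U → (∀ y ∈ V, Φ (Ψ y) = y) →
      (∀ x ∈ U, ∀ j, 1 ≤ j → j ≤ m → ‖iteratedFDeriv ℝ j Φ x‖ ≤ b) →
      (∀ x ∈ U, ∀ u, ‖u‖ ≤ b * ‖fderiv ℝ Φ x u‖) →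
      ∀ y ∈ V, ∀ j, 1 ≤ j → j ≤ l → ‖iteratedFDeriv ℝ j Ψ y‖ ≤ C ^ j from H m le_rfl
  intro l
  induction l with
  | zero =>
    intro _
    refine ⟨1, le_rfl, ?_⟩
    intro U V Φ Ψ _ _ _ _ _ _ _ _ y _ j h1 h2
    omega
  | succ l ih =>
    intro hl
    obtain ⟨C, hC1, hC⟩ := ih (by omega)
    refine ⟨max C (l.factorial * M' * C ^ l), hC1.trans (le_max_left _ _), ?_⟩
    intro U V Φ Ψ hU hV hΦ hΨ hVU hinv hΦb hΦi y hy j hj1 hjl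
    rcases Nat.lt_or_ge l j with hlj | hlj
    swap
    · exact (hC U V Φ Ψ hU hV hΦ hΨ hVU hinv hΦb hΦi y hy j hj1 hlj).trans
        (pow_le_pow_left₀ (by linarith) (le_max_left _ _) _)
    obtain rfl : j = l + 1 := by omega
    set g : Space n → (Space n →L[ℝ] Space n) :=
      ContinuousLinearMap.inverse ∘ fderiv ℝ Φ with hg
    have hdΦ : ContDiffOn ℝ ∞ (fderiv ℝ Φ) U := hΦ.fderiv_of_isOpen hU (by simp)
    have hinvs : MapsTo (fderiv ℝ Φ) U
        (range ((↑) : (Space n ≃L[ℝ] Space n) → (Space n →L[ℝ] Space n))) := by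
      intro x hx
      obtain ⟨e, he⟩ := exists_equiv_of_antilipschitz (hΦi x hx)
      exact ⟨e, he⟩
    have hinvc : ContDiffOn ℝ ∞ (ContinuousLinearMap.inverse : (Space n →L[ℝ] Space n) → _)
        (range ((↑) : (Space n ≃L[ℝ] Space n) → (Space n →L[ℝ] Space n))) := by
      rintro _ ⟨e, rfl⟩
      exact (contDiffAt_map_inverse e).contDiffWithinAt
    have hgc : ContDiffOn ℝ ∞ g U := hinvc.comp hdΦ hinvs
    have hgb : ∀ x ∈ U, ∀ i ≤ l, ‖iteratedFDeriv ℝ i g x‖ ≤ M' := by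
      intro x hx i hi
      have h1 : ‖fderiv ℝ Φ x‖ ≤ b := by
        have := hΦb x hx 1 le_rfl (by omega)
        rwa [norm_iteratedFDeriv_one] at this
      refine (norm_iteratedFDeriv_comp_le_of_isOpen (C := M) (D := max 1 b)
        ContinuousLinearEquiv.isOpen hU
        (hinvc.of_le (by exact_mod_cast le_top)) (hdΦ.of_le (by exact_mod_cast le_top)) hinvs hx
        (fun i' hi' => hM _ h1 (hΦi x hx) i' (by omega)) (fun i' hi1 hi' => ?_)).trans ?_
      · rw [norm_iteratedFDeriv_fderiv]
        exact ((hΦb x hx (i' + 1) (by omega) (by omega)).trans (le_max_right _ _)).trans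
          (le_self_pow₀ (le_max_left _ _) (by omega))
      · rw [hM']
        have hfac : ((i.factorial : ℕ) : ℝ) ≤ m.factorial := by
          exact_mod_cast Nat.factorial_le (by omega)
        have hpow : max 1 b ^ i ≤ max 1 b ^ m := pow_le_pow_right₀ (le_max_left _ _) (by omega)
        gcongr
    -- On `V` the derivative of `Ψ` is the inverse of the derivative of `Φ`, evaluated at `Ψ`. The
    -- derivatives of order `l` of this expression involve `Ψ` only up to the order `l`, so the
    -- bounds are gained one order at a time.
    have hdΨ : EqOn (fderiv ℝ Ψ) (g ∘ Ψ) V := by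
      intro z hz
      have hΦz : HasFDerivAt Φ (fderiv ℝ Φ (Ψ z)) (Ψ z) :=
        ((hΦ.contDiffAt (hU.mem_nhds (hVU hz))).differentiableAt (by simp)).hasFDerivAt
      have hΨz : HasFDerivAt Ψ (fderiv ℝ Ψ z) z :=
        ((hΨ.contDiffAt (hV.mem_nhds hz)).differentiableAt (by simp)).hasFDerivAt
      have h1 : (fderiv ℝ Φ (Ψ z)).comp (fderiv ℝ Ψ z) = ContinuousLinearMap.id ℝ _ := by
        refine (hΦz.comp z hΨz).unique ((hasFDerivAt_id z).congr_of_eventuallyEq ?_)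
        filter_upwards [hV.mem_nhds hz] with w hw using hinv w hw
      obtain ⟨e, he⟩ := exists_equiv_of_antilipschitz (hΦi _ (hVU hz))
      rw [hg, Function.comp_apply, Function.comp_apply, ← he, ContinuousLinearMap.inverse_equiv]
      ext1 u
      rw [ContinuousLinearEquiv.coe_coe, ContinuousLinearEquiv.eq_symm_apply]
      have := DFunLike.congr_fun h1 u
      rw [← he] at this
      exact this
    rw [← norm_iteratedFDeriv_fderiv]
    have hev : fderiv ℝ Ψ =ᶠ[nhds y] g ∘ Ψ := by
      filter_upwards [hV.mem_nhds hy] with w hw using hdΨ hw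
    rw [(Filter.EventuallyEq.iteratedFDeriv ℝ hev l).eq_of_nhds]
    refine (norm_iteratedFDeriv_comp_le_of_isOpen (C := M') (D := C) hU hV
      (hgc.of_le (by exact_mod_cast le_top)) (hΨ.of_le (by exact_mod_cast le_top)) hVU hy
      (fun i hi => hgb _ (hVU hy) i hi) (fun i hi1 hi =>
        hC U V Φ Ψ hU hV hΦ hΨ hVU hinv hΦb hΦi y hy i hi1 hi)).trans ?_
    exact (le_max_right _ _).trans (le_self_pow₀ (hC1.trans (le_max_left _ _)) (by omega))

/-- Injectivity holds on all of `W` by the distance estimate. Openness and smoothness of the inverse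
are local and follow from the inverse function theorem. -/
lemma exists_inverse_of_antilipschitz {W : Set (Space n)} (hW : IsOpen W) {F : Space n → Space n}
    (hF : ContDiff ℝ ∞ F) {c : ℝ} (hanti : AntiLipOn c F W)
    (hd : ∀ x ∈ W, ∀ u, ‖u‖ ≤ c * ‖fderiv ℝ F x u‖) :
    (∀ S ⊆ W, IsOpen S → IsOpen (F '' S)) ∧
      ∃ G : Space n → Space n, (∀ x ∈ W, G (F x) = x) ∧ ContDiffOn ℝ ∞ G (F '' W) := by
  have hloc : ∀ x ∈ W, ∃ e : Space n ≃L[ℝ] Space n, HasFDerivAt F (e : Space n →L[ℝ] Space n) x := by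
    intro x hx
    obtain ⟨e, he⟩ := exists_equiv_of_antilipschitz (hd x hx)
    exact ⟨e, he ▸ (hF.differentiable (by simp) x).hasFDerivAt⟩
  have hG : ∀ x ∈ W, Function.invFunOn F W (F x) = x := fun x hx =>
    hanti.injOn.leftInvOn_invFunOn hx
  refine ⟨fun S hS hSo => ?_, Function.invFunOn F W, hG, ?_⟩
  · rw [isOpen_iff_mem_nhds]
    rintro _ ⟨x, hx, rfl⟩
    obtain ⟨e, he⟩ := hloc x (hS hx)
    rw [← (hF.contDiffAt.hasStrictFDerivAt' he (by simp)).map_nhds_eq_of_equiv]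
    exact Filter.image_mem_map (hSo.mem_nhds hx)
  · rintro _ ⟨x, hx, rfl⟩
    obtain ⟨e, he⟩ := hloc x hx
    have h1 := (hF.contDiffAt (x := x)).to_localInverse he (by simp)
    refine ContDiffAt.contDiffWithinAt (h1.congr_of_eventuallyEq ?_)
    refine (hF.contDiffAt.hasStrictFDerivAt' he (by simp)).localInverse_unique ?_
    filter_upwards [hW.mem_nhds hx] with y hy using hG y hy

/-- `F` is a parametric map onto a curved element of size `h`. -/
structure IsElemMap (k : ℕ) (t : AffineBasis (Fin (n + 1)) ℝ (Space n)) (b h : ℝ)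
    (F : Space n → Space n) : Prop where
  contDiff : ContDiff ℝ ∞ F
  antilip : AntiLipOn (b / h) F (simplex t)
  dist_le : ∀ x ∈ simplex t, ∀ y ∈ simplex t, dist (F x) (F y) ≤ b * h * dist x y
  norm_deriv_le : ∀ j, 1 ≤ j → j ≤ k + 1 → ∀ x ∈ simplex t, ‖iteratedFDeriv ℝ j F x‖ ≤ (b * h) ^ j
  isOpen_image : IsOpen (F '' interior (simplex t))
  interior_image : interior (F '' simplex t) = F '' interior (simplex t)
  exists_inverse : ∃ G : Space n → Space n, ContDiffOn ℝ ∞ G (F '' interior (simplex t)) ∧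
    (∀ x ∈ interior (simplex t), G (F x) = x) ∧
    ∀ y ∈ F '' interior (simplex t), ∀ j, 1 ≤ j → j ≤ k + 1 →
      ‖iteratedFDeriv ℝ j G y‖ ≤ (b / h) ^ j

/-- Small perturbations of affine maps are parametric maps. -/
theorem exists_isElemMap (k : ℕ) (t : AffineBasis (Fin (n + 1)) ℝ (Space n)) {a : ℝ} (ha : 1 ≤ a) :
    ∃ b h₀ : ℝ, 1 ≤ b ∧ 0 < h₀ ∧ ∀ (h : ℝ) (z : Space n) (L : Space n →L[ℝ] Space n)
      (e : NodeIdx n k → Space n), 0 < h → h ≤ h₀ → ‖L‖ ≤ a * h → (∀ u, ‖u‖ ≤ a / h * ‖L u‖) →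
      (∀ α, ‖e α‖ ≤ a * h ^ 2) →
      (∀ j, 1 ≤ j → j ≤ k + 1 → ∀ x ∈ simplex t,
        ‖iteratedFDeriv ℝ j (fun x => z + L x + ∑ α, refBasis t α x • e α) x‖ ≤ (a * h) ^ j) →
      IsElemMap k t b h (fun x => z + L x + ∑ α, refBasis t α x • e α) := by
  obtain ⟨R, hR⟩ := (isCompact_simplex t).isBounded.subset_ball 0
  -- The estimates are proved on a ball around the closed simplex, because the inverse function
  -- theorem needs an open set and the boundary points of the simplex must be included.
  set W := Metric.ball (0 : Space n) R
  have hφ : ∀ α : NodeIdx n k, ContDiff ℝ ∞ (refBasis t α) := fun α =>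
    contDiff_of_mem_polyLT (refBasis_mem_polyLT t α) _
  have hMα : ∀ α : NodeIdx n k, ∃ M : ℝ, ∀ x ∈ Metric.closedBall (0 : Space n) R,
      ‖fderiv ℝ (refBasis t α) x‖ ≤ M := fun α =>
    (isCompact_closedBall _ _).exists_bound_of_continuousOn
      ((hφ α).continuous_fderiv (by simp)).continuousOn
  choose M hM using hMα
  set E : ℝ := (∑ α, |M α|) * a with hE
  have hE0 : 0 ≤ E := mul_nonneg (Finset.sum_nonneg fun _ _ => abs_nonneg _) (by linarith)
  obtain ⟨C, hC1, hC⟩ := exists_iteratedFDeriv_le_of_leftInverse n (k + 1) (2 * a ^ (k + 1))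
  have hb1 : 1 ≤ max C (2 * a + E) := hC1.trans (le_max_left _ _)
  -- The bound on `h` makes the Lipschitz constant `E h²` of the perturbation at most half of the
  -- lower bound `h / a` for the linear part. The constant `b` dominates `2 a` for the lower
  -- distance estimate, `a + E` for the upper one, and `C` for the derivatives of the inverse.
  refine ⟨max C (2 * a + E), min 1 (1 / (2 * a * (E + 1))), hb1,
    by positivity, ?_⟩
  intro h z L e hh hh0 hLa hLi he hder
  set b := max C (2 * a + E) with hb
  have hh1 : h ≤ 1 := hh0.trans (min_le_left _ _)
  have ha0 : 0 < a := by linarith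
  have hhE : E * h ^ 2 ≤ h / (2 * a) := by
    have h1 : h ≤ 1 / (2 * a * (E + 1)) := hh0.trans (min_le_right _ _)
    rw [le_div_iff₀ (by positivity)] at h1 ⊢
    nlinarith [mul_nonneg hE0 hh.le, mul_pos ha0 hh]
  set P : Space n → Space n := fun x => ∑ α, refBasis t α x • e α with hP
  set F : Space n → Space n := fun x => z + L x + P x with hF
  have hPs : ContDiff ℝ ∞ P := ContDiff.sum fun α _ => (hφ α).smul contDiff_const
  have hFs : ContDiff ℝ ∞ F := (contDiff_const.add L.contDiff).add hPs
  have hdP : ∀ x ∈ W, ‖fderiv ℝ P x‖ ≤ E * h ^ 2 := by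
    intro x hx
    have h1 : HasFDerivAt P (∑ α, (fderiv ℝ (refBasis t α) x).smulRight (e α)) x :=
      HasFDerivAt.fun_sum fun α _ => (((hφ α).differentiable (by simp) x).hasFDerivAt).smul_const _
    rw [h1.fderiv, hE, Finset.sum_mul, Finset.sum_mul]
    refine (norm_sum_le _ _).trans (Finset.sum_le_sum fun α _ => ?_)
    rw [ContinuousLinearMap.norm_smulRight_apply, mul_assoc]
    exact mul_le_mul ((hM α x (Metric.ball_subset_closedBall hx)).trans (le_abs_self _)) (he α)
      (norm_nonneg _) (abs_nonneg _)
  have hPL : ∀ x ∈ W, ∀ y ∈ W, ‖P x - P y‖ ≤ E * h ^ 2 * ‖x - y‖ := fun x hx y hy =>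
    (convex_ball (0 : Space n) R).norm_image_sub_le_of_norm_fderiv_le
      (fun x _ => hPs.differentiable (by simp) x) hdP hy hx
  have hLi' : ∀ u, h / a * ‖u‖ ≤ ‖L u‖ := by
    intro u
    have := hLi u
    calc h / a * ‖u‖ ≤ h / a * (a / h * ‖L u‖) := by gcongr
      _ = _ := by field_simp
  have hsub : ∀ x y, F x - F y = L (x - y) + (P x - P y) := by
    intro x y
    simp only [hF, map_sub]
    abel
  have hlow : ∀ u w : Space n, ‖w‖ ≤ E * h ^ 2 * ‖u‖ → ‖u‖ ≤ 2 * a / h * ‖L u + w‖ := by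
    intro u w hw
    have h1 := norm_sub_le (L u + w) w
    rw [add_sub_cancel_right] at h1
    have h2 := hLi' u
    have h3 : E * h ^ 2 * ‖u‖ ≤ h / (2 * a) * ‖u‖ := by gcongr
    have h4 : h / a * ‖u‖ = 2 * (h / (2 * a) * ‖u‖) := by field_simp
    have h5 : h / (2 * a) * ‖u‖ ≤ ‖L u + w‖ := by linarith
    calc ‖u‖ = 2 * a / h * (h / (2 * a) * ‖u‖) := by field_simp
      _ ≤ _ := by gcongr
  have hanti : AntiLipOn (2 * a / h) F W := by
    intro x hx y hy
    rw [dist_eq_norm, dist_eq_norm, hsub]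
    exact hlow _ _ (hPL x hx y hy)
  have hdF : ∀ x, fderiv ℝ F x = L + fderiv ℝ P x := by
    intro x
    have h1 : HasFDerivAt F (L + fderiv ℝ P x) x :=
      (L.hasFDerivAt.const_add z).add (hPs.differentiable (by simp) x).hasFDerivAt
    exact h1.fderiv
  have hdi : ∀ x ∈ W, ∀ u, ‖u‖ ≤ 2 * a / h * ‖fderiv ℝ F x u‖ := by
    intro x hx u
    rw [hdF, add_apply]
    exact hlow _ _ ((ContinuousLinearMap.le_opNorm _ _).trans (by gcongr; exact hdP x hx))
  obtain ⟨hopen, G, hGF, hGs⟩ := exists_inverse_of_antilipschitz Metric.isOpen_ball hFs hanti hdi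
  have hTW : simplex t ⊆ W := hR
  have hIW : interior (simplex t) ⊆ W := interior_subset.trans hTW
  have hbC : C ≤ b := le_max_left _ _
  have hba : 2 * a + E ≤ b := le_max_right _ _
  have hIo := hopen _ hIW isOpen_interior
  refine ⟨hFs, ?_, ?_, ?_, hIo, ?_, G, ?_, fun x hx => hGF x (hIW hx), ?_⟩
  · intro x hx y hy
    refine (hanti.mono hTW x hx y hy).trans ?_
    gcongr
    linarith
  · intro x hx y hy
    rw [dist_eq_norm, dist_eq_norm, hsub]
    calc _ ≤ ‖L (x - y)‖ + ‖P x - P y‖ := norm_add_le _ _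
      _ ≤ a * h * ‖x - y‖ + E * h ^ 2 * ‖x - y‖ := by
          gcongr
          · exact (ContinuousLinearMap.le_opNorm _ _).trans (by gcongr)
          · exact hPL x (hTW hx) y (hTW hy)
      _ ≤ a * h * ‖x - y‖ + E * h * ‖x - y‖ := by
          gcongr
          nlinarith
      _ = (a + E) * h * ‖x - y‖ := by ring
      _ ≤ _ := by gcongr; linarith
  · intro j hj1 hjk x hx
    refine (hder j hj1 hjk x hx).trans (pow_le_pow_left₀ (by positivity) ?_ _)
    gcongr
    linarith
  -- If `F x` is interior to the image, points near `x` are mapped into the image, and injectivity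
  -- on the larger ball `W` puts them into the simplex.
  · refine Subset.antisymm ?_ (interior_maximal (image_mono interior_subset) hIo)
    intro y hy
    obtain ⟨x, hx, rfl⟩ := interior_subset hy
    refine ⟨x, ?_, rfl⟩
    rw [mem_interior_iff_mem_nhds]
    have h1 : F ⁻¹' (F '' simplex t) ∈ nhds x :=
      hFs.continuous.continuousAt.preimage_mem_nhds (mem_interior_iff_mem_nhds.mp hy)
    filter_upwards [h1, Metric.isOpen_ball.mem_nhds (hTW hx)] with w ⟨w', hw', hww'⟩ hwW
    rwa [← hanti.injOn (hTW hw') hwW hww']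
  · exact hGs.mono (image_mono hIW)
  · intro y hy j hj1 hjk
    have hhn : ‖h⁻¹‖ = h⁻¹ := by rw [Real.norm_of_nonneg (by positivity)]
    -- The quantitative inverse function theorem is applied to `h⁻¹ F`, whose derivatives and lower
    -- bound do not depend on `h`. Undoing the dilation in the argument of the inverse contributes
    -- the factor `h⁻¹` per derivative.
    set V : Set (Space n) := (fun y => h • y) ⁻¹' (F '' interior (simplex t))
    have hV : IsOpen V := hIo.preimage (by fun_prop)
    set Ψ : Space n → Space n := fun y => G (h • y)
    have hΨs : ContDiffOn ℝ ∞ Ψ V :=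
      (hGs.mono (image_mono hIW)).comp (contDiff_id.const_smul h).contDiffOn fun y hy => hy
    have hFi : ∀ (i : ℕ) x, ‖iteratedFDeriv ℝ i (fun x => h⁻¹ • F x) x‖ =
        h⁻¹ * ‖iteratedFDeriv ℝ i F x‖ := by
      intro i x
      have := iteratedFDeriv_const_smul_apply (𝕜 := ℝ) (i := i) (a := h⁻¹) (f := F) (x := x)
        (hFs.contDiffAt.of_le (by exact_mod_cast le_top))
      rw [show (fun x => h⁻¹ • F x) = h⁻¹ • F from rfl, this, norm_smul, hhn]
    have key := hC (interior (simplex t)) V (fun x => h⁻¹ • F x) Ψ isOpen_interior hV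
      (hFs.const_smul _).contDiffOn hΨs ?_ ?_ ?_ ?_
    · have hyV : h⁻¹ • y ∈ V := by
        change h • h⁻¹ • y ∈ F '' interior (simplex t)
        rwa [smul_inv_smul₀ hh.ne']
      have h1 := key (h⁻¹ • y) hyV j hj1 hjk
      let S : Space n →L[ℝ] Space n := h⁻¹ • ContinuousLinearMap.id ℝ _
      have hSV : S ⁻¹' V = F '' interior (simplex t) := by
        ext w
        change h • h⁻¹ • w ∈ F '' interior (simplex t) ↔ _
        rw [smul_inv_smul₀ hh.ne']
      have hΨS : Ψ ∘ S = G := by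
        ext1 w
        change G (h • h⁻¹ • w) = _
        rw [smul_inv_smul₀ hh.ne']
      have h2 := S.iteratedFDerivWithin_comp_right (f := Ψ) (s := V) (n := ∞) (i := j) (x := y) hΨs
        hV.uniqueDiffOn (by rw [hSV]; exact hIo.uniqueDiffOn) hyV (by exact_mod_cast le_top)
      rw [hΨS, hSV, iteratedFDerivWithin_of_isOpen j hIo hy] at h2
      have h3 : iteratedFDerivWithin ℝ j Ψ V (S y) = iteratedFDeriv ℝ j Ψ (h⁻¹ • y) :=
        iteratedFDerivWithin_of_isOpen j hV hyV
      rw [h3] at h2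
      rw [h2]
      refine (ContinuousMultilinearMap.norm_compContinuousLinearMap_le _ _).trans ?_
      have hS : ‖S‖ ≤ h⁻¹ := by
        refine ContinuousLinearMap.opNorm_le_bound _ (by positivity) fun u => ?_
        change ‖h⁻¹ • u‖ ≤ _
        rw [norm_smul, hhn]
      rw [Finset.prod_const, Finset.card_univ, Fintype.card_fin, div_eq_mul_inv, mul_pow]
      exact mul_le_mul (h1.trans (pow_le_pow_left₀ (by linarith) hbC _))
        (pow_le_pow_left₀ (norm_nonneg _) hS _) (by positivity) (by positivity)
    · rintro w ⟨x, hx, hxw⟩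
      change G (h • w) ∈ _
      have hxw' : F x = h • w := hxw
      rwa [← hxw', hGF x (hIW hx)]
    · rintro w ⟨x, hx, hxw⟩
      have hxw' : F x = h • w := hxw
      change h⁻¹ • F (G (h • w)) = w
      rw [← hxw', hGF x (hIW hx), hxw', inv_smul_smul₀ hh.ne']
    · intro x hx i hi1 hik
      rw [hFi]
      obtain ⟨i, rfl⟩ : ∃ i', i = i' + 1 := ⟨i - 1, by omega⟩
      calc h⁻¹ * ‖iteratedFDeriv ℝ (i + 1) F x‖ ≤ h⁻¹ * (a * h) ^ (i + 1) := by
            gcongr; exact hder _ hi1 hik x (interior_subset hx)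
        _ = a ^ (i + 1) * h ^ i := by rw [mul_pow, pow_succ h]; field_simp
        _ ≤ a ^ (k + 1) * 1 := by
            exact mul_le_mul (pow_le_pow_right₀ ha hik) (pow_le_one₀ hh.le hh1) (by positivity)
              (by positivity)
        _ ≤ _ := by nlinarith [pow_pos ha0 (k + 1)]
    · intro x hx u
      have h1 : fderiv ℝ (fun x => h⁻¹ • F x) x = h⁻¹ • fderiv ℝ F x :=
        ((hFs.differentiable (by simp) x).hasFDerivAt.const_smul h⁻¹).fderiv
      rw [h1, smul_apply, norm_smul, hhn]
      refine (hdi x (hIW hx) u).trans ?_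
      rw [div_eq_mul_inv, mul_assoc]
      gcongr
      exact le_self_pow₀ ha (by omega)

end

section

variable {n : ℕ}

/-! ### Geometry of the mesh -/

/-- Each component is a polynomial of degree at most one, hence reproduced when `k ≠ 0`. This
compares the parametric map with the affine one. -/
lemma eq_sum_refBasis_smul {k : ℕ} (hk : k ≠ 0) (t : AffineBasis (Fin (n + 1)) ℝ (Space n))
    (A : Space n →ᵃ[ℝ] Space n) (x : Space n) :
    A x = ∑ α : NodeIdx n k, refBasis t α x • A (refNode t α) := by
  ext i
  have hQ : (fun x => A x i) ∈ polyLT n (k + 1) := by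
    refine polyLT_mono n (show 2 ≤ k + 1 by omega) ?_
    change _ ∈ affFun n ^ 1
    rw [pow_one]
    refine mem_affFun.mpr ⟨A 0 i, (EuclideanSpace.proj i).comp
      (LinearMap.toContinuousLinearMap A.linear), ?_⟩
    ext x
    have := congrFun (AffineMap.decomp A) x
    rw [this]
    simp [add_comm]
  have h1 := congrFun (eq_sum_refBasis hk t hQ) x
  simp only at h1
  rw [h1]
  simp [mul_comm]

lemma exists_closedBall_subset_simplex (t : AffineBasis (Fin (n + 1)) ℝ (Space n)) :
    ∃ (z : Space n) (r : ℝ), 0 < r ∧ Metric.closedBall z r ⊆ interior (simplex t) := by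
  obtain ⟨z, hz⟩ := interior_simplex_nonempty t
  obtain ⟨r, hr, h⟩ := Metric.nhds_basis_closedBall.mem_iff.mp (isOpen_interior.mem_nhds hz)
  exact ⟨z, r, hr, h⟩

lemma norm_map_le_of_sphere {f : Space n →ₗ[ℝ] Space n} {r M : ℝ} (hr : 0 < r)
    (h : ∀ u, ‖u‖ = r → ‖f u‖ ≤ M) (u : Space n) : ‖f u‖ ≤ M / r * ‖u‖ := by
  rcases eq_or_ne u 0 with rfl | hu
  · simp
  · have hu' : 0 < ‖u‖ := norm_pos_iff.mpr hu
    have h1 := h ((r / ‖u‖) • u) (by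
      rw [norm_smul, Real.norm_of_nonneg (by positivity), div_mul_cancel₀ _ hu'.ne'])
    rw [map_smul, norm_smul, Real.norm_of_nonneg (by positivity), div_mul_eq_mul_div,
      div_le_iff₀ hu'] at h1
    rw [div_mul_eq_mul_div, le_div_iff₀ hr]
    linarith

variable {k : ℕ}

namespace Mesh

variable (𝒯 : Mesh n k) (t : AffineBasis (Fin (n + 1)) ℝ (Space n))

lemma isBounded_straight (i : Fin 𝒯.card) : Bornology.IsBounded (𝒯.straight t i) := by
  have h : Continuous (𝒯.aff i) := (𝒯.aff i).toAffineMap.continuous_of_finiteDimensional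
  exact ((isCompact_simplex t).image h).isBounded

lemma diam_le_size (i : Fin 𝒯.card) : 𝒯.diam t i ≤ 𝒯.size t :=
  le_ciSup (f := fun i => 𝒯.diam t i) (finite_range _).bddAbove i

lemma diam_pos (hn : n ≠ 0) (i : Fin 𝒯.card) : 0 < 𝒯.diam t i := by
  obtain ⟨z, r, hr, h⟩ := exists_closedBall_subset_simplex t
  have : Nonempty (Fin n) := ⟨⟨0, by omega⟩⟩
  obtain ⟨u, hu⟩ : ∃ u : Space n, ‖u‖ = r := ⟨EuclideanSpace.single ⟨0, by omega⟩ r, by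
    simp [abs_of_pos hr]⟩
  have h1 : z + u ∈ simplex t := interior_subset (h (by simp [hu]))
  have h2 : z ∈ simplex t := interior_subset (h (by simp [hr.le]))
  refine lt_of_lt_of_le ?_ (Metric.dist_le_diam_of_mem (𝒯.isBounded_straight t i)
    (mem_image_of_mem _ h1) (mem_image_of_mem _ h2))
  rw [dist_pos]
  intro h3
  have := (𝒯.aff i).injective h3
  rw [add_eq_left] at this
  rw [this, norm_zero] at hu
  exact hr.ne hu

lemma aff_sub (i : Fin 𝒯.card) (x u : Space n) :
    𝒯.aff i (x + u) - 𝒯.aff i x = (𝒯.aff i).linear u := by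
  have := (𝒯.aff i).map_vadd x u
  rw [vadd_eq_add, vadd_eq_add, add_comm] at this
  rw [this, add_sub_cancel_right]

lemma norm_linear_le {z : Space n} {r : ℝ} (hr : 0 < r) (h : Metric.closedBall z r ⊆ simplex t)
    (i : Fin 𝒯.card) (u : Space n) : ‖(𝒯.aff i).linear u‖ ≤ 𝒯.diam t i / r * ‖u‖ := by
  refine norm_map_le_of_sphere (f := ((𝒯.aff i).linear : Space n →ₗ[ℝ] Space n)) hr (fun u hu => ?_) u
  change ‖(𝒯.aff i).linear u‖ ≤ _
  rw [← 𝒯.aff_sub i z u, ← dist_eq_norm]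
  exact Metric.dist_le_diam_of_mem (𝒯.isBounded_straight t i)
    (mem_image_of_mem _ (h (by simp [hu]))) (mem_image_of_mem _ (h (by simp [hr.le])))

/-- A vector of length `r` is the difference of two points of the straight simplex, and their
preimages lie in the reference simplex. So the inverse linear part maps it to a vector of length at
most the diameter of the reference simplex. -/
lemma norm_le_norm_linear {z : Space n} {r : ℝ} (hr : 0 < r) (i : Fin 𝒯.card)
    (h : Metric.closedBall z r ⊆ 𝒯.straight t i) (u : Space n) :
    ‖u‖ ≤ Metric.diam (simplex t) / r * ‖(𝒯.aff i).linear u‖ := by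
  have key : ∀ w, ‖(𝒯.aff i).linear.symm w‖ ≤ Metric.diam (simplex t) / r * ‖w‖ := by
    refine norm_map_le_of_sphere (f := ((𝒯.aff i).linear.symm : Space n →ₗ[ℝ] Space n)) hr
      fun w hw => ?_
    obtain ⟨x, hx, hxz⟩ := h (show z ∈ _ by simp [hr.le])
    obtain ⟨y, hy, hyz⟩ := h (show z + w ∈ _ by simp [hw])
    have h1 : (𝒯.aff i).linear (y - x) = w := by
      rw [← 𝒯.aff_sub i x (y - x), add_sub_cancel, hxz, hyz, add_sub_cancel_left]
    have h2 : (𝒯.aff i).linear.symm w = y - x := by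
      rw [← h1, LinearEquiv.symm_apply_apply]
    change ‖(𝒯.aff i).linear.symm w‖ ≤ _
    rw [h2, ← dist_eq_norm]
    exact Metric.dist_le_diam_of_mem (isCompact_simplex t).isBounded hy hx
  simpa using key ((𝒯.aff i).linear u)

lemma exists_closedBall_subset_straight {c : ℝ} (hn : n ≠ 0) (i : Fin 𝒯.card) (hc : 1 ≤ c)
    (h : 𝒯.diam t i ≤ c * 𝒯.inDiam t i) :
    ∃ (z : Space n) (r : ℝ), 𝒯.diam t i / (4 * c) ≤ r ∧
      Metric.closedBall z r ⊆ 𝒯.straight t i := by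
  have hd := 𝒯.diam_pos t hn i
  have hs : 𝒯.inDiam t i / 2 < 𝒯.inDiam t i := by
    have : 0 < 𝒯.inDiam t i := by
      by_contra! h0
      nlinarith
    linarith
  obtain ⟨x, hx⟩ := interior_simplex_nonempty t
  have hne : {s | ∃ (z : Space n) (r : ℝ), 0 ≤ r ∧ s = 2 * r ∧
      Metric.closedBall z r ⊆ 𝒯.straight t i}.Nonempty :=
    ⟨0, 𝒯.aff i x, 0, le_rfl, by simp, by
      rw [Metric.closedBall_zero, singleton_subset_iff]
      exact mem_image_of_mem (𝒯.aff i) (interior_subset hx)⟩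
  obtain ⟨s, ⟨z, r, hr, rfl, hz⟩, hs'⟩ := exists_lt_of_lt_csSup hne hs
  refine ⟨z, r, ?_, hz⟩
  rw [div_le_iff₀ (by positivity)]
  nlinarith

/-- The displacement of the nodes, of order `h²`, is isolated as the perturbation of an affine map;
this is the form required by `exists_isElemMap`. -/
lemma param_eq (hk : k ≠ 0) (i : Fin 𝒯.card) :
    𝒯.param t i = fun x => 𝒯.aff i 0 +
      LinearMap.toContinuousLinearMap ((𝒯.aff i).linear : Space n →ₗ[ℝ] Space n) x +
      ∑ α, refBasis t α x • (𝒯.node i α - 𝒯.aff i (refNode t α)) := by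
  ext1 x
  have h1 := eq_sum_refBasis_smul hk t ((𝒯.aff i) : Space n →ᵃ[ℝ] Space n) x
  have h2 := 𝒯.aff_sub i 0 x
  rw [zero_add, sub_eq_iff_eq_add'] at h2
  change _ = 𝒯.aff i 0 + (𝒯.aff i).linear x + _
  rw [← h2]
  simp only [smul_sub, Finset.sum_sub_distrib]
  change 𝒯.aff i x = ∑ α, refBasis t α x • 𝒯.aff i (refNode t α) at h1
  rw [← h1, param]
  abel

end Mesh

/-- On an admissible mesh, the parametric maps satisfy uniform estimates. -/
theorem exists_isElemMap_of_admissible {d k : ℕ} {Ω : Set (Space (d + 1))}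
    (hk : k ≠ 0) (A : BoundaryAtlas d k Ω) (t : AffineBasis (Fin (d + 2)) ℝ (Space (d + 1)))
    (c cδ : ℝ) : ∃ b h₀ : ℝ, 1 ≤ b ∧ 0 < h₀ ∧ ∀ 𝒯 : Mesh (d + 1) k, 𝒯.Admissible A t c cδ →
      𝒯.size t ≤ h₀ → ∀ i, 0 < 𝒯.size t ∧ IsElemMap k t b (𝒯.size t) (𝒯.param t i) := by
  obtain ⟨z, r, hr, hzr⟩ := exists_closedBall_subset_simplex t
  set c' := max c 1
  set D := Metric.diam (simplex t)
  have hD : 0 ≤ D := Metric.diam_nonneg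
  have hc'1 : 1 ≤ c' := le_max_right _ _
  -- One summand for each requirement of `exists_isElemMap`: `r⁻¹` bounds the linear part, `4 c'² D`
  -- bounds its inverse, `c'` the displacement of the nodes, and `c' r⁻¹` the derivatives.
  set a := 1 + r⁻¹ + 4 * c' ^ 2 * D + c' + c' * r⁻¹
  have ha : 1 ≤ a := by
    have : 0 ≤ r⁻¹ + 4 * c' ^ 2 * D + c' + c' * r⁻¹ := by positivity
    linarith
  obtain ⟨b, h₀, hb, hh₀, H⟩ := exists_isElemMap k t ha
  refine ⟨b, h₀, hb, hh₀, fun 𝒯 h𝒯 hsize i => ?_⟩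
  have hd := 𝒯.diam_pos t (by omega) i
  have hds := 𝒯.diam_le_size t i
  set h := 𝒯.size t with hh
  have hh0 : 0 < h := hd.trans_le hds
  have hlin : ∀ u, ‖(𝒯.aff i).linear u‖ ≤ r⁻¹ * h * ‖u‖ := by
    intro u
    refine (𝒯.norm_linear_le t hr (hzr.trans interior_subset) i u).trans ?_
    rw [div_eq_inv_mul]
    gcongr
  have hlinN : 𝒯.linNorm i ≤ r⁻¹ * h :=
    ContinuousLinearMap.opNorm_le_bound _ (by positivity) hlin
  have hr0 : 0 ≤ r⁻¹ := by positivity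
  have h1 : 0 ≤ 4 * c' ^ 2 * D := by positivity
  have h2 : 0 ≤ c' * r⁻¹ := by positivity
  have har : r⁻¹ ≤ a := by linarith
  have hac : c' ≤ a := by linarith
  have hacr : c' * r⁻¹ ≤ a := by linarith
  have haD : 4 * c' ^ 2 * D ≤ a := by linarith
  refine ⟨hh0, ?_⟩
  have hpar := 𝒯.param_eq t hk i
  rw [hpar]
  refine H h _ _ _ hh0 hsize (hlinN.trans (by gcongr)) (fun u => ?_) (fun α => ?_) ?_
  · have hsr : 𝒯.diam t i ≤ c' * 𝒯.inDiam t i := by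
      refine (h𝒯.shape_regular i).trans ?_
      have : 0 ≤ 𝒯.inDiam t i := Real.sSup_nonneg (by rintro _ ⟨_, s, hs, rfl, -⟩; linarith)
      gcongr
      exact le_max_left _ _
    obtain ⟨y, s, hs, hys⟩ := 𝒯.exists_closedBall_subset_straight t (by omega) i hc'1 hsr
    have hs0 : 0 < s := lt_of_lt_of_le (by positivity) hs
    refine (𝒯.norm_le_norm_linear t hs0 i hys u).trans ?_
    change _ ≤ a / h * ‖(𝒯.aff i).linear u‖
    refine mul_le_mul_of_nonneg_right ?_ (norm_nonneg _)
    rw [div_le_div_iff₀ hs0 hh0]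
    have hq : h ≤ c' * 𝒯.diam t i := (h𝒯.quasi_uniform i).trans (by
      gcongr; exact le_max_left _ _)
    rw [div_le_iff₀ (by positivity)] at hs
    have h3 : h ≤ 4 * c' ^ 2 * s := by nlinarith
    calc D * h ≤ D * (4 * c' ^ 2 * s) := by gcongr
      _ = 4 * c' ^ 2 * D * s := by ring
      _ ≤ _ := by gcongr
  · refine (h𝒯.perturb i α).trans ?_
    calc c * 𝒯.diam t i ^ 2 ≤ c' * h ^ 2 := by
          gcongr
          exact le_max_left _ _
      _ ≤ _ := by gcongr
  · intro j hj1 hjk x hx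
    rw [← hpar]
    refine (h𝒯.regular i j hj1 hjk x hx).trans ?_
    have h3 : 0 ≤ 𝒯.linNorm i := norm_nonneg _
    calc c * 𝒯.linNorm i ^ j ≤ c' * (r⁻¹ * h) ^ j := by
          gcongr
          exact le_max_left _ _
      _ ≤ c' ^ j * (r⁻¹ * h) ^ j := by
          gcongr
          exact le_self_pow₀ hc'1 (by omega)
      _ = (c' * r⁻¹ * h) ^ j := by rw [← mul_pow, mul_assoc]
      _ ≤ _ := by gcongr

/-! ### The interpolation on an element -/

lemma refNode_injective (hk : k ≠ 0) (t : AffineBasis (Fin (n + 1)) ℝ (Space n)) :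
    Function.Injective (refNode (k := k) t) := by
  intro α β h
  have h1 := refBasis_refNode hk t α α
  rw [h, refBasis_refNode hk] at h1
  by_contra hne
  simp [hne] at h1

/-- Two different elements meet in the image of a proper face, which avoids the image of the open
simplex by injectivity. Hence the images of the open simplex are disjoint, and the element chosen in
`basis` is forced there. -/
lemma Mesh.Admissible.eq_of_mem_elem {d k : ℕ} {Ω : Set (Space (d + 1))} {A : BoundaryAtlas d k Ω}
    {t : AffineBasis (Fin (d + 2)) ℝ (Space (d + 1))} {c cδ : ℝ} {𝒯 : Mesh (d + 1) k}
    (h𝒯 : 𝒯.Admissible A t c cδ) {i j : Fin 𝒯.card} (hi : InjOn (𝒯.param t i) (simplex t))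
    {x : Space (d + 1)} (hx : x ∈ interior (simplex t)) (hj : 𝒯.param t i x ∈ 𝒯.elem t j) : j = i := by
  by_contra hne
  obtain ⟨s, s', hs, -, h1, -, -⟩ := h𝒯.elem_inter i j (Ne.symm hne)
  have h2 : 𝒯.param t i x ∈ 𝒯.param t i '' face t s := by
    rw [← h1]
    exact ⟨mem_image_of_mem _ (interior_subset hx), hj⟩
  obtain ⟨y, hy, hyx⟩ := h2
  have hys : y ∈ simplex t := convexHull_mono (image_mono (subset_univ s)) hy
  rw [hi hys (interior_subset hx) hyx] at hy
  exact face_subset_compl_interior t hs hy hx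

open Classical in
-- In the interior of an element both choices in the definition of the global basis are determined,
-- the node index by injectivity on the nodes. Nodes of other elements contribute zero.
lemma Mesh.Admissible.interp_param {d k : ℕ} (hk : k ≠ 0) {Ω : Set (Space (d + 1))}
    {A : BoundaryAtlas d k Ω}
    {t : AffineBasis (Fin (d + 2)) ℝ (Space (d + 1))} {c cδ : ℝ} {𝒯 : Mesh (d + 1) k}
    (h𝒯 : 𝒯.Admissible A t c cδ) (i : Fin 𝒯.card) (hi : InjOn (𝒯.param t i) (simplex t))
    (v : Space (d + 1) → ℝ) {x : Space (d + 1)} (hx : x ∈ interior (simplex t)) :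
    𝒯.interp t v (𝒯.param t i x) =
      ∑ α : NodeIdx (d + 1) k with 𝒯.param t i (refNode t α) ∈ 𝒯.domain t,
        v (𝒯.param t i (refNode t α)) * refBasis t α x := by
  have hxs := interior_subset hx
  have hnode := fun α => refNode_mem_simplex hk t α
  have hbasis : ∀ a, 𝒯.basis t a (𝒯.param t i x) = 𝒯.localBasis t i a (𝒯.param t i x) := by
    intro a
    have h : ∃ j, 𝒯.param t i x ∈ 𝒯.elem t j := ⟨i, mem_image_of_mem _ hxs⟩
    rw [Mesh.basis, dif_pos h, h𝒯.eq_of_mem_elem hi hx h.choose_spec]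
  have hinv : Function.invFunOn (𝒯.param t i) (simplex t) (𝒯.param t i x) = x :=
    hi.leftInvOn_invFunOn hxs
  have hlocal : ∀ α : NodeIdx (d + 1) k, 𝒯.localBasis t i (𝒯.param t i (refNode t α)) (𝒯.param t i x) =
      refBasis t α x := by
    intro α
    have h : ∃ β : NodeIdx (d + 1) k, 𝒯.param t i (refNode t β) = 𝒯.param t i (refNode t α) := ⟨α, rfl⟩
    have h1 : h.choose = α := refNode_injective hk t (hi (hnode _) (hnode _) h.choose_spec)
    rw [Mesh.localBasis, dif_pos h, h1, hinv]
  have hinj : InjOn (fun α : NodeIdx (d + 1) k => 𝒯.param t i (refNode t α)) univ :=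
    fun α _ β _ h => refNode_injective hk t (hi (hnode _) (hnode _) h)
  simp only [Mesh.interp, hbasis]
  have himg : ∑ α : NodeIdx (d + 1) k with 𝒯.param t i (refNode t α) ∈ 𝒯.domain t,
        v (𝒯.param t i (refNode t α)) * refBasis t α x =
      ∑ a ∈ (Finset.univ.filter fun α : NodeIdx (d + 1) k => 𝒯.param t i (refNode t α) ∈ 𝒯.domain t).image
        (fun α => 𝒯.param t i (refNode t α)), v a * 𝒯.localBasis t i a (𝒯.param t i x) := by
    rw [Finset.sum_image fun α _ β _ h => hinj (mem_univ _) (mem_univ _) h]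
    exact Finset.sum_congr rfl fun α _ => by rw [hlocal]
  rw [himg]
  symm
  refine Finset.sum_subset ?_ fun a ha ha' => ?_
  · intro a ha
    obtain ⟨α, hα, rfl⟩ := Finset.mem_image.mp ha
    exact Finset.mem_filter.mpr ⟨Finset.mem_image.mpr ⟨(i, α), Finset.mem_univ _, rfl⟩,
      (Finset.mem_filter.mp hα).2⟩
  · rw [Mesh.localBasis, dif_neg, mul_zero]
    rintro ⟨α, rfl⟩
    exact ha' (Finset.mem_image.mpr ⟨α, Finset.mem_filter.mpr ⟨Finset.mem_univ _,
      (Finset.mem_filter.mp ha).2⟩, rfl⟩)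

/-! ### Finite overlap -/

lemma IsElemMap.image_subset_closedBall {t : AffineBasis (Fin (n + 1)) ℝ (Space n)} {b h : ℝ}
    (hb : 0 ≤ b * h)
    {F : Space n → Space n} (hF : IsElemMap k t b h F) {z : Space n} (hz : z ∈ simplex t) :
    F '' simplex t ⊆ Metric.closedBall (F z) (b * h * Metric.diam (simplex t)) := by
  rintro _ ⟨x, hx, rfl⟩
  refine (hF.dist_le x hx z hz).trans ?_
  gcongr
  exact Metric.dist_le_diam_of_mem (isCompact_simplex t).isBounded hx hz

/-- The balls of radius `C h` around the elements have finite overlap. -/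
theorem exists_card_le_of_admissible {d k : ℕ} {Ω : Set (Space (d + 1))}
    (A : BoundaryAtlas d k Ω) (t : AffineBasis (Fin (d + 2)) ℝ (Space (d + 1))) (c cδ : ℝ)
    {b C : ℝ} (hb : 1 ≤ b) (hC : 0 ≤ C) {z : Space (d + 1)} (hz : z ∈ simplex t) :
    ∃ M : ℕ, ∀ 𝒯 : Mesh (d + 1) k, 𝒯.Admissible A t c cδ → 0 < 𝒯.size t →
      (∀ i, IsElemMap k t b (𝒯.size t) (𝒯.param t i)) → ∀ (x : Space (d + 1))
      (s : Finset (Fin 𝒯.card)), (∀ i ∈ s, dist x (𝒯.param t i z) < C * 𝒯.size t) → s.card ≤ M := by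
  set V := volume (interior (simplex t)) with hV
  have hV0 : V ≠ 0 := (isOpen_interior.measure_pos _ (interior_simplex_nonempty t)).ne'
  have hVt : V ≠ ⊤ := ((isCompact_simplex t).isBounded.subset interior_subset).measure_lt_top.ne
  set C' := C + b * Metric.diam (simplex t) + 1
  have hC' : 0 ≤ C' := by
    have := mul_nonneg (by linarith : 0 ≤ b) (Metric.diam_nonneg (s := simplex t))
    linarith
  set W : ℝ≥0∞ := ENNReal.ofReal ((b * C') ^ (d + 1)) * volume (Metric.ball (0 : Space (d + 1)) 1)
  have hWt : W / V ≠ ⊤ := ENNReal.div_ne_top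
    (ENNReal.mul_ne_top ENNReal.ofReal_ne_top Metric.isBounded_ball.measure_lt_top.ne) hV0
  obtain ⟨M, hM⟩ := ENNReal.exists_nat_gt hWt
  refine ⟨M, fun 𝒯 h𝒯 hh hF x s hs => ?_⟩
  set h := 𝒯.size t with hhdef
  have hb0 : 0 < b := by linarith
  -- A packing argument: the images of the open simplex are disjoint, have volume at least `(h /
  -- b)^(d+1) V`, and all lie in one ball of radius `C' h`. The powers of `h` cancel in the
  -- quotient.
  have hvol : ∀ i, V ≤ ENNReal.ofReal (b / h) ^ (d + 1) *
      volume (𝒯.param t i '' interior (simplex t)) := by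
    intro i
    have := ((hF i).antilip.mono interior_subset).volume_preimage_le (by positivity)
      (E := 𝒯.param t i '' interior (simplex t))
    rwa [inter_eq_left.mpr (subset_preimage_image _ _), inter_self] at this
  have hsub : ∀ i ∈ s, 𝒯.param t i '' interior (simplex t) ⊆ Metric.ball x (C' * h) := by
    intro i hi y hy
    have h1 := (hF i).image_subset_closedBall (by positivity) hz (image_mono interior_subset hy)
    rw [Metric.mem_closedBall] at h1
    rw [Metric.mem_ball]
    have h2 := hs i hi
    rw [dist_comm] at h2
    calc dist y x ≤ dist y (𝒯.param t i z) + dist (𝒯.param t i z) x := dist_triangle _ _ _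
      _ < b * h * Metric.diam (simplex t) + C * h := by linarith
      _ ≤ _ := by
        have : 0 ≤ h := hh.le
        simp only [C']
        nlinarith
  have hdisj : (s : Set (Fin 𝒯.card)).PairwiseDisjoint
      fun i => 𝒯.param t i '' interior (simplex t) := by
    intro i _ j _ hij
    refine Set.disjoint_left.mpr ?_
    rintro _ ⟨y, hy, rfl⟩ hj
    exact hij (h𝒯.eq_of_mem_elem (hF i).antilip.injOn hy (image_mono interior_subset hj)).symm
  have h1 : ∑ i ∈ s, volume (𝒯.param t i '' interior (simplex t)) ≤
      volume (Metric.ball x (C' * h)) := by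
    rw [← measure_biUnion_finset hdisj fun i _ => (hF i).isOpen_image.measurableSet]
    exact measure_mono (iUnion₂_subset hsub)
  have h2 : (s.card : ℝ≥0∞) * V ≤ W := by
    calc (s.card : ℝ≥0∞) * V = ∑ _i ∈ s, V := by rw [Finset.sum_const, nsmul_eq_mul]
      _ ≤ ∑ i ∈ s, ENNReal.ofReal (b / h) ^ (d + 1) * volume (𝒯.param t i '' interior (simplex t)) :=
          Finset.sum_le_sum fun i _ => hvol i
      _ = ENNReal.ofReal (b / h) ^ (d + 1) * ∑ i ∈ s, volume (𝒯.param t i '' interior (simplex t)) := by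
          rw [Finset.mul_sum]
      _ ≤ ENNReal.ofReal (b / h) ^ (d + 1) * volume (Metric.ball x (C' * h)) := by gcongr
      _ = _ := by
          rw [Measure.addHaar_ball _ _ (by positivity), ← mul_assoc,
            ← ENNReal.ofReal_pow (by positivity), ← ENNReal.ofReal_mul (by positivity),
            finrank_euclideanSpace_fin, ← mul_pow]
          congr 3
          field_simp
  have h3 : (s.card : ℝ≥0∞) ≤ W / V := (ENNReal.le_div_iff_mul_le (Or.inl hV0) (Or.inl hVt)).mpr h2
  exact_mod_cast (h3.trans hM.le)

lemma sum_setLIntegral_le {ι : Type*} (s : Finset ι) {U : Set (Space n)} {B : ι → Set (Space n)}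
    (hB : ∀ i, MeasurableSet (B i)) {M : ℕ}
    (hM : ∀ x, ∀ s' ⊆ s, (∀ i ∈ s', x ∈ B i) → s'.card ≤ M)
    {f : Space n → ℝ≥0∞} (hf : AEMeasurable f (volume.restrict U)) :
    ∑ i ∈ s, ∫⁻ x in U ∩ B i, f x ≤ M * ∫⁻ x in U, f x := by
  classical
  calc ∑ i ∈ s, ∫⁻ x in U ∩ B i, f x = ∑ i ∈ s, ∫⁻ x in U, (B i).indicator f x := by
        refine Finset.sum_congr rfl fun i _ => ?_
        rw [lintegral_indicator (hB i), Measure.restrict_restrict (hB i), inter_comm]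
    _ = ∫⁻ x in U, ∑ i ∈ s, (B i).indicator f x :=
        (lintegral_finsetSum' _ fun i _ => hf.indicator (hB i)).symm
    _ ≤ ∫⁻ x in U, M * f x := by
        refine lintegral_mono fun x => ?_
        simp only [indicator_apply]
        rw [← Finset.sum_filter, Finset.sum_const, nsmul_eq_mul]
        gcongr
        exact hM x _ (Finset.filter_subset _ _) fun i hi => (Finset.mem_filter.mp hi).2
    _ = _ := lintegral_const_mul' _ _ (by simp)

end

/-! ### The boundary of the tubular neighbourhood is a null set -/

section
variable {n : ℕ}

/-- No point of the level set is a density point. Near `x`, half-way along the radius `r` towards a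
closest point `b` of `Γ`, there is a ball of radius `r / 2` on which the distance is less than `δ`.
The level set misses it, so its density in the ball of radius `r` is at most `1 - 2^(-n)`, contrary
to the Lebesgue density theorem. -/
lemma volume_infDist_eq (Γ : Set (Space n)) (hΓ : IsClosed Γ) (hne : Γ.Nonempty) {δ : ℝ}
    (hδ : 0 < δ) : volume {x : Space n | Metric.infDist x Γ = δ} = 0 := by
  set S : Set (Space n) := {x | Metric.infDist x Γ = δ} with hS
  have hSm : MeasurableSet S :=
    (isClosed_eq (Metric.continuous_infDist_pt Γ) continuous_const).measurableSet
  have key := Besicovitch.ae_tendsto_measure_inter_div (volume : Measure (Space n)) S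
  suffices h : ∀ x ∈ S, ¬ Filter.Tendsto
      (fun r => volume (S ∩ Metric.closedBall x r) / volume (Metric.closedBall x r))
      (nhdsWithin 0 (Ioi 0)) (nhds 1) by
    have h2 : ∀ᵐ x ∂(volume.restrict S), False := by
      filter_upwards [key, ae_restrict_mem hSm] with x hx hxS using h x hxS hx
    have h3 : volume.restrict S = 0 := by
      simpa using h2
    simpa using h3
  intro x hx ht
  have hq : (2 : ℝ≥0∞)⁻¹ ^ n ≠ 0 := by
    apply pow_ne_zero; simp
  have hlt : (1 : ℝ≥0∞) - (2 : ℝ≥0∞)⁻¹ ^ n < 1 :=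
    ENNReal.sub_lt_self (by simp) (by simp) hq
  have hev := ht.eventually (lt_mem_nhds hlt)
  have hev2 : ∀ᶠ r : ℝ in nhdsWithin 0 (Ioi 0), 0 < r ∧ r < δ := by
    filter_upwards [self_mem_nhdsWithin, mem_nhdsWithin_of_mem_nhds (Iio_mem_nhds hδ)] with r h1 h2
      using ⟨h1, h2⟩
  obtain ⟨r, hr, hr0, hrδ⟩ := (hev.and hev2).exists
  obtain ⟨b, hb, hbd⟩ := hΓ.exists_infDist_eq_dist hne x
  have hxb : dist x b = δ := by rw [← hbd]; exact hx
  set z : Space n := x + (r / (2 * δ)) • (b - x) with hz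
  have hnb : ‖b - x‖ = δ := by rw [← dist_eq_norm, dist_comm, hxb]
  have hzx : dist z x = r / 2 := by
    rw [hz, dist_eq_norm, add_sub_cancel_left, norm_smul, hnb, Real.norm_of_nonneg (by positivity)]
    field_simp
  have hzb : dist z b = δ - r / 2 := by
    have : z - b = (-(1 - r / (2 * δ))) • (b - x) := by rw [hz]; module
    rw [dist_eq_norm, this, norm_smul, hnb, norm_neg, Real.norm_of_nonneg]
    · field_simp
    · rw [sub_nonneg, div_le_one (by positivity)]; linarith
  have hsub : S ∩ Metric.closedBall x r ⊆ Metric.closedBall x r \ Metric.ball z (r / 2) := by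
    rintro y ⟨hyS, hyr⟩
    refine ⟨hyr, fun hyz => ?_⟩
    have h1 : Metric.infDist y Γ ≤ dist y b := Metric.infDist_le_dist_of_mem hb
    have h2 : dist y b ≤ dist y z + dist z b := dist_triangle _ _ _
    have h3 : dist y z < r / 2 := hyz
    have h4 : Metric.infDist y Γ = δ := hyS
    linarith
  have hBsub : Metric.ball z (r / 2) ⊆ Metric.closedBall x r := by
    intro y hy
    have h2 : dist y x ≤ dist y z + dist z x := dist_triangle _ _ _
    have h3 : dist y z < r / 2 := hy
    rw [Metric.mem_closedBall]; linarith
  have hvol : volume (Metric.ball z (r / 2)) =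
      (2 : ℝ≥0∞)⁻¹ ^ n * volume (Metric.closedBall x r) := by
    rw [Measure.addHaar_ball_of_pos _ _ (by positivity : 0 < r / 2),
      Measure.addHaar_closedBall _ _ hr0.le, ← mul_assoc]
    congr 1
    rw [show r / 2 = 2⁻¹ * r by ring, mul_pow, ENNReal.ofReal_mul (by positivity)]
    congr 1
    rw [finrank_euclideanSpace_fin, ENNReal.ofReal_pow (by positivity),
      ENNReal.ofReal_inv_of_pos (by norm_num)]
    simp
  have hV0 : volume (Metric.closedBall x r) ≠ 0 :=
    (Metric.measure_closedBall_pos volume x hr0).ne'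
  have hVt : volume (Metric.closedBall x r) ≠ ⊤ := measure_closedBall_lt_top.ne
  have hle : volume (S ∩ Metric.closedBall x r) ≤
      (1 - (2 : ℝ≥0∞)⁻¹ ^ n) * volume (Metric.closedBall x r) := by
    refine (measure_mono hsub).trans ?_
    rw [measure_sdiff hBsub measurableSet_ball.nullMeasurableSet
      (measure_ball_lt_top).ne, hvol, ENNReal.sub_mul (fun _ _ => hVt), one_mul]
  have := ENNReal.div_le_of_le_mul hle
  exact absurd hr (not_lt.mpr this)

/-- The tube is closed, but the seminorms are taken over its interior. This permits the exchange of
the two under an integral. -/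
lemma volume_tube_diff_interior (Ω : Set (Space n)) {δ : ℝ} (hδ : 0 < δ) :
    volume (tube Ω δ \ interior (tube Ω δ)) = 0 := by
  rcases (frontier Ω).eq_empty_or_nonempty with h | hne
  · simp [tube, h]
  refine measure_mono_null ?_ (volume_infDist_eq (frontier Ω) isClosed_frontier hne hδ)
  rintro x ⟨hx, hx'⟩
  have h1 : Metric.infDist x (frontier Ω) ≤ δ := by
    rw [tube, Metric.cthickening_eq_preimage_infEDist] at hx
    exact ENNReal.toReal_le_of_le_ofReal hδ.le hx
  refine le_antisymm h1 ?_
  by_contra hlt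
  push Not at hlt
  apply hx'
  refine interior_maximal (Metric.thickening_subset_cthickening δ _) Metric.isOpen_thickening ?_
  rw [Metric.mem_thickening_iff_infDist_lt hne]
  exact hlt

/-! ### Charts that flatten the boundary -/

/-- A coordinate system in which the boundary of `Ω` is flat near the boundary point `b`. -/
structure IsGraphChart {d : ℕ} (k : ℕ) (Ω : Set (Space (d + 1))) (CL ε : ℝ) (b : Space (d + 1))
    (Θ Ξ : Space (d + 1) → Space (d + 1)) (ν : Space (d + 1)) : Prop where
  norm_normal : ‖ν‖ = 1
  apply_zero : Θ 0 = b
  left_inv : ∀ y, Ξ (Θ y) = y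
  right_inv : ∀ x, Θ (Ξ x) = x
  apply_add : ∀ y (s : ℝ), Θ (y + s • EuclideanSpace.single (Fin.last d) 1) = Θ y + s • ν
  contDiffOn : ContDiffOn ℝ (k + 1 : ℕ) Θ (Metric.ball 0 ε)
  contDiffOn_inv : ContDiffOn ℝ (k + 1 : ℕ) Ξ (Metric.ball b ε)
  norm_le : ∀ j, 1 ≤ j → j ≤ k + 1 → ∀ y ∈ Metric.ball 0 ε, ‖iteratedFDeriv ℝ j Θ y‖ ≤ CL
  norm_inv_le : ∀ j, 1 ≤ j → j ≤ k + 1 → ∀ x ∈ Metric.ball b ε, ‖iteratedFDeriv ℝ j Ξ x‖ ≤ CL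
  dist_le : ∀ x ∈ Metric.ball (0 : Space (d + 1)) ε, ∀ y ∈ Metric.ball (0 : Space (d + 1)) ε,
    dist (Θ x) (Θ y) ≤ CL * dist x y
  dist_inv_le : ∀ x ∈ Metric.ball b ε, ∀ y ∈ Metric.ball b ε,
    dist (Ξ x) (Ξ y) ≤ CL * dist x y
  mem_iff : ∀ y ∈ Metric.ball (0 : Space (d + 1)) ε, Θ y ∈ Ω ↔ 0 < height y
  mem_frontier_iff : ∀ y ∈ Metric.ball (0 : Space (d + 1)) ε, Θ y ∈ frontier Ω ↔ height y = 0

lemma norm_iteratedFDeriv_affine_le {E F : Type*} [NormedAddCommGroup E] [NormedSpace ℝ E]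
    [NormedAddCommGroup F] [NormedSpace ℝ F] (L : E →L[ℝ] F) (a : F) {j : ℕ} (hj : 1 ≤ j) (x : E) :
    ‖iteratedFDeriv ℝ j (fun y => L y + a) x‖ ≤ ‖L‖ := by
  obtain ⟨i, rfl⟩ : ∃ i, j = i + 1 := ⟨j - 1, by omega⟩
  rw [← norm_iteratedFDeriv_fderiv]
  have : fderiv ℝ (fun y => L y + a) = fun _ => L := by
    ext1 y; simp
  rw [this]
  rcases Nat.eq_zero_or_pos i with rfl | hi
  · simp
  · rw [iteratedFDeriv_const_of_ne (by omega)]; simp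

/-- The derivatives of `x ↦ L x + a + ψ (M x + c) ν`. -/
lemma graphMap_bounds {E E' F : Type*} [NormedAddCommGroup E] [NormedSpace ℝ E]
    [NormedAddCommGroup E'] [NormedSpace ℝ E'] [NormedAddCommGroup F] [NormedSpace ℝ F]
    {k : ℕ} (L : E →L[ℝ] F) (a : F) (hL : ‖L‖ ≤ 1) (M : E →L[ℝ] E') (c : E') (hM : ‖M‖ ≤ 1)
    (ν : F) (hν : ‖ν‖ ≤ 1) {ψ : E' → ℝ} {s : Set E} {s' : Set E'} (hs : IsOpen s)
    (hs' : IsOpen s') (hss' : ∀ x ∈ s, M x + c ∈ s') (hψ : ContDiffOn ℝ (k + 1 : ℕ) ψ s')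
    {K : ℝ} (hK : ∀ j ≤ k + 1, ∀ y ∈ s', ‖iteratedFDeriv ℝ j ψ y‖ ≤ K) :
    ContDiffOn ℝ (k + 1 : ℕ) (fun x => L x + a + ψ (M x + c) • ν) s ∧
    ∀ j, 1 ≤ j → j ≤ k + 1 → ∀ x ∈ s,
      ‖iteratedFDeriv ℝ j (fun x => L x + a + ψ (M x + c) • ν) x‖ ≤ 1 + (k + 1).factorial * K := by
  have h1 : ContDiff ℝ (k + 1 : ℕ) (fun x => L x + a) := by fun_prop
  have hM1 : ContDiff ℝ (k + 1 : ℕ) (fun x => M x + c) := by fun_prop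
  have h2 : ContDiffOn ℝ (k + 1 : ℕ) (fun x => ψ (M x + c)) s :=
    hψ.comp hM1.contDiffOn hss'
  have h3 : ContDiffOn ℝ (k + 1 : ℕ) (fun x => ψ (M x + c) • ν) s := h2.smul contDiffOn_const
  refine ⟨h1.contDiffOn.add h3, fun j hj1 hjk x hx => ?_⟩
  have hjn : ((j : ℕ) : WithTop ℕ∞) ≤ ((k + 1 : ℕ) : WithTop ℕ∞) := by exact_mod_cast hjk
  have hx3 : ContDiffAt ℝ j (fun x => ψ (M x + c) • ν) x :=
    ((h3.of_le hjn).contDiffAt (hs.mem_nhds hx))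
  have hx2 : ContDiffAt ℝ j (fun x => ψ (M x + c)) x :=
    ((h2.of_le hjn).contDiffAt (hs.mem_nhds hx))
  have e : (fun x => L x + a + ψ (M x + c) • ν) =
    (fun x => L x + a) + (fun x => ψ (M x + c) • ν) := rfl
  rw [e, iteratedFDeriv_add_apply ((h1.of_le hjn).contDiffAt) hx3]
  have hK0 : 0 ≤ K := (norm_nonneg _).trans (hK 0 (by omega) _ (hss' x hx))
  have hA := (norm_iteratedFDeriv_affine_le L a hj1 x).trans hL
  have hB : ‖iteratedFDeriv ℝ j (fun x => ψ (M x + c)) x‖ ≤ (j.factorial : ℝ) * K * 1 ^ j := by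
    refine norm_iteratedFDeriv_comp_le_of_isOpen (g := ψ) (f := fun x => M x + c)
      hs' hs (hψ.of_le hjn) (hM1.of_le hjn).contDiffOn hss' hx
      (fun i hi => hK i (by omega) _ (hss' x hx)) (fun i hi1 _ => ?_)
    rw [one_pow]
    exact (norm_iteratedFDeriv_affine_le M c hi1 x).trans hM
  have hC : ‖iteratedFDeriv ℝ j (fun x => ψ (M x + c) • ν) x‖ ≤ (j.factorial : ℝ) * K := by
    have e2 : (fun x => ψ (M x + c) • ν) =
      (ContinuousLinearMap.toSpanSingleton ℝ ν) ∘ (fun x => ψ (M x + c)) := by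
      ext1 y; simp
    rw [e2]
    refine (ContinuousLinearMap.norm_iteratedFDeriv_comp_left _ hx2 le_rfl).trans ?_
    rw [ContinuousLinearMap.norm_toSpanSingleton]
    calc ‖ν‖ * _ ≤ 1 * _ := by gcongr
      _ ≤ _ := by rw [one_mul]; simpa using hB
  refine (norm_add_le _ _).trans (add_le_add hA (hC.trans ?_))
  gcongr


/-- The projection to the first coordinates as a continuous linear map. -/
noncomputable def baseCLM (d : ℕ) : Space (d + 1) →L[ℝ] Space d :=
  LinearMap.mkContinuous
    { toFun := base
      map_add' := fun x y => by ext i; simp [base]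
      map_smul' := fun c x => by ext i; simp [base] } 1 (fun x => by
        rw [one_mul, EuclideanSpace.norm_eq, EuclideanSpace.norm_eq]
        refine Real.sqrt_le_sqrt ?_
        rw [Fin.sum_univ_castSucc]
        simp only [LinearMap.coe_mk, AddHom.coe_mk, base]
        have := sq_nonneg ‖x (Fin.last d)‖
        linarith)

@[simp] lemma baseCLM_apply {d : ℕ} (x : Space (d + 1)) : baseCLM d x = base x := rfl

lemma norm_baseCLM_le (d : ℕ) : ‖baseCLM d‖ ≤ 1 := LinearMap.mkContinuous_norm_le _ zero_le_one _

lemma dist_le_of_norm_iteratedFDeriv_one {E F : Type*} [NormedAddCommGroup E] [NormedSpace ℝ E]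
    [NormedAddCommGroup F] [NormedSpace ℝ F] {f : E → F} {z : E} {ε C : ℝ} {k : ℕ}
    (hf : ContDiffOn ℝ (k + 1 : ℕ) f (Metric.ball z ε))
    (hC : ∀ x ∈ Metric.ball z ε, ‖iteratedFDeriv ℝ 1 f x‖ ≤ C) :
    ∀ x ∈ Metric.ball z ε, ∀ y ∈ Metric.ball z ε, dist (f x) (f y) ≤ C * dist x y := by
  intro x hx y hy
  rw [dist_eq_norm, dist_eq_norm]
  refine (convex_ball z ε).norm_image_sub_le_of_norm_fderiv_le (𝕜 := ℝ) (fun w hw => ?_)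
    (fun w hw => ?_) hy hx
  · exact (hf.contDiffAt (Metric.isOpen_ball.mem_nhds hw)).differentiableAt (by simp)
  · have := hC w hw
    rwa [← zero_add 1, ← norm_iteratedFDeriv_fderiv, norm_iteratedFDeriv_zero] at this

/-- In the rigid coordinates of a suitable `U r`, the chart is the shear that adds the value of `φ
r` to the last coordinate. Hence its inverse is explicit, and vertical lines go to lines in a fixed
unit direction `ν`. A Lebesgue number `ε₀` of the cover of the compact boundary makes the radius
uniform; it is divided by the Lipschitz constant `CL` so that the chart maps its ball into `U r`. -/
lemma exists_isGraphChart {d k : ℕ} {Ω : Set (Space (d + 1))}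
    (hΩ_bdd : Bornology.IsBounded Ω) (A : BoundaryAtlas d k Ω) :
    ∃ CL ε : ℝ, 1 ≤ CL ∧ 0 < ε ∧ ∀ b ∈ frontier Ω, ∃ Θ Ξ ν, IsGraphChart k Ω CL ε b Θ Ξ ν := by
  have hcomp : IsCompact (frontier Ω) :=
    Metric.isCompact_of_isClosed_isBounded isClosed_frontier
      ((hΩ_bdd.closure).subset frontier_subset_closure)
  obtain ⟨ε₀, hε₀, hleb⟩ := lebesgue_number_lemma_of_metric hcomp A.isOpen_U A.cover
  obtain ⟨K, hK⟩ := A.bounded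
  set CL : ℝ := 1 + (k + 1).factorial * K with hCL
  have hCL1 : 1 ≤ CL := by
    have : (0 : ℝ) ≤ (k + 1).factorial * K := by positivity
    linarith
  have hCL0 : 0 < CL := by linarith
  refine ⟨CL, ε₀ / CL, hCL1, by positivity, fun b hb => ?_⟩
  have hεε : ε₀ / CL ≤ ε₀ := div_le_self hε₀.le hCL1
  obtain ⟨r, hr⟩ := hleb b hb
  set χ := A.coord r with hχ
  set e : Space (d + 1) := EuclideanSpace.single (Fin.last d) 1 with he
  have hen : ‖e‖ = 1 := by simp [he]
  have hbe : ∀ s : ℝ, base (s • e) = 0 := by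
    intro s; ext i
    simp [base, he, Fin.castSucc_ne_last]
  have hhe : ∀ s : ℝ, height (s • e) = s := by
    intro s; simp [height, he]
  have hbadd : ∀ x y : Space (d + 1), base (x + y) = base x + base y := fun x y =>
    (baseCLM d).map_add x y
  have hhadd : ∀ x y : Space (d + 1), height (x + y) = height x + height y := fun x y => rfl
  have hbU : b ∈ A.U r := hr (Metric.mem_ball_self hε₀)
  set b' : Space d := base (χ b) with hb'
  have hφb : height (χ b) = A.φ r b' := by
    have : b ∈ frontier Ω ∩ A.U r := ⟨hb, hbU⟩
    rw [A.graph r] at this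
    exact this.2
  set bb : Space (d + 1) := χ b + (-(A.φ r b')) • e with hbb
  have hbbb : base bb = b' := by rw [hbb, hbadd, hbe, add_zero]
  have hhbb : height bb = 0 := by rw [hbb, hhadd, hhe, hφb, add_neg_cancel]
  have hcube : ∀ y : Space (d + 1), ‖y‖ < ε₀ →
      base y + b' ∈ cube (A.center r) (A.half r) := by
    intro y hy
    have h1 : χ.symm (χ b + y) ∈ A.U r := by
      apply hr
      rw [Metric.mem_ball, ← χ.dist_map, χ.apply_symm_apply, dist_eq_norm, add_sub_cancel_left]
      exact hy
    have := A.base_mem r _ h1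
    rw [← hχ, χ.apply_symm_apply, hbadd, add_comm] at this
    exact this
  set Ls := χ.symm.linearIsometryEquiv with hLs
  set Lχ := χ.linearIsometryEquiv with hLχ
  have hsymm : ∀ y z, χ.symm (y + z) = Ls y + χ.symm z := fun y z => χ.symm.map_vadd z y
  have hfwd : ∀ y z, χ (y + z) = Lχ y + χ z := fun y z => χ.map_vadd z y
  set Θ : Space (d + 1) → Space (d + 1) := fun y => χ.symm (y + bb + A.φ r (base y + b') • e)
    with hΘ
  set Ξ : Space (d + 1) → Space (d + 1) := fun x => χ x + (-(A.φ r (base (χ x)))) • e - bb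
    with hΞ
  have hΘ' : Θ = fun y => (Ls : Space (d + 1) →L[ℝ] Space (d + 1)) y + χ.symm bb +
      A.φ r (baseCLM d y + b') • Ls e := by
    ext1 y
    rw [hΘ]
    simp only
    rw [add_assoc, hsymm, add_comm bb, hsymm, map_smul, baseCLM_apply, add_comm (_ • Ls e),
      ← add_assoc]
    rfl
  have hχ0 : ∀ x, χ x = Lχ x + χ 0 := fun x => by simpa using hfwd x 0
  have hΞ' : Ξ = fun x => (Lχ : Space (d + 1) →L[ℝ] Space (d + 1)) x + (χ 0 - bb) +
      A.φ r (((baseCLM d).comp (Lχ : Space (d + 1) →L[ℝ] Space (d + 1))) x + base (χ 0)) •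
        (-e) := by
    ext1 x
    rw [hΞ]
    simp only
    have h1 : base (χ x) = ((baseCLM d).comp (Lχ : Space (d + 1) →L[ℝ] Space (d + 1))) x +
        base (χ 0) := by
      rw [hχ0 x, hbadd]; rfl
    rw [h1, hχ0 x]
    have h2 : (Lχ : Space (d + 1) →L[ℝ] Space (d + 1)) x = Lχ x := rfl
    rw [h2]
    module
  have hLsn : ‖(Ls : Space (d + 1) →L[ℝ] Space (d + 1))‖ ≤ 1 :=
    Ls.toLinearIsometry.norm_toContinuousLinearMap_le
  have hLχn : ‖(Lχ : Space (d + 1) →L[ℝ] Space (d + 1))‖ ≤ 1 :=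
    Lχ.toLinearIsometry.norm_toContinuousLinearMap_le
  have hcubeo : IsOpen (cube (A.center r) (A.half r)) := by
    have : cube (A.center r) (A.half r) = ⋂ i, {y : Space d | |y i - A.center r i| < A.half r} := by
      ext y; simp [cube]
    rw [this]
    exact isOpen_iInter_of_finite fun i => isOpen_lt (by fun_prop) continuous_const
  obtain ⟨hΘc, hΘb⟩ := graphMap_bounds (Ls : Space (d + 1) →L[ℝ] Space (d + 1)) (χ.symm bb) hLsn
    (baseCLM d) b' (norm_baseCLM_le d) (Ls e) (by rw [Ls.norm_map, hen])
    (s := Metric.ball 0 (ε₀ / CL)) Metric.isOpen_ball hcubeo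
    (fun x hx => hcube x (by
      have := mem_ball_zero_iff.mp hx
      linarith)) (by exact_mod_cast A.contDiffOn r) (hK r).1
  obtain ⟨hΞc, hΞb⟩ := graphMap_bounds (Lχ : Space (d + 1) →L[ℝ] Space (d + 1)) (χ 0 - bb) hLχn
    ((baseCLM d).comp (Lχ : Space (d + 1) →L[ℝ] Space (d + 1))) (base (χ 0))
    ((ContinuousLinearMap.opNorm_comp_le _ _).trans
      (mul_le_one₀ (norm_baseCLM_le d) (norm_nonneg _) hLχn)) (-e) (by rw [norm_neg, hen])
    (s := Metric.ball b (ε₀ / CL)) Metric.isOpen_ball hcubeo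
    (fun x hx => by
      have h1 : base (χ x) = ((baseCLM d).comp (Lχ : Space (d + 1) →L[ℝ] Space (d + 1))) x +
          base (χ 0) := by
        rw [hχ0 x, hbadd]; rfl
      rw [← h1]
      exact A.base_mem r x (hr (Metric.ball_subset_ball hεε hx)))
    (by exact_mod_cast A.contDiffOn r) (hK r).1
  rw [← hΘ'] at hΘc hΘb
  rw [← hΞ'] at hΞc hΞb
  have hχΘ : ∀ y, χ (Θ y) = y + bb + A.φ r (base y + b') • e := fun y => χ.apply_symm_apply _
  have hbΘ : ∀ y, base (χ (Θ y)) = base y + b' := fun y => by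
    rw [hχΘ, hbadd, hbadd, hbe, hbbb, add_zero]
  have hhΘ : ∀ y, height (χ (Θ y)) = height y + A.φ r (base y + b') := fun y => by
    rw [hχΘ, hhadd, hhadd, hhe, hhbb, add_zero]
  have hΘ0 : Θ 0 = b := by
    apply χ.injective
    rw [hχΘ, hbb]
    have : base (0 : Space (d + 1)) = 0 := (baseCLM d).map_zero
    rw [this, zero_add, zero_add]
    module
  have hdist := dist_le_of_norm_iteratedFDeriv_one hΘc
    (fun x hx => hΘb 1 le_rfl (by omega) x hx)
  have hΘU : ∀ y ∈ Metric.ball (0 : Space (d + 1)) (ε₀ / CL), Θ y ∈ A.U r := by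
    intro y hy
    apply hr
    have h1 := hdist y hy 0 (Metric.mem_ball_self (by positivity))
    rw [hΘ0] at h1
    rw [Metric.mem_ball] at hy ⊢
    calc dist (Θ y) b ≤ CL * dist y 0 := h1
      _ < CL * (ε₀ / CL) := by gcongr
      _ = ε₀ := by field_simp
  refine ⟨Θ, Ξ, Ls e, by rw [Ls.norm_map, hen], hΘ0, fun y => ?_, fun x => ?_, fun y s => ?_, hΘc,
    hΞc, hΘb, hΞb, hdist, dist_le_of_norm_iteratedFDeriv_one hΞc
    (fun x hx => hΞb 1 le_rfl (by omega) x hx), fun y hy => ?_, fun y hy => ?_⟩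
  · show χ (Θ y) + (-(A.φ r (base (χ (Θ y))))) • e - bb = y
    rw [hbΘ, hχΘ]
    module
  · apply χ.injective
    rw [hχΘ]
    have h1 : base (Ξ x) + b' = base (χ x) := by
      have : Ξ x + bb = χ x + (-(A.φ r (base (χ x)))) • e := by rw [hΞ]; simp
      rw [← hbbb, ← hbadd, this, hbadd, hbe, add_zero]
    rw [h1, hΞ]
    module
  · rw [hΘ']
    simp only [map_add, map_smul, baseCLM_apply]
    rw [← he]
    have h0 : base e = 0 := by simpa using hbe 1
    have h1 : (Ls : Space (d + 1) →L[ℝ] Space (d + 1)) e = Ls e := rfl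
    rw [h0, h1, smul_zero, add_zero]
    module
  · have hU := hΘU y hy
    have : Θ y ∈ Ω ↔ Θ y ∈ Ω ∩ A.U r := by simp [hU]
    rw [this, A.side r]
    simp only [mem_ofPred_eq, hU, true_and]
    rw [← hχ, hbΘ, hhΘ]
    constructor <;> intro h <;> linarith
  · have hU := hΘU y hy
    have : Θ y ∈ frontier Ω ↔ Θ y ∈ frontier Ω ∩ A.U r := by simp [hU]
    rw [this, A.graph r]
    simp only [mem_ofPred_eq]
    have hc := A.base_mem r _ hU
    rw [← hχ, hbΘ, hhΘ] at *
    simp only [hc, true_and]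
    constructor <;> intro h <;> linarith

end

/-! ### Polynomial approximation on a slab above a flat boundary -/

section
variable {n : ℕ}

lemma enorm_tensorDeriv_zero (g : Space n → ℝ) (x : Space n) : ‖tensorDeriv 0 g x‖ₑ = ‖g x‖ₑ := by
  have h : ‖tensorDeriv 0 g x‖ = ‖g x‖ := by
    refine le_antisymm ?_ ?_
    · simpa using norm_tensorDeriv_le 0 g x
    · simpa using norm_iteratedFDeriv_le_tensorDeriv 0 g x
  rw [← ofReal_norm, ← ofReal_norm, h]

lemma tensorDeriv_sub_of_contDiffAt {l : ℕ} {f g : Space n → ℝ} {x : Space n}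
    (hf : ContDiffAt ℝ l f x) (hg : ContDiffAt ℝ l g x) :
    tensorDeriv l (fun y => f y - g y) x = tensorDeriv l f x - tensorDeriv l g x := by
  have e : (fun y => f y - g y) = f - g := rfl
  rw [e]
  unfold tensorDeriv
  rw [iteratedFDeriv_sub_apply hf hg, map_sub]

/-- The unit vector in the direction of the last coordinate. -/
noncomputable abbrev lastVec (d : ℕ) : Space (d + 1) := EuclideanSpace.single (Fin.last d) 1

lemma enorm_iteratedFDeriv_lastVec_le {d : ℕ} (l : ℕ) (g : Space (d + 1) → ℝ) (x : Space (d + 1)) :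
    ‖iteratedFDeriv ℝ l g x (fun _ => lastVec d)‖ₑ ≤ ‖tensorDeriv l g x‖ₑ := by
  have := abs_tensor_apply_le (tensorDeriv l g x) (fun _ => Fin.last d)
  rw [← ofReal_norm, ← ofReal_norm]
  exact ENNReal.ofReal_le_ofReal this

/-- The part of a cube around the origin above the height `s`. -/
def slab {d : ℕ} (ρ s : ℝ) : Set (Space (d + 1)) :=
  {y | (∀ i : Fin d, |y (Fin.castSucc i)| < ρ) ∧ s < height y ∧ height y < ρ}

section slab

variable {d : ℕ} {ρ s : ℝ}

lemma continuous_height : Continuous (height (d := d)) := by unfold height; fun_prop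

lemma isOpen_slab : IsOpen (slab (d := d) ρ s) := by
  have : slab (d := d) ρ s = (⋂ i : Fin d, {y | |y (Fin.castSucc i)| < ρ}) ∩
      ({y | s < height y} ∩ {y | height y < ρ}) := by
    ext y; simp [slab]
  rw [this]
  exact (isOpen_iInter_of_finite fun i => isOpen_lt (by fun_prop) continuous_const).inter
    ((isOpen_lt continuous_const continuous_height).inter
      (isOpen_lt continuous_height continuous_const))

lemma convex_slab : Convex ℝ (slab (d := d) ρ s) := by
  rintro x ⟨hx, hx1, hx2⟩ y ⟨hy, hy1, hy2⟩ a b ha hb hab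
  refine ⟨fun i => ?_, ?_, ?_⟩
  · have h1 := abs_lt.mp (hx i)
    have h2 := abs_lt.mp (hy i)
    have hc := (convex_Ioo (-ρ) ρ) (mem_Ioo.mpr h1) (mem_Ioo.mpr h2) ha hb hab
    exact abs_lt.mpr hc
  · exact (convex_Ioi s) (mem_Ioi.mpr hx1) (mem_Ioi.mpr hy1) ha hb hab
  · exact (convex_Iio ρ) (mem_Iio.mpr hx2) (mem_Iio.mpr hy2) ha hb hab

lemma norm_le_of_coord_le {y : Space (d + 1)} (h : ∀ i : Fin d, |y (Fin.castSucc i)| ≤ ρ)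
    (h' : |height y| ≤ ρ) : ‖y‖ ≤ (d + 1 : ℕ) * ρ := by
  refine (norm_euclidean_le_sum y).trans ?_
  calc ∑ i, ‖y i‖ ≤ ∑ _i : Fin (d + 1), ρ := Finset.sum_le_sum fun i _ => by
        rw [Real.norm_eq_abs]
        refine Fin.lastCases h' h i
    _ = _ := by simp

lemma norm_le_of_mem_slab (hs : 0 ≤ s) {y : Space (d + 1)} (hy : y ∈ slab ρ s) :
    ‖y‖ ≤ (d + 1 : ℕ) * ρ :=
  norm_le_of_coord_le (fun i => (hy.1 i).le)
    (abs_le.mpr ⟨by linarith [hy.2.1, hy.2.2], hy.2.2.le⟩)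

lemma volume_slab_le (hρ : 0 < ρ) (hs : 0 ≤ s) : volume (slab (d := d) ρ s) ≤
    ENNReal.ofReal (ρ ^ (d + 1)) * volume (Metric.closedBall (0 : Space (d + 1)) (d + 1 : ℕ)) := by
  refine (measure_mono (t := Metric.closedBall 0 (ρ * (d + 1 : ℕ))) fun y hy => ?_).trans ?_
  · rw [mem_closedBall_zero_iff, mul_comm]; exact norm_le_of_mem_slab hs hy
  · rw [Measure.addHaar_closedBall_mul _ _ hρ.le (by positivity), finrank_euclideanSpace_fin]

/-- Center of a ball in the upper part of the unit slab. -/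
noncomputable def slabPt (d : ℕ) : Space (d + 1) := (3 / 4 : ℝ) • lastVec d

lemma closedBall_subset_slab (hρ : 0 < ρ) (hs : s ≤ ρ / 2) :
    Metric.closedBall (ρ • slabPt d) (ρ / 8) ⊆ slab ρ s := by
  intro y hy
  rw [mem_closedBall_iff_norm] at hy
  have h : ∀ i, |(y - ρ • slabPt d) i| ≤ ρ / 8 := fun i => (PiLp.norm_apply_le _ i).trans hy
  have hl := h (Fin.last d)
  simp only [slabPt, PiLp.sub_apply, PiLp.smul_apply, PiLp.single_apply, if_true,
    smul_eq_mul, mul_one] at hl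
  have hl' := abs_le.mp hl
  refine ⟨fun i => ?_, ?_, ?_⟩
  · have := h (Fin.castSucc i)
    simp only [slabPt, PiLp.sub_apply, PiLp.smul_apply, PiLp.single_apply,
      Fin.castSucc_ne_last, if_false, smul_eq_mul, mul_zero, sub_zero] at this
    linarith
  · unfold height; linarith
  · unfold height; linarith

end slab

/-- Taylor's formula on a segment in the last coordinate direction. -/
lemma enorm_le_of_vertical_segment {d : ℕ} {U : Set (Space (d + 1))} (hU : IsOpen U)
    {g : Space (d + 1) → ℝ} (hg : ContDiffOn ℝ 2 g U) {y : Space (d + 1)} {a : ℝ} (ha : 0 ≤ a)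
    (hseg : ∀ s ∈ Icc (-a) 0, y + s • lastVec d ∈ U) :
    ‖g (y + (-a) • lastVec d)‖ₑ ≤ ‖g y‖ₑ + ENNReal.ofReal a * ‖tensorDeriv 1 g y‖ₑ +
      ∫⁻ s in Ioc (-a) 0, ‖s + a‖ₑ *
        ‖iteratedFDeriv ℝ 2 g (y + s • lastVec d) (fun _ => lastVec d)‖ₑ := by
  set e := lastVec d with he
  set φ' : ℝ → ℝ := fun s => fderiv ℝ g (y + s • e) e with hφ'
  set φ'' : ℝ → ℝ := fun s => iteratedFDeriv ℝ 2 g (y + s • e) (fun _ => e) with hφ''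
  have hline : ∀ s : ℝ, HasDerivAt (fun s : ℝ => y + s • e) e s := fun s => by
    simpa using ((hasDerivAt_id s).smul_const e).const_add y
  have hd1 : ∀ s ∈ Icc (-a) 0, HasDerivAt (fun s : ℝ => g (y + s • e)) (φ' s) s := by
    intro s hs
    have h1 : HasFDerivAt g (fderiv ℝ g (y + s • e)) (y + s • e) :=
      ((hg.contDiffAt (hU.mem_nhds (hseg s hs))).differentiableAt (by simp)).hasFDerivAt
    exact h1.comp_hasDerivAt s (hline s)
  have hc1 : ∀ s ∈ Icc (-a) 0, ContDiffAt ℝ 1 (fderiv ℝ g) (y + s • e) := fun s hs =>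
    (hg.contDiffAt (hU.mem_nhds (hseg s hs))).fderiv_right (by norm_num)
  have hd2 : ∀ s ∈ Icc (-a) 0, HasDerivAt φ' (φ'' s) s := by
    intro s hs
    have h1 : HasFDerivAt (fderiv ℝ g) (fderiv ℝ (fderiv ℝ g) (y + s • e)) (y + s • e) :=
      ((hc1 s hs).differentiableAt (by simp)).hasFDerivAt
    have h2 : HasDerivAt (fun s : ℝ => fderiv ℝ g (y + s • e))
        (fderiv ℝ (fderiv ℝ g) (y + s • e) e) s := h1.comp_hasDerivAt s (hline s)
    have h3 : φ'' s = fderiv ℝ (fderiv ℝ g) (y + s • e) e e := by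
      simp only [hφ'']; rw [iteratedFDeriv_two_apply]
    rw [h3]
    exact (ContinuousLinearMap.apply ℝ ℝ e).hasFDerivAt.comp_hasDerivAt s h2
  have hcont : ContinuousOn φ'' (Icc (-a) 0) := by
    intro s hs
    have h3 : φ'' = fun s => fderiv ℝ (fderiv ℝ g) (y + s • e) e e := by
      ext s; simp only [hφ'']; rw [iteratedFDeriv_two_apply]
    rw [h3]
    have h4 : ContinuousAt (fderiv ℝ (fderiv ℝ g)) (y + s • e) :=
      ((hc1 s hs).fderiv_right (m := 0) (by norm_num)).continuousAt
    have h5 : ContinuousAt (fun s : ℝ => fderiv ℝ (fderiv ℝ g) (y + s • e)) s :=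
      ContinuousAt.comp (f := fun s : ℝ => y + s • e) h4 (by fun_prop)
    exact ((h5.clm_apply continuousAt_const).clm_apply continuousAt_const).continuousWithinAt
  have hle : -a ≤ 0 := by linarith
  -- The function `g (y + s e) - (s + a) φ' s` has the derivative `-(s + a) φ''`. The weight `s + a`
  -- vanishes at the lower end of the segment. When `a` is the height of `y`, the weight is the
  -- height of the point `y + s e`.
  have hftc : ∫ s in (-a)..0, -((s + a) * φ'' s) =
      (g (y + (0 : ℝ) • e) - (0 + a) * φ' 0) - (g (y + (-a) • e) - (-a + a) * φ' (-a)) := by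
    refine intervalIntegral.integral_eq_sub_of_hasDerivAt
      (f := fun s => g (y + s • e) - (s + a) * φ' s) (fun s hs => ?_) ?_
    · rw [uIcc_of_le hle] at hs
      have : HasDerivAt (fun s => g (y + s • e) - (s + a) * φ' s)
          (φ' s - (1 * φ' s + (s + a) * φ'' s)) s :=
        (hd1 s hs).sub (((hasDerivAt_id s).add_const a).mul (hd2 s hs))
      exact this.congr_deriv (by ring)
    · refine ContinuousOn.intervalIntegrable ?_
      rw [uIcc_of_le hle]
      fun_prop
  have hval : g (y + (-a) • e) = g y - a * φ' 0 + ∫ s in (-a)..0, (s + a) * φ'' s := by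
    rw [intervalIntegral.integral_neg] at hftc
    simp only [zero_smul, add_zero, zero_add, neg_add_cancel, zero_mul, sub_zero] at hftc
    linarith
  rw [hval]
  refine (enorm_add_le _ _).trans (add_le_add ((enorm_sub_le).trans (add_le_add le_rfl ?_)) ?_)
  · rw [enorm_mul, ← ofReal_norm a, Real.norm_of_nonneg ha]
    gcongr
    have h1 : φ' 0 = iteratedFDeriv ℝ 1 g y (fun _ => e) := by
      simp [hφ', iteratedFDeriv_one_apply]
    rw [h1]
    exact enorm_iteratedFDeriv_lastVec_le 1 g y
  · rw [intervalIntegral.integral_of_le hle]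
    refine (enorm_integral_le_lintegral_enorm _).trans (lintegral_mono fun s => ?_)
    rw [enorm_mul]

lemma lintegral_lintegral_translate_le {ρ : ℝ} {W : Space n → ℝ≥0∞}
    (hW : Measurable W) (K : Set (Space n)) (e : Space n) :
    ∫⁻ y in K, ∫⁻ s in Ioc (-ρ) 0, W (y + s • e) ≤ ENNReal.ofReal ρ * ∫⁻ y, W y := by
  rw [lintegral_lintegral_swap]
  · calc ∫⁻ s in Ioc (-ρ) 0, ∫⁻ y in K, W (y + s • e)
        ≤ ∫⁻ _s in Ioc (-ρ) 0, ∫⁻ y, W y := by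
          refine lintegral_mono fun s => (setLIntegral_le_lintegral _ _).trans ?_
          rw [lintegral_add_right_eq_self]
      _ = _ := by
          rw [lintegral_const, Measure.restrict_apply_univ, Real.volume_Ioc, mul_comm]
          simp
  · exact (hW.comp (by fun_prop : Measurable fun q : Space n × ℝ => q.1 + q.2 • e)).aemeasurable


set_option maxHeartbeats 1000000 in
/-- Approximation on a slab by a polynomial whose value at the origin is small if the function is
small on the flat part of the boundary. -/
theorem exists_polyLT_slab (d : ℕ) {m : ℕ} (hm : 2 ≤ m) : ∃ C : ℝ, 0 < C ∧
    ∀ (ρ s₀ : ℝ), 0 < ρ → ρ ≤ 1 → 0 ≤ s₀ → s₀ ≤ ρ / 2 → ∀ (U : Set (Space (d + 1))), IsOpen U →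
    Metric.closedBall 0 ((d + 1 : ℕ) * ρ) ⊆ U → ∀ f : Space (d + 1) → ℝ, ContDiffOn ℝ m f U →
    ∀ η A D : ℝ≥0∞,
    (∀ y : Space (d + 1), (∀ i : Fin d, |y (Fin.castSucc i)| < ρ) → height y = 0 → ‖f y‖ₑ ≤ η) →
    (∀ j ≤ m, ∫⁻ y in slab ρ s₀, ‖tensorDeriv j f y‖ₑ ≤ A) →
    (∫⁻ y in slab ρ 0, ‖iteratedFDeriv ℝ 2 f y (fun _ => lastVec d)‖ₑ ≤ D) →
    ∃ P ∈ polyLT (d + 1) m,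
      (∀ j ≤ m, ∀ y ∈ Metric.closedBall (0 : Space (d + 1)) ((d + 1 : ℕ) * ρ),
        ‖tensorDeriv j P y‖ₑ ≤ ENNReal.ofReal (C / ρ ^ (d + 1)) * A) ∧
      (∫⁻ y in slab ρ s₀, ‖f y - P y‖ₑ ≤ ENNReal.ofReal (C * ρ ^ m) * A) ∧
      ‖P 0‖ₑ ≤ ENNReal.ofReal C * η + ENNReal.ofReal (C * (ρ ^ m + s₀ * ρ) / ρ ^ (d + 1)) * A +
        ENNReal.ofReal (C * (s₀ * ρ) / ρ ^ (d + 1)) * D := by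
  classical
  set N := d + 1 with hN
  have hN1 : (1 : ℝ) ≤ (N : ℕ) := by exact_mod_cast Nat.succ_le_succ (Nat.zero_le d)
  -- The fixed ball is chosen in the upper part of the unit slab. Scaled by `ρ` it lies in the slab
  -- for every `s₀ ≤ ρ / 2`, so the constants depend on neither `ρ` nor `s₀`.
  choose Cb hCb0 hCb using fun j => exists_polyLT_bound N m j
    (B := Metric.ball (slabPt d) (1 / 8)) (K := Metric.closedBall 0 (N : ℕ)) Metric.isOpen_ball
    ⟨_, Metric.mem_ball_self (by norm_num)⟩ Metric.isBounded_ball (isCompact_closedBall _ _)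
  set C2 : ℝ := ∑ j ∈ Finset.range (m + 1), Cb j with hC2
  have hCb2 : ∀ j ≤ m, Cb j ≤ C2 := fun j hj =>
    Finset.single_le_sum (f := Cb) (fun i _ => (hCb0 i).le) (Finset.mem_range.mpr (by omega))
  have hC2p : 0 < C2 := (hCb0 0).trans_le (hCb2 0 (by omega))
  -- The number `8 N` is the ratio of the radius `N ρ` of a ball containing the slab to the radius
  -- `ρ / 8` of a ball inside it.
  set Pc : ℝ := (N : ℝ) ^ (2 * m + 1) * (2 ^ N * (1 + (8 * N) ^ N)) with hPc
  have hPc0 : 0 ≤ Pc := by positivity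
  set C1 : ℝ := Pc * (2 * N) with hC1
  have hC10 : 0 ≤ C1 := by positivity
  set M1 : ℝ := (1 + C1) ^ m with hM1
  have hM11 : 1 ≤ M1 := one_le_pow₀ (by linarith)
  obtain ⟨V, hV0, hV⟩ := exists_ofReal_of_ne_top
    (measure_closedBall_lt_top (μ := volume) (x := (0 : Space N)) (r := (N : ℕ))).ne
  set C : ℝ := M1 + C2 * (1 + M1) + C2 * V + C2 * (3 * M1) + C2 * (V * (C2 * (1 + M1))) + C2 with hC
  refine ⟨C, by positivity, fun ρ s₀ hρ hρ1 hs0 hs U hU hUb f hf η A D hη hA hD => ?_⟩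
  set K := slab (d := d) ρ s₀ with hK
  set K₀ := slab (d := d) ρ 0 with hK₀
  have hK₀U : K₀ ⊆ U := fun y hy => hUb (mem_closedBall_zero_iff.mpr (norm_le_of_mem_slab le_rfl hy))
  have hKK₀ : K ⊆ K₀ := fun y hy => ⟨hy.1, hs0.trans_lt hy.2.1, hy.2.2⟩
  have hKU : K ⊆ U := hKK₀.trans hK₀U
  have hKb : K ⊆ Metric.closedBall 0 (N * ρ) := fun y hy =>
    mem_closedBall_zero_iff.mpr (norm_le_of_mem_slab hs0 hy)
  have hfj : ∀ j ≤ m, ContDiffOn ℝ j f U := fun j hj => hf.of_le (by exact_mod_cast hj)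
  have hvolB : volume (Metric.closedBall (ρ • slabPt d) (ρ / 8)) ≠ 0 :=
    (Metric.measure_closedBall_pos volume _ (by positivity)).ne'
  have hratio : volume K / volume (Metric.closedBall (ρ • slabPt d) (ρ / 8)) ≤
      ENNReal.ofReal ((8 * N) ^ N) := by
    refine ENNReal.div_le_of_le_mul ((measure_mono hKb).trans ?_)
    have e1 : (N : ℝ) * ρ = (8 * N) * (ρ / 8) := by ring
    rw [e1, Measure.addHaar_closedBall_mul _ _ (by positivity) (by positivity),
      finrank_euclideanSpace_fin, Measure.addHaar_closedBall_center volume (ρ • slabPt d)]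
  obtain ⟨P, hPm, hP⟩ := exists_polyLT_approx (K := K) (B := Metric.closedBall (ρ • slabPt d) (ρ / 8))
    isOpen_slab convex_slab (Metric.isBounded_closedBall.subset hKb) (isCompact_closedBall _ _)
    (closedBall_subset_slab hρ hs) hvolB (d := 2 * N * ρ) (P := Pc) (by positivity) hPc0
    (fun x hx y hy => by
      have h1 := mem_closedBall_zero_iff.mp (hKb hx)
      have h2 := mem_closedBall_zero_iff.mp (hKb hy)
      have := dist_le_norm_add_norm x y
      linarith) (m := m) (fun j hj => by
      rw [hPc, ENNReal.ofReal_mul (by positivity), ENNReal.ofReal_mul (by positivity),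
        ENNReal.ofReal_add (by positivity) (by positivity)]
      refine mul_le_mul' (ENNReal.ofReal_le_ofReal (pow_le_pow_right₀ hN1 (by omega)))
        (mul_le_mul' ?_ (add_le_add ?_ hratio))
      · rw [ENNReal.ofReal_pow (by positivity)]; simp [hN]
      · simp)
    (v := f) (G := fun j => tensorDeriv j f)
    (fun j hj => isWeakGrad_tensorDeriv isOpen_slab ((hfj j hj).mono hKU)) (p := 1) le_rfl
  have hPs : ∀ j : ℕ, ContDiff ℝ j P := fun j => contDiff_of_mem_polyLT hPm _
  have hPt : ∀ j : ℕ, Continuous (tensorDeriv j P) := fun j =>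
    (contDiff_tensorDeriv (contDiff_of_mem_polyLT hPm _) j).continuous
  have hdiff : ∀ j ≤ m, ∫⁻ y in K, ‖tensorDeriv j f y - tensorDeriv j P y‖ₑ ≤
      ENNReal.ofReal (M1 * ρ ^ (m - j)) * A := by
    intro j hj
    have h1 := hP j hj
    rw [eLpNorm_one_eq_lintegral_enorm, eLpNorm_one_eq_lintegral_enorm] at h1
    refine h1.trans ?_
    have h2 := hA m le_rfl
    gcongr
    rw [show Pc * (2 * N * ρ) = C1 * ρ by rw [hC1]; ring, mul_pow]
    gcongr
    calc C1 ^ (m - j) ≤ (1 + C1) ^ (m - j) := by gcongr; linarith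
      _ ≤ (1 + C1) ^ m := pow_le_pow_right₀ (by linarith) (by omega)
  have hg : ∀ j ≤ m, ∀ y ∈ U, tensorDeriv j (fun y => f y - P y) y =
      tensorDeriv j f y - tensorDeriv j P y := fun j hj y hy =>
    tensorDeriv_sub_of_contDiffAt ((hfj j hj).contDiffAt (hU.mem_nhds hy)) (hPs j).contDiffAt
  have hgs : ContDiffOn ℝ m (fun y => f y - P y) U := hf.sub (hPs m).contDiffOn
  have hgint : ∀ j ≤ m, ∫⁻ y in K, ‖tensorDeriv j (fun y => f y - P y) y‖ₑ ≤
      ENNReal.ofReal (M1 * ρ ^ (m - j)) * A := by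
    intro j hj
    refine le_trans (le_of_eq ?_) (hdiff j hj)
    exact setLIntegral_congr_fun isOpen_slab.measurableSet fun y hy => by rw [hg j hj y (hKU hy)]
  have himg : (fun x : Space N => (0 : Space N) + ρ • x) '' Metric.ball (slabPt d) (1 / 8) ⊆ K := by
    rintro _ ⟨x, hx, rfl⟩
    apply closedBall_subset_slab hρ hs
    simp only [mem_closedBall_iff_norm, zero_add]
    rw [← smul_sub, norm_smul, Real.norm_of_nonneg hρ.le]
    have := (mem_ball_iff_norm.mp hx).le
    calc ρ * ‖x - slabPt d‖ ≤ ρ * (1 / 8) := by gcongr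
      _ = ρ / 8 := by ring
  have hsup : ∀ j ≤ m, ∀ Q ∈ polyLT N m, ∀ y ∈ Metric.closedBall (0 : Space N) (N * ρ),
      ‖tensorDeriv j Q y‖ₑ ≤ ENNReal.ofReal (C2 / ρ ^ N) * ∫⁻ y in K, ‖tensorDeriv j Q y‖ₑ := by
    intro j hj Q hQ y hy
    have h1 := hCb j Q hQ 0 ρ hρ (ρ⁻¹ • y) (by
      rw [mem_closedBall_zero_iff] at hy ⊢
      rw [norm_smul, norm_inv, Real.norm_of_nonneg hρ.le, inv_mul_le_iff₀ hρ, mul_comm]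
      exact hy)
    rw [zero_add, smul_inv_smul₀ hρ.ne'] at h1
    refine h1.trans ?_
    have := hCb2 j hj
    gcongr
  have hPint : ∀ j ≤ m, ∫⁻ y in K, ‖tensorDeriv j P y‖ₑ ≤ ENNReal.ofReal (1 + M1) * A := by
    intro j hj
    calc ∫⁻ y in K, ‖tensorDeriv j P y‖ₑ
        ≤ ∫⁻ y in K, (‖tensorDeriv j f y‖ₑ + ‖tensorDeriv j f y - tensorDeriv j P y‖ₑ) := by
          refine lintegral_mono fun y => ?_
          have : tensorDeriv j P y = tensorDeriv j f y - (tensorDeriv j f y - tensorDeriv j P y) := by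
            abel
          conv_lhs => rw [this]
          exact enorm_sub_le
      _ = (∫⁻ y in K, ‖tensorDeriv j f y‖ₑ) +
          ∫⁻ y in K, ‖tensorDeriv j f y - tensorDeriv j P y‖ₑ :=
          lintegral_add_left' (((continuousOn_tensorDeriv hU (hfj j hj)).mono hKU).aemeasurable
            isOpen_slab.measurableSet).enorm _
      _ ≤ A + ENNReal.ofReal (M1 * ρ ^ (m - j)) * A := add_le_add (hA j hj) (hdiff j hj)
      _ ≤ A + ENNReal.ofReal M1 * A := by
          gcongr
          exact mul_le_of_le_one_right (by linarith) (pow_le_one₀ hρ.le hρ1)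
      _ = _ := by
          rw [ENNReal.ofReal_add zero_le_one (by linarith), add_mul, ENNReal.ofReal_one, one_mul]
  have hPsup : ∀ j ≤ m, ∀ y ∈ Metric.closedBall (0 : Space N) (N * ρ),
      ‖tensorDeriv j P y‖ₑ ≤ ENNReal.ofReal (C2 * (1 + M1) / ρ ^ N) * A := by
    intro j hj y hy
    refine (hsup j hj P hPm y hy).trans ?_
    calc _ ≤ ENNReal.ofReal (C2 / ρ ^ N) * (ENNReal.ofReal (1 + M1) * A) := by
          gcongr; exact hPint j hj
      _ = _ := by
          rw [← mul_assoc, ← ENNReal.ofReal_mul (by positivity)]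
          congr 2; ring
  refine ⟨P, hPm, fun j hj y hy => (hPsup j hj y hy).trans ?_, ?_, ?_⟩
  · gcongr
    rw [hC]
    have : 0 ≤ M1 + C2 * V + C2 * (3 * M1) + C2 * (V * (C2 * (1 + M1))) + C2 := by positivity
    linarith
  · refine le_trans (le_of_eq ?_) ((hdiff 0 (by omega)).trans ?_)
    · refine setLIntegral_congr_fun isOpen_slab.measurableSet fun y hy => ?_
      rw [← hg 0 (by omega) y (hKU hy), enorm_tensorDeriv_zero]
    · rw [Nat.sub_zero]
      gcongr
      rw [hC]
      have : 0 ≤ C2 * (1 + M1) + C2 * V + C2 * (3 * M1) + C2 * (V * (C2 * (1 + M1))) + C2 := by positivity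
      linarith
  · set g : Space (d + 1) → ℝ := fun y => f y - P y with hgdef
    set e := lastVec d with he
    have h2m : ((2 : ℕ) : WithTop ℕ∞) ≤ (m : ℕ) := by exact_mod_cast hm
    have hcont : ∀ u : Space (d + 1) → ℝ, ContDiffOn ℝ m u U →
        ContinuousOn (fun z => iteratedFDeriv ℝ 2 u z (fun _ => e)) K₀ := by
      intro u hu z hz
      have h1 : ContDiffAt ℝ (2 : ℕ) u z := (hu.of_le h2m).contDiffAt (hU.mem_nhds (hK₀U hz))
      have h3 : ContinuousAt (iteratedFDeriv ℝ 2 u) z :=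
        (h1.iteratedFDeriv_right (m := 0) (i := 2) (by simp)).continuousAt
      exact ((ContinuousMultilinearMap.apply ℝ (fun _ : Fin 2 => Space (d + 1)) ℝ
        (fun _ => e)).continuous.continuousAt.comp h3).continuousWithinAt
    set r : Space (d + 1) → ℝ := fun z => height z * iteratedFDeriv ℝ 2 g z (fun _ => e) with hr
    have hrc : ContinuousOn r K₀ := continuous_height.continuousOn.mul (hcont g hgs)
    set W : Space (d + 1) → ℝ≥0∞ := fun z => ‖K₀.indicator r z‖ₑ with hW
    have hWm : Measurable W := by
      have : Measurable (K₀.indicator r) := by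
        rw [← Set.piecewise_eq_indicator]
        exact hrc.measurable_piecewise continuousOn_const isOpen_slab.measurableSet
      exact this.enorm
    -- The remainder is split at the height `s₀`. Above it, the weight is at most `ρ` and the second
    -- derivatives of `f - P` are small by approximation. Below it, `P` need not be close to `f`, so
    -- the two are estimated separately, with the weight at most `s₀`.
    have hWint : ∫⁻ z, W z ≤ ENNReal.ofReal ρ * (ENNReal.ofReal (M1 * ρ ^ (m - 2)) * A) +
        ENNReal.ofReal s₀ * (D + ENNReal.ofReal (C2 * (1 + M1) / ρ ^ N) * A *
          (ENNReal.ofReal (ρ ^ N) * ENNReal.ofReal V)) := by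
      have hma : AEMeasurable (fun z => ‖iteratedFDeriv ℝ 2 f z (fun _ => e)‖ₑ)
          (volume.restrict K₀) := ((hcont f hf).aemeasurable isOpen_slab.measurableSet).enorm
      have hmb : AEMeasurable (fun z => ‖tensorDeriv 2 P z‖ₑ) (volume.restrict K₀) :=
        (hPt 2).measurable.enorm.aemeasurable
      calc ∫⁻ z, W z = ∫⁻ z in K₀, ‖r z‖ₑ := by
            rw [← lintegral_indicator isOpen_slab.measurableSet]
            refine lintegral_congr fun z => ?_
            simp only [hW]
            exact enorm_indicator_eq_indicator_enorm _ _
        _ ≤ ∫⁻ z in K₀, (K.indicator (fun z => ENNReal.ofReal ρ * ‖tensorDeriv 2 g z‖ₑ) z +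
              ENNReal.ofReal s₀ *
                (‖iteratedFDeriv ℝ 2 f z (fun _ => e)‖ₑ + ‖tensorDeriv 2 P z‖ₑ)) := by
            refine setLIntegral_mono' isOpen_slab.measurableSet fun z hz => ?_
            simp only [hr]
            rw [enorm_mul]
            have hh : ‖height z‖ₑ = ENNReal.ofReal (height z) := by
              rw [← ofReal_norm, Real.norm_of_nonneg hz.2.1.le]
            rw [hh]
            by_cases hzK : z ∈ K
            · rw [indicator_of_mem hzK]
              refine le_trans ?_ le_self_add
              exact mul_le_mul' (ENNReal.ofReal_le_ofReal hz.2.2.le)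
                (enorm_iteratedFDeriv_lastVec_le 2 g z)
            · rw [indicator_of_notMem hzK, zero_add]
              have hzs : height z ≤ s₀ := by
                by_contra hlt
                exact hzK ⟨hz.1, not_le.mp hlt, hz.2.2⟩
              refine mul_le_mul' (ENNReal.ofReal_le_ofReal hzs) ?_
              have e1 : iteratedFDeriv ℝ 2 g z (fun _ => e) =
                  iteratedFDeriv ℝ 2 f z (fun _ => e) - iteratedFDeriv ℝ 2 P z (fun _ => e) := by
                have e2 : g = f - P := rfl
                rw [e2, iteratedFDeriv_sub_apply
                  ((hfj 2 hm).contDiffAt (hU.mem_nhds (hK₀U hz))) (hPs 2).contDiffAt]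
                rfl
              rw [e1]
              exact enorm_sub_le.trans (add_le_add le_rfl (enorm_iteratedFDeriv_lastVec_le 2 P z))
        _ = (∫⁻ z in K₀, K.indicator (fun z => ENNReal.ofReal ρ * ‖tensorDeriv 2 g z‖ₑ) z) +
            ∫⁻ z in K₀, ENNReal.ofReal s₀ *
                (‖iteratedFDeriv ℝ 2 f z (fun _ => e)‖ₑ + ‖tensorDeriv 2 P z‖ₑ) :=
            lintegral_add_right' _ ((hma.add hmb).const_mul _)
        _ ≤ _ := by
            refine add_le_add ?_ ?_
            · refine (setLIntegral_le_lintegral _ _).trans ?_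
              rw [lintegral_indicator isOpen_slab.measurableSet,
                lintegral_const_mul' _ _ ENNReal.ofReal_ne_top]
              exact mul_le_mul' le_rfl (hgint 2 hm)
            · rw [lintegral_const_mul' _ _ ENNReal.ofReal_ne_top, lintegral_add_left' hma]
              refine mul_le_mul' le_rfl (add_le_add hD ?_)
              calc ∫⁻ z in K₀, ‖tensorDeriv 2 P z‖ₑ
                  ≤ ∫⁻ _z in K₀, ENNReal.ofReal (C2 * (1 + M1) / ρ ^ N) * A :=
                    setLIntegral_mono' isOpen_slab.measurableSet fun z hz => hPsup 2 hm z
                      (mem_closedBall_zero_iff.mpr (norm_le_of_mem_slab le_rfl hz))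
                _ = ENNReal.ofReal (C2 * (1 + M1) / ρ ^ N) * A * volume K₀ := by
                    rw [setLIntegral_const]
                _ ≤ _ := by
                    gcongr
                    refine (volume_slab_le hρ le_rfl).trans ?_
                    gcongr
    have hbase : ∀ y : Space (d + 1), ∀ s : ℝ, (∀ i : Fin d,
        (y + s • e) (Fin.castSucc i) = y (Fin.castSucc i)) ∧ height (y + s • e) = height y + s := by
      intro y s
      refine ⟨fun i => ?_, ?_⟩
      · simp [he, Fin.castSucc_ne_last]
      · simp [he, height]
    -- At the vertical projection of `y` to the flat boundary `f` is at most `η`, so `P` there is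
    -- `-(f - P)` up to `η`, and Taylor's formula applies to `f - P`.
    have hpt : ∀ y ∈ K, ‖P (y + (-height y) • e)‖ₑ ≤ η + (‖g y‖ₑ +
        ENNReal.ofReal ρ * ‖tensorDeriv 1 g y‖ₑ + ∫⁻ s in Ioc (-ρ) 0, W (y + s • e)) := by
      intro y hy
      have hyh : 0 ≤ height y := hs0.trans hy.2.1.le
      have e1 : P (y + (-height y) • e) = f (y + (-height y) • e) - g (y + (-height y) • e) := by
        simp only [hgdef]; ring
      rw [e1]
      refine enorm_sub_le.trans (add_le_add (hη _ (fun i => ?_) ?_) ?_)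
      · rw [(hbase y _).1 i]; exact hy.1 i
      · rw [(hbase y _).2]; ring
      · refine (enorm_le_of_vertical_segment hU (hgs.of_le h2m) hyh (fun s hs => hUb ?_)).trans ?_
        · rw [mem_closedBall_zero_iff]
          refine norm_le_of_coord_le (fun i => ?_) ?_
          · rw [(hbase y s).1 i]; exact (hy.1 i).le
          · rw [(hbase y s).2, abs_le]
            constructor <;> linarith [hs.1, hs.2, hy.2.2]
        · refine add_le_add (add_le_add le_rfl (mul_le_mul' (ENNReal.ofReal_le_ofReal hy.2.2.le)
            le_rfl)) ?_
          refine le_trans (setLIntegral_mono' measurableSet_Ioc fun s hs => ?_)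
            (lintegral_mono_set (Ioc_subset_Ioc_left (by linarith [hy.2.2])))
          have hmem : y + s • e ∈ K₀ := by
            refine ⟨fun i => ?_, ?_, ?_⟩
            · rw [(hbase y s).1 i]; exact hy.1 i
            · rw [(hbase y s).2]; linarith [hs.1]
            · rw [(hbase y s).2]; linarith [hs.2, hy.2.2]
          simp only [hW]
          rw [indicator_of_mem hmem]
          simp only [hr]
          rw [enorm_mul, (hbase y s).2, add_comm s]
    set Lp : Space N →L[ℝ] Space N := ContinuousLinearMap.id ℝ _ -
      (EuclideanSpace.proj (Fin.last d) : Space N →L[ℝ] ℝ).smulRight e with hLp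
    have hLpv : ∀ y : Space N, 0 + Lp y = y + (-height y) • e := by
      intro y
      rw [zero_add, hLp]
      simp [height, sub_eq_add_neg]
    -- Composed with the linear vertical projection, `P` remains a polynomial of the same degree. It
    -- has the same value at the origin, which is therefore bounded by the `L¹` norm of the
    -- composition on the slab.
    have hbar : (fun y : Space N => P (y + (-height y) • e)) ∈ polyLT N m := by
      have := comp_mem_polyLT (comp_affine_mem_affFun 0 Lp) hPm
      simpa only [hLpv] using this
    have hzero : height (0 : Space (d + 1)) = 0 := rfl
    have h0 := hsup 0 (by omega) _ hbar 0 (by simp; positivity)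
    simp only [enorm_tensorDeriv_zero] at h0
    rw [hzero, neg_zero, zero_smul, add_zero] at h0
    have hmg : ∀ j ≤ m, AEMeasurable (fun y => ‖tensorDeriv j g y‖ₑ) (volume.restrict K) :=
      fun j hj => (((continuousOn_tensorDeriv hU (hgs.of_le (by exact_mod_cast hj))).mono
        hKU).aemeasurable isOpen_slab.measurableSet).enorm
    have hmg0 : AEMeasurable (fun y => ‖g y‖ₑ) (volume.restrict K) := by
      simpa only [enorm_tensorDeriv_zero] using hmg 0 (by omega)
    have hmg1 : AEMeasurable (fun y => ‖g y‖ₑ + ENNReal.ofReal ρ * ‖tensorDeriv 1 g y‖ₑ)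
        (volume.restrict K) := hmg0.add ((hmg 1 (by omega)).const_mul _)
    have hI : ∫⁻ y in K, ‖P (y + (-height y) • e)‖ₑ ≤ η * (ENNReal.ofReal (ρ ^ N) *
        ENNReal.ofReal V) + (ENNReal.ofReal (M1 * ρ ^ m) * A +
        ENNReal.ofReal ρ * (ENNReal.ofReal (M1 * ρ ^ (m - 1)) * A) + ENNReal.ofReal ρ *
        (ENNReal.ofReal ρ * (ENNReal.ofReal (M1 * ρ ^ (m - 2)) * A) +
        ENNReal.ofReal s₀ * (D + ENNReal.ofReal (C2 * (1 + M1) / ρ ^ N) * A *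
          (ENNReal.ofReal (ρ ^ N) * ENNReal.ofReal V)))) := by
      refine (setLIntegral_mono' isOpen_slab.measurableSet hpt).trans ?_
      rw [lintegral_add_left measurable_const, setLIntegral_const,
        lintegral_add_left' hmg1,
        lintegral_add_left' hmg0, lintegral_const_mul' _ _ ENNReal.ofReal_ne_top]
      refine add_le_add (mul_le_mul' le_rfl ((volume_slab_le hρ hs0).trans
        (mul_le_mul' le_rfl hV))) (add_le_add (add_le_add ?_ (mul_le_mul' le_rfl
          (hgint 1 (by omega)))) ((lintegral_lintegral_translate_le hWm K e).trans
          (mul_le_mul' le_rfl hWint)))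
      have := hgint 0 (by omega)
      simpa only [enorm_tensorDeriv_zero, Nat.sub_zero] using this
    refine (h0.trans (mul_le_mul' le_rfl hI)).trans ?_
    have e1 : ENNReal.ofReal ρ * (ENNReal.ofReal (M1 * ρ ^ (m - 1)) * A) =
        ENNReal.ofReal (M1 * ρ ^ m) * A := by
      rw [← mul_assoc, ← ENNReal.ofReal_mul hρ.le]
      congr 2
      obtain ⟨i, rfl⟩ : ∃ i, m = i + 1 := ⟨m - 1, by omega⟩
      rw [Nat.add_sub_cancel]; ring
    have e2 : ENNReal.ofReal ρ * (ENNReal.ofReal ρ * (ENNReal.ofReal (M1 * ρ ^ (m - 2)) * A)) =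
        ENNReal.ofReal (M1 * ρ ^ m) * A := by
      rw [← mul_assoc, ← mul_assoc, ← ENNReal.ofReal_mul hρ.le, ← ENNReal.ofReal_mul (by positivity)]
      congr 2
      obtain ⟨i, rfl⟩ : ∃ i, m = i + 2 := ⟨m - 2, by omega⟩
      rw [Nat.add_sub_cancel]; ring
    have e3 : ENNReal.ofReal (C2 * (1 + M1) / ρ ^ N) * A *
          (ENNReal.ofReal (ρ ^ N) * ENNReal.ofReal V) = ENNReal.ofReal (C2 * (1 + M1) * V) * A := by
      rw [mul_right_comm, ← ENNReal.ofReal_mul (by positivity), ← ENNReal.ofReal_mul (by positivity)]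
      congr 2
      field_simp
    have e4 : ENNReal.ofReal (C2 / ρ ^ N) * (ENNReal.ofReal (ρ ^ N) * ENNReal.ofReal V) =
        ENNReal.ofReal (C2 * V) := by
      rw [← ENNReal.ofReal_mul (by positivity), ← ENNReal.ofReal_mul (by positivity)]
      congr 1
      field_simp
    have e5 : ENNReal.ofReal (C2 * (s₀ * ρ) / ρ ^ N) =
        ENNReal.ofReal (C2 / ρ ^ N) * (ENNReal.ofReal ρ * ENNReal.ofReal s₀) := by
      rw [← ENNReal.ofReal_mul (by positivity), ← ENNReal.ofReal_mul (by positivity)]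
      congr 1
      ring
    have e6 : ENNReal.ofReal (C2 * (3 * M1 * ρ ^ m + C2 * (1 + M1) * V * (s₀ * ρ)) / ρ ^ N) =
        ENNReal.ofReal (C2 / ρ ^ N) * (3 * ENNReal.ofReal (M1 * ρ ^ m) +
          ENNReal.ofReal ρ * ENNReal.ofReal s₀ * ENNReal.ofReal (C2 * (1 + M1) * V)) := by
      have h3 : (3 : ℝ≥0∞) = ENNReal.ofReal 3 := by simp
      rw [h3, ← ENNReal.ofReal_mul (by positivity), ← ENNReal.ofReal_mul (by positivity),
        ← ENNReal.ofReal_mul (by positivity), ← ENNReal.ofReal_add (by positivity) (by positivity),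
        ← ENNReal.ofReal_mul (by positivity)]
      congr 1
      ring
    calc _ = ENNReal.ofReal (C2 * V) * η +
          ENNReal.ofReal (C2 * (3 * M1 * ρ ^ m + C2 * (1 + M1) * V * (s₀ * ρ)) / ρ ^ N) * A +
          ENNReal.ofReal (C2 * (s₀ * ρ) / ρ ^ N) * D := by
          rw [mul_add (ENNReal.ofReal ρ), e2, e1, e3, e5, e6, ← e4]
          ring
      _ ≤ _ := by
          have hx0 : 0 ≤ s₀ * ρ := by positivity
          have hx1 : 0 ≤ ρ ^ m := by positivity
          have hx2 : 0 ≤ C2 * V := by positivity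
          have hx3 : 0 ≤ C2 * (1 + M1) := by positivity
          have hx4 : 0 ≤ C2 * (3 * M1) := by positivity
          have hx5 : 0 ≤ C2 * (V * (C2 * (1 + M1))) := by positivity
          have hC1' : C2 * V ≤ C := by rw [hC]; linarith
          have hC2' : C2 * (3 * M1) ≤ C := by rw [hC]; linarith
          have hC3' : C2 * (V * (C2 * (1 + M1))) ≤ C := by rw [hC]; linarith
          have hC4' : C2 ≤ C := by rw [hC]; linarith
          have hx6 : C2 * (3 * M1 * ρ ^ m + C2 * (1 + M1) * V * (s₀ * ρ)) ≤
              C * (ρ ^ m + s₀ * ρ) := by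
            calc C2 * (3 * M1 * ρ ^ m + C2 * (1 + M1) * V * (s₀ * ρ))
                = C2 * (3 * M1) * ρ ^ m + C2 * (V * (C2 * (1 + M1))) * (s₀ * ρ) := by ring
              _ ≤ C * ρ ^ m + C * (s₀ * ρ) := add_le_add (mul_le_mul_of_nonneg_right hC2' hx1)
                  (mul_le_mul_of_nonneg_right hC3' hx0)
              _ = _ := by ring
          have hx7 : 0 ≤ ρ ^ N := by positivity
          exact add_le_add (add_le_add (mul_le_mul' (ENNReal.ofReal_le_ofReal hC1') le_rfl)
            (mul_le_mul' (ENNReal.ofReal_le_ofReal (div_le_div_of_nonneg_right hx6 hx7)) le_rfl))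
            (mul_le_mul' (ENNReal.ofReal_le_ofReal (div_le_div_of_nonneg_right
              (mul_le_mul_of_nonneg_right hC4' hx0) hx7)) le_rfl)

end

section
variable {n : ℕ}

/-! ### The position of the elements at the boundary -/

/-- The ball is connected, so it suffices that the open image is relatively closed in it. A limit
point is the image of some point of the compact simplex; if it lies in the ball, the lower distance
estimate puts this point within `r` of `q`, hence in the interior. -/
lemma IsElemMap.ball_subset_image {k : ℕ} {t : AffineBasis (Fin (n + 1)) ℝ (Space n)} {b h : ℝ}
    {F : Space n → Space n} (hF : IsElemMap k t b h F) (hb : 0 < b) (hh : 0 < h) {q : Space n}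
    {r : ℝ} (hr : 0 < r) (hq : Metric.ball q r ⊆ interior (simplex t)) :
    Metric.ball (F q) (r / b * h) ⊆ F '' interior (simplex t) := by
  have hqi : q ∈ interior (simplex t) := hq (Metric.mem_ball_self hr)
  have hcpt : IsClosed (F '' simplex t) :=
    ((isCompact_simplex t).image hF.contDiff.continuous).isClosed
  refine (convex_ball (F q) (r / b * h)).isPreconnected.subset_of_closure_inter_subset
    hF.isOpen_image ⟨F q, Metric.mem_ball_self (by positivity), q, hqi, rfl⟩ ?_
  rintro x ⟨hx, hxb⟩
  obtain ⟨y, hy, rfl⟩ := hcpt.closure_subset_iff.mpr (image_mono interior_subset) hx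
  refine ⟨y, hq ?_, rfl⟩
  have h1 := hF.antilip y hy q (interior_subset hqi)
  rw [Metric.mem_ball] at hxb ⊢
  calc dist y q ≤ b / h * dist (F y) (F q) := h1
    _ < b / h * (r / b * h) := by gcongr
    _ = r := by field_simp

/-- Off the closed tube, `Ω` and `D` coincide. A point of the closure of `D` off the tube would lie
in the closure of `Ω` but not on its boundary, hence in `Ω`, and so in `D`. -/
lemma mem_tube_of_notMem {Ω D : Set (Space n)} {δ : ℝ}
    (hc : Ω ∪ tube Ω δ = D ∪ tube Ω δ) {a : Space n} (ha : a ∈ closure D) (haD : a ∉ D) :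
    a ∈ tube Ω δ := by
  by_contra hat
  have hopen : IsOpen (tube Ω δ)ᶜ := Metric.isClosed_cthickening.isOpen_compl
  have h1 : a ∈ closure Ω := by
    rw [mem_closure_iff_nhds] at ha ⊢
    intro s hs
    obtain ⟨y, ⟨hys, hyt⟩, hyD⟩ := ha _ (Filter.inter_mem hs (hopen.mem_nhds hat))
    refine ⟨y, hys, ?_⟩
    have : y ∈ Ω ∪ tube Ω δ := by rw [hc]; exact Or.inl hyD
    exact this.resolve_right hyt
  have h2 : a ∉ frontier Ω := fun h => hat (Metric.self_subset_cthickening _ h)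
  have h3 : a ∈ Ω := by
    by_contra h
    exact h2 ⟨h1, fun hi => h (interior_subset hi)⟩
  have : a ∈ D ∪ tube Ω δ := by rw [← hc]; exact Or.inl h3
  exact haD (this.resolve_right hat)

lemma height_le_norm {d : ℕ} (y : Space (d + 1)) : |height y| ≤ ‖y‖ := by
  have := PiLp.norm_apply_le y (Fin.last d)
  exact this

lemma IsGraphChart.inv_apply {d k : ℕ} {Ω : Set (Space (d + 1))} {CL ε : ℝ} {b : Space (d + 1)}
    {Θ Ξ : Space (d + 1) → Space (d + 1)} {ν : Space (d + 1)}
    (hχ : IsGraphChart k Ω CL ε b Θ Ξ ν) : Ξ b = 0 := by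
  rw [← hχ.apply_zero, hχ.left_inv]

/-- In a chart, the points of the tubular neighborhood have a small height. -/
lemma IsGraphChart.height_le_of_mem_tube {d k : ℕ} {Ω : Set (Space (d + 1))}
    (hΩ : Bornology.IsBounded Ω) {CL ε : ℝ} {b : Space (d + 1)}
    {Θ Ξ : Space (d + 1) → Space (d + 1)} {ν : Space (d + 1)}
    (hχ : IsGraphChart k Ω CL ε b Θ Ξ ν) (hCL : 1 ≤ CL) {δ : ℝ} (hδ : 0 ≤ δ) {x : Space (d + 1)}
    (hx : CL * (dist x b + δ) < ε) (hxt : x ∈ tube Ω δ) : |height (Ξ x)| ≤ CL * δ := by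
  have hcomp : IsCompact (frontier Ω) :=
    Metric.isCompact_of_isClosed_isBounded isClosed_frontier
      (hΩ.closure.subset frontier_subset_closure)
  rw [tube, hcomp.cthickening_eq_biUnion_closedBall hδ] at hxt
  obtain ⟨y, hy, hxy⟩ := mem_iUnion₂.mp hxt
  rw [Metric.mem_closedBall] at hxy
  have hε : 0 < ε := lt_of_le_of_lt (by positivity) hx
  have hle : ∀ s : ℝ, 0 ≤ s → s ≤ CL * s := fun s hs => le_mul_of_one_le_left hs hCL
  have h0 := hle _ (by positivity : 0 ≤ dist x b + δ)
  have hxb : x ∈ Metric.ball b ε := by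
    rw [Metric.mem_ball]; linarith
  have hyb' : dist y b ≤ dist x b + δ := by
    have := dist_triangle y x b
    rw [dist_comm y x] at this
    linarith
  have hyb : y ∈ Metric.ball b ε := by rw [Metric.mem_ball]; linarith
  have hΞy : Ξ y ∈ Metric.ball (0 : Space (d + 1)) ε := by
    have := hχ.dist_inv_le y hyb b (Metric.mem_ball_self hε)
    rw [hχ.inv_apply] at this
    rw [Metric.mem_ball]
    calc dist (Ξ y) 0 ≤ CL * dist y b := this
      _ ≤ CL * (dist x b + δ) := by gcongr
      _ < ε := hx
  have hhy : height (Ξ y) = 0 := by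
    rw [← hχ.mem_frontier_iff _ hΞy, hχ.right_inv]; exact hy
  have h1 := hχ.dist_inv_le x hxb y hyb
  have h2 := height_le_norm (Ξ x - Ξ y)
  have h3 : height (Ξ x - Ξ y) = height (Ξ x) := by
    show height (Ξ x) - height (Ξ y) = _
    rw [hhy, sub_zero]
  rw [h3, ← dist_eq_norm] at h2
  calc _ ≤ CL * dist x y := h2.trans h1
    _ ≤ _ := by gcongr

set_option maxHeartbeats 1000000 in
/-- A chart around a boundary node of an element, such that a part of the element and the part of
the domain below it lie in a slab of the size of the element. -/
theorem exists_chart_of_boundary_node {d k : ℕ} (hk : 1 ≤ k) {Ω : Set (Space (d + 1))}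
    (hΩ_bdd : Bornology.IsBounded Ω)
    (t : AffineBasis (Fin (d + 2)) ℝ (Space (d + 1))) {cδ b CL ε : ℝ} (hcδ : 0 < cδ) (hb : 1 ≤ b)
    (hCL : 1 ≤ CL) (hε : 0 < ε)
    (hchart : ∀ b ∈ frontier Ω, ∃ Θ Ξ ν, IsGraphChart k Ω CL ε b Θ Ξ ν)
    {z : Space (d + 1)} {r : ℝ} (hr : 0 < r) (hz : Metric.ball z (2 * r) ⊆ interior (simplex t)) :
    ∃ κ h₁ R : ℝ, 0 < κ ∧ 0 < h₁ ∧ h₁ ≤ 1 ∧ 0 < R ∧ ∀ (h : ℝ) (D : Set (Space (d + 1)))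
      (F : Space (d + 1) → Space (d + 1)) (q : Space (d + 1)), 0 < h → h ≤ h₁ →
      Ω ∪ tube Ω (cδ * h ^ (k + 1)) = D ∪ tube Ω (cδ * h ^ (k + 1)) →
      IsElemMap k t b h F → F '' interior (simplex t) ⊆ D → q ∈ simplex t → F q ∉ D →
      (d + 1 : ℕ) * (κ * h) < ε ∧ κ * h ≤ 1 ∧ CL * (cδ * h ^ (k + 1)) ≤ κ * h / 2 ∧
      ∃ a Θ Ξ ν, IsGraphChart k Ω CL ε a Θ Ξ ν ∧ a ∈ frontier Ω ∧
        (∀ x ∈ simplex t, F x ∈ Metric.ball a ε ∧ ‖Ξ (F x)‖ ≤ κ * h) ∧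
        ‖Ξ (F q)‖ ≤ CL * (cδ * h ^ (k + 1)) ∧
        (∀ y ∈ Metric.closedBall (0 : Space (d + 1)) ((d + 1 : ℕ) * (κ * h)),
          Θ y ∈ Metric.ball a ε ∧ Θ y ∈ Metric.ball (F z) (R * h)) ∧
        (∀ y ∈ slab (κ * h) (CL * (cδ * h ^ (k + 1))), Θ y ∈ D) ∧
        (∀ x ∈ Metric.ball z r, Ξ (F x) ∈ slab (κ * h) (CL * (cδ * h ^ (k + 1)))) := by
  set N : ℝ := ((d + 1 : ℕ) : ℝ) with hN
  have hN1 : 1 ≤ N := by rw [hN]; exact_mod_cast Nat.succ_le_succ (Nat.zero_le d)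
  set Dm := Metric.diam (simplex t) with hDm
  have hDm0 : 0 ≤ Dm := Metric.diam_nonneg
  -- Every point of the element is within `(b Dm + 1) h` of the boundary point `a`: the diameter of
  -- the element plus `δ ≤ h`. The chart multiplies this by at most `CL`, and the last summand `1`
  -- leaves room for strict inequalities.
  set κ : ℝ := CL * (b * Dm + 1) + 1 with hκ
  have hbD : 0 ≤ b * Dm := by positivity
  have hκ1 : 1 ≤ κ := by rw [hκ]; nlinarith
  set R : ℝ := CL * (N * κ) + 1 + b * Dm + 1 with hR
  set c₁ : ℝ := r / b with hc₁
  have hc₁0 : 0 < c₁ := by positivity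
  -- smallness conditions
  set T : ℝ := CL * (CL * (N * κ) + c₁ + 2) / ε + CL * cδ * (2 + 8 / c₁) + cδ + κ + 1 with hT
  have hT1 : 1 ≤ T := by
    have : 0 ≤ CL * (CL * (N * κ) + c₁ + 2) / ε + CL * cδ * (2 + 8 / c₁) + cδ + κ := by positivity
    rw [hT]; linarith
  refine ⟨κ, 1 / (2 * T), R, by linarith, by positivity, ?_, by positivity,
    fun h D F q hh hh1 hc hF hFD hq hqD => ?_⟩
  · rw [div_le_one (by positivity)]; linarith
  have hTh : T * h ≤ 1 / 2 := by
    calc T * h ≤ T * (1 / (2 * T)) := by gcongr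
      _ = 1 / 2 := by field_simp
  have hle1 : h ≤ 1 := by nlinarith
  set δ : ℝ := cδ * h ^ (k + 1) with hδ
  have hδ0 : 0 < δ := by positivity
  have hδh : δ ≤ cδ * h * h := by
    rw [hδ, mul_assoc, ← pow_two]
    exact mul_le_mul_of_nonneg_left (pow_le_pow_of_le_one hh.le hle1 (by omega)) hcδ.le
  have part : ∀ s : ℝ, s ≤ T → s * h ≤ 1 / 2 := fun s hs =>
    (mul_le_mul_of_nonneg_right hs hh.le).trans hTh
  have hp1 : 0 ≤ CL * (CL * (N * κ) + c₁ + 2) / ε := by positivity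
  have hp2 : 0 ≤ CL * cδ * (2 + 8 / c₁) := by positivity
  have k1 : CL * (CL * (N * κ) + c₁ + 2) * h < ε := by
    have := part (CL * (CL * (N * κ) + c₁ + 2) / ε) (by rw [hT]; linarith)
    rw [div_mul_eq_mul_div, div_le_iff₀ hε] at this
    linarith
  have k2 : cδ * h ≤ 1 / 2 := part _ (by rw [hT]; linarith)
  have k3 : κ * h ≤ 1 / 2 := part _ (by rw [hT]; linarith)
  have k4 : CL * cδ * (2 + 8 / c₁) * h ≤ 1 / 2 := part _ (by rw [hT]; linarith)
  have hδ1 : δ ≤ h := by nlinarith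
  have k5 : CL * δ ≤ h / 2 := by
    have h1 : CL * cδ * 2 * h ≤ 1 / 2 := by
      refine le_trans ?_ k4
      gcongr
      have : 0 ≤ 8 / c₁ := by positivity
      linarith
    have h2 : CL * δ ≤ CL * (cδ * h * h) := by gcongr
    nlinarith
  have k6 : 2 * (CL * δ) < c₁ * h / 2 := by
    have h1 : CL * cδ * (8 / c₁) * h ≤ 1 / 2 := by
      refine le_trans ?_ k4
      gcongr
      linarith
    have h2 : CL * δ ≤ CL * (cδ * h * h) := by gcongr
    have h3 : CL * cδ * h * 8 ≤ c₁ / 2 := by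
      have : CL * cδ * (8 / c₁) * h = CL * cδ * h * 8 / c₁ := by ring
      rw [this, div_le_iff₀ hc₁0] at h1
      linarith
    have h4 : CL * cδ * h * 8 * h ≤ c₁ / 2 * h := by gcongr
    have h5 : 0 < c₁ * h := by positivity
    nlinarith
  have hCLN : N * κ ≤ CL * (N * κ) := le_mul_of_one_le_left (by positivity) hCL
  have hbig : CL * (N * κ) + c₁ + 2 ≤ CL * (CL * (N * κ) + c₁ + 2) :=
    le_mul_of_one_le_left (by positivity) hCL
  have k7 : (CL * (N * κ) + c₁ + 2) * h < ε :=
    (mul_le_mul_of_nonneg_right hbig hh.le).trans_lt k1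
  have k8 : N * (κ * h) < ε := by
    have : N * κ * h ≤ (CL * (N * κ) + c₁ + 2) * h := by gcongr; linarith
    linarith
  have hs0 : CL * δ ≤ κ * h / 2 := by nlinarith
  refine ⟨k8, by linarith, hs0, ?_⟩
  -- the chart
  have hcl : F q ∈ closure D := by
    have h1 : q ∈ closure (interior (simplex t)) := by
      rw [closure_interior_simplex]; exact hq
    exact closure_mono hFD (image_closure_subset_closure_image hF.contDiff.continuous ⟨q, h1, rfl⟩)
  have htube := mem_tube_of_notMem hc hcl hqD
  have hcomp : IsCompact (frontier Ω) :=
    Metric.isCompact_of_isClosed_isBounded isClosed_frontier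
      (hΩ_bdd.closure.subset frontier_subset_closure)
  have htube' := htube
  rw [tube, hcomp.cthickening_eq_biUnion_closedBall hδ0.le] at htube'
  obtain ⟨a, ha, hqa⟩ := mem_iUnion₂.mp htube'
  rw [Metric.mem_closedBall] at hqa
  obtain ⟨Θ, Ξ, ν, hχ⟩ := hchart a ha
  have hFx : ∀ x ∈ simplex t, dist (F x) a ≤ (b * Dm + 1) * h := by
    intro x hx
    have h1 : dist (F x) (F q) ≤ b * h * Dm :=
      hF.image_subset_closedBall (by positivity) hq ⟨x, hx, rfl⟩
    have h2 := dist_triangle (F x) (F q) a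
    nlinarith
  have hκle : b * Dm + 1 ≤ κ := by rw [hκ]; nlinarith
  have hκN : κ ≤ N * κ := le_mul_of_one_le_left (by linarith) hN1
  have hball : ∀ x, dist x a ≤ CL * (N * κ) * h → x ∈ Metric.ball a ε := by
    intro x hx
    rw [Metric.mem_ball]
    refine (hx.trans ?_).trans_lt k7
    gcongr; linarith
  have hFball : ∀ x ∈ simplex t, F x ∈ Metric.ball a ε := fun x hx => hball _ ((hFx x hx).trans (by
    gcongr; linarith))
  have haa : a ∈ Metric.ball a ε := Metric.mem_ball_self hε
  have hΞF : ∀ x ∈ simplex t, ‖Ξ (F x)‖ ≤ (κ - 1) * h := by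
    intro x hx
    have := hχ.dist_inv_le (F x) (hFball x hx) a haa
    rw [hχ.inv_apply, dist_zero_right] at this
    calc ‖Ξ (F x)‖ ≤ CL * dist (F x) a := this
      _ ≤ CL * ((b * Dm + 1) * h) := by gcongr; exact hFx x hx
      _ = _ := by rw [hκ]; ring
  have hΘ : ∀ y ∈ Metric.closedBall (0 : Space (d + 1)) (N * (κ * h)),
      dist (Θ y) a ≤ CL * (N * κ) * h := by
    intro y hy
    rw [Metric.mem_closedBall] at hy
    have := hχ.dist_le y (by rw [Metric.mem_ball]; linarith) 0 (Metric.mem_ball_self hε)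
    rw [hχ.apply_zero] at this
    calc _ ≤ CL * dist y 0 := this
      _ ≤ CL * (N * (κ * h)) := by gcongr
      _ = _ := by ring
  have hzs : z ∈ simplex t := interior_subset (hz (Metric.mem_ball_self (by positivity)))
  have hslabball : ∀ y ∈ slab (κ * h) (CL * δ),
      y ∈ Metric.closedBall (0 : Space (d + 1)) (N * (κ * h)) := fun y hy =>
    mem_closedBall_zero_iff.mpr (norm_le_of_mem_slab (by positivity) hy)
  refine ⟨a, Θ, Ξ, ν, hχ, ha, fun x hx => ⟨hFball x hx, (hΞF x hx).trans (by nlinarith)⟩,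
    ?_, fun y hy => ⟨hball _ (hΘ y hy), ?_⟩, fun y hy => ?_, fun x hx => ?_⟩
  · have := hχ.dist_inv_le (F q) (hFball q hq) a haa
    rw [hχ.inv_apply, dist_zero_right] at this
    exact this.trans (by gcongr)
  · have h1 := hΘ y hy
    have h2 : dist (F z) (F q) ≤ b * h * Dm :=
      hF.image_subset_closedBall (by positivity) hq ⟨z, hzs, rfl⟩
    have h3 := dist_triangle4 (Θ y) a (F q) (F z)
    rw [dist_comm a, dist_comm (F q) (F z)] at h3
    rw [Metric.mem_ball, hR]
    have h4 : (CL * (N * κ) + 1 + b * Dm + 1) * h = CL * (N * κ) * h + h + b * h * Dm + h := by ring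
    linarith
  · have hyb := hslabball y hy
    have h1 : Θ y ∈ Ω := by
      rw [hχ.mem_iff y (by
        rw [mem_closedBall_zero_iff] at hyb
        rw [mem_ball_zero_iff]; linarith)]
      exact (by positivity : 0 ≤ CL * δ).trans_lt hy.2.1
    have h2 : Θ y ∉ tube Ω δ := by
      intro h2
      have h3 := hχ.height_le_of_mem_tube hΩ_bdd hCL hδ0.le (x := Θ y) (by
        refine lt_of_le_of_lt ?_ k1
        rw [mul_assoc]
        gcongr
        have := hΘ y hyb
        nlinarith) h2
      rw [hχ.left_inv] at h3
      exact absurd ((le_abs_self _).trans h3) (not_le.mpr hy.2.1)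
    have : Θ y ∈ D ∪ tube Ω δ := by rw [← hc]; exact Or.inl h1
    exact this.resolve_right h2
  · have hxi : Metric.ball x r ⊆ interior (simplex t) := by
      refine (Metric.ball_subset_ball' ?_).trans hz
      rw [Metric.mem_ball] at hx
      linarith
    have hxs : x ∈ simplex t := interior_subset (hxi (Metric.mem_ball_self hr))
    have hnorm := hΞF x hxs
    have hlt : ‖Ξ (F x)‖ < κ * h := by nlinarith
    have hcoord : ∀ i, |Ξ (F x) i| < κ * h := fun i =>
      lt_of_le_of_lt (PiLp.norm_apply_le (Ξ (F x)) i) hlt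
    refine ⟨fun i => hcoord _, ?_, (le_abs_self _).trans_lt (hcoord (Fin.last d))⟩
    -- A descent from `F x` by `s = c₁ h / 2` in the direction `-ν` stays in the element, hence in
    -- `D`, so the point reached lies in `Ω` or in the tube. Its height in the chart is therefore at
    -- least `-CL δ`. Since `s` exceeds `2 CL δ`, the height of `y` itself exceeds `CL δ`.
    set y := Ξ (F x) with hy
    set s := c₁ * h / 2 with hs
    have hs0' : 0 < s := by positivity
    have hΘy : Θ (y + (-s) • lastVec d) = F x + (-s) • ν := by
      rw [hχ.apply_add, hy, hχ.right_inv]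
    have hdist : dist (F x + (-s) • ν) (F x) = s := by
      rw [dist_eq_norm, add_sub_cancel_left, norm_smul, hχ.norm_normal, norm_neg,
        Real.norm_of_nonneg hs0'.le, mul_one]
    have hmem : F x + (-s) • ν ∈ D := by
      apply hFD
      apply hF.ball_subset_image (by linarith) hh hr hxi
      rw [Metric.mem_ball, hdist]
      show s < c₁ * h
      have : 0 < c₁ * h := by positivity
      rw [hs]; linarith
    have hht : height (y + (-s) • lastVec d) = height y - s := by
      simp [height, sub_eq_add_neg]
    have hyn : ‖y + (-s) • lastVec d‖ < ε := by
      have h1 := norm_add_le y ((-s) • lastVec d)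
      have h2 : ‖(-s) • lastVec d‖ = s := by
        rw [norm_smul, norm_neg, Real.norm_of_nonneg hs0'.le]; simp
      have h3 : (κ - 1) * h + s ≤ (CL * (N * κ) + c₁ + 2) * h := by
        rw [hs]
        have h4 : κ * h ≤ CL * (N * κ) * h := by gcongr; linarith
        have : 0 < c₁ * h := by positivity
        linarith
      linarith
    have hunion : F x + (-s) • ν ∈ Ω ∪ tube Ω δ := by rw [hc]; exact Or.inl hmem
    have hge : -(CL * δ) ≤ height y - s := by
      rw [← hht]
      rcases hunion with hΩ | ht
      · rw [← hΘy, hχ.mem_iff _ (by rw [mem_ball_zero_iff]; exact hyn)] at hΩ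
        have : 0 ≤ CL * δ := by positivity
        linarith
      · have h3 := hχ.height_le_of_mem_tube hΩ_bdd hCL hδ0.le (by
          refine lt_of_le_of_lt ?_ k1
          rw [mul_assoc]
          gcongr
          have h5 := dist_triangle (F x + (-s) • ν) (F x) a
          have h6 := hFx x hxs
          rw [hdist, hs] at h5
          have h4 : (b * Dm + 1) * h ≤ CL * (N * κ) * h := by gcongr; linarith
          have : 0 < c₁ * h := by positivity
          linarith) ht
        rw [← hΘy, hχ.left_inv] at h3
        exact (abs_le.mp h3).1
    linarith

end

/-! ### Transport of the slab estimate by a chart -/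

section
variable {n : ℕ}

lemma enorm_chainTensor_le {l : ℕ} {Φ : Space n → Space n}
    (G : (j : ℕ) → Space n → EuclideanSpace ℝ (Fin j → Fin n)) {x : Space n} {D : ℝ}
    (hD : ∀ i, 1 ≤ i → i ≤ l → ‖iteratedFDeriv ℝ i Φ x‖ ≤ D ^ i) (hD0 : 0 ≤ D) :
    ‖chainTensor l Φ G x‖ₑ ≤
      ENNReal.ofReal (chainConst n l * D ^ l) * ∑ j ∈ Finset.range (l + 1), ‖G j (Φ x)‖ₑ := by
  have h := norm_chainTensor_le G hD
  have h0 := (chainConst_pos n l).le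
  rw [← ofReal_norm]
  refine (ENNReal.ofReal_le_ofReal h).trans ?_
  rw [ENNReal.ofReal_mul (by positivity), ENNReal.ofReal_sum_of_nonneg fun _ _ => norm_nonneg _]
  simp only [ofReal_norm, le_refl]

/-- The second derivative in the vertical direction is preserved by a chart. -/
lemma IsGraphChart.iteratedFDeriv_two_comp {d k : ℕ} (hk : 1 ≤ k) {Ω : Set (Space (d + 1))}
    {CL ε : ℝ} {b : Space (d + 1)} {Θ Ξ : Space (d + 1) → Space (d + 1)} {ν : Space (d + 1)}
    (hχ : IsGraphChart k Ω CL ε b Θ Ξ ν) {g : Space (d + 1) → ℝ} (hg : ContDiff ℝ ∞ g)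
    {y : Space (d + 1)} (hy : y ∈ Metric.ball 0 ε) :
    iteratedFDeriv ℝ 2 (fun y => g (Θ y)) y (fun _ => lastVec d) =
      iteratedFDeriv ℝ 2 g (Θ y) (fun _ => ν) := by
  set e := lastVec d with he
  have hΘd : ∀ z ∈ Metric.ball (0 : Space (d + 1)) ε, ContDiffAt ℝ (k + 1 : ℕ) Θ z := fun z hz =>
    hχ.contDiffOn.contDiffAt (Metric.isOpen_ball.mem_nhds hz)
  -- Along vertical lines the chart is affine with the constant direction `ν`, so no second
  -- derivatives of the chart enter. Consequently no first derivatives of `g` appear, as required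
  -- for a bound on the tube that contains only `∇²v`.
  have hΘν : ∀ z ∈ Metric.ball (0 : Space (d + 1)) ε, fderiv ℝ Θ z e = ν := by
    intro z hz
    have h1 : HasFDerivAt Θ (fderiv ℝ Θ z) (z + (0 : ℝ) • e) := by
      rw [zero_smul, add_zero]
      exact ((hΘd z hz).differentiableAt (by simp)).hasFDerivAt
    have h2 : HasDerivAt (fun s : ℝ => z + s • e) e 0 := by
      simpa using ((hasDerivAt_id (0 : ℝ)).smul_const e).const_add z
    have h3 : HasDerivAt (fun s : ℝ => Θ (z + s • e)) (fderiv ℝ Θ z e) 0 :=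
      h1.comp_hasDerivAt 0 h2
    have h4 : HasDerivAt (fun s : ℝ => Θ (z + s • e)) ν 0 := by
      have : (fun s : ℝ => Θ (z + s • e)) = fun s => Θ z + s • ν := by
        ext1 s; exact hχ.apply_add z s
      rw [this]
      simpa using ((hasDerivAt_id (0 : ℝ)).smul_const ν).const_add (Θ z)
    exact h3.unique h4
  have hgd : Differentiable ℝ g := hg.differentiable (by simp)
  have h1 : ∀ z ∈ Metric.ball (0 : Space (d + 1)) ε,
      fderiv ℝ (fun y => g (Θ y)) z e = fderiv ℝ g (Θ z) ν := by
    intro z hz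
    have hc : HasFDerivAt (fun y => g (Θ y)) ((fderiv ℝ g (Θ z)).comp (fderiv ℝ Θ z)) z :=
      (hgd (Θ z)).hasFDerivAt.comp z ((hΘd z hz).differentiableAt (by simp)).hasFDerivAt
    rw [hc.fderiv, ContinuousLinearMap.comp_apply, hΘν z hz]
  have hfc : ContDiffAt ℝ (2 : ℕ) (fun y => g (Θ y)) y :=
    (contDiff_infty.mp hg 2).contDiffAt.comp y
      ((hΘd y hy).of_le (by exact_mod_cast (show 2 ≤ k + 1 by omega)))
  have hfd : DifferentiableAt ℝ (fderiv ℝ (fun y => g (Θ y))) y :=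
    (hfc.fderiv_right (m := 1) (by norm_num)).differentiableAt (by simp)
  have hgfd : Differentiable ℝ (fderiv ℝ g) :=
    ((contDiff_infty.mp hg 2).fderiv_right (m := 1) (by norm_num)).differentiable (by simp)
  have hL : HasFDerivAt (fun z => fderiv ℝ (fun y => g (Θ y)) z e)
      ((ContinuousLinearMap.apply ℝ ℝ e).comp (fderiv ℝ (fderiv ℝ (fun y => g (Θ y))) y)) y :=
    (ContinuousLinearMap.apply ℝ ℝ e).hasFDerivAt.comp y hfd.hasFDerivAt
  have hgν : HasFDerivAt (fun x => fderiv ℝ g x ν)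
      ((ContinuousLinearMap.apply ℝ ℝ ν).comp (fderiv ℝ (fderiv ℝ g) (Θ y))) (Θ y) :=
    (ContinuousLinearMap.apply ℝ ℝ ν).hasFDerivAt.comp (Θ y) (hgfd (Θ y)).hasFDerivAt
  have hR : HasFDerivAt (fun z => fderiv ℝ g (Θ z) ν)
      (((ContinuousLinearMap.apply ℝ ℝ ν).comp (fderiv ℝ (fderiv ℝ g) (Θ y))).comp
        (fderiv ℝ Θ y)) y :=
    hgν.comp y ((hΘd y hy).differentiableAt (by simp)).hasFDerivAt
  have hev : (fun z => fderiv ℝ (fun y => g (Θ y)) z e) =ᶠ[nhds y] fun z => fderiv ℝ g (Θ z) ν := by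
    filter_upwards [Metric.isOpen_ball.mem_nhds hy] with z hz using h1 z hz
  have heq := congrArg (fun L => L e) ((hL.congr_of_eventuallyEq hev.symm).unique hR)
  simp only [ContinuousLinearMap.comp_apply, hΘν y hy] at heq
  rw [iteratedFDeriv_two_apply, iteratedFDeriv_two_apply]
  exact heq

lemma enorm_iteratedFDeriv_apply_le {l : ℕ} (g : Space n → ℝ) (x : Space n) {ν : Space n}
    (hν : ‖ν‖ = 1) : ‖iteratedFDeriv ℝ l g x (fun _ => ν)‖ₑ ≤
      ENNReal.ofReal ((n : ℝ) ^ l) * ‖tensorDeriv l g x‖ₑ := by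
  have h1 := (iteratedFDeriv ℝ l g x).le_opNorm (fun _ => ν)
  simp only [hν, Finset.prod_const_one, mul_one] at h1
  have h2 := h1.trans (norm_iteratedFDeriv_le_tensorDeriv l g x)
  rw [← ofReal_norm, ← ofReal_norm, ← ENNReal.ofReal_mul (by positivity)]
  exact ENNReal.ofReal_le_ofReal h2

/-- Substitution costs a power of the Lipschitz constant `CL` of the inverse chart. The derivatives
of the smooth approximation are replaced by the weak derivatives at the price of their `L¹` distance
`τ`. -/
lemma IsGraphChart.lintegral_tensorDeriv_le {d k : ℕ} {Ω : Set (Space (d + 1))}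
    {CL ε : ℝ} {b : Space (d + 1)} {Θ Ξ : Space (d + 1) → Space (d + 1)} {ν : Space (d + 1)}
    (hχ : IsGraphChart k Ω CL ε b Θ Ξ ν) (hCL : 0 ≤ CL) {Q K S : Set (Space (d + 1))}
    (hQ : MeasurableSet Q) (hQε : Q ⊆ Metric.ball 0 ε) (hQb : ∀ y ∈ Q, Θ y ∈ Metric.ball b ε)
    (hQK : MapsTo Θ Q K) (hQS : MapsTo Θ Q S) {i : ℕ}
    {g : Space (d + 1) → ℝ} (hg : ContDiff ℝ ∞ g)
    {G : Space (d + 1) → EuclideanSpace ℝ (Fin i → Fin (d + 1))} {τ : ℝ≥0∞}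
    (hGm : AEStronglyMeasurable G (volume.restrict K))
    (hτ : ∫⁻ x in K, ‖tensorDeriv i g x - G x‖ₑ ≤ τ) :
    ∫⁻ y in Q, ‖tensorDeriv i g (Θ y)‖ₑ ≤
      ENNReal.ofReal (CL ^ (d + 1)) * (τ + ∫⁻ x in S, ‖G x‖ₑ) := by
  have hanti : AntiLipOn CL Θ Q := fun x hx y hy => by
    have := hχ.dist_inv_le _ (hQb x hx) _ (hQb y hy)
    rwa [hχ.left_inv, hχ.left_inv] at this
  have hcont : ContinuousOn Θ Q := hχ.contDiffOn.continuousOn.mono hQε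
  have hm : Measurable fun x => ‖tensorDeriv i g x‖ₑ :=
    (contDiff_tensorDeriv hg i).continuous.measurable.enorm
  have hmono : volume.restrict (K ∩ S) ≤ volume.restrict K :=
    Measure.restrict_mono inter_subset_left le_rfl
  refine (hanti.lintegral_comp_le hCL hQ hcont (T := K ∩ S) (fun y hy => ⟨hQK hy, hQS hy⟩)
    hm.aemeasurable).trans ?_
  rw [ENNReal.ofReal_pow hCL]
  refine mul_le_mul' le_rfl ?_
  calc ∫⁻ x in K ∩ S, ‖tensorDeriv i g x‖ₑ
      ≤ ∫⁻ x in K ∩ S, (‖tensorDeriv i g x - G x‖ₑ + ‖G x‖ₑ) := by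
        refine lintegral_mono fun x => ?_
        have := enorm_add_le (tensorDeriv i g x - G x) (G x)
        rwa [sub_add_cancel] at this
    _ = (∫⁻ x in K ∩ S, ‖tensorDeriv i g x - G x‖ₑ) + ∫⁻ x in K ∩ S, ‖G x‖ₑ :=
        lintegral_add_right' _ (hGm.mono_measure hmono).enorm
    _ ≤ _ := add_le_add ((lintegral_mono_set inter_subset_left).trans hτ)
        (lintegral_mono_set inter_subset_right)

lemma IsGraphChart.tensorDeriv_comp_le {d k m : ℕ} (hmk : m ≤ k + 1) {Ω : Set (Space (d + 1))}
    {CL ε : ℝ} {b : Space (d + 1)} {Θ Ξ : Space (d + 1) → Space (d + 1)} {ν : Space (d + 1)}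
    (hχ : IsGraphChart k Ω CL ε b Θ Ξ ν) (hCL : 1 ≤ CL) {g : Space (d + 1) → ℝ}
    (hg : ContDiff ℝ ∞ g) {j : ℕ} (hj : j ≤ m) {y : Space (d + 1)} (hy : y ∈ Metric.ball 0 ε) :
    ‖tensorDeriv j (fun y => g (Θ y)) y‖ₑ ≤
      ENNReal.ofReal ((∑ j ∈ Finset.range (m + 1), chainConst (d + 1) j) * CL ^ m) *
        ∑ i ∈ Finset.range (m + 1), ‖tensorDeriv i g (Θ y)‖ₑ := by
  have hΘ : ContDiffAt ℝ j Θ y :=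
    (hχ.contDiffOn.contDiffAt (Metric.isOpen_ball.mem_nhds hy)).of_le
      (by exact_mod_cast hj.trans hmk)
  rw [← chainTensor_tensorDeriv hΘ (contDiff_infty.mp hg j).contDiffAt]
  refine (enorm_chainTensor_le _ (D := CL) (fun i hi1 hij => ?_) (by linarith)).trans ?_
  · exact (hχ.norm_le i hi1 (by omega) y hy).trans (le_self_pow₀ hCL (by omega))
  · refine mul_le_mul' (ENNReal.ofReal_le_ofReal ?_) ?_
    · refine mul_le_mul ?_ (pow_le_pow_right₀ hCL hj) (by positivity)
        (Finset.sum_nonneg fun i _ => (chainConst_pos _ i).le)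
      exact Finset.single_le_sum (f := chainConst (d + 1)) (fun i _ => (chainConst_pos _ i).le)
        (Finset.mem_range.mpr (by omega))
    · exact Finset.sum_le_sum_of_subset (Finset.range_mono (by omega))

set_option maxHeartbeats 800000 in
/-- Approximation of a function with zero boundary values by a polynomial in a chart. -/
theorem exists_polyLT_chart (d : ℕ) {k m : ℕ} (hm : 2 ≤ m) (hmk : m ≤ k + 1) {CL : ℝ}
    (hCL : 1 ≤ CL) : ∃ C : ℝ, 0 < C ∧
    ∀ (Ω : Set (Space (d + 1))) (ε : ℝ) (a : Space (d + 1)) (Θ Ξ : Space (d + 1) → Space (d + 1))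
      (ν : Space (d + 1)), IsGraphChart k Ω CL ε a Θ Ξ ν →
    ∀ (ρ s₀ : ℝ), 0 < ρ → ρ ≤ 1 → 0 ≤ s₀ → s₀ ≤ ρ / 2 → (d + 1 : ℕ) * ρ < ε →
    (∀ y ∈ Metric.closedBall (0 : Space (d + 1)) ((d + 1 : ℕ) * ρ), Θ y ∈ Metric.ball a ε) →
    ∀ (O : Set (Space (d + 1))), IsOpen O → Ω ⊆ O → frontier Ω ⊆ O →
    ∀ (v : Space (d + 1) → ℝ) (G : (j : ℕ) → Space (d + 1) → EuclideanSpace ℝ (Fin j → Fin (d + 1))),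
    (∀ j ≤ m, IsWeakGrad j O v (G j)) → ContinuousOn v O → (∀ x ∈ frontier Ω, v x = 0) →
    ∀ S₁ S₀ : Set (Space (d + 1)), MapsTo Θ (slab ρ s₀) S₁ → MapsTo Θ (slab ρ 0) S₀ →
    ∀ τ : ℝ, 0 < τ → ∃ P ∈ polyLT (d + 1) m,
      (∀ j ≤ m, ∀ y ∈ Metric.closedBall (0 : Space (d + 1)) ((d + 1 : ℕ) * ρ),
        ‖tensorDeriv j P y‖ₑ ≤ ENNReal.ofReal (C / ρ ^ (d + 1)) *
          (ENNReal.ofReal τ + ∑ j ∈ Finset.range (m + 1), ∫⁻ x in S₁, ‖G j x‖ₑ)) ∧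
      (∫⁻ y in slab ρ s₀, ‖v (Θ y) - P y‖ₑ ≤ ENNReal.ofReal C * ENNReal.ofReal τ +
        ENNReal.ofReal (C * ρ ^ m) *
          (ENNReal.ofReal τ + ∑ j ∈ Finset.range (m + 1), ∫⁻ x in S₁, ‖G j x‖ₑ)) ∧
      ‖P 0‖ₑ ≤ ENNReal.ofReal C * ENNReal.ofReal τ +
        ENNReal.ofReal (C * (ρ ^ m + s₀ * ρ) / ρ ^ (d + 1)) *
          (ENNReal.ofReal τ + ∑ j ∈ Finset.range (m + 1), ∫⁻ x in S₁, ‖G j x‖ₑ) +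
        ENNReal.ofReal (C * (s₀ * ρ) / ρ ^ (d + 1)) *
          (ENNReal.ofReal τ + ∫⁻ x in S₀, ‖G 2 x‖ₑ) := by
  have hN1 : (1 : ℝ) ≤ (d + 1 : ℕ) := by exact_mod_cast Nat.succ_le_succ (Nat.zero_le d)
  obtain ⟨C₀, hC₀, key⟩ := exists_polyLT_slab d hm
  set C₁ : ℝ := (∑ j ∈ Finset.range (m + 1), chainConst (d + 1) j) * CL ^ m with hC₁
  have hC₁0 : 0 ≤ C₁ := mul_nonneg (Finset.sum_nonneg fun i _ => (chainConst_pos _ i).le)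
    (by positivity)
  set C₂ : ℝ := C₁ * CL ^ (d + 1) * (m + 1) with hC₂
  have hC₂0 : 0 ≤ C₂ := by positivity
  set C₃ : ℝ := ((d + 1 : ℕ) : ℝ) ^ 2 * CL ^ (d + 1) with hC₃
  have hC₃0 : 0 ≤ C₃ := by positivity
  obtain ⟨V, hV0, hV⟩ := exists_ofReal_of_ne_top
    (measure_closedBall_lt_top (μ := volume) (x := (0 : Space (d + 1))) (r := (d + 1 : ℕ))).ne
  set C : ℝ := C₀ * C₂ + C₀ * C₃ + C₀ + V with hC
  refine ⟨C, by positivity, ?_⟩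
  intro Ω ε a Θ Ξ ν hχ ρ s₀ hρ hρ1 hs0 hs hρε hball O hO hΩO hΓO v G hG hv hvΓ S₁ S₀ hS₁ hS₀ τ hτ
  -- The closed box includes the flat boundary, because the values there enter Taylor's formula. Its
  -- image is compact and contained in `Ω` together with its boundary, hence in `O`, where smoothing
  -- is possible.
  set Qc : Set (Space (d + 1)) := {y | (∀ i : Fin d, |y (Fin.castSucc i)| ≤ ρ) ∧
    0 ≤ height y ∧ height y ≤ ρ} with hQc
  have hQn : Qc ⊆ Metric.closedBall 0 ((d + 1 : ℕ) * ρ) := fun y hy =>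
    mem_closedBall_zero_iff.mpr (norm_le_of_coord_le hy.1
      (abs_le.mpr ⟨by linarith [hy.2.1], hy.2.2⟩))
  have hBε : Metric.closedBall (0 : Space (d + 1)) ((d + 1 : ℕ) * ρ) ⊆ Metric.ball 0 ε :=
    Metric.closedBall_subset_ball hρε
  have hQcl : IsClosed Qc := by
    have : Qc = (⋂ i : Fin d, {y | |y (Fin.castSucc i)| ≤ ρ}) ∩
        ({y | 0 ≤ height y} ∩ {y | height y ≤ ρ}) := by
      ext y; simp [hQc]
    rw [this]
    exact (isClosed_iInter fun i => isClosed_le (by fun_prop) continuous_const).inter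
      ((isClosed_le continuous_const continuous_height).inter
        (isClosed_le continuous_height continuous_const))
  have hQcpt : IsCompact Qc := (isCompact_closedBall _ _).of_isClosed_subset hQcl hQn
  have hΘc : ContinuousOn Θ (Metric.ball 0 ε) := hχ.contDiffOn.continuousOn
  have hKcpt : IsCompact (Θ '' Qc) := hQcpt.image_of_continuousOn (hΘc.mono (hQn.trans hBε))
  have hKO : Θ '' Qc ⊆ O := by
    rintro _ ⟨y, hy, rfl⟩
    have hyε := hBε (hQn hy)
    rcases hy.2.1.eq_or_lt with h0 | h0
    · exact hΓO ((hχ.mem_frontier_iff y hyε).mpr h0.symm)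
    · exact hΩO ((hχ.mem_iff y hyε).mpr h0)
  obtain ⟨g, hg, hgG, -, hgv⟩ := exists_smoothing hO (hG 0 (by omega)).1 hG hKcpt hKO hτ
  have hgv := hgv hv
  have hslab : ∀ s : ℝ, 0 ≤ s → slab ρ s ⊆ Qc := fun s hs y hy =>
    ⟨fun i => (hy.1 i).le, hs.trans hy.2.1.le, hy.2.2.le⟩
  have hf : ContDiffOn ℝ m (fun y => g (Θ y)) (Metric.ball 0 ε) :=
    (contDiff_infty.mp hg m).comp_contDiffOn (hχ.contDiffOn.of_le (by exact_mod_cast hmk))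
  have hGm : ∀ i ≤ m, AEStronglyMeasurable (G i) (volume.restrict (Θ '' Qc)) := fun i hi =>
    ((hG i hi).2.1.mono_set hKO).aestronglyMeasurable
  have hint : ∀ s : ℝ, 0 ≤ s → ∀ S, MapsTo Θ (slab ρ s) S → ∀ i ≤ m,
      ∫⁻ y in slab ρ s, ‖tensorDeriv i g (Θ y)‖ₑ ≤
        ENNReal.ofReal (CL ^ (d + 1)) * (ENNReal.ofReal τ + ∫⁻ x in S, ‖G i x‖ₑ) :=
    fun s hs S hS i hi => hχ.lintegral_tensorDeriv_le (K := Θ '' Qc) (by linarith) isOpen_slab.measurableSet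
      (((hslab s hs).trans hQn).trans hBε) (fun y hy => hball y (hQn (hslab s hs hy)))
      (fun y hy => ⟨y, hslab s hs hy, rfl⟩) hS hg (hGm i hi) (hgG i hi)
  set A := ENNReal.ofReal τ + ∑ j ∈ Finset.range (m + 1), ∫⁻ x in S₁, ‖G j x‖ₑ with hA
  set J := ENNReal.ofReal τ + ∫⁻ x in S₀, ‖G 2 x‖ₑ with hJ
  have hmeas : ∀ i, ∀ s : ℝ, 0 ≤ s →
      AEMeasurable (fun y => ‖tensorDeriv i g (Θ y)‖ₑ) (volume.restrict (slab ρ s)) :=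
    fun i s hs => (((contDiff_tensorDeriv hg i).continuous.comp_continuousOn
      (hΘc.mono (((hslab s hs).trans hQn).trans hBε))).aemeasurable
        isOpen_slab.measurableSet).enorm
  have hk1 : ∀ y : Space (d + 1), (∀ i : Fin d, |y (Fin.castSucc i)| < ρ) → height y = 0 →
      ‖g (Θ y)‖ₑ ≤ ENNReal.ofReal τ := by
    intro y hy hy0
    have hyQ : y ∈ Qc := ⟨fun i => (hy i).le, hy0.ge, hy0.le.trans hρ.le⟩
    have h1 := hgv (Θ y) ⟨y, hyQ, rfl⟩
    rw [hvΓ _ ((hχ.mem_frontier_iff y (hBε (hQn hyQ))).mpr hy0), sub_zero] at h1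
    rw [← ofReal_norm]
    exact ENNReal.ofReal_le_ofReal h1
  have hk2 : ∀ j ≤ m, ∫⁻ y in slab ρ s₀, ‖tensorDeriv j (fun y => g (Θ y)) y‖ₑ ≤
      ENNReal.ofReal C₂ * A := by
    intro j hj
    calc ∫⁻ y in slab ρ s₀, ‖tensorDeriv j (fun y => g (Θ y)) y‖ₑ
        ≤ ∫⁻ y in slab ρ s₀, ENNReal.ofReal C₁ *
            ∑ i ∈ Finset.range (m + 1), ‖tensorDeriv i g (Θ y)‖ₑ :=
          setLIntegral_mono' isOpen_slab.measurableSet fun y hy =>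
            hχ.tensorDeriv_comp_le hmk hCL hg hj (hBε (hQn (hslab s₀ hs0 hy)))
      _ = ENNReal.ofReal C₁ * ∑ i ∈ Finset.range (m + 1),
            ∫⁻ y in slab ρ s₀, ‖tensorDeriv i g (Θ y)‖ₑ := by
          rw [lintegral_const_mul' _ _ ENNReal.ofReal_ne_top,
            lintegral_finsetSum' _ fun i _ => hmeas i s₀ hs0]
      _ ≤ ENNReal.ofReal C₁ * ∑ i ∈ Finset.range (m + 1),
            ENNReal.ofReal (CL ^ (d + 1)) * (ENNReal.ofReal τ + ∫⁻ x in S₁, ‖G i x‖ₑ) := by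
          refine mul_le_mul' le_rfl (Finset.sum_le_sum fun i hi => hint s₀ hs0 S₁ hS₁ i ?_)
          have := Finset.mem_range.mp hi; omega
      _ ≤ ENNReal.ofReal C₁ * (ENNReal.ofReal (CL ^ (d + 1)) * ((m + 1 : ℕ) * A)) := by
          rw [← Finset.mul_sum, Finset.sum_add_distrib, Finset.sum_const, Finset.card_range,
            nsmul_eq_mul]
          refine mul_le_mul' le_rfl (mul_le_mul' le_rfl ?_)
          rw [hA, mul_add]
          refine add_le_add le_rfl (le_mul_of_one_le_left' ?_)
          exact_mod_cast Nat.succ_le_succ (Nat.zero_le m)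
      _ = _ := by
          rw [hC₂, ENNReal.ofReal_mul (mul_nonneg hC₁0 (by positivity)), ENNReal.ofReal_mul hC₁0]
          have : ENNReal.ofReal ((m : ℝ) + 1) = ((m + 1 : ℕ) : ℝ≥0∞) := by
            rw [← ENNReal.ofReal_natCast]; push_cast; rfl
          rw [this]
          ring
  have hk3 : ∫⁻ y in slab ρ 0, ‖iteratedFDeriv ℝ 2 (fun y => g (Θ y)) y (fun _ => lastVec d)‖ₑ ≤
      ENNReal.ofReal C₃ * J := by
    calc ∫⁻ y in slab ρ 0, ‖iteratedFDeriv ℝ 2 (fun y => g (Θ y)) y (fun _ => lastVec d)‖ₑ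
        ≤ ∫⁻ y in slab ρ 0, ENNReal.ofReal (((d + 1 : ℕ) : ℝ) ^ 2) *
            ‖tensorDeriv 2 g (Θ y)‖ₑ := by
          refine setLIntegral_mono' isOpen_slab.measurableSet fun y hy => ?_
          rw [hχ.iteratedFDeriv_two_comp (by omega) hg (hBε (hQn (hslab 0 le_rfl hy)))]
          exact enorm_iteratedFDeriv_apply_le g (Θ y) hχ.norm_normal
      _ = ENNReal.ofReal (((d + 1 : ℕ) : ℝ) ^ 2) *
            ∫⁻ y in slab ρ 0, ‖tensorDeriv 2 g (Θ y)‖ₑ :=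
          lintegral_const_mul' _ _ ENNReal.ofReal_ne_top
      _ ≤ ENNReal.ofReal (((d + 1 : ℕ) : ℝ) ^ 2) * (ENNReal.ofReal (CL ^ (d + 1)) * J) :=
          mul_le_mul' le_rfl (hint 0 le_rfl S₀ hS₀ 2 hm)
      _ = _ := by rw [hC₃, ENNReal.ofReal_mul (by positivity), mul_assoc]
  obtain ⟨P, hP, hP1, hP2, hP3⟩ := key ρ s₀ hρ hρ1 hs0 hs (Metric.ball 0 ε) Metric.isOpen_ball hBε
    (fun y => g (Θ y)) hf (ENNReal.ofReal τ) (ENNReal.ofReal C₂ * A) (ENNReal.ofReal C₃ * J)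
    hk1 hk2 hk3
  have e1 : ∀ x y : ℝ, 0 ≤ x → 0 ≤ y → ENNReal.ofReal x * (ENNReal.ofReal y * A) =
      ENNReal.ofReal (x * y) * A := fun x y hx hy => by
    rw [ENNReal.ofReal_mul hx, mul_assoc]
  have e2 : ∀ x y : ℝ, 0 ≤ x → 0 ≤ y → ENNReal.ofReal x * (ENNReal.ofReal y * J) =
      ENNReal.ofReal (x * y) * J := fun x y hx hy => by
    rw [ENNReal.ofReal_mul hx, mul_assoc]
  have hx1 : 0 ≤ C₀ * C₂ := by positivity
  have hx2 : 0 ≤ C₀ * C₃ := by positivity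
  have hCa : C₀ * C₂ ≤ C := by rw [hC]; linarith
  have hCb : C₀ * C₃ ≤ C := by rw [hC]; linarith
  have hCc : C₀ ≤ C := by rw [hC]; linarith
  have hCd : V ≤ C := by rw [hC]; linarith
  refine ⟨P, hP, fun j hj y hy => (hP1 j hj y hy).trans ?_, ?_, hP3.trans ?_⟩
  · rw [e1 _ _ (by positivity) hC₂0]
    refine mul_le_mul' (ENNReal.ofReal_le_ofReal ?_) le_rfl
    rw [div_mul_eq_mul_div]
    gcongr
  · have hPc : Continuous P := (contDiff_of_mem_polyLT hP 0).continuous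
    have hmd : AEMeasurable (fun y => ‖g (Θ y) - P y‖ₑ) (volume.restrict (slab ρ s₀)) :=
      ((hf.continuousOn.sub hPc.continuousOn).mono
        (((hslab s₀ hs0).trans hQn).trans hBε) |>.aemeasurable isOpen_slab.measurableSet).enorm
    calc ∫⁻ y in slab ρ s₀, ‖v (Θ y) - P y‖ₑ
        ≤ ∫⁻ y in slab ρ s₀, (ENNReal.ofReal τ + ‖g (Θ y) - P y‖ₑ) := by
          refine setLIntegral_mono' isOpen_slab.measurableSet fun y hy => ?_
          have h1 := hgv (Θ y) ⟨y, hslab s₀ hs0 hy, rfl⟩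
          have h2 : v (Θ y) - P y = -(g (Θ y) - v (Θ y)) + (g (Θ y) - P y) := by ring
          rw [h2]
          refine (enorm_add_le _ _).trans (add_le_add ?_ le_rfl)
          rw [enorm_neg, ← ofReal_norm]
          exact ENNReal.ofReal_le_ofReal h1
      _ = ENNReal.ofReal τ * volume (slab ρ s₀) + ∫⁻ y in slab ρ s₀, ‖g (Θ y) - P y‖ₑ := by
          rw [lintegral_add_right' _ hmd, setLIntegral_const]
      _ ≤ ENNReal.ofReal τ * ENNReal.ofReal V +
            ENNReal.ofReal (C₀ * ρ ^ m) * (ENNReal.ofReal C₂ * A) := by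
          refine add_le_add (mul_le_mul' le_rfl ?_) hP2
          refine (volume_slab_le hρ hs0).trans ?_
          calc _ ≤ 1 * ENNReal.ofReal V := mul_le_mul'
                (ENNReal.ofReal_le_one.mpr (pow_le_one₀ hρ.le hρ1)) hV
            _ = _ := one_mul _
      _ ≤ _ := by
          rw [e1 _ _ (by positivity) hC₂0, mul_comm (ENNReal.ofReal τ)]
          refine add_le_add (mul_le_mul' (ENNReal.ofReal_le_ofReal hCd) le_rfl)
            (mul_le_mul' (ENNReal.ofReal_le_ofReal ?_) le_rfl)
          rw [mul_right_comm]
          gcongr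
  · rw [e1 _ _ (by positivity) hC₂0, e2 _ _ (by positivity) hC₃0]
    refine add_le_add (add_le_add (mul_le_mul' (ENNReal.ofReal_le_ofReal hCc) le_rfl)
      (mul_le_mul' (ENNReal.ofReal_le_ofReal ?_) le_rfl))
      (mul_le_mul' (ENNReal.ofReal_le_ofReal ?_) le_rfl)
    · rw [div_mul_eq_mul_div, mul_right_comm]
      gcongr
    · rw [div_mul_eq_mul_div, mul_right_comm]
      gcongr

end

/-! ### The values at the boundary nodes -/

section
variable {n : ℕ}

lemma enorm_sub_zero_le_of_tensorDeriv {P : Space n → ℝ} (hP : ContDiff ℝ ∞ P) {x : Space n}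
    {M : ℝ≥0∞} (hM : ∀ y ∈ Metric.closedBall (0 : Space n) ‖x‖, ‖tensorDeriv 1 P y‖ₑ ≤ M) :
    ‖P x‖ₑ ≤ ‖P 0‖ₑ + ENNReal.ofReal (‖x‖ * n) * M := by
  rcases eq_or_ne x 0 with rfl | hx
  · exact le_self_add
  rcases n.eq_zero_or_pos with rfl | hn
  · exact absurd (Subsingleton.elim x 0) hx
  rcases eq_or_ne M ⊤ with rfl | hMt
  · rw [ENNReal.mul_top]
    · simp
    · have : 0 < ‖x‖ * n := by positivity
      simpa only [ne_eq, ENNReal.ofReal_eq_zero, not_le] using this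
  have h1 : ∀ y ∈ Metric.closedBall (0 : Space n) ‖x‖, ‖fderiv ℝ P y‖ ≤ n * M.toReal := by
    intro y hy
    have h2 := norm_iteratedFDeriv_le_tensorDeriv 1 P y
    rw [← zero_add 1, ← norm_iteratedFDeriv_fderiv, norm_iteratedFDeriv_zero, zero_add,
      pow_one] at h2
    refine h2.trans ?_
    gcongr
    have := ENNReal.toReal_mono hMt (hM y hy)
    simpa using this
  have h3 := (convex_closedBall (0 : Space n) ‖x‖).norm_image_sub_le_of_norm_fderiv_le (𝕜 := ℝ)
    (fun y _ => (hP.differentiable (by simp)) y) h1 (Metric.mem_closedBall_self (norm_nonneg x))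
    (mem_closedBall_zero_iff.mpr le_rfl)
  rw [sub_zero] at h3
  have h4 : P x = P 0 + (P x - P 0) := by ring
  rw [h4]
  refine (enorm_add_le _ _).trans (add_le_add le_rfl ?_)
  rw [← ofReal_norm]
  refine (ENNReal.ofReal_le_ofReal h3).trans ?_
  rw [← ENNReal.ofReal_toReal hMt, ← ENNReal.ofReal_mul (by positivity),
    ENNReal.toReal_ofReal ENNReal.toReal_nonneg]
  exact ENNReal.ofReal_le_ofReal (by linarith)

/-- Removes the smoothing error. The coefficients may depend on `h`, because `h` is fixed while `τ`
tends to zero. -/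
lemma le_of_forall_pos_error {x E a J : ℝ≥0∞} {c₂ c₃ c₄ : ℝ} (h2 : 0 ≤ c₂) (h3 : 0 ≤ c₃)
    (h4 : 0 ≤ c₄) (h : ∀ τ : ℝ, 0 < τ → x ≤ E + ENNReal.ofReal c₂ * (ENNReal.ofReal τ + a) +
      ENNReal.ofReal c₃ * (ENNReal.ofReal τ + J) + ENNReal.ofReal c₄ * ENNReal.ofReal τ) :
    x ≤ E + ENNReal.ofReal c₂ * a + ENNReal.ofReal c₃ * J := by
  refine ENNReal.le_of_forall_pos_le_add fun ε hε _ => ?_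
  have hc : 0 < c₂ + c₃ + c₄ + 1 := by linarith
  have hε' : (0 : ℝ) < ε := hε
  set τ : ℝ := ε / (c₂ + c₃ + c₄ + 1) with hτ
  have hτ0 : 0 < τ := by positivity
  refine (h τ hτ0).trans ?_
  have h5 : ENNReal.ofReal (c₂ + c₃ + c₄) * ENNReal.ofReal τ ≤ ε := by
    rw [← ENNReal.ofReal_mul (by linarith), ← ENNReal.ofReal_coe_nnreal]
    refine ENNReal.ofReal_le_ofReal ?_
    rw [hτ, mul_div_assoc', div_le_iff₀ hc]
    nlinarith
  calc _ = E + ENNReal.ofReal c₂ * a + ENNReal.ofReal c₃ * J +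
        ENNReal.ofReal (c₂ + c₃ + c₄) * ENNReal.ofReal τ := by
        rw [ENNReal.ofReal_add (by linarith) h4, ENNReal.ofReal_add h2 h3]
        ring
    _ ≤ _ := by gcongr

set_option maxHeartbeats 1000000 in
/-- The values at the boundary nodes of a function which vanishes on the boundary of the
domain. -/
theorem exists_node_bound {d k m : ℕ} (hk : 1 ≤ k) (hm : 2 ≤ m) (hmk : m ≤ k + 1)
    {Ω : Set (Space (d + 1))} (hΩ_bdd : Bornology.IsBounded Ω)
    (t : AffineBasis (Fin (d + 2)) ℝ (Space (d + 1))) {cδ b CL ε : ℝ} (hcδ : 0 < cδ) (hb : 1 ≤ b)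
    (hCL : 1 ≤ CL) (hε : 0 < ε)
    (hchart : ∀ b ∈ frontier Ω, ∃ Θ Ξ ν, IsGraphChart k Ω CL ε b Θ Ξ ν)
    {p : ℝ≥0∞} (hp : 1 ≤ p) (hemb : EmbedsC0 m p (interior (simplex t)))
    {z : Space (d + 1)} {r : ℝ} (hr : 0 < r) (hz : Metric.ball z (2 * r) ⊆ interior (simplex t)) :
    ∃ C h₁ R : ℝ, 0 < C ∧ 0 < h₁ ∧ h₁ ≤ 1 ∧ 0 < R ∧ ∀ (h : ℝ) (D : Set (Space (d + 1)))
      (F : Space (d + 1) → Space (d + 1)) (q : Space (d + 1)), 0 < h → h ≤ h₁ →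
      Ω ∪ tube Ω (cδ * h ^ (k + 1)) = D ∪ tube Ω (cδ * h ^ (k + 1)) →
      IsElemMap k t b h F → F '' interior (simplex t) ⊆ D → q ∈ simplex t → F q ∉ D →
      ∀ O : Set (Space (d + 1)), IsOpen O → Ω ⊆ O → frontier Ω ⊆ O → ∀ (v : Space (d + 1) → ℝ)
      (G : (j : ℕ) → Space (d + 1) → EuclideanSpace ℝ (Fin j → Fin (d + 1))),
      (∀ j ≤ m, IsWeakGrad j O v (G j)) → ContinuousOn v O → (∀ x ∈ frontier Ω, v x = 0) →
      ∀ (H : (j : ℕ) → Space (d + 1) → EuclideanSpace ℝ (Fin j → Fin (d + 1))),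
      (∀ j ≤ m, IsWeakGrad j (interior (simplex t)) (fun x => v (F x)) (H j)) →
      ∀ w' : Space (d + 1) → ℝ, ContinuousOn w' (simplex t) →
      w' =ᵐ[volume.restrict (interior (simplex t))] (fun x => v (F x)) →
      ‖w' q‖ₑ ≤ ENNReal.ofReal C * eLpNorm (H m) p (volume.restrict (interior (simplex t))) +
        ENNReal.ofReal (C * (h ^ m / h ^ (d + 1))) * (∑ j ∈ Finset.range (m + 1),
          ∫⁻ x in D ∩ Metric.ball (F z) (R * h), ‖G j x‖ₑ) +
        ENNReal.ofReal (C * (h ^ (k + 1) / h ^ (d + 1))) *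
          ∫⁻ x in (D ∪ tube Ω (cδ * h ^ (k + 1))) ∩ Metric.ball (F z) (R * h), ‖G 2 x‖ₑ := by
  obtain ⟨κ, h₁, R, hκ, hh₁, hh₁1, hR, hgeo⟩ := exists_chart_of_boundary_node hk hΩ_bdd t hcδ hb hCL
    hε hchart hr hz
  obtain ⟨C₁, hC₁, hpoly⟩ := exists_polyLT_chart d hm hmk hCL
  have hcl : closure (interior (simplex t)) = simplex t := closure_interior_simplex t
  have hzr : Metric.ball z r ⊆ interior (simplex t) :=
    (Metric.ball_subset_ball (by linarith)).trans hz
  obtain ⟨C₂, hC₂, hsup⟩ := exists_enorm_le_of_embedsC0 isOpen_interior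
    (convex_simplex t).interior ((isCompact_simplex t).isBounded.subset interior_subset)
    Metric.isOpen_ball ⟨z, Metric.mem_ball_self hr⟩ hzr hp hemb
  obtain ⟨V, hV0, hV⟩ := exists_ofReal_of_ne_top
    (a := volume (interior (simplex t)) ^ p.toReal⁻¹) (ENNReal.rpow_ne_top_of_nonneg (by positivity)
    ((isCompact_simplex t).isBounded.subset interior_subset).measure_lt_top.ne)
  set CΨ : ℝ := (k + 1).factorial * CL * b with hCΨ
  have hfac : (1 : ℝ) ≤ (k + 1).factorial := by exact_mod_cast Nat.factorial_pos (k + 1)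
  have hfacCL : (1 : ℝ) ≤ (k + 1).factorial * CL := one_le_mul_of_one_le_of_one_le hfac hCL
  have hCΨ0 : 0 < CΨ := by positivity
  have hcc := chainConst_pos (d + 1) m
  -- `K₁` belongs to the derivatives of order `m` of `P ∘ Ψ`, `K₂` to the `L¹` error on the interior
  -- ball, `K₃` and `K₄` to the value of `P` at the origin, and `K₅` to the step from the origin to
  -- the node.
  set K₁ : ℝ := C₂ * V * (chainConst (d + 1) m * CΨ ^ m) * (m + 1) * C₁ / κ ^ (d + 1) with hK₁
  set K₂ : ℝ := C₂ * (b * CL) ^ (d + 1) * (C₁ * κ ^ m) with hK₂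
  set K₃ : ℝ := C₁ * (κ ^ m + CL * cδ * κ) / κ ^ (d + 1) with hK₃
  set K₄ : ℝ := C₁ * (CL * cδ * κ) / κ ^ (d + 1) with hK₄
  set K₅ : ℝ := CL * cδ * (d + 1 : ℕ) * C₁ / κ ^ (d + 1) with hK₅
  refine ⟨C₂ + K₁ + K₂ + K₃ + K₄ + K₅, h₁, R, by positivity, hh₁, hh₁1, hR, ?_⟩
  intro h D F q hh hhh hcompat hF hFD hq hqD O hO hΩO hΓO v G hG hv hvΓ H hH w' hw' hww
  obtain ⟨hρε, hρ1, hs, a, Θ, Ξ, ν, hχ, ha, hFx, hΞq, hΘb, hΘD, hball⟩ :=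
    hgeo h D F q hh hhh hcompat hF hFD hq hqD
  have hh1 : h ≤ 1 := hhh.trans hh₁1
  set δ : ℝ := cδ * h ^ (k + 1) with hδ
  set ρ : ℝ := κ * h with hρ
  set s₀ : ℝ := CL * δ with hs₀
  set B := Metric.ball (F z) (R * h) with hB
  have hδ0 : 0 < δ := by positivity
  have hρ0 : 0 < ρ := by positivity
  have hs0 : 0 ≤ s₀ := by positivity
  set S₁ := D ∩ B
  set S₀ := (D ∪ tube Ω δ) ∩ B
  have hN1 : (1 : ℝ) ≤ (d + 1 : ℕ) := by exact_mod_cast Nat.succ_le_succ (Nat.zero_le d)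
  have hslabN : ∀ s : ℝ, 0 ≤ s → slab ρ s ⊆ Metric.closedBall (0 : Space (d + 1)) ((d + 1 : ℕ) * ρ) :=
    fun s hs y hy => mem_closedBall_zero_iff.mpr (norm_le_of_mem_slab hs hy)
  have hslabε : ∀ s : ℝ, 0 ≤ s → slab ρ s ⊆ Metric.ball (0 : Space (d + 1)) ε :=
    fun s hs => (hslabN s hs).trans (Metric.closedBall_subset_ball hρε)
  have hΘΩ : MapsTo Θ (slab ρ 0) Ω := fun y hy =>
    (hχ.mem_iff y (hslabε 0 le_rfl hy)).mpr hy.2.1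
  have hslab0 : slab (d := d) ρ s₀ ⊆ slab ρ 0 := fun y hy => ⟨hy.1, hs0.trans_lt hy.2.1, hy.2.2⟩
  have hS₁ : MapsTo Θ (slab ρ s₀) S₁ := fun y hy => ⟨hΘD y hy, (hΘb y (hslabN s₀ hs0 hy)).2⟩
  have hS₀ : MapsTo Θ (slab ρ 0) S₀ := fun y hy =>
    ⟨by rw [← hcompat]; exact Or.inl (hΘΩ hy), (hΘb y (hslabN 0 le_rfl hy)).2⟩
  set A := ∑ j ∈ Finset.range (m + 1), ∫⁻ x in S₁, ‖G j x‖ₑ with hA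
  set J := ∫⁻ x in S₀, ‖G 2 x‖ₑ with hJ
  set E := eLpNorm (H m) p (volume.restrict (interior (simplex t))) with hE
  -- the composition of the chart with the parametric map
  set Ψ : Space (d + 1) → Space (d + 1) := fun x => Ξ (F x) with hΨ
  have hFint : MapsTo F (interior (simplex t)) (Metric.ball a ε) := fun x hx =>
    (hFx x (interior_subset hx)).1
  have hΨc : ContDiffOn ℝ (k + 1 : ℕ) Ψ (interior (simplex t)) :=
    hχ.contDiffOn_inv.comp ((contDiff_infty.mp hF.contDiff (k + 1)).contDiffOn) hFint
  have hΨm : ContDiffOn ℝ m Ψ (interior (simplex t)) := hΨc.of_le (by exact_mod_cast hmk)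
  have hΨd : ∀ x ∈ interior (simplex t), ∀ i, 1 ≤ i → i ≤ k + 1 →
      ‖iteratedFDeriv ℝ i Ψ x‖ ≤ (CΨ * h) ^ i := by
    intro x hx i hi1 hik
    have h1 := norm_iteratedFDeriv_comp_le_of_isOpen (g := Ξ) (f := F) (l := i) (C := CL)
      (D := b * h) Metric.isOpen_ball isOpen_interior
      (hχ.contDiffOn_inv.of_le (by exact_mod_cast hik)) (contDiff_infty.mp hF.contDiff i).contDiffOn
      hFint hx (fun j hj => ?_)
      (fun j hj1 hji => hF.norm_deriv_le j hj1 (by omega) x (interior_subset hx))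
    · refine h1.trans ?_
      have h2 : (i.factorial : ℝ) ≤ (k + 1).factorial := by
        exact_mod_cast Nat.factorial_le hik
      calc (i.factorial : ℝ) * CL * (b * h) ^ i ≤ ((k + 1).factorial * CL) * (b * h) ^ i := by
            gcongr
        _ ≤ ((k + 1).factorial * CL) ^ i * (b * h) ^ i := by
            gcongr
            exact le_self_pow₀ hfacCL (by omega)
        _ = _ := by rw [← mul_pow, hCΨ]; ring
    · rcases Nat.eq_zero_or_pos j with rfl | hj0
      · rw [norm_iteratedFDeriv_zero]
        exact ((hFx x (interior_subset hx)).2.trans hρ1).trans hCL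
      · exact hχ.norm_inv_le j hj0 (by omega) _ (hFint hx)
  have hΨN : ∀ x ∈ simplex t, Ψ x ∈ Metric.closedBall (0 : Space (d + 1)) ((d + 1 : ℕ) * ρ) := fun x hx =>
    mem_closedBall_zero_iff.mpr (((hFx x hx).2).trans (le_mul_of_one_le_left hρ0.le hN1))
  have hanti : AntiLipOn (b / h * CL) Ψ (Metric.ball z r) := by
    intro x hx y hy
    have hxb := hball x hx
    have hyb := hball y hy
    have h1 := hF.antilip x (interior_subset (hzr hx)) y (interior_subset (hzr hy))
    have h2 := hχ.dist_le _ (hslabε s₀ hs0 hxb) _ (hslabε s₀ hs0 hyb)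
    rw [hχ.right_inv, hχ.right_inv] at h2
    calc dist x y ≤ b / h * dist (F x) (F y) := h1
      _ ≤ b / h * (CL * dist (Ψ x) (Ψ y)) := by gcongr
      _ = _ := by ring
  have hΨcont : ContinuousOn Ψ (simplex t) :=
    hχ.contDiffOn_inv.continuousOn.comp hF.contDiff.continuous.continuousOn fun x hx => (hFx x hx).1
  have hfin : ‖w' q‖ₑ ≤ ENNReal.ofReal C₂ * E +
      ENNReal.ofReal ((K₁ + K₂ + K₃ + K₅) * (h ^ m / h ^ (d + 1))) * A +
      ENNReal.ofReal (K₄ * (h ^ (k + 1) / h ^ (d + 1))) * J := by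
    refine le_of_forall_pos_error (by positivity) (by positivity)
      (c₄ := C₂ * (b / h * CL) ^ (d + 1) * C₁ + C₁) (by positivity) fun τ hτ => ?_
    obtain ⟨P, hP, hP1, hP2, hP3⟩ := hpoly Ω ε a Θ Ξ ν hχ ρ s₀ hρ0 hρ1 hs0 hs hρε
      (fun y hy => (hΘb y hy).1) O hO hΩO hΓO v G hG hv hvΓ S₁ S₀ hS₁ hS₀ τ hτ
    rw [← hA] at hP1 hP2 hP3
    rw [← hJ] at hP3
    set T := ENNReal.ofReal τ with hT
    have hPs : ContDiff ℝ ∞ P := contDiff_of_mem_polyLT hP _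
    have hPΨ : ∀ j ≤ m, ContDiffOn ℝ j (fun x => P (Ψ x)) (interior (simplex t)) := fun j hj =>
      (contDiff_infty.mp hPs j).comp_contDiffOn (hΨm.of_le (by exact_mod_cast hj))
    -- The difference of `w'` and `P ∘ Ψ` at the node is estimated on the reference simplex, where
    -- the embedding is assumed. Its `L¹` norm is needed only on the ball around `z`, which `Ψ` maps
    -- into the slab where `P` approximates `v`.
    have hbase := hsup (fun x => v (F x) - P (Ψ x)) (fun x => w' x - P (Ψ x))
      (fun j x => H j x - tensorDeriv j (fun x => P (Ψ x)) x)
      (fun j hj => (hH j hj).sub (isWeakGrad_tensorDeriv isOpen_interior (hPΨ j hj)))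
      (by
        rw [hcl]
        exact hw'.sub (hPs.continuous.comp_continuousOn hΨcont))
      (by filter_upwards [hww] with x hx; rw [hx]) q (by rw [hcl]; exact hq)
    have hbd1 : eLpNorm (fun x => H m x - tensorDeriv m (fun x => P (Ψ x)) x) p
        (volume.restrict (interior (simplex t))) ≤
        E + ENNReal.ofReal (V * (chainConst (d + 1) m * CΨ ^ m) * (m + 1) * C₁ / κ ^ (d + 1) *
          (h ^ m / h ^ (d + 1))) * (T + A) := by
      have hmeas : AEStronglyMeasurable (tensorDeriv m (fun x => P (Ψ x)))
          (volume.restrict (interior (simplex t))) :=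
        (continuousOn_tensorDeriv isOpen_interior (hPΨ m le_rfl)).aestronglyMeasurable
          isOpen_interior.measurableSet
      refine (eLpNorm_sub_le (hH m le_rfl).2.1.aestronglyMeasurable hmeas hp).trans
        (add_le_add le_rfl ?_)
      refine (eLpNorm_le_of_ae_enorm_bound (C := ENNReal.ofReal (chainConst (d + 1) m *
        (CΨ * h) ^ m) * ((m + 1 : ℕ) * (ENNReal.ofReal (C₁ / ρ ^ (d + 1)) * (T + A)))) ?_).trans ?_
      · filter_upwards [ae_restrict_mem isOpen_interior.measurableSet] with x hx
        rw [← chainTensor_tensorDeriv (hΨm.contDiffAt (isOpen_interior.mem_nhds hx))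
          (contDiff_infty.mp hPs m).contDiffAt]
        refine (enorm_chainTensor_le _ (fun i hi1 him => hΨd x hx i hi1 (him.trans hmk))
          (by positivity)).trans ?_
        refine mul_le_mul' le_rfl ?_
        calc _ ≤ ∑ _j ∈ Finset.range (m + 1), ENNReal.ofReal (C₁ / ρ ^ (d + 1)) * (T + A) :=
              Finset.sum_le_sum fun j hj => hP1 j (by
                have := Finset.mem_range.mp hj; omega) _ (hΨN x (interior_subset hx))
          _ = _ := by rw [Finset.sum_const, Finset.card_range, nsmul_eq_mul]
      · rw [smul_eq_mul, Measure.restrict_apply_univ]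
        refine (mul_le_mul' le_rfl hV).trans_eq ?_
        have e1 : ((m + 1 : ℕ) : ℝ≥0∞) = ENNReal.ofReal ((m : ℝ) + 1) := by
          rw [← ENNReal.ofReal_natCast]; push_cast; rfl
        rw [e1, ← mul_assoc, ← mul_assoc, ← ENNReal.ofReal_mul (by positivity),
          ← ENNReal.ofReal_mul (by positivity), mul_right_comm, ← ENNReal.ofReal_mul (by positivity)]
        congr 2
        rw [hρ, mul_pow CΨ, mul_pow κ]
        field_simp
    have hbd2 : ∫⁻ y in Metric.ball z r, ‖v (F y) - P (Ψ y)‖ₑ ≤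
        ENNReal.ofReal ((b / h * CL) ^ (d + 1)) * (ENNReal.ofReal C₁ * T +
          ENNReal.ofReal (C₁ * ρ ^ m) * (T + A)) := by
      have hmeas : AEMeasurable (fun y => ‖v (Θ y) - P y‖ₑ) (volume.restrict (slab ρ s₀)) := by
        refine (ContinuousOn.aemeasurable (ContinuousOn.sub ?_ hPs.continuous.continuousOn)
          isOpen_slab.measurableSet).enorm
        exact hv.comp (hχ.contDiffOn.continuousOn.mono (hslabε s₀ hs0)) fun y hy =>
          hΩO (hΘΩ (hslab0 hy))
      have h1 := hanti.lintegral_comp_le (by positivity) measurableSet_ball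
        (hΨcont.mono (hzr.trans interior_subset)) (fun x hx => hball x hx) hmeas
      have h2 : ∀ x, Θ (Ψ x) = F x := fun x => hχ.right_inv _
      simp only [h2] at h1
      refine h1.trans ?_
      rw [ENNReal.ofReal_pow (by positivity)]
      exact mul_le_mul' le_rfl hP2
    -- The chart coordinate of the node has norm at most `s₀`, a multiple of `h ^ (k + 1)`. This
    -- factor in front of the gradient of `P` is at most a multiple of `h ^ m`.
    have hbd3 : ‖P (Ψ q)‖ₑ ≤ ‖P 0‖ₑ +
        ENNReal.ofReal (s₀ * (d + 1 : ℕ)) * (ENNReal.ofReal (C₁ / ρ ^ (d + 1)) * (T + A)) := by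
      have hsub : Metric.closedBall (0 : Space (d + 1)) ‖Ψ q‖ ⊆
          Metric.closedBall 0 ((d + 1 : ℕ) * ρ) :=
        Metric.closedBall_subset_closedBall (mem_closedBall_zero_iff.mp (hΨN q hq))
      refine (enorm_sub_zero_le_of_tensorDeriv hPs fun y hy => hP1 1 (by omega) y
        (hsub hy)).trans (add_le_add le_rfl (mul_le_mul' (ENNReal.ofReal_le_ofReal ?_) le_rfl))
      exact mul_le_mul_of_nonneg_right hΞq (by positivity)
    have hhm : h ^ (k + 1) ≤ h ^ m := pow_le_pow_of_le_one hh.le hh1 hmk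
    have hsρ : s₀ * ρ ≤ CL * cδ * κ * h ^ (k + 1) := by
      have : s₀ * ρ = CL * cδ * κ * h ^ (k + 1) * h := by rw [hs₀, hδ, hρ]; ring
      rw [this]
      exact mul_le_of_le_one_right (by positivity) hh1
    have r1 : C₂ * (V * (chainConst (d + 1) m * CΨ ^ m) * (m + 1) * C₁ / κ ^ (d + 1) *
        (h ^ m / h ^ (d + 1))) = K₁ * (h ^ m / h ^ (d + 1)) := by rw [hK₁]; ring
    have r2 : C₂ * ((b / h * CL) ^ (d + 1) * (C₁ * ρ ^ m)) = K₂ * (h ^ m / h ^ (d + 1)) := by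
      rw [hK₂, hρ, show b / h * CL = b * CL / h by ring, div_pow, mul_pow κ]
      ring
    have r3 : C₁ * (ρ ^ m + s₀ * ρ) / ρ ^ (d + 1) ≤ K₃ * (h ^ m / h ^ (d + 1)) := by
      have : K₃ * (h ^ m / h ^ (d + 1)) =
          C₁ * (κ ^ m * h ^ m + CL * cδ * κ * h ^ m) / ρ ^ (d + 1) := by
        rw [hK₃, hρ, mul_pow κ h (d + 1)]
        field_simp
      rw [this, hρ, mul_pow κ h m, ← hρ]
      have h9 : s₀ * ρ ≤ CL * cδ * κ * h ^ m :=
        hsρ.trans (mul_le_mul_of_nonneg_left hhm (by positivity))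
      exact div_le_div_of_nonneg_right (mul_le_mul_of_nonneg_left (add_le_add le_rfl h9) hC₁.le)
        (by positivity)
    have r4 : C₁ * (s₀ * ρ) / ρ ^ (d + 1) ≤ K₄ * (h ^ (k + 1) / h ^ (d + 1)) := by
      have : K₄ * (h ^ (k + 1) / h ^ (d + 1)) =
          C₁ * (CL * cδ * κ * h ^ (k + 1)) / ρ ^ (d + 1) := by
        rw [hK₄, hρ, mul_pow κ h (d + 1)]
        field_simp
      rw [this]
      gcongr
    have r5 : s₀ * (d + 1 : ℕ) * (C₁ / ρ ^ (d + 1)) ≤ K₅ * (h ^ m / h ^ (d + 1)) := by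
      have : K₅ * (h ^ m / h ^ (d + 1)) =
          CL * cδ * h ^ m * (d + 1 : ℕ) * (C₁ / ρ ^ (d + 1)) := by
        rw [hK₅, hρ, mul_pow κ h (d + 1)]
        field_simp
      rw [this]
      have : s₀ ≤ CL * cδ * h ^ m := by
        rw [hs₀, hδ, ← mul_assoc]; gcongr
      gcongr
    have hX0 : 0 ≤ h ^ m / h ^ (d + 1) := by positivity
    have hY0 : 0 ≤ h ^ (k + 1) / h ^ (d + 1) := by positivity
    set X := h ^ m / h ^ (d + 1) with hX
    set Y := h ^ (k + 1) / h ^ (d + 1) with hY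
    have hw : w' q = (w' q - P (Ψ q)) + P (Ψ q) := by ring
    have hk1 : 0 ≤ K₁ := by positivity
    have hk2 : 0 ≤ K₂ := by positivity
    have hk3 : 0 ≤ K₃ := by positivity
    have hk5 : 0 ≤ K₅ := by positivity
    have hs0N : 0 ≤ s₀ * (d + 1 : ℕ) := by positivity
    have hq0 : 0 ≤ (b / h * CL) ^ (d + 1) := by positivity
    calc ‖w' q‖ₑ ≤ ‖w' q - P (Ψ q)‖ₑ + ‖P (Ψ q)‖ₑ := by
          conv_lhs => rw [hw]
          exact enorm_add_le _ _
      _ ≤ ENNReal.ofReal C₂ * ((E + ENNReal.ofReal (V * (chainConst (d + 1) m * CΨ ^ m) *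
            (m + 1) * C₁ / κ ^ (d + 1) * X) * (T + A)) +
            ENNReal.ofReal ((b / h * CL) ^ (d + 1)) * (ENNReal.ofReal C₁ * T +
              ENNReal.ofReal (C₁ * ρ ^ m) * (T + A))) +
          ((ENNReal.ofReal C₁ * T + ENNReal.ofReal (K₃ * X) * (T + A) +
            ENNReal.ofReal (K₄ * Y) * (T + J)) + ENNReal.ofReal (K₅ * X) * (T + A)) := by
          refine add_le_add (hbase.trans (mul_le_mul' le_rfl (add_le_add hbd1 hbd2)))
            (hbd3.trans (add_le_add (hP3.trans ?_) ?_))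
          · exact add_le_add (add_le_add le_rfl (mul_le_mul' (ENNReal.ofReal_le_ofReal r3) le_rfl))
              (mul_le_mul' (ENNReal.ofReal_le_ofReal r4) le_rfl)
          · rw [← mul_assoc, ← ENNReal.ofReal_mul hs0N]
            exact mul_le_mul' (ENNReal.ofReal_le_ofReal r5) le_rfl
      _ = _ := by
          have e1 : ENNReal.ofReal ((K₁ + K₂ + K₃ + K₅) * X) = ENNReal.ofReal C₂ *
              ENNReal.ofReal (V * (chainConst (d + 1) m * CΨ ^ m) *
              (m + 1) * C₁ / κ ^ (d + 1) * X) + ENNReal.ofReal C₂ *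
              (ENNReal.ofReal ((b / h * CL) ^ (d + 1)) * ENNReal.ofReal (C₁ * ρ ^ m)) +
              ENNReal.ofReal (K₃ * X) + ENNReal.ofReal (K₅ * X) := by
            rw [← ENNReal.ofReal_mul hq0, ← ENNReal.ofReal_mul hC₂.le, ← ENNReal.ofReal_mul hC₂.le,
              r1, r2, ← ENNReal.ofReal_add (by positivity) (by positivity),
              ← ENNReal.ofReal_add (by positivity) (by positivity),
              ← ENNReal.ofReal_add (by positivity) (by positivity)]
            congr 1
            ring
          have e2 : ENNReal.ofReal (C₂ * (b / h * CL) ^ (d + 1) * C₁ + C₁) = ENNReal.ofReal C₂ *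
              (ENNReal.ofReal ((b / h * CL) ^ (d + 1)) * ENNReal.ofReal C₁) +
              ENNReal.ofReal C₁ := by
            rw [← ENNReal.ofReal_mul hq0, ← ENNReal.ofReal_mul hC₂.le,
              ← ENNReal.ofReal_add (by positivity) hC₁.le, mul_assoc]
          rw [e1, e2]
          ring
  refine hfin.trans ?_
  have hx1 : 0 ≤ K₁ := by positivity
  have hx2 : 0 ≤ K₂ := by positivity
  have hx3 : 0 ≤ K₃ := by positivity
  have hx4 : 0 ≤ K₄ := by positivity
  have hx5 : 0 ≤ K₅ := by positivity
  refine add_le_add (add_le_add (mul_le_mul' (ENNReal.ofReal_le_ofReal (by linarith)) le_rfl)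
    (mul_le_mul' (ENNReal.ofReal_le_ofReal ?_) le_rfl))
    (mul_le_mul' (ENNReal.ofReal_le_ofReal ?_) le_rfl)
  · exact mul_le_mul_of_nonneg_right (by linarith) (by positivity)
  · exact mul_le_mul_of_nonneg_right (by linarith) (by positivity)

end

/-! ### Scaling of `L^p` norms -/

section
variable {n : ℕ}

/-- The factor `h^{n/p}` by which `L^p` norms scale. -/
noncomputable def lpScale (n : ℕ) (p : ℝ≥0∞) (h : ℝ) : ℝ≥0∞ :=
  (ENNReal.ofReal h ^ n) ^ (1 / p).toReal

lemma lpScale_ne_zero (n : ℕ) (p : ℝ≥0∞) {h : ℝ} (hh : 0 < h) : lpScale n p h ≠ 0 := by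
  unfold lpScale
  rw [Ne, ENNReal.rpow_eq_zero_iff]
  have : ENNReal.ofReal h ^ n ≠ 0 := pow_ne_zero _ (by simpa using hh)
  have : ENNReal.ofReal h ^ n ≠ ⊤ := ENNReal.pow_ne_top ENNReal.ofReal_ne_top
  tauto

lemma lpScale_ne_top (n : ℕ) (p : ℝ≥0∞) (h : ℝ) : lpScale n p h ≠ ⊤ :=
  ENNReal.rpow_ne_top_of_nonneg ENNReal.toReal_nonneg (ENNReal.pow_ne_top ENNReal.ofReal_ne_top)

lemma one_div_toReal_le_one {p : ℝ≥0∞} (hp : 1 ≤ p) : (1 / p).toReal ≤ 1 := by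
  have h : 1 / p ≤ 1 := by
    rw [one_div]
    exact ENNReal.inv_le_one.mpr hp
  simpa using ENNReal.toReal_mono ENNReal.one_ne_top h

lemma ennreal_rpow_le_of_one_le {a : ℝ≥0∞} (ha : 1 ≤ a) {e : ℝ} (he : e ≤ 1) : a ^ e ≤ a := by
  simpa using ENNReal.rpow_le_rpow_of_exponent_le ha he

/-- Only the power of `h` has to be exact. The power of `b ≥ 1` has an exponent at most `n`, so it
is bounded independently of `p`. -/
lemma rpow_ofReal_div_le {p : ℝ≥0∞} (hp : 1 ≤ p) {b h : ℝ} (hb : 1 ≤ b) (hh : 0 < h) :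
    (ENNReal.ofReal (b / h) ^ n) ^ (1 / p).toReal ≤
      ENNReal.ofReal (b ^ n) * (lpScale n p h)⁻¹ := by
  rw [ENNReal.ofReal_div_of_pos hh, div_eq_mul_inv, mul_pow,
    ENNReal.mul_rpow_of_nonneg _ _ ENNReal.toReal_nonneg]
  refine mul_le_mul' ?_ (le_of_eq ?_)
  · rw [← ENNReal.ofReal_pow (by linarith)]
    refine ennreal_rpow_le_of_one_le ?_ (one_div_toReal_le_one hp)
    rw [← ENNReal.ofReal_one]
    exact ENNReal.ofReal_le_ofReal (one_le_pow₀ hb)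
  · rw [lpScale, ← ENNReal.inv_rpow, ENNReal.inv_pow]

lemma rpow_ofReal_mul_le {p : ℝ≥0∞} (hp : 1 ≤ p) {b h : ℝ} (hb : 1 ≤ b) :
    (ENNReal.ofReal (b * h) ^ n) ^ (1 / p).toReal ≤
      ENNReal.ofReal (b ^ n) * lpScale n p h := by
  rw [ENNReal.ofReal_mul (by linarith), mul_pow,
    ENNReal.mul_rpow_of_nonneg _ _ ENNReal.toReal_nonneg]
  refine mul_le_mul' ?_ le_rfl
  rw [← ENNReal.ofReal_pow (by linarith)]
  refine ennreal_rpow_le_of_one_le ?_ (one_div_toReal_le_one hp)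
  rw [← ENNReal.ofReal_one]
  exact ENNReal.ofReal_le_ofReal (one_le_pow₀ hb)

/-- Hölder's inequality on a subset of a ball of radius `R h`. -/
lemma exists_lintegral_le_lpScale (n : ℕ) (R : ℝ) : ∃ K : ℝ, 0 < K ∧ ∀ {p : ℝ≥0∞}, 1 ≤ p →
    ∀ {h : ℝ}, 0 < h → ∀ {x : Space n} {E : Set (Space n)}, E ⊆ Metric.ball x (R * h) →
    ∀ {l : ℕ} {g : Space n → EuclideanSpace ℝ (Fin l → Fin n)},
    AEStronglyMeasurable g (volume.restrict E) →
    ∫⁻ y in E, ‖g y‖ₑ ≤ ENNReal.ofReal (K * h ^ n) * ((lpScale n p h)⁻¹ *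
      eLpNorm g p (volume.restrict E)) := by
  obtain ⟨K₀, hK₀⟩ : ∃ K₀ : ℝ, 1 ≤ K₀ ∧
      ENNReal.ofReal (R ^ n) * volume (Metric.ball (0 : Space n) 1) ≤ ENNReal.ofReal K₀ := by
    have hne : ENNReal.ofReal (R ^ n) * volume (Metric.ball (0 : Space n) 1) ≠ ⊤ :=
      ENNReal.mul_ne_top ENNReal.ofReal_ne_top measure_ball_lt_top.ne
    refine ⟨max 1 (ENNReal.ofReal (R ^ n) * volume (Metric.ball (0 : Space n) 1)).toReal,
      le_max_left _ _, ?_⟩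
    exact (ENNReal.ofReal_toReal hne).symm.le.trans (ENNReal.ofReal_le_ofReal (le_max_right _ _))
  refine ⟨K₀, by linarith [hK₀.1], fun {p} hp {h} hh {x} {E} hE {l} {g} hg => ?_⟩
  have hvol : volume E ≤ ENNReal.ofReal (K₀ * h ^ n) := by
    rcases le_or_gt R 0 with hR | hR
    · have : E = ∅ := by
        refine Set.subset_empty_iff.mp (hE.trans ?_)
        rw [Metric.ball_eq_empty.mpr (mul_nonpos_of_nonpos_of_nonneg hR hh.le)]
      simp [this]
    calc volume E ≤ volume (Metric.ball x (R * h)) := measure_mono hE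
      _ = ENNReal.ofReal ((R * h) ^ n) * volume (Metric.ball (0 : Space n) 1) := by
          rw [Measure.addHaar_ball_of_pos _ _ (mul_pos hR hh)]
          simp
      _ = ENNReal.ofReal (h ^ n) *
            (ENNReal.ofReal (R ^ n) * volume (Metric.ball (0 : Space n) 1)) := by
          rw [mul_pow, mul_comm (R ^ n), ENNReal.ofReal_mul (by positivity), mul_assoc]
      _ ≤ ENNReal.ofReal (h ^ n) * ENNReal.ofReal K₀ := by gcongr; exact hK₀.2
      _ = _ := by rw [← ENNReal.ofReal_mul (by positivity), mul_comm]
  set e := (1 / p).toReal with he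
  have he1 : e ≤ 1 := one_div_toReal_le_one hp
  have he0 : 0 ≤ e := ENNReal.toReal_nonneg
  have h1 := eLpNorm_le_eLpNorm_mul_rpow_measure_univ hp hg
  rw [eLpNorm_one_eq_lintegral_enorm] at h1
  refine h1.trans ?_
  rw [Measure.restrict_apply_univ]
  have e1 : (1 / ENNReal.toReal 1 - 1 / p.toReal) = 1 - e := by
    rw [he, one_div p, ENNReal.toReal_inv]
    simp
  rw [e1]
  -- The factor `h^(n (1 - 1/p))` from Hölder's inequality is written as `h^n` divided by `lpScale`;
  -- the other factor uses `K₀ ≥ 1` and an exponent at most one.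
  have h2 : volume E ^ (1 - e) ≤ ENNReal.ofReal (K₀ * h ^ n) * (lpScale n p h)⁻¹ := by
    calc volume E ^ (1 - e) ≤ ENNReal.ofReal (K₀ * h ^ n) ^ (1 - e) :=
          ENNReal.rpow_le_rpow hvol (by linarith)
      _ = ENNReal.ofReal K₀ ^ (1 - e) * (ENNReal.ofReal h ^ n) ^ (1 - e) := by
          rw [ENNReal.ofReal_mul (by linarith [hK₀.1]),
            ENNReal.mul_rpow_of_nonneg _ _ (by linarith), ENNReal.ofReal_pow hh.le]
      _ ≤ ENNReal.ofReal K₀ * (ENNReal.ofReal h ^ n * (lpScale n p h)⁻¹) := by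
          refine mul_le_mul' (ennreal_rpow_le_of_one_le ?_ (by linarith)) (le_of_eq ?_)
          · rw [← ENNReal.ofReal_one]
            exact ENNReal.ofReal_le_ofReal hK₀.1
          · rw [ENNReal.rpow_sub _ _ (pow_ne_zero _ (by simpa using hh))
              (ENNReal.pow_ne_top ENNReal.ofReal_ne_top), ENNReal.rpow_one, div_eq_mul_inv]
            rfl
      _ = _ := by
          rw [ENNReal.ofReal_mul (by linarith [hK₀.1]), ENNReal.ofReal_pow hh.le, mul_assoc]
  calc _ ≤ eLpNorm g p (volume.restrict E) *
        (ENNReal.ofReal (K₀ * h ^ n) * (lpScale n p h)⁻¹) := by gcongr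
    _ = _ := by ring

/-- The `L^p` norm of the chain rule tensor. -/
lemma eLpNorm_chainTensor_le {l : ℕ} {Φ : Space n → Space n} {U T : Set (Space n)}
    (hU : IsOpen U) (hΦ : ContDiffOn ℝ l Φ U) (hT : MapsTo Φ U T) {c D : ℝ} (hc : 0 ≤ c)
    (hanti : AntiLipOn c Φ U) (hD0 : 0 ≤ D)
    (hD : ∀ x ∈ U, ∀ i, 1 ≤ i → i ≤ l → ‖iteratedFDeriv ℝ i Φ x‖ ≤ D ^ i) {p : ℝ≥0∞}
    (hp : 1 ≤ p) {G : (j : ℕ) → Space n → EuclideanSpace ℝ (Fin j → Fin n)}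
    (hG : ∀ j ≤ l, AEStronglyMeasurable (G j) (volume.restrict T)) :
    eLpNorm (chainTensor l Φ G) p (volume.restrict U) ≤
      ENNReal.ofReal (chainConst n l * D ^ l) * ((ENNReal.ofReal c ^ n) ^ (1 / p).toReal *
        ∑ j ∈ Finset.range (l + 1), eLpNorm (G j) p (volume.restrict T)) := by
  have hmeas : ∀ j ∈ Finset.range (l + 1),
      AEStronglyMeasurable (fun x => ‖G j (Φ x)‖) (volume.restrict U) := fun j hj =>
    (hanti.aestronglyMeasurable_comp hc hU.measurableSet hΦ.continuousOn hT
      (hG j (by simpa [Nat.lt_succ_iff] using hj))).norm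
  have h1 : eLpNorm (chainTensor l Φ G) p (volume.restrict U) ≤
      ENNReal.ofReal (chainConst n l * D ^ l) *
        eLpNorm (∑ j ∈ Finset.range (l + 1), fun x => ‖G j (Φ x)‖) p (volume.restrict U) := by
    refine eLpNorm_le_mul_eLpNorm_of_ae_le_mul' (c := (chainConst n l * D ^ l).toNNReal) ?_ p
    filter_upwards [ae_restrict_mem hU.measurableSet] with x hx
    refine (enorm_chainTensor_le G (hD x hx) hD0).trans (le_of_eq ?_)
    rw [Finset.sum_apply]
    congr 1
    rw [Real.enorm_of_nonneg (Finset.sum_nonneg fun _ _ => norm_nonneg _),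
      ENNReal.ofReal_sum_of_nonneg (fun _ _ => norm_nonneg _)]
    simp
  refine h1.trans (mul_le_mul' le_rfl ?_)
  refine (eLpNorm_sum_le hmeas hp).trans ?_
  rw [Finset.mul_sum]
  refine Finset.sum_le_sum fun j hj => ?_
  rw [eLpNorm_norm]
  exact hanti.eLpNorm_comp_le hc hU.measurableSet hΦ.continuousOn hT p
    (hG j (by simpa [Nat.lt_succ_iff] using hj))

end

/-! ### The interpolation error on one element -/

section
variable {n : ℕ}

/-- A continuous representative of `v ∘ F` agrees with `v ∘ F` wherever `v` is continuous. -/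
lemma eq_of_ae_eq_comp {U O : Set (Space n)} (hU : IsOpen U) (hO : IsOpen O)
    {F : Space n → Space n} (hF : Continuous F) (hFU : MapsTo F U O) {v w : Space n → ℝ}
    (hv : ContinuousOn v O) (hw : ContinuousOn w (closure U))
    (hwv : w =ᵐ[volume.restrict U] fun x => v (F x)) {q : Space n} (hq : q ∈ closure U)
    (hFq : F q ∈ O) : w q = v (F q) := by
  have heq : EqOn w (fun x => v (F x)) U :=
    Measure.eqOn_open_of_ae_eq hwv hU (hw.mono subset_closure)
      (hv.comp hF.continuousOn hFU)
  have h1 : Filter.Tendsto w (nhdsWithin q U) (nhds (w q)) :=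
    (hw q hq).mono_left (nhdsWithin_mono _ subset_closure)
  have h2 : Filter.Tendsto (fun x => v (F x)) (nhdsWithin q U) (nhds (v (F q))) :=
    ((hv.continuousAt (hO.mem_nhds hFq)).comp (f := F) hF.continuousAt).mono_left
      nhdsWithin_le_nhds
  have : (nhdsWithin q U).NeBot := mem_closure_iff_nhdsWithin_neBot.mp hq
  refine tendsto_nhds_unique (h1.congr' ?_) h2
  filter_upwards [self_mem_nhdsWithin] with x hx using heq hx

lemma memSobolev_of_isWeakGrad {m : ℕ} {p : ℝ≥0∞} (hp : 1 ≤ p) {U : Set (Space n)}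
    {w : Space n → ℝ} {H : (j : ℕ) → Space n → EuclideanSpace ℝ (Fin j → Fin n)}
    (hH : ∀ j ≤ m, IsWeakGrad j U w (H j)) (hf : ∀ j ≤ m, eLpNorm (H j) p (volume.restrict U) < ⊤) :
    MemSobolev m p U w := by
  refine (lpSum_le hp (M := ∑ j ∈ Finset.range (m + 1), eLpNorm (H j) p (volume.restrict U))
    fun i => ?_).trans_lt ?_
  · refine (gradNorm_le (hH i (by omega))).trans ?_
    exact Finset.single_le_sum (f := fun j => eLpNorm (H j) p (volume.restrict U))
      (fun _ _ => zero_le) (Finset.mem_range.mpr i.2)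
  · refine ENNReal.mul_lt_top (ENNReal.natCast_lt_top _) ?_
    exact ENNReal.sum_lt_top.mpr fun j hj => hf j (by simpa [Nat.lt_succ_iff] using hj)

open Classical in
/-- The interpolation error on one element. -/
theorem exists_local_interp_bound {d k m l : ℕ} (hk : 1 ≤ k) (hlm : l ≤ m) (hm : 2 ≤ m)
    (hmk : m ≤ k + 1) {Ω : Set (Space (d + 1))} (hΩ_bdd : Bornology.IsBounded Ω)
    (t : AffineBasis (Fin (d + 2)) ℝ (Space (d + 1))) {cδ b CL ε : ℝ} (hcδ : 0 < cδ) (hb : 1 ≤ b)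
    (hCL : 1 ≤ CL) (hε : 0 < ε)
    (hchart : ∀ b ∈ frontier Ω, ∃ Θ Ξ ν, IsGraphChart k Ω CL ε b Θ Ξ ν)
    {p : ℝ≥0∞} (hp : 1 ≤ p) (hemb : EmbedsC0 m p (interior (simplex t)))
    {z : Space (d + 1)} {r : ℝ} (hr : 0 < r) (hz : Metric.ball z (2 * r) ⊆ interior (simplex t)) :
    ∃ C h₁ R : ℝ, 0 < C ∧ 0 < h₁ ∧ 0 < R ∧ ∀ (h : ℝ) (D : Set (Space (d + 1)))
      (F : Space (d + 1) → Space (d + 1)), 0 < h → h ≤ h₁ →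
      Ω ∪ tube Ω (cδ * h ^ (k + 1)) = D ∪ tube Ω (cδ * h ^ (k + 1)) →
      IsElemMap k t b h F → F '' interior (simplex t) ⊆ D →
      ∀ O : Set (Space (d + 1)), IsOpen O → Ω ⊆ O → frontier Ω ⊆ O → D ⊆ O →
      interior (tube Ω (cδ * h ^ (k + 1))) ⊆ O → ∀ (v u : Space (d + 1) → ℝ)
      (G : (j : ℕ) → Space (d + 1) → EuclideanSpace ℝ (Fin j → Fin (d + 1))),
      (∀ j ≤ m, IsWeakGrad j O v (G j)) → (∀ j ≤ m, eLpNorm (G j) p (volume.restrict O) < ⊤) →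
      ContinuousOn v O → (∀ x ∈ frontier Ω, v x = 0) →
      (∀ x ∈ interior (simplex t), u (F x) = ∑ α : NodeIdx (d + 1) k with F (refNode t α) ∈ D,
        v (F (refNode t α)) * refBasis t α x) →
      gradNorm l p (F '' interior (simplex t)) (fun x => v x - u x) ≤
        ENNReal.ofReal (C * h ^ (m - l)) * (∑ j ∈ Finset.range (m + 1),
          eLpNorm (G j) p (volume.restrict (D ∩ Metric.ball (F z) (R * h)))) +
        ENNReal.ofReal (C * h ^ (k + 1 - l)) * eLpNorm (G 2) p
          (volume.restrict (interior (tube Ω (cδ * h ^ (k + 1))) ∩ Metric.ball (F z) (R * h))) := by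
  obtain ⟨C₂, h₁, R₀, hC₂, hh₁, hh₁1, hR₀, hnode⟩ := exists_node_bound hk hm hmk hΩ_bdd t hcδ hb hCL
    hε hchart hp hemb hr hz
  obtain ⟨C₅, hC₅, hinterp⟩ := exists_interp_bound (by omega) hmk t hp hemb (k := k)
  set R := R₀ + b * Metric.diam (simplex t) + 1 with hR
  have hdiam : 0 ≤ Metric.diam (simplex t) := Metric.diam_nonneg
  have hbd : 0 ≤ b * Metric.diam (simplex t) := by positivity
  have hRpos : 0 < R := by positivity
  obtain ⟨K₃, hK₃, hHolder⟩ := exists_lintegral_le_lpScale (d + 1) R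
  have hcm := chainConst_pos (d + 1) m
  have hcl := chainConst_pos (d + 1) l
  set c₁ := chainConst (d + 1) m * b ^ m * b ^ (d + 1) with hc₁
  have hc₁0 : 0 < c₁ := by positivity
  set c₂ := C₂ * c₁ + C₂ * K₃ + C₂ * K₃ with hc₂
  have hc₂0 : 0 < c₂ := by positivity
  set c₃ := C₅ * (c₁ + Fintype.card (NodeIdx (d + 1) k) * c₂) with hc₃
  have hc₃0 : 0 < c₃ := by positivity
  set c₄ := chainConst (d + 1) l * b ^ l * b ^ (d + 1) * ((l + 1 : ℕ) * c₃) with hc₄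
  have hc₄0 : 0 < c₄ := by positivity
  refine ⟨c₄, h₁, R, hc₄0, hh₁, hRpos, fun h D F hh hhh₁ hcompat hF hFD O hO hΩO hΓO hDO hTO v u G hG
    hGp hv hv0 hu => ?_⟩
  have hh1 : h ≤ 1 := hhh₁.trans hh₁1
  set U := interior (simplex t) with hUdef
  have hUo : IsOpen U := isOpen_interior
  have hUs : U ⊆ simplex t := interior_subset
  have hclU : closure U = simplex t := closure_interior_simplex t
  have hzU : z ∈ U := hz (Metric.mem_ball_self (by positivity))
  set τ := interior (tube Ω (cδ * h ^ (k + 1))) with hτ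
  set B := Metric.ball (F z) (R * h) with hB
  set s := lpScale (d + 1) p h with hs
  have hs0 : s ≠ 0 := lpScale_ne_zero _ _ hh
  have hst : s ≠ ⊤ := lpScale_ne_top _ _ _
  set X := ∑ j ∈ Finset.range (m + 1), eLpNorm (G j) p (volume.restrict (D ∩ B)) with hX
  set Y := eLpNorm (G 2) p (volume.restrict (τ ∩ B)) with hY
  -- `Z` is the desired bound on the reference element, before the factor `h^(-l)` from the
  -- differentiations. Its factor `s⁻¹ = h^(-(d+1)/p)` cancels when the norm is transported back to
  -- the element.
  set Z := s⁻¹ * (ENNReal.ofReal (h ^ m) * X + ENNReal.ofReal (h ^ (k + 1)) * Y) with hZ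
  have hGO : ∀ j ≤ m, AEStronglyMeasurable (G j) (volume.restrict O) := fun j hj =>
    (hG j hj).2.1.aestronglyMeasurable
  have hmapsD : MapsTo F U D := fun x hx => hFD ⟨x, hx, rfl⟩
  have hmapsB : MapsTo F U (D ∩ B) := by
    refine fun x hx => ⟨hmapsD hx, ?_⟩
    have := hF.image_subset_closedBall (by positivity) (hUs hzU) ⟨x, hUs hx, rfl⟩
    rw [Metric.mem_closedBall] at this
    rw [hB, Metric.mem_ball]
    refine this.trans_lt ?_
    rw [hR]
    nlinarith
  have hFm : ContDiffOn ℝ m F U := (contDiff_infty.mp hF.contDiff m).contDiffOn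
  have hFanti : AntiLipOn (b / h) F U := fun x hx y hy => hF.antilip x (hUs hx) y (hUs hy)
  have hbh : 0 ≤ b / h := by positivity
  have hFder : ∀ x ∈ U, ∀ i, 1 ≤ i → i ≤ m → ‖iteratedFDeriv ℝ i F x‖ ≤ (b * h) ^ i :=
    fun x hx i h1 h2 => hF.norm_deriv_le i h1 (h2.trans hmk) x (hUs hx)
  -- the weak derivatives of the pull-back
  set H := fun j : ℕ => chainTensor j F G with hH
  have hHw : ∀ j ≤ m, IsWeakGrad j U (fun x => v (F x)) (H j) := fun j hj =>
    IsWeakGrad.comp hj hUo hO hFm (fun x hx => hDO (hmapsD hx)) hbh hFanti hG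
  have hHp : ∀ j ≤ m, eLpNorm (H j) p (volume.restrict U) < ⊤ := by
    intro j hj
    refine (eLpNorm_chainTensor_le hUo (hFm.of_le (by exact_mod_cast hj))
      (fun x hx => hDO (hmapsD hx)) hbh hFanti (by positivity : 0 ≤ b * h)
      (fun x hx i h1 h2 => hFder x hx i h1 (h2.trans hj)) hp
      (fun i hi => hGO i (hi.trans hj))).trans_lt ?_
    refine ENNReal.mul_lt_top ENNReal.ofReal_lt_top (ENNReal.mul_lt_top ?_ ?_)
    · exact (ENNReal.rpow_ne_top_of_nonneg ENNReal.toReal_nonneg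
        (ENNReal.pow_ne_top ENNReal.ofReal_ne_top)).lt_top
    · exact ENNReal.sum_lt_top.mpr fun i hi =>
        hGp i ((Nat.lt_succ_iff.mp (Finset.mem_range.mp hi)).trans hj)
  have hA : eLpNorm (H m) p (volume.restrict U) ≤ ENNReal.ofReal c₁ * Z := by
    have h1 := eLpNorm_chainTensor_le hUo hFm hmapsB hbh hFanti (by positivity : 0 ≤ b * h) hFder hp
      (fun i hi => (hGO i hi).mono_set (inter_subset_left.trans hDO))
    refine h1.trans ?_
    calc _ ≤ ENNReal.ofReal (chainConst (d + 1) m * (b * h) ^ m) *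
          (ENNReal.ofReal (b ^ (d + 1)) * s⁻¹ * X) := by
          gcongr
          exact rpow_ofReal_div_le hp hb hh
      _ = ENNReal.ofReal c₁ * (s⁻¹ * (ENNReal.ofReal (h ^ m) * X)) := by
          rw [hc₁, mul_pow, ← mul_assoc (chainConst (d + 1) m),
            ENNReal.ofReal_mul (p := chainConst (d + 1) m * b ^ m) (q := h ^ m) (by positivity),
            ENNReal.ofReal_mul (p := chainConst (d + 1) m * b ^ m) (q := b ^ (d + 1)) (by positivity)]
          ring
      _ ≤ _ := by
          rw [hZ]
          gcongr
          exact le_self_add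
  -- A boundary node may lie on the boundary of `O`, where `v` is not known to be continuous.
  -- Therefore the continuous representative `w'` on the closed simplex is used; at the nodes in `D`
  -- it agrees with `v ∘ F`.
  obtain ⟨Cw, hCw⟩ := hemb
  obtain ⟨w', hw'c, hw'ae, -⟩ := hCw _ (memSobolev_of_isWeakGrad hp hHw hHp)
  have hw's : ContinuousOn w' (simplex t) := hclU ▸ hw'c
  set S : Finset (NodeIdx (d + 1) k) := {α | F (refNode t α) ∈ D} with hS
  have hw'S : ∀ α ∈ S, w' (refNode t α) = v (F (refNode t α)) := by
    intro α hα
    refine eq_of_ae_eq_comp hUo hO hF.contDiff.continuous (fun x hx => hDO (hmapsD hx)) hv hw'c hw'ae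
      ?_ (hDO (Finset.mem_filter.mp hα).2)
    rw [hclU]
    exact refNode_mem_simplex (by omega) t α
  -- the values at the nodes on the boundary
  have hbdry : ∀ α ∈ Sᶜ, ‖w' (refNode t α)‖ₑ ≤ ENNReal.ofReal c₂ * Z := by
    intro α hα
    have hαD : F (refNode t α) ∉ D := by simpa [hS] using hα
    refine (hnode h D F (refNode t α) hh hhh₁ hcompat hF hFD (refNode_mem_simplex (by omega) t α) hαD
      O hO hΩO hΓO v G hG hv hv0 H hHw w' hw's hw'ae).trans ?_
    have hBB : Metric.ball (F z) (R₀ * h) ⊆ B := Metric.ball_subset_ball (by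
      rw [hR]; nlinarith)
    have hholD : ∀ j ≤ m, ∫⁻ x in D ∩ Metric.ball (F z) (R₀ * h), ‖G j x‖ₑ ≤
        ENNReal.ofReal (K₃ * h ^ (d + 1)) * (s⁻¹ * eLpNorm (G j) p (volume.restrict (D ∩ B))) :=
      fun j hj => (lintegral_mono_set (inter_subset_inter_right _ hBB)).trans
        (hHolder hp hh inter_subset_right ((hGO j hj).mono_set (inter_subset_left.trans hDO)))
    have hholT : ∫⁻ x in τ ∩ Metric.ball (F z) (R₀ * h), ‖G 2 x‖ₑ ≤
        ENNReal.ofReal (K₃ * h ^ (d + 1)) * (s⁻¹ * Y) :=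
      (lintegral_mono_set (inter_subset_inter_right _ hBB)).trans
        (hHolder hp hh inter_subset_right ((hGO 2 hm).mono_set (inter_subset_left.trans hTO)))
    have hsum : ∑ j ∈ Finset.range (m + 1), ∫⁻ x in D ∩ Metric.ball (F z) (R₀ * h), ‖G j x‖ₑ ≤
        ENNReal.ofReal (K₃ * h ^ (d + 1)) * (s⁻¹ * X) := by
      rw [hX, Finset.mul_sum, Finset.mul_sum]
      exact Finset.sum_le_sum fun j hj => hholD j (Nat.lt_succ_iff.mp (Finset.mem_range.mp hj))
    -- The closed tube is replaced by its interior up to a null set. The part over `D` is later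
    -- absorbed into the first term, since `h ^ (k + 1) ≤ h ^ m`.
    have hsplit : ∫⁻ x in (D ∪ tube Ω (cδ * h ^ (k + 1))) ∩ Metric.ball (F z) (R₀ * h), ‖G 2 x‖ₑ ≤
        ENNReal.ofReal (K₃ * h ^ (d + 1)) * (s⁻¹ * (X + Y)) := by
      have hae : ((D ∪ tube Ω (cδ * h ^ (k + 1))) ∩ Metric.ball (F z) (R₀ * h) : Set _) ≤ᵐ[volume]
          ((D ∩ Metric.ball (F z) (R₀ * h)) ∪ (τ ∩ Metric.ball (F z) (R₀ * h)) : Set _) := by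
        rw [ae_le_set]
        refine measure_mono_null ?_ (volume_tube_diff_interior Ω
          (by positivity : 0 < cδ * h ^ (k + 1)))
        rintro x ⟨⟨hx1 | hx1, hx2⟩, hx3⟩
        · exact absurd (Or.inl ⟨hx1, hx2⟩) hx3
        · exact ⟨hx1, fun hx4 => hx3 (Or.inr ⟨hx4, hx2⟩)⟩
      calc _ ≤ ∫⁻ x in (D ∩ Metric.ball (F z) (R₀ * h)) ∪ (τ ∩ Metric.ball (F z) (R₀ * h)),
            ‖G 2 x‖ₑ := lintegral_mono' (Measure.restrict_mono_ae hae) le_rfl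
        _ ≤ _ := lintegral_union_le _ _ _
        _ ≤ ENNReal.ofReal (K₃ * h ^ (d + 1)) * (s⁻¹ * X) +
            ENNReal.ofReal (K₃ * h ^ (d + 1)) * (s⁻¹ * Y) := by
            refine add_le_add ((hholD 2 hm).trans ?_) hholT
            gcongr
            exact Finset.single_le_sum
              (f := fun j => eLpNorm (G j) p (volume.restrict (D ∩ B))) (fun _ _ => zero_le)
              (Finset.mem_range.mpr (by omega))
        _ = _ := by ring
    have hcancel : ∀ e : ℕ, ∀ W : ℝ≥0∞, ENNReal.ofReal (C₂ * (h ^ e / h ^ (d + 1))) *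
        (ENNReal.ofReal (K₃ * h ^ (d + 1)) * (s⁻¹ * W)) =
        ENNReal.ofReal (C₂ * K₃) * (s⁻¹ * (ENNReal.ofReal (h ^ e) * W)) := by
      intro e W
      rw [← mul_assoc, ← ENNReal.ofReal_mul (by positivity)]
      have : C₂ * (h ^ e / h ^ (d + 1)) * (K₃ * h ^ (d + 1)) = C₂ * K₃ * h ^ e := by
        field_simp
      rw [this, ENNReal.ofReal_mul (by positivity)]
      ring
    have hpow : ENNReal.ofReal (h ^ (k + 1)) ≤ ENNReal.ofReal (h ^ m) :=
      ENNReal.ofReal_le_ofReal (pow_le_pow_of_le_one hh.le hh1 hmk)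
    calc _ ≤ ENNReal.ofReal C₂ * (ENNReal.ofReal c₁ * Z) +
          ENNReal.ofReal (C₂ * (h ^ m / h ^ (d + 1))) *
            (ENNReal.ofReal (K₃ * h ^ (d + 1)) * (s⁻¹ * X)) +
          ENNReal.ofReal (C₂ * (h ^ (k + 1) / h ^ (d + 1))) *
            (ENNReal.ofReal (K₃ * h ^ (d + 1)) * (s⁻¹ * (X + Y))) := by
          gcongr
      _ ≤ ENNReal.ofReal (C₂ * c₁) * Z + ENNReal.ofReal (C₂ * K₃) * Z +
          ENNReal.ofReal (C₂ * K₃) * Z := by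
          rw [hcancel, hcancel]
          refine add_le_add (add_le_add (le_of_eq ?_) ?_) ?_
          · rw [ENNReal.ofReal_mul hC₂.le, mul_assoc]
          · rw [hZ]
            gcongr
            exact le_self_add
          · rw [hZ, mul_add]
            gcongr
      _ = ENNReal.ofReal c₂ * Z := by
          rw [hc₂, ENNReal.ofReal_add (by positivity) (by positivity),
            ENNReal.ofReal_add (by positivity) (by positivity)]
          ring
  set P : Space (d + 1) → ℝ := fun y => ∑ α ∈ S, w' (refNode t α) * refBasis t α y with hP
  have hĤ : ∀ j ≤ m, eLpNorm (fun x => H j x - tensorDeriv j P x) p (volume.restrict U) ≤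
      ENNReal.ofReal c₃ * Z := by
    intro j hj
    refine (hinterp _ w' H S hHw hw's hw'ae j hj).trans ?_
    have hsum : ∑ α ∈ Sᶜ, ‖w' (refNode t α)‖ₑ ≤
        ENNReal.ofReal (Fintype.card (NodeIdx (d + 1) k) * c₂) * Z := by
      calc _ ≤ ∑ α ∈ Sᶜ, ENNReal.ofReal c₂ * Z := Finset.sum_le_sum hbdry
        _ ≤ ∑ α : NodeIdx (d + 1) k, ENNReal.ofReal c₂ * Z :=
            Finset.sum_le_sum_of_subset (Finset.subset_univ _)
        _ = _ := by
            rw [Finset.sum_const, Finset.card_univ, nsmul_eq_mul,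
              ENNReal.ofReal_mul (by positivity), ENNReal.ofReal_natCast, mul_assoc]
    calc _ ≤ ENNReal.ofReal C₅ * (ENNReal.ofReal c₁ * Z +
          ENNReal.ofReal (Fintype.card (NodeIdx (d + 1) k) * c₂) * Z) := by gcongr
      _ = _ := by
          rw [hc₃, ENNReal.ofReal_mul hC₅.le, ENNReal.ofReal_add (by positivity) (by positivity)]
          ring
  have hPc : ∀ j : ℕ, ContDiff ℝ j P := fun j =>
    ContDiff.sum fun α _ => contDiff_const.mul
      (contDiff_of_mem_polyLT (refBasis_mem_polyLT t α) j)
  have hĤw : ∀ j ≤ m, IsWeakGrad j U (fun x => v (F x) - P x)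
      (fun x => H j x - tensorDeriv j P x) := fun j hj =>
    (hHw j hj).sub (isWeakGrad_tensorDeriv hUo (hPc j).contDiffOn)
  -- back to the element
  obtain ⟨Φ, hΦc, hΦF, hΦd⟩ := hF.exists_inverse
  set W := F '' U with hW
  have hWo : IsOpen W := hF.isOpen_image
  have hΦm : ContDiffOn ℝ m Φ W := hΦc.of_le (by exact_mod_cast le_top)
  have hΦU : MapsTo Φ W U := by
    rintro _ ⟨x, hx, rfl⟩
    rw [hΦF x hx]
    exact hx
  have hΦanti : AntiLipOn (b * h) Φ W := by
    rintro _ ⟨x, hx, rfl⟩ _ ⟨y, hy, rfl⟩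
    rw [hΦF x hx, hΦF y hy]
    exact hF.dist_le x (hUs hx) y (hUs hy)
  have hcomp := IsWeakGrad.comp hlm hWo hUo hΦm hΦU (by positivity : 0 ≤ b * h) hΦanti hĤw
  have hcongr : (fun y => v (F (Φ y)) - P (Φ y)) =ᵐ[volume.restrict W] fun y => v y - u y := by
    filter_upwards [ae_restrict_mem hWo.measurableSet] with y hy
    obtain ⟨x, hx, rfl⟩ := hy
    rw [hΦF x hx, hu x hx, hP]
    congr 1
    exact Finset.sum_congr rfl fun α hα => by rw [hw'S α hα]
  refine (gradNorm_le (hcomp.congr hWo.measurableSet hcongr)).trans ?_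
  have hfin := eLpNorm_chainTensor_le hWo (hΦm.of_le (by exact_mod_cast hlm)) hΦU
    (by positivity : 0 ≤ b * h) hΦanti hbh
    (fun y hy i h1 h2 => hΦd y hy i h1 ((h2.trans hlm).trans hmk)) hp
    (G := fun j x => H j x - tensorDeriv j P x)
    (fun j hj => (hĤw j (hj.trans hlm)).2.1.aestronglyMeasurable)
  refine hfin.trans ?_
  -- The chain rule for the inverse map mixes all orders up to `l`. On the reference element they
  -- share one bound, and each comes with the same factor `(b / h) ^ l`.
  have hsum : ∑ j ∈ Finset.range (l + 1),
      eLpNorm (fun x => H j x - tensorDeriv j P x) p (volume.restrict U) ≤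
      ENNReal.ofReal ((l + 1 : ℕ) * c₃) * Z := by
    calc _ ≤ ∑ j ∈ Finset.range (l + 1), ENNReal.ofReal c₃ * Z :=
          Finset.sum_le_sum fun j hj =>
            hĤ j ((Nat.lt_succ_iff.mp (Finset.mem_range.mp hj)).trans hlm)
      _ = _ := by
          rw [Finset.sum_const, Finset.card_range, nsmul_eq_mul,
            ENNReal.ofReal_mul (p := ((l + 1 : ℕ) : ℝ)) (by positivity), ENNReal.ofReal_natCast,
            mul_assoc]
  calc _ ≤ ENNReal.ofReal (chainConst (d + 1) l * (b / h) ^ l) *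
        (ENNReal.ofReal (b ^ (d + 1)) * s * (ENNReal.ofReal ((l + 1 : ℕ) * c₃) * Z)) := by
        gcongr
        exact rpow_ofReal_mul_le hp hb
    _ = ENNReal.ofReal (chainConst (d + 1) l * (b / h) ^ l * b ^ (d + 1) * ((l + 1 : ℕ) * c₃)) *
        (s * Z) := by
        rw [ENNReal.ofReal_mul (p := chainConst (d + 1) l * (b / h) ^ l * b ^ (d + 1)) (by positivity),
          ENNReal.ofReal_mul (p := chainConst (d + 1) l * (b / h) ^ l) (by positivity)]
        ring
    _ = ENNReal.ofReal (c₄ / h ^ l) *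
        (ENNReal.ofReal (h ^ m) * X + ENNReal.ofReal (h ^ (k + 1)) * Y) := by
        rw [hZ, ← mul_assoc s, ENNReal.mul_inv_cancel hs0 hst, one_mul, hc₄, div_pow]
        congr 2
        ring
    _ = _ := by
        rw [mul_add, ← mul_assoc, ← mul_assoc, ← ENNReal.ofReal_mul (by positivity),
          ← ENNReal.ofReal_mul (by positivity)]
        congr 3
        · rw [pow_sub₀ _ hh.ne' hlm]; field_simp
        · rw [pow_sub₀ _ hh.ne' (hlm.trans hmk)]; field_simp

end

/-! ### Summation over the elements -/

section
variable {n : ℕ}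

section lpSum

variable {ι : Type} [Fintype ι] {p : ℝ≥0∞}

lemma lpSum_mono {f g : ι → ℝ≥0∞} (h : ∀ i, f i ≤ g i) : lpSum p f ≤ lpSum p g := by
  unfold lpSum
  split_ifs
  · exact iSup_mono h
  · refine ENNReal.rpow_le_rpow (Finset.sum_le_sum fun i _ => ?_) (by positivity)
    exact ENNReal.rpow_le_rpow (h i) ENNReal.toReal_nonneg

lemma toReal_pos_of_one_le (hp : 1 ≤ p) (hpt : p ≠ ⊤) : 0 < p.toReal :=
  ENNReal.toReal_pos (zero_lt_one.trans_le hp).ne' hpt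

lemma lpSum_add_le (hp : 1 ≤ p) (f g : ι → ℝ≥0∞) :
    lpSum p (fun i => f i + g i) ≤ lpSum p f + lpSum p g := by
  unfold lpSum
  split_ifs with h
  · exact iSup_le fun i => add_le_add (le_iSup f i) (le_iSup g i)
  · exact ENNReal.Lp_add_le _ f g (by simpa using ENNReal.toReal_mono h hp)

lemma lpSum_const_mul_le (hp : 1 ≤ p) (c : ℝ≥0∞) (f : ι → ℝ≥0∞) :
    lpSum p (fun i => c * f i) ≤ c * lpSum p f := by
  unfold lpSum
  split_ifs with h
  · exact iSup_le fun i => mul_le_mul' le_rfl (le_iSup f i)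
  · have hpos := toReal_pos_of_one_le hp h
    simp_rw [ENNReal.mul_rpow_of_nonneg _ _ hpos.le]
    rw [← Finset.mul_sum, ENNReal.mul_rpow_of_nonneg _ _ (by positivity), ← ENNReal.rpow_mul,
      mul_one_div_cancel hpos.ne', ENNReal.rpow_one]

lemma lpSum_zero (hp : 1 ≤ p) : lpSum p (fun _ : ι => 0) = 0 :=
  le_antisymm ((lpSum_le hp (M := 0) fun _ => le_rfl).trans (by simp)) zero_le

lemma lpSum_sum_le (hp : 1 ≤ p) {κ : Type*} (s : Finset κ) (f : κ → ι → ℝ≥0∞) :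
    lpSum p (fun i => ∑ j ∈ s, f j i) ≤ ∑ j ∈ s, lpSum p (f j) := by
  classical
  induction s using Finset.induction_on with
  | empty => simp [lpSum_zero hp]
  | insert a s ha ih =>
    simp only [Finset.sum_insert ha]
    exact (lpSum_add_le hp _ _).trans (add_le_add le_rfl ih)

/-- `L^p` norms over sets with finite overlap. -/
lemma lpSum_eLpNorm_le (hp : 1 ≤ p) {U : Set (Space n)} {B : ι → Set (Space n)}
    (hB : ∀ i, MeasurableSet (B i)) {M : ℕ} (hM1 : 1 ≤ M)
    (hM : ∀ (x : Space n) (s : Finset ι), (∀ i ∈ s, x ∈ B i) → s.card ≤ M)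
    {E : Type*} [NormedAddCommGroup E] {g : Space n → E}
    (hg : AEStronglyMeasurable g (volume.restrict U)) :
    lpSum p (fun i => eLpNorm g p (volume.restrict (U ∩ B i))) ≤
      M * eLpNorm g p (volume.restrict U) := by
  have hM1' : (1 : ℝ≥0∞) ≤ M := by exact_mod_cast hM1
  unfold lpSum
  split_ifs with h
  · refine iSup_le fun i => ?_
    calc _ ≤ 1 * eLpNorm g p (volume.restrict U) := by
          rw [one_mul]
          exact eLpNorm_mono_measure g (Measure.restrict_mono inter_subset_left le_rfl)
      _ ≤ _ := by gcongr
  · have hpos := toReal_pos_of_one_le hp h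
    have hp0 : p ≠ 0 := (zero_lt_one.trans_le hp).ne'
    have he : ∀ V : Set (Space n), eLpNorm g p (volume.restrict V) ^ p.toReal =
        ∫⁻ x in V, ‖g x‖ₑ ^ p.toReal := fun V => by
      rw [eLpNorm_eq_lintegral_rpow_enorm_toReal hp0 h, ← ENNReal.rpow_mul,
        one_div_mul_cancel hpos.ne', ENNReal.rpow_one]
    simp_rw [he]
    have h1 := sum_setLIntegral_le Finset.univ hB (U := U) (fun x s' _ hs' => hM x s' hs')
      (f := fun x => ‖g x‖ₑ ^ p.toReal) (hg.enorm.pow_const _)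
    refine (ENNReal.rpow_le_rpow h1 (by positivity)).trans ?_
    rw [← he U, ENNReal.mul_rpow_of_nonneg _ _ (by positivity), ← ENNReal.rpow_mul,
      mul_one_div_cancel hpos.ne', ENNReal.rpow_one]
    gcongr
    refine ennreal_rpow_le_of_one_le hM1' ?_
    rw [div_le_one hpos]
    simpa using ENNReal.toReal_mono h hp

end lpSum

/-- All weak derivatives of a function in a Sobolev space. -/
lemma MemSobolev.exists_isWeakGrad {m : ℕ} {p : ℝ≥0∞} (hp : 1 ≤ p) {U : Set (Space n)}
    {v : Space n → ℝ} (hv : MemSobolev m p U v) :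
    ∃ G : (j : ℕ) → Space n → EuclideanSpace ℝ (Fin j → Fin n),
      (∀ j ≤ m, IsWeakGrad j U v (G j)) ∧ ∀ j ≤ m, eLpNorm (G j) p (volume.restrict U) < ⊤ := by
  have h : ∀ j : ℕ, ∃ G : Space n → EuclideanSpace ℝ (Fin j → Fin n), j ≤ m →
      IsWeakGrad j U v G ∧ eLpNorm G p (volume.restrict U) < ⊤ := by
    intro j
    by_cases hj : j ≤ m
    · obtain ⟨G, hG⟩ := exists_isWeakGrad_of_gradNorm_lt_top
        ((le_lpSum hp (fun j : Fin (m + 1) => gradNorm (j : ℕ) p U v)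
          ⟨j, Nat.lt_succ_iff.mpr hj⟩).trans_lt hv)
      exact ⟨G, fun _ => hG⟩
    · exact ⟨0, fun h => absurd h hj⟩
  choose G hG using h
  exact ⟨G, fun j hj => (hG j hj).1, fun j hj => (hG j hj).2⟩

lemma eLpNorm_le_sobolevNorm {m j : ℕ} (hj : j ≤ m) {p : ℝ≥0∞} (hp : 1 ≤ p) {U : Set (Space n)}
    (hU : IsOpen U) {v : Space n → ℝ} {G : Space n → EuclideanSpace ℝ (Fin j → Fin n)}
    (hG : IsWeakGrad j U v G) : eLpNorm G p (volume.restrict U) ≤ sobolevNorm m p U v := by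
  rw [← gradNorm_eq hU hG]
  exact le_lpSum hp (fun j : Fin (m + 1) => gradNorm (j : ℕ) p U v) ⟨j, Nat.lt_succ_iff.mpr hj⟩

end

end IsoFEM

/-- Interpolation into the isoparametric finite element space with zero boundary values:
`(∑_T ‖∇^l (v - I̊_h v)‖_{L^p(T)}^p)^{1/p}
  ≤ C h^{m-l} ‖v‖_{W^{m,p}(Ω_h)} + C h^{k+1-l} ‖∇² v‖_{L^p(Γ(δ))}`. All norms over a set are taken
over its interior, and `v` is identified with its continuous representative. -/
theorem proposition3p3 (d k : ℕ) (hd : d + 1 = 2 ∨ d + 1 = 3) (hk : 2 ≤ k)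
    (Ω : Set (IsoFEM.Space (d + 1))) (hΩ_open : IsOpen Ω) (hΩ_conn : IsConnected Ω)
    (hΩ_bdd : Bornology.IsBounded Ω) (A : IsoFEM.BoundaryAtlas d k Ω)
    (t : AffineBasis (Fin (d + 2)) ℝ (IsoFEM.Space (d + 1)))
    (c cδ : ℝ) (hcδ : 0 < cδ)
    (l m : ℕ) (hlm : l ≤ m) (hmk : m ≤ k + 1) (hm : 2 ≤ m)
    (p : ℝ≥0∞) (hp : 1 ≤ p)
    (hemb : IsoFEM.EmbedsC0 m p (interior (IsoFEM.simplex t))) :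
    ∃ C h₀ : ℝ, 0 < C ∧ 0 < h₀ ∧
      ∀ 𝒯 : IsoFEM.Mesh (d + 1) k, 𝒯.Admissible A t c cδ → 𝒯.size t ≤ h₀ →
      ∀ v : IsoFEM.Space (d + 1) → ℝ,
        IsoFEM.MemSobolev m p
          (interior (Ω ∪ IsoFEM.tube Ω (cδ * 𝒯.size t ^ (k + 1)))) v →
        ContinuousOn v (interior (Ω ∪ IsoFEM.tube Ω (cδ * 𝒯.size t ^ (k + 1)))) →
        (∀ x ∈ frontier Ω, v x = 0) →
        IsoFEM.lpSum p (fun i : Fin 𝒯.card =>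
            IsoFEM.gradNorm l p (interior (𝒯.elem t i)) (fun x => v x - 𝒯.interp t v x)) ≤
          ENNReal.ofReal (C * 𝒯.size t ^ (m - l)) *
              IsoFEM.sobolevNorm m p (𝒯.domain t) v +
            ENNReal.ofReal (C * 𝒯.size t ^ (k + 1 - l)) *
              IsoFEM.gradNorm 2 p
                (interior (IsoFEM.tube Ω (cδ * 𝒯.size t ^ (k + 1)))) v := by
  have hk1 : 1 ≤ k := by omega
  have hk0 : k ≠ 0 := by omega
  obtain ⟨b, h₀, hb, hh₀, hmap⟩ := IsoFEM.exists_isElemMap_of_admissible hk0 A t c cδ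
  obtain ⟨CL, ε, hCL, hε, hchart⟩ := IsoFEM.exists_isGraphChart hΩ_bdd A
  obtain ⟨z, r, hr, hz⟩ := IsoFEM.exists_closedBall_subset_simplex t
  obtain ⟨C, h₁, R, hC, hh₁, hR, hloc⟩ := IsoFEM.exists_local_interp_bound hk1 hlm hm hmk hΩ_bdd t
    hcδ hb hCL hε hchart hp hemb (half_pos hr) (z := z)
    (by rw [mul_div_cancel₀ r two_ne_zero]; exact Metric.ball_subset_closedBall.trans hz)
  have hzU : z ∈ interior (IsoFEM.simplex t) := hz (Metric.mem_closedBall_self hr.le)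
  obtain ⟨M₀, hM₀⟩ := IsoFEM.exists_card_le_of_admissible A t c cδ hb hR.le (interior_subset hzU)
  -- The overlap number is enlarged to at least `1`, so that `M^(1/p) ≤ M` and the case `p = ∞` are
  -- covered.
  obtain ⟨M, hM1, hMM⟩ : ∃ M : ℕ, 1 ≤ M ∧ M₀ ≤ M := ⟨max 1 M₀, le_max_left _ _, le_max_right _ _⟩
  have hMpos : (0 : ℝ) < M := by exact_mod_cast hM1
  refine ⟨C * ((m + 1 : ℕ) * M), min h₀ h₁, by positivity, lt_min hh₀ hh₁,
    fun 𝒯 h𝒯 hsize v hv hvc hv0 => ?_⟩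
  -- Positivity of the mesh size is derived from an element. Without elements the left-hand side is
  -- zero.
  rcases isEmpty_or_nonempty (Fin 𝒯.card) with hemp | ⟨⟨i₀⟩⟩
  · refine (IsoFEM.lpSum_le hp (M := 0) fun i => isEmptyElim i).trans ?_
    simp
  have hmap' := hmap 𝒯 h𝒯 (hsize.trans (min_le_left _ _))
  have hcompat := h𝒯.compat
  have hh : 0 < 𝒯.size t := (hmap' i₀).1
  have hF := fun i => (hmap' i).2
  generalize hhdef : 𝒯.size t = h at *
  generalize hOdef : interior (Ω ∪ IsoFEM.tube Ω (cδ * h ^ (k + 1))) = O at *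
  have hδ : 0 < cδ * h ^ (k + 1) := by positivity
  have hO : IsOpen O := hOdef ▸ isOpen_interior
  have hDo : IsOpen (𝒯.domain t) := isOpen_interior
  have hΩO : Ω ⊆ O := hOdef ▸ interior_maximal subset_union_left hΩ_open
  have hDO : 𝒯.domain t ⊆ O :=
    hOdef ▸ interior_maximal (hcompat ▸ subset_union_left) hDo
  have hΓO : frontier Ω ⊆ O := by
    rw [← hOdef]
    exact (Metric.self_subset_thickening hδ _).trans (interior_maximal
      ((Metric.thickening_subset_cthickening _ _).trans subset_union_right)
      Metric.isOpen_thickening)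
  have hTO : interior (IsoFEM.tube Ω (cδ * h ^ (k + 1))) ⊆ O :=
    hOdef ▸ interior_mono subset_union_right
  -- One choice of weak derivatives on `O` serves everywhere: by uniqueness their restrictions
  -- compute the norms over `Ω_h` and over the interior of the tube.
  obtain ⟨G, hG, hGp⟩ := hv.exists_isWeakGrad hp
  have hGO : ∀ j ≤ m, AEStronglyMeasurable (G j) (volume.restrict O) := fun j hj =>
    (hG j hj).2.1.aestronglyMeasurable
  have hFD : ∀ i, 𝒯.param t i '' interior (IsoFEM.simplex t) ⊆ 𝒯.domain t := fun i =>
    interior_maximal ((image_mono interior_subset).trans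
      (subset_iUnion (fun i => 𝒯.elem t i) i)) (hF i).isOpen_image
  have hover : ∀ {j : ℕ} (U : Set (IsoFEM.Space (d + 1))), j ≤ m → U ⊆ O →
      IsoFEM.lpSum p (fun i : Fin 𝒯.card => eLpNorm (G j) p
        (volume.restrict (U ∩ Metric.ball (𝒯.param t i z) (R * h)))) ≤
      M * eLpNorm (G j) p (volume.restrict U) := fun U hj hU =>
    IsoFEM.lpSum_eLpNorm_le hp (fun i => measurableSet_ball) hM1
      (fun x s hs => (hM₀ 𝒯 h𝒯 (hhdef.symm ▸ hh) (hhdef.symm ▸ hF) x s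
        (fun i hi => by rw [hhdef]; exact hs i hi)).trans hMM)
      ((hGO _ hj).mono_set hU)
  have hlocal : ∀ i, IsoFEM.gradNorm l p (interior (𝒯.elem t i))
      (fun x => v x - 𝒯.interp t v x) ≤
      ENNReal.ofReal (C * h ^ (m - l)) * (∑ j ∈ Finset.range (m + 1), eLpNorm (G j) p
        (volume.restrict (𝒯.domain t ∩ Metric.ball (𝒯.param t i z) (R * h)))) +
      ENNReal.ofReal (C * h ^ (k + 1 - l)) * eLpNorm (G 2) p (volume.restrict
        (interior (IsoFEM.tube Ω (cδ * h ^ (k + 1))) ∩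
          Metric.ball (𝒯.param t i z) (R * h))) := by
    intro i
    have hinj : InjOn (𝒯.param t i) (IsoFEM.simplex t) := by
      intro x hx y hy hxy
      have := (hF i).antilip x hx y hy
      rw [hxy, dist_self, mul_zero] at this
      exact dist_le_zero.mp this
    rw [IsoFEM.Mesh.elem, (hF i).interior_image]
    exact hloc h (𝒯.domain t) (𝒯.param t i) hh (hsize.trans (min_le_right _ _)) hcompat (hF i)
      (hFD i) O hO hΩO hΓO hDO hTO v (𝒯.interp t v) G hG hGp hvc hv0
      (fun x hx => h𝒯.interp_param hk0 i hinj v hx)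
  have hm1 : (1 : ℝ≥0∞) ≤ (m + 1 : ℕ) := by exact_mod_cast Nat.le_add_left 1 m
  refine ((IsoFEM.lpSum_mono hlocal).trans (IsoFEM.lpSum_add_le hp _ _)).trans ((add_le_add
    (IsoFEM.lpSum_const_mul_le hp _ _) (IsoFEM.lpSum_const_mul_le hp _ _)).trans ?_)
  calc _ ≤ ENNReal.ofReal (C * h ^ (m - l)) *
          ((m + 1 : ℕ) * (M * IsoFEM.sobolevNorm m p (𝒯.domain t) v)) +
        ENNReal.ofReal (C * h ^ (k + 1 - l)) * ((m + 1 : ℕ) * (M * IsoFEM.gradNorm 2 p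
          (interior (IsoFEM.tube Ω (cδ * h ^ (k + 1)))) v)) := by
        refine add_le_add (mul_le_mul' le_rfl ?_) (mul_le_mul' le_rfl ?_)
        · refine (IsoFEM.lpSum_sum_le hp _ _).trans ?_
          refine (Finset.sum_le_card_nsmul (Finset.range (m + 1)) _
            (M * IsoFEM.sobolevNorm m p (𝒯.domain t) v) fun j hj => ?_).trans
              (by rw [Finset.card_range, nsmul_eq_mul])
          have hj' : j ≤ m := Nat.lt_succ_iff.mp (Finset.mem_range.mp hj)
          refine (hover _ hj' hDO).trans (mul_le_mul' le_rfl ?_)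
          exact IsoFEM.eLpNorm_le_sobolevNorm hj' hp hDo ((hG j hj').mono hDO)
        · refine (hover _ hm hTO).trans ?_
          rw [IsoFEM.gradNorm_eq isOpen_interior ((hG 2 hm).mono hTO)]
          exact le_mul_of_one_le_left zero_le hm1
    _ = _ := by
        have e : ∀ a : ℝ, 0 ≤ a → ENNReal.ofReal (C * ((m + 1 : ℕ) * M) * a) =
            ENNReal.ofReal (C * a) * ((m + 1 : ℕ) * M) := by
          intro a ha
          rw [mul_right_comm, ENNReal.ofReal_mul (by positivity),
            ENNReal.ofReal_mul (p := ((m + 1 : ℕ) : ℝ)) (by positivity), ENNReal.ofReal_natCast,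
            ENNReal.ofReal_natCast]
        rw [e _ (by positivity), e _ (by positivity)]
        ring
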